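/- Let $\Omega\subset\mathbb{R}^2$ be a bounded convex polygonal domain (nonempty, open) and $\kappa>0$. There is a constant $C>0$, depending only on $\Omega$ and $\kappa$, such that the following holds for every conforming triangulation $\mathcal T$ of $\Omega$ into open triangles $T$ that is shape-regular with parameter $\kappa$ (every $T$ contains a disc of radius $r_T$ with $\operatorname{diam}T\le\kappa\,r_T$). Let $h:=\max_{T\in\mathcal T}\operatorname{diam}T$. *Notation.* $\|\cdot\|_\omega$ is the norm of $L^2(\omega)$ (for matrices, with the Frobenius norm), $\|\cdot\|=\|\cdot\|_\Omega$, $\|v\|_{H^k(\omega)}^2=\|v\|_\omega^2+\|D^kv\|_\omega^2$, and $X:=H^2(\Omega)\cap H^1_0(\Omega)$. $\boldsymbol L^2_{\rm sym}(\Omega)$ is the space of symmetric $2\times2$ matrix fields with entries in $L^2(\Omega)$. $H(\operatorname{div}\mathbf{Div};T)$ is the completion of the symmetric matrix fields that are smooth up to the boundary of $T$ with respect to the norm $(\|\boldsymbol Q\|_T^2+\|\operatorname{div}\mathbf{Div}\,\boldsymbol Q\|_T^2)^{1/2}$, and $H(\operatorname{div}\mathbf{Div};\mathcal T):=\prod_{T\in\mathcal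 T}H(\operatorname{div}\mathbf{Div};T)$. For $v\in H^2(T)$ the functional $\mathrm{tr}^2_Tv\in H(\operatorname{div}\mathbf{Div};T)'$ is $$\langle \mathrm{tr}^2_Tv,\boldsymbol Q\rangle_{\partial T}:=(\operatorname{div}\mathbf{Div}\,\boldsymbol Q,v)_T-(\boldsymbol Q,D^2v)_T ,$$ and for $v\in H^2(\Omega)$ the functional $\mathrm{tr}^2_{\mathcal T}v\in H(\operatorname{div}\mathbf{Div};\mathcal T)'$ is $\langle\mathrm{tr}^2_{\mathcal T}v,\boldsymbol Q\rangle:=\sum_{T\in\mathcal T}\langle\mathrm{tr}^2_T(v|_T),\boldsymbol Q|_T\rangle_{\partial T}$. Put $\widehat U:=\mathrm{tr}^2_{\mathcal T}(X)$ with the norm $$\|\widehat{\boldsymbol u}\|_{3/2,1/2,\mathcal S}:=\inf\{\|v\|_{H^2(\Omega)} : v\in H^2(\Omega),\ \mathrm{tr}^2_{\mathcal T}v=\widehat{\boldsymbol u}\},$$ and $U:=L^2(\Omega)\times\boldsymbol L^2_{\rm sym}(\Omega)\times\widehat U$ with the norm $\|(u,\boldsymbol M,\widehat{\boldsymbol u})\|_U^2:=\|u\|^2+\|\boldsymbol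 M\|^2+\|\widehat{\boldsymbol u}\|_{3/2,1/2,\mathcal S}^2$. *Discrete space.* For a triangle $T\in\mathcal T$ with unit normal $\boldsymbol n_T$ let $U_T$ be the space of all $v\in H^2(T)$ with $\Delta^2v+v=0$ in $T$ (in the sense of distributions) such that on every edge of $T$ the trace of $v$ is a polynomial of degree at most $3$ and the trace of $\boldsymbol n_T\cdot\nabla v$ is a polynomial of degree at most $1$. Let $$\widehat U_h:=\{\widehat{\boldsymbol v}\in\widehat U : \widehat{\boldsymbol v}|_{\partial T}\in\mathrm{tr}^2_T(U_T)\ \ \forall T\in\mathcal T\},$$ where $\widehat{\boldsymbol v}|_{\partial T}$ is the restriction of the functional $\widehat{\boldsymbol v}$ to the component $H(\operatorname{div}\mathbf{Div};T)$. Let $\mathcal P^0(\mathcal T)$ be the space of functions that are constant on every $T\in\mathcal T$, and $$U_h:=\mathcal P^0(\mathcal T)\times\big(\mathcal P^0(\mathcal T)^{2\times2}\cap\boldsymbol L^2_{\rm sym}(\Omega)\big)\times\widehat U_h .$$ *Claim.* For every $u\in H^3(\Omega)\cap X$ the triple $\boldsymbol u:=(u,D^2u,\mathrm{tr}^2_{\mathcal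 T}u)$ belongs to $U$, the minimum below is attained, and $$\min_{\boldsymbol w_h\in U_h}\|\boldsymbol u-\boldsymbol w_h\|_U\le C\,h\,\|u\|_{H^3(\Omega)} .$$ -/

import Mathlib

open MeasureTheory Set
open scoped ContDiff InnerProductSpace

noncomputable section

/-! ### Square integrable functions and tensors on planar sets -/

/-- The Euclidean plane. -/
abbrev Plane : Type := EuclideanSpace ℝ (Fin 2)

/-- The Hilbert space `L²(D)`. -/
abbrev L2 (D : Set Plane) : Type := Lp ℝ 2 (volume.restrict D)

/-- Tensors of order `m` with entries in `L²(D)`, with the Hilbert norm `‖M‖² = ∑ᵢ ‖Mᵢ‖²`; the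
entries are indexed by `i = (i₀, …, i_{m-1})`. For `m = 2` these are `2 × 2` matrices with the
Frobenius inner product `∫ M : Q`. -/
abbrev L2Tensor (D : Set Plane) (m : ℕ) : Type := PiLp 2 (fun _ : Fin m → Fin 2 => L2 D)

/-- Symmetry of a matrix with entries in `L²(D)`. -/
def IsSymmL2 {D : Set Plane} (M : L2Tensor D 2) : Prop :=
  ∀ j k : Fin 2, M ![j, k] = M ![k, j]

/-- The classical partial derivative `∂_{i₀} ⋯ ∂_{i_{m-1}} φ`. -/
def partialDeriv {m : ℕ} (i : Fin m → Fin 2) (φ : Plane → ℝ) (x : Plane) : ℝ :=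
  iteratedFDeriv ℝ m φ x (fun l => EuclideanSpace.single (i l) (1 : ℝ))

/-- Restriction `L²(D) → L²(T)` for `T ⊆ D`. -/
def restrictL2 {T D : Set Plane} (h : T ⊆ D) (u : L2 D) : L2 T :=
  ((Lp.memLp u).mono_measure (Measure.restrict_mono h le_rfl)).toLp u

/-! ### Weak derivatives and Sobolev spaces -/

/-- `φ ∈ C_c^∞(D)`. -/
def IsTestFunction (D : Set Plane) (φ : Plane → ℝ) : Prop :=
  ContDiff ℝ ∞ φ ∧ HasCompactSupport φ ∧ tsupport φ ⊆ D

/-- `g` is the `m`-th weak derivative `D^m u` of `u` in `D`. -/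
def IsWeakDeriv (D : Set Plane) (m : ℕ) (u : L2 D) (g : L2Tensor D m) : Prop :=
  ∀ φ : Plane → ℝ, IsTestFunction D φ → ∀ i : Fin m → Fin 2,
    ∫ x in D, u x * partialDeriv i φ x = (-1 : ℝ) ^ m * ∫ x in D, g i x * φ x

/-- Weak derivatives in open sets are unique. -/
theorem IsWeakDeriv.unique {D : Set Plane} (hD : IsOpen D) {m : ℕ} {u : L2 D}
    {g g' : L2Tensor D m} (h : IsWeakDeriv D m u g) (h' : IsWeakDeriv D m u g') : g = g' := by
  ext1 i
  have hint : ∀ f : L2 D, LocallyIntegrableOn (fun x => f x) D volume := fun f =>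
    (locallyIntegrableOn_of_locallyIntegrable_restrict
      ((Lp.memLp f).locallyIntegrable (by norm_num)))
  have key := hD.ae_eq_zero_of_integral_contDiff_smul_eq_zero (μ := volume)
    (f := fun x => g i x - g' i x) ((hint _).sub (hint _)) (by
      intro φ hφ hc hs
      have e := (h φ ⟨hφ, hc, hs⟩ i).symm.trans (h' φ ⟨hφ, hc, hs⟩ i)
      have e' : ∫ x in D, g i x * φ x = ∫ x in D, g' i x * φ x :=
        mul_left_cancel₀ (pow_ne_zero _ (by norm_num)) e
      have hφ2 : MemLp φ 2 (volume.restrict D) :=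
        (hφ.continuous.memLp_of_hasCompactSupport hc).mono_measure Measure.restrict_le_self
      have hi : ∀ f : L2 D, Integrable (fun x => f x * φ x) (volume.restrict D) := fun f =>
        (Lp.memLp f).integrable_mul hφ2
      have hz : ∀ x, x ∉ D → φ x • (g i x - g' i x) = 0 := fun x hx => by
        rw [image_eq_zero_of_notMem_tsupport (fun hx' => hx (hs hx')), zero_smul]
      rw [← setIntegral_eq_integral_of_forall_compl_eq_zero hz]
      have : (fun x => φ x • (g i x - g' i x)) = fun x => g i x * φ x - g' i x * φ x := by
        ext x; simp only [smul_eq_mul]; ring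
      rw [this, integral_sub (hi _) (hi _), e', sub_self])
  refine Lp.ext ?_
  filter_upwards [(ae_restrict_iff' hD.measurableSet).2 key] with x hx
  exact sub_eq_zero.1 hx

open Classical in
/-- The weak derivative `D^m u ∈ L²(D)` (with the value `0` if there is none). -/
def weakDeriv (D : Set Plane) (m : ℕ) (u : L2 D) : L2Tensor D m :=
  if h : ∃ g, IsWeakDeriv D m u g then h.choose else 0

/-- The Sobolev space `H^k(D)`. -/
def Hk (D : Set Plane) (k : ℕ) : Set (L2 D) :=
  {u | ∀ m ≤ k, ∃ g : L2Tensor D m, IsWeakDeriv D m u g}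

/-- The norm `‖u‖²_{H^k(D)} = ‖u‖²_D + ‖D^k u‖²_D`. -/
def HkNorm (D : Set Plane) (k : ℕ) (u : L2 D) : ℝ :=
  √(‖u‖ ^ 2 + ‖weakDeriv D k u‖ ^ 2)

/-- `H₀¹(D)`, the closure of `C_c^∞(D)` in `H¹(D)`. -/
def H10 (D : Set Plane) : Set (L2 D) :=
  {u | u ∈ Hk D 1 ∧ ∀ ε > 0, ∃ φ : Plane → ℝ, IsTestFunction D φ ∧
    ∃ v : L2 D, v =ᵐ[volume.restrict D] φ ∧ HkNorm D 1 (u - v) < ε}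

/-- `X = H²(D) ∩ H₀¹(D)`. -/
def spaceX (D : Set Plane) : Set (L2 D) := Hk D 2 ∩ H10 D

/-! ### The space `H(div Div; D)` and the trace operator of `H²(D)` -/

/-- `div Div Φ = ∑_{j,k} ∂_j ∂_k Φ_{jk}` for a smooth matrix field. -/
def divDiv (Φ : (Fin 2 → Fin 2) → Plane → ℝ) (x : Plane) : ℝ :=
  ∑ i : Fin 2 → Fin 2, partialDeriv i (Φ i) x

/-- The pairs `(Φ, div Div Φ)` with `Φ` a symmetric matrix field in `C^∞(D̄)`. -/
def smoothDivDiv (D : Set Plane) : Set (WithLp 2 (L2Tensor D 2 × L2 D)) :=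
  {q | ∃ Φ : (Fin 2 → Fin 2) → Plane → ℝ,
    (∀ i, ContDiff ℝ ∞ (Φ i) ∧ HasCompactSupport (Φ i)) ∧
    (∀ j k : Fin 2, Φ ![j, k] = Φ ![k, j]) ∧
    (∀ i, q.fst i =ᵐ[volume.restrict D] Φ i) ∧
    q.snd =ᵐ[volume.restrict D] divDiv Φ}

/-- `H(div Div; D)`: the completion of the symmetric matrix fields in `C^∞(D̄)` with respect to the
norm `(‖Q‖² + ‖div Div Q‖²)^{1/2}`, realised as the closure of the graph of `div Div` in
`L²(D)^{2×2} × L²(D)`. The components of an element `q` are `q.fst = Q` and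
`q.snd = div Div Q`. The linear span only serves to have a subspace by definition: the pairs
of smooth fields already form one. -/
def HdivDiv (D : Set Plane) : Submodule ℝ (WithLp 2 (L2Tensor D 2 × L2 D)) :=
  (Submodule.span ℝ (smoothDivDiv D)).topologicalClosure

/-- The trace operator of `H²(D)`,
`⟨tr²_D u, Q⟩ = (div Div Q, u)_D - (Q, D² u)_D` for `Q ∈ H(div Div; D)`. -/
def trace2 (D : Set Plane) (u : L2 D) : StrongDual ℝ (HdivDiv D) :=
  ((innerSL ℝ u).comp (WithLp.sndL 2 ℝ (L2Tensor D 2) (L2 D)) -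
    (innerSL ℝ (weakDeriv D 2 u)).comp (WithLp.fstL 2 ℝ (L2Tensor D 2) (L2 D))).comp
    (HdivDiv D).subtypeL

theorem trace2_apply (D : Set Plane) (u : L2 D) (Q : HdivDiv D) :
    trace2 D u Q = ⟪(Q : WithLp 2 (L2Tensor D 2 × L2 D)).snd, u⟫_ℝ -
      ⟪(Q : WithLp 2 (L2Tensor D 2 × L2 D)).fst, weakDeriv D 2 u⟫_ℝ := by
  simp only [trace2]
  rw [real_inner_comm, real_inner_comm (weakDeriv D 2 u)]
  rfl

/-! ### Domains and triangulations -/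

/-- Bounded convex polygonal domains (boundedness follows from the last condition). -/
def IsConvexPolygonalDomain (Ω : Set Plane) : Prop :=
  IsOpen Ω ∧ Ω.Nonempty ∧ Convex ℝ Ω ∧
    ∃ V : Finset Plane, closure Ω = convexHull ℝ (V : Set Plane)

/-- The open triangle with the given set of vertices. -/
def cell (s : Finset Plane) : Set Plane := interior (convexHull ℝ (s : Set Plane))

/-- A (conforming) triangulation of `Ω`: a finite set of nondegenerate triangles, given by their
vertex sets, whose open cells lie in `Ω`, whose closed cells cover `Ω̄`, and such that two
closed triangles meet exactly in the convex hull of their common vertices (the empty set, a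
common vertex or a common edge). -/
structure Triangulation (Ω : Set Plane) where
  tris : Finset (Finset Plane)
  card_eq : ∀ s ∈ tris, s.card = 3
  indep : ∀ s ∈ tris, AffineIndependent ℝ ((↑) : s → Plane)
  cell_subset : ∀ s ∈ tris, cell s ⊆ Ω
  cover : (⋃ s ∈ tris, convexHull ℝ (s : Set Plane)) = closure Ω
  conforming : ∀ s ∈ tris, ∀ t ∈ tris,
    convexHull ℝ (s : Set Plane) ∩ convexHull ℝ (t : Set Plane) =
      convexHull ℝ ((s : Set Plane) ∩ (t : Set Plane))

namespace Triangulation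

variable {Ω : Set Plane} (𝒯 : Triangulation Ω)

/-- The mesh size `h = max_T diam T`. -/
def meshSize : ℝ := ⨆ s : 𝒯.tris, Metric.diam (cell s)

/-- Shape regularity with parameter `κ`: every triangle contains a disc whose radius is at
least its diameter divided by `κ`. -/
def ShapeRegular (κ : ℝ) : Prop :=
  ∀ s ∈ 𝒯.tris, ∃ x : Plane, ∃ r > 0, Metric.ball x r ⊆ cell s ∧ Metric.diam (cell s) ≤ κ * r

/-- The product space `H(div Div; 𝒯) = ∏_T H(div Div; T)` with its Hilbert norm. -/
abbrev HdivDivT : Type := PiLp 2 (fun s : 𝒯.tris => HdivDiv (cell s))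

/-- The collective trace operator
`⟨tr²_𝒯 u, Q⟩ = ∑_T ⟨tr²_T (u|_T), Q_T⟩` with values in `H(div Div; 𝒯)'`. -/
def trace2T (u : L2 Ω) : StrongDual ℝ 𝒯.HdivDivT :=
  ∑ s : 𝒯.tris, (trace2 (cell s) (restrictL2 (𝒯.cell_subset s s.2) u)).comp
    (PiLp.proj (𝕜 := ℝ) 2 (fun s : 𝒯.tris => HdivDiv (cell s)) s)

/-- `Û = tr²_𝒯 (X)`. -/
def traceSpace : Set (StrongDual ℝ 𝒯.HdivDivT) := 𝒯.trace2T '' spaceX Ω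

/-- The minimum energy extension norm on `Û`,
`‖û‖_{3/2,1/2,S} = inf {‖v‖_{H²(Ω)} : v ∈ H²(Ω), tr²_𝒯 v = û}`. -/
def traceNorm (û : StrongDual ℝ 𝒯.HdivDivT) : ℝ :=
  sInf (HkNorm Ω 2 '' {v | v ∈ Hk Ω 2 ∧ 𝒯.trace2T v = û})

/-- The ambient space `L²(Ω) × L²(Ω)^{2×2} × H(div Div; 𝒯)'`. -/
abbrev Ambient : Type := L2 Ω × L2Tensor Ω 2 × StrongDual ℝ 𝒯.HdivDivT

/-- `U = L²(Ω) × L²_sym(Ω) × Û`. -/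
def spaceU : Set 𝒯.Ambient := {w | IsSymmL2 w.2.1 ∧ w.2.2 ∈ 𝒯.traceSpace}

/-- `‖(u, M, û)‖_U = (‖u‖² + ‖M‖² + ‖û‖²_{3/2,1/2,S})^{1/2}`. -/
def normU (w : 𝒯.Ambient) : ℝ := √(‖w.1‖ ^ 2 + ‖w.2.1‖ ^ 2 + 𝒯.traceNorm w.2.2 ^ 2)

end Triangulation

/-! ### The lowest-order discrete space -/

/-- The function `g` of the parameter `t ∈ [0, 1]` of the segment from `a` to `b`, an edge of the
triangle `T`, is the trace of `w ∈ H¹(T)` on that edge: some functions in `C^∞(T̄)` converge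
to `w` in `H¹(T)` while their values on the edge converge to `g` in `L²`. -/
def HasEdgeTrace (T : Set Plane) (a b : Plane) (w : L2 T) (g : ℝ → ℝ) : Prop :=
  w ∈ Hk T 1 ∧ ∀ ε > 0, ∃ φ : Plane → ℝ, ContDiff ℝ ∞ φ ∧ HasCompactSupport φ ∧
    ∃ v : L2 T, v =ᵐ[volume.restrict T] φ ∧ HkNorm T 1 (w - v) < ε ∧
      ∫ t in (0 : ℝ)..1, (φ (AffineMap.lineMap a b t) - g t) ^ 2 < ε

/-- The trace of `w ∈ H¹(T)` on the edge from `a` to `b` is a polynomial of degree at most `p`. -/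
def HasPolyEdgeTrace (T : Set Plane) (a b : Plane) (w : L2 T) (p : ℕ) : Prop :=
  ∃ q : Polynomial ℝ, q.natDegree ≤ p ∧ HasEdgeTrace T a b w (fun t => q.eval t)

/-- The directional derivative `n · ∇v`. -/
def dirDeriv (T : Set Plane) (n : Plane) (v : L2 T) : L2 T :=
  ∑ j : Fin 2, n j • weakDeriv T 1 v ![j]

/-- The local space `U_T`: the functions `v ∈ H²(T)` with `Δ² v + v = 0` (in the sense of
distributions) such that on every edge of `T` the trace of `v` is a polynomial of degree at most 3
and the normal derivative of `v` is a polynomial of degree at most 1. (The last condition depends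
neither on the length nor on the orientation of the normal vector.) -/
def localSpace (s : Finset Plane) : Set (L2 (cell s)) :=
  {v | v ∈ Hk (cell s) 2 ∧
    (∀ φ : Plane → ℝ, IsTestFunction (cell s) φ →
      ∫ x in cell s, v x * (Laplacian.laplacian (Laplacian.laplacian φ) x + φ x) = 0) ∧
    ∀ a ∈ s, ∀ b ∈ s, a ≠ b →
      HasPolyEdgeTrace (cell s) a b v 3 ∧
      ∀ n : Plane, ⟪n, b - a⟫_ℝ = 0 → HasPolyEdgeTrace (cell s) a b (dirDeriv (cell s) n v) 1}

namespace Triangulation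

variable {Ω : Set Plane} (𝒯 : Triangulation Ω)

/-- Membership in `P⁰(𝒯)`: `v` is constant on every triangle. -/
def IsPiecewiseConst (v : L2 Ω) : Prop :=
  ∀ s ∈ 𝒯.tris, ∃ c : ℝ, ∀ᵐ x ∂(volume.restrict (cell s)), v x = c

open Classical in
/-- `Û_h = {v̂ ∈ Û : v̂|_{∂T} ∈ Û_T = tr²_T(U_T) for all T}`, where `v̂|_{∂T}` is the functional
`Q ↦ v̂ Q` for `Q ∈ H(div Div; T)` extended by zero. -/
def discreteTraceSpace : Set (StrongDual ℝ 𝒯.HdivDivT) :=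
  {vh | vh ∈ 𝒯.traceSpace ∧ ∀ s : 𝒯.tris, ∃ v ∈ localSpace s, ∀ Q : HdivDiv (cell s),
    vh (PiLp.single 2 s Q) = trace2 (cell s) v Q}

/-- `U_h = P⁰(𝒯) × (P⁰(𝒯)^{2×2} ∩ L²_sym(Ω)) × Û_h`. -/
def spaceUh : Set 𝒯.Ambient :=
  {w | 𝒯.IsPiecewiseConst w.1 ∧ IsSymmL2 w.2.1 ∧ (∀ i, 𝒯.IsPiecewiseConst (w.2.1 i)) ∧
    w.2.2 ∈ 𝒯.discreteTraceSpace}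

/-- The triple `(u, D² u, tr²_𝒯 u)`. -/
def lift (u : L2 Ω) : 𝒯.Ambient := (u, weakDeriv Ω 2 u, 𝒯.trace2T u)

end Triangulation

end

/-! The squared norm of `U` is a sum of three squares and `U_h` is a product, so the three
components are approximated, and their minima attained, separately.

The first two components are approximated by the best piecewise constants for `u` and for the
entries of `D² u`. Poincaré's inequality on the convex triangles (`poincare`,
`dist_piecewiseConst_le`) bounds each error by the mesh size times the gradient of the approximated
function. The `H³` norm contains only `‖u‖` and `‖D³ u‖`, so the gradient of `u` has to be recovered
from these two; this is the interpolation inequality `exists_interp_Hk_three`, with a constant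
depending on `Ω`.

For the third component, the trace norm is a minimal extension norm. Hence every `v ∈ H²(Ω)` with a
discrete trace bounds the error by `‖u - v‖` in `H²(Ω)`. The choice of `v` is the reduced
Hsieh–Clough–Tocher interpolant `hct`: a piecewise cubic `C¹` function, given by values and
gradients at the vertices, cubic on every edge and with linear normal derivative there. Vertex
gradients make sense because `H³` functions on `Ω` have `C¹` representatives (`exists_C1_approx`).
Since `u` vanishes on the boundary, so do its tangential derivatives on boundary edges, and
therefore also the interpolant. The interpolant does not solve `Δ² v + v = 0`, but this equation is
orthogonality to all test functions in the graph inner product of `D²`. Subtracting the projection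
onto `H₀²(T)` yields an element of `U_T` with the same functional `tr²_T` (`exists_mem_localSpace`).
For the error estimate, `hct` reproduces quadratic polynomials (`hct_eq_quadratic`), an averaged
Taylor polynomial approximates the function on each triangle up to terms in `D³`
(`exists_quadratic_approx`), and shape regularity bounds the interpolant by its data (`abs_hct_le`,
`abs_hctD_sub_le`).

Attainment for the third component rests on finite dimension of the discrete traces: vanishing
traces and normal derivatives on all edges force the functional to vanish (`trace2_eq_zero`), so it
is determined by finitely many polynomials. The functions with discrete trace then form a closed
subspace of `H²(Ω)`, and projecting `u` onto it attains the quotient norm (`exists_best_trace`).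

The Sobolev tools come from one smoothing operator. Contracting a convex set towards an interior
point before mollifying uses only values inside the set, so the operator commutes with weak
differentiation up to a factor tending to 1 (`exists_smoothing`). Inequalities are proved for smooth
functions, by Taylor expansion along segments and change of variables by homotheties, and pass to
the limit. -/

section

/-! ### Partial derivatives of smooth functions -/

/-- The partial derivative `∂_j f`. -/
noncomputable def dd (j : Fin 2) (f : Plane → ℝ) (x : Plane) : ℝ :=
  fderiv ℝ f x (EuclideanSpace.single j (1 : ℝ))

/-- Smooth functions with compact support. -/
def Smc (f : Plane → ℝ) : Prop := ContDiff ℝ ∞ f ∧ HasCompactSupport f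

theorem ContDiff.dd {f : Plane → ℝ} (h : ContDiff ℝ ∞ f) (j : Fin 2) : ContDiff ℝ ∞ (dd j f) :=
  ((contDiff_infty_iff_fderiv.1 h).2).clm_apply contDiff_const

theorem tsupport_dd_subset (f : Plane → ℝ) (j : Fin 2) : tsupport (dd j f) ⊆ tsupport f :=
  (tsupport_fderiv_apply_subset ℝ (EuclideanSpace.single j (1 : ℝ)))

theorem HasCompactSupport.dd {f : Plane → ℝ} (h : HasCompactSupport f) (j : Fin 2) :
    HasCompactSupport (dd j f) := h.fderiv_apply (𝕜 := ℝ) _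

namespace Smc

variable {f g : Plane → ℝ}

theorem differentiable (h : Smc f) : Differentiable ℝ f := h.1.differentiable (by simp)

theorem continuous (h : Smc f) : Continuous f := h.1.continuous

protected theorem dd (h : Smc f) (j : Fin 2) : Smc (dd j f) := ⟨h.1.dd j, h.2.dd j⟩

theorem mul_left (h : Smc f) (hg : ContDiff ℝ ∞ g) : Smc (fun x => g x * f x) :=
  ⟨hg.mul h.1, h.2.mul_left⟩

theorem mul_right (h : Smc f) (hg : ContDiff ℝ ∞ g) : Smc (fun x => f x * g x) :=
  ⟨h.1.mul hg, h.2.mul_right⟩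

theorem mul (h : Smc f) (hg : Smc g) : Smc (fun x => f x * g x) := h.mul_right hg.1

theorem const_mul (h : Smc f) (c : ℝ) : Smc (fun x => c * f x) := h.mul_left contDiff_const

theorem add (h : Smc f) (hg : Smc g) : Smc (fun x => f x + g x) :=
  ⟨h.1.add hg.1, h.2.add hg.2⟩

theorem sub (h : Smc f) (hg : Smc g) : Smc (fun x => f x - g x) := by
  simpa [sub_eq_add_neg] using h.add (hg.const_mul (-1))

theorem zero : Smc (fun _ => 0) := ⟨contDiff_const, HasCompactSupport.zero⟩

theorem sum {ι : Type*} (s : Finset ι) {f : ι → Plane → ℝ} (h : ∀ i, Smc (f i)) :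
    Smc (fun x => ∑ i ∈ s, f i x) := by
  classical
  induction s using Finset.induction_on with
  | empty => simpa using zero
  | insert a s ha ih => simpa [Finset.sum_insert ha] using (h a).add ih

theorem integrable (h : Smc f) {μ : Measure Plane} [IsFiniteMeasureOnCompacts μ] :
    Integrable f μ := h.continuous.integrable_of_hasCompactSupport h.2

theorem memLp (h : Smc f) (D : Set Plane) : MemLp f 2 (volume.restrict D) :=
  (h.continuous.memLp_of_hasCompactSupport h.2).mono_measure Measure.restrict_le_self

end Smc

theorem IsTestFunction.smc {D : Set Plane} {φ : Plane → ℝ} (h : IsTestFunction D φ) : Smc φ :=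
  ⟨h.1, h.2.1⟩

theorem IsTestFunction.dd {D : Set Plane} {φ : Plane → ℝ} (h : IsTestFunction D φ) (j : Fin 2) :
    IsTestFunction D (dd j φ) :=
  ⟨h.1.dd j, h.2.1.dd j, (tsupport_dd_subset φ j).trans h.2.2⟩

theorem IsTestFunction.mono {T D : Set Plane} (hT : T ⊆ D) {φ : Plane → ℝ}
    (h : IsTestFunction T φ) : IsTestFunction D φ := ⟨h.1, h.2.1, h.2.2.trans hT⟩

theorem IsTestFunction.eq_zero {D : Set Plane} {φ : Plane → ℝ} (h : IsTestFunction D φ)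
    {x : Plane} (hx : x ∉ D) : φ x = 0 :=
  image_eq_zero_of_notMem_tsupport fun hx' => hx (h.2.2 hx')

theorem plane_eq_sum (v : Plane) : v = ∑ j, v j • EuclideanSpace.single j (1 : ℝ) := by
  ext i; fin_cases i <;> simp

theorem fderiv_eq_sum_dd (f : Plane → ℝ) (x v : Plane) :
    fderiv ℝ f x v = ∑ j, v j * dd j f x := by
  conv_lhs => rw [plane_eq_sum v]
  simp [dd]

theorem dd_mul {f g : Plane → ℝ} {x : Plane} (hf : DifferentiableAt ℝ f x)
    (hg : DifferentiableAt ℝ g x) (j : Fin 2) :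
    dd j (fun y => f y * g y) x = f x * dd j g x + g x * dd j f x := by
  simp only [dd]; rw [fderiv_fun_mul hf hg]; simp

theorem dd_add {f g : Plane → ℝ} {x : Plane} (hf : DifferentiableAt ℝ f x)
    (hg : DifferentiableAt ℝ g x) (j : Fin 2) :
    dd j (fun y => f y + g y) x = dd j f x + dd j g x := by
  simp only [dd]; rw [fderiv_fun_add hf hg]; simp

theorem dd_sub {f g : Plane → ℝ} {x : Plane} (hf : DifferentiableAt ℝ f x)
    (hg : DifferentiableAt ℝ g x) (j : Fin 2) :
    dd j (fun y => f y - g y) x = dd j f x - dd j g x := by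
  simp only [dd]; rw [fderiv_fun_sub hf hg]; simp

theorem dd_const_mul {f : Plane → ℝ} {x : Plane} (hf : DifferentiableAt ℝ f x) (c : ℝ)
    (j : Fin 2) : dd j (fun y => c * f y) x = c * dd j f x := by
  simp only [dd]; rw [fderiv_const_mul hf]; simp

protected theorem Smc.dd_sub {f g : Plane → ℝ} (hf : Smc f) (hg : Smc g) (j : Fin 2) :
    dd j (fun y => f y - g y) = fun x => dd j f x - dd j g x :=
  funext fun x => _root_.dd_sub (hf.differentiable x) (hg.differentiable x) j

theorem dd_congr_of_isOpen {D : Set Plane} (hD : IsOpen D) {f g : Plane → ℝ} (h : EqOn f g D)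
    (j : Fin 2) : EqOn (dd j f) (dd j g) D := fun x hx => by
  have : f =ᶠ[nhds x] g := Filter.eventuallyEq_of_mem (hD.mem_nhds hx) h
  simp only [dd]; rw [this.fderiv_eq]

theorem dd_comm {f : Plane → ℝ} (hf : ContDiff ℝ ∞ f) (j k : Fin 2) :
    dd j (dd k f) = dd k (dd j f) := by
  funext x
  have hd : DifferentiableAt ℝ (fderiv ℝ f) x :=
    ((contDiff_infty_iff_fderiv.1 hf).2.differentiable (by simp)) x
  have h : ∀ a b : Fin 2, dd a (dd b f) x = fderiv ℝ (fderiv ℝ f) x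
      (EuclideanSpace.single a 1) (EuclideanSpace.single b 1) := fun a b => by
    have : dd b f = fun y => fderiv ℝ f y (EuclideanSpace.single b (1 : ℝ)) := rfl
    rw [dd, this, fderiv_clm_apply hd (differentiableAt_const _)]
    simp
  rw [h, h]
  exact ((contDiff_infty.1 hf 2).contDiffAt.isSymmSndFDerivAt (by simp)) _ _

theorem partialDeriv_zero (i : Fin 0 → Fin 2) (φ : Plane → ℝ) : partialDeriv i φ = φ := by
  funext x; simp [partialDeriv]

theorem partialDeriv_succ {m : ℕ} (i : Fin (m + 1) → Fin 2) {φ : Plane → ℝ}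
    (hφ : ContDiff ℝ ∞ φ) :
    partialDeriv i φ = dd (i 0) (partialDeriv (Fin.tail i) φ) := by
  funext x
  have hd : DifferentiableAt ℝ (iteratedFDeriv ℝ m φ) x :=
    (hφ.differentiable_iteratedFDeriv (by exact_mod_cast WithTop.coe_lt_top m)) x
  simp only [partialDeriv, dd]
  rw [iteratedFDeriv_succ_apply_left]
  have := fderiv_continuousMultilinear_apply_const_apply hd
    (fun l => EuclideanSpace.single (i (Fin.succ l)) (1 : ℝ)) (EuclideanSpace.single (i 0) 1)
  exact this.symm

theorem partialDeriv_one {φ : Plane → ℝ} (hφ : ContDiff ℝ ∞ φ) (i : Fin 1 → Fin 2) :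
    partialDeriv i φ = dd (i 0) φ := by
  rw [partialDeriv_succ _ hφ, partialDeriv_zero]

theorem partialDeriv_two {φ : Plane → ℝ} (hφ : ContDiff ℝ ∞ φ) (i : Fin 2 → Fin 2) :
    partialDeriv i φ = dd (i 0) (dd (i 1) φ) := by
  rw [partialDeriv_succ _ hφ, partialDeriv_one hφ]; rfl

theorem partialDeriv_three {φ : Plane → ℝ} (hφ : ContDiff ℝ ∞ φ) (i : Fin 3 → Fin 2) :
    partialDeriv i φ = dd (i 0) (dd (i 1) (dd (i 2) φ)) := by
  rw [partialDeriv_succ _ hφ, partialDeriv_two hφ]; rfl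

theorem Smc.partialDeriv {φ : Plane → ℝ} (hφ : Smc φ) : ∀ {m : ℕ} (i : Fin m → Fin 2),
    Smc (partialDeriv i φ)
  | 0, i => by rwa [partialDeriv_zero]
  | m + 1, i => by rw [partialDeriv_succ i hφ.1]; exact (hφ.partialDeriv _).dd _

theorem IsTestFunction.partialDeriv {D : Set Plane} {φ : Plane → ℝ} (hφ : IsTestFunction D φ) :
    ∀ {m : ℕ} (i : Fin m → Fin 2), IsTestFunction D (partialDeriv i φ)
  | 0, i => by rwa [partialDeriv_zero]
  | m + 1, i => by rw [partialDeriv_succ i hφ.1]; exact (hφ.partialDeriv _).dd _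

theorem integral_mul_dd {f g : Plane → ℝ} (hf : Smc f) (hg : Smc g) (j : Fin 2) :
    ∫ x, f x * dd j g x = -∫ x, dd j f x * g x :=
  integral_mul_fderiv_eq_neg_fderiv_mul_of_integrable (v := EuclideanSpace.single j (1 : ℝ))
    ((hf.dd j).mul hg).integrable (hf.mul (hg.dd j)).integrable (hf.mul hg).integrable
    (fun x _ => hf.differentiable x) (fun x _ => hg.differentiable x)

theorem sum_fin_one_index {M : Type*} [AddCommMonoid M] (f : (Fin 1 → Fin 2) → M) :
    ∑ i, f i = ∑ j, f ![j] := by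
  rw [← (Equiv.funUnique (Fin 1) (Fin 2)).symm.sum_comp]
  refine Finset.sum_congr rfl fun j _ => congrArg f ?_
  ext a; fin_cases a; rfl

theorem sum_fin_two_index {M : Type*} [AddCommMonoid M] (f : (Fin 2 → Fin 2) → M) :
    ∑ i, f i = ∑ j, ∑ k, f ![j, k] := by
  rw [← (finTwoArrowEquiv (Fin 2)).symm.sum_comp, Fintype.sum_prod_type]
  rfl

theorem sum_fin_three_index {M : Type*} [AddCommMonoid M] (f : (Fin 3 → Fin 2) → M) :
    ∑ i, f i = ∑ j, ∑ k, ∑ l, f ![j, k, l] := by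
  rw [← (Fin.consEquiv (fun _ : Fin 3 => Fin 2)).sum_comp, Fintype.sum_prod_type]
  refine Finset.sum_congr rfl fun j _ => ?_
  rw [sum_fin_two_index (fun i => f (Fin.consEquiv (fun _ : Fin 3 => Fin 2) (j, i)))]
  rfl

/-! ### Elements of `L²(D)` -/

open Classical in
/-- The class of a function in `L²(D)`, with the value `0` for functions that are not square
integrable. -/
noncomputable def toL2 (D : Set Plane) (f : Plane → ℝ) : L2 D :=
  if h : MemLp f 2 (volume.restrict D) then h.toLp f else 0

section toL2

variable {D : Set Plane} {f g : Plane → ℝ}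

theorem coeFn_toL2 (h : MemLp f 2 (volume.restrict D)) : toL2 D f =ᵐ[volume.restrict D] f := by
  rw [toL2, dif_pos h]; exact h.coeFn_toLp

theorem eq_toL2 {u : L2 D} (h : u =ᵐ[volume.restrict D] f) : u = toL2 D f := by
  have hm : MemLp f 2 (volume.restrict D) := (memLp_congr_ae h).1 (Lp.memLp u)
  exact Lp.ext (h.trans (coeFn_toL2 hm).symm)

theorem toL2_congr (hD : MeasurableSet D) (h : EqOn f g D) : toL2 D f = toL2 D g := by
  have hae : f =ᵐ[volume.restrict D] g := (ae_restrict_iff' hD).2 (Filter.Eventually.of_forall h)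
  by_cases hf : MemLp f 2 (volume.restrict D)
  · exact eq_toL2 ((coeFn_toL2 hf).trans hae)
  · rw [toL2, toL2, dif_neg hf, dif_neg (fun h' => hf ((memLp_congr_ae hae).2 h'))]

theorem toL2_add (hf : MemLp f 2 (volume.restrict D)) (hg : MemLp g 2 (volume.restrict D)) :
    toL2 D (fun x => f x + g x) = toL2 D f + toL2 D g := by
  refine (eq_toL2 ?_).symm
  filter_upwards [Lp.coeFn_add (toL2 D f) (toL2 D g), coeFn_toL2 hf, coeFn_toL2 hg] with x h h1 h2
  rw [h, Pi.add_apply, h1, h2]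

theorem toL2_sub (hf : MemLp f 2 (volume.restrict D)) (hg : MemLp g 2 (volume.restrict D)) :
    toL2 D (fun x => f x - g x) = toL2 D f - toL2 D g := by
  refine (eq_toL2 ?_).symm
  filter_upwards [Lp.coeFn_sub (toL2 D f) (toL2 D g), coeFn_toL2 hf, coeFn_toL2 hg] with x h h1 h2
  rw [h, Pi.sub_apply, h1, h2]

theorem toL2_const_mul (hf : MemLp f 2 (volume.restrict D)) (c : ℝ) :
    toL2 D (fun x => c * f x) = c • toL2 D f := by
  refine (eq_toL2 ?_).symm
  filter_upwards [Lp.coeFn_smul c (toL2 D f), coeFn_toL2 hf] with x h h1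
  rw [h, Pi.smul_apply, h1, smul_eq_mul]

theorem inner_L2_eq (u v : L2 D) : ⟪u, v⟫_ℝ = ∫ x in D, u x * v x := by
  rw [L2.inner_def]; exact integral_congr_ae (.of_forall fun x => mul_comm _ _)

theorem inner_toL2 (u : L2 D) (hf : MemLp f 2 (volume.restrict D)) :
    ⟪u, toL2 D f⟫_ℝ = ∫ x in D, u x * f x := by
  rw [inner_L2_eq]
  refine integral_congr_ae ?_
  filter_upwards [coeFn_toL2 hf] with x h1
  rw [h1]

theorem inner_toL2_toL2 (hf : MemLp f 2 (volume.restrict D))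
    (hg : MemLp g 2 (volume.restrict D)) : ⟪toL2 D f, toL2 D g⟫_ℝ = ∫ x in D, f x * g x := by
  rw [inner_toL2 _ hg]
  refine integral_congr_ae ?_
  filter_upwards [coeFn_toL2 hf] with x h1
  rw [h1]

theorem norm_toL2_sq (hf : MemLp f 2 (volume.restrict D)) :
    ‖toL2 D f‖ ^ 2 = ∫ x in D, f x ^ 2 := by
  rw [← real_inner_self_eq_norm_sq, inner_toL2_toL2 hf hf]
  simp only [pow_two]

theorem Smc.toL2_sub (hf : Smc f) (hg : Smc g) :
    toL2 D (fun x => f x - g x) = toL2 D f - toL2 D g :=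
  _root_.toL2_sub (hf.memLp D) (hg.memLp D)

end toL2

theorem coeFn_restrictL2 {T D : Set Plane} (h : T ⊆ D) (u : L2 D) :
    restrictL2 h u =ᵐ[volume.restrict T] u :=
  MemLp.coeFn_toLp _

theorem MeasureTheory.MemLp.restrict_mono {T D : Set Plane} (h : T ⊆ D) {f : Plane → ℝ}
    (hf : MemLp f 2 (volume.restrict D)) : MemLp f 2 (volume.restrict T) :=
  hf.mono_measure (Measure.restrict_mono h le_rfl)

theorem restrictL2_toL2 {T D : Set Plane} (h : T ⊆ D) {f : Plane → ℝ}
    (hf : MemLp f 2 (volume.restrict D)) : restrictL2 h (toL2 D f) = toL2 T f :=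
  eq_toL2 ((coeFn_restrictL2 h _).trans
    ((coeFn_toL2 hf).filter_mono (ae_mono (Measure.restrict_mono h le_rfl))))

/-- Restriction as a continuous linear map. -/
noncomputable def restrictCLM {T D : Set Plane} (h : T ⊆ D) : L2 D →L[ℝ] L2 T :=
  LinearMap.mkContinuous
    { toFun := restrictL2 h
      map_add' := fun u v => by
        refine Lp.ext ?_
        filter_upwards [coeFn_restrictL2 h (u + v), coeFn_restrictL2 h u, coeFn_restrictL2 h v,
          Lp.coeFn_add (restrictL2 h u) (restrictL2 h v),
          (Lp.coeFn_add u v).filter_mono (ae_mono (Measure.restrict_mono h le_rfl))] with x a b c d e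
        rw [a, e, d, Pi.add_apply, Pi.add_apply, b, c]
      map_smul' := fun c u => by
        refine Lp.ext ?_
        filter_upwards [coeFn_restrictL2 h (c • u), coeFn_restrictL2 h u,
          Lp.coeFn_smul c (restrictL2 h u),
          (Lp.coeFn_smul c u).filter_mono (ae_mono (Measure.restrict_mono h le_rfl))] with x a b d e
        rw [a, e, RingHom.id_apply, d, Pi.smul_apply, Pi.smul_apply, b] } 1 (fun u => by
      rw [one_mul]
      change ‖restrictL2 h u‖ ≤ ‖u‖
      rw [restrictL2, Lp.norm_toLp, Lp.norm_def]
      exact ENNReal.toReal_mono (Lp.eLpNorm_ne_top u)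
        (eLpNorm_mono_measure _ (Measure.restrict_mono h le_rfl)))

theorem restrictCLM_apply {T D : Set Plane} (h : T ⊆ D) (u : L2 D) :
    restrictCLM h u = restrictL2 h u := rfl

/-- A function supported in `T` does not see `u` outside `T`; hence weak derivatives restrict to
subdomains. -/
theorem inner_restrictL2_test {T D : Set Plane} (hD : MeasurableSet D) (h : T ⊆ D) (u : L2 D)
    {φ : Plane → ℝ} (hφ : IsTestFunction T φ) :
    ⟪restrictL2 h u, toL2 T φ⟫_ℝ = ⟪u, toL2 D φ⟫_ℝ := by
  rw [inner_toL2 _ (hφ.smc.memLp T), inner_toL2 _ (hφ.smc.memLp D),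
    setIntegral_eq_of_subset_of_forall_sdiff_eq_zero hD h
      (fun x hx => by rw [hφ.eq_zero hx.2, mul_zero])]
  refine integral_congr_ae ?_
  filter_upwards [coeFn_restrictL2 h u] with x hx
  rw [hx]

/-! ### First-order weak derivatives -/

/-- `g` is the weak partial derivative `∂_j u` in `D`. -/
def HasWD (D : Set Plane) (j : Fin 2) (u g : L2 D) : Prop :=
  ∀ φ : Plane → ℝ, IsTestFunction D φ → ⟪u, toL2 D (dd j φ)⟫_ℝ = -⟪g, toL2 D φ⟫_ℝ

namespace HasWD

variable {D : Set Plane} {j : Fin 2} {u v g h : L2 D}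

theorem add (hu : HasWD D j u g) (hv : HasWD D j v h) : HasWD D j (u + v) (g + h) :=
  fun φ hφ => by rw [inner_add_left, inner_add_left, hu φ hφ, hv φ hφ]; ring

theorem smul (c : ℝ) (hu : HasWD D j u g) : HasWD D j (c • u) (c • g) :=
  fun φ hφ => by rw [real_inner_smul_left, real_inner_smul_left, hu φ hφ]; ring

theorem sub (hu : HasWD D j u g) (hv : HasWD D j v h) : HasWD D j (u - v) (g - h) :=
  fun φ hφ => by rw [inner_sub_left, inner_sub_left, hu φ hφ, hv φ hφ]; ring

theorem of_tendsto {u' g' : ℕ → L2 D} (hw : ∀ n, HasWD D j (u' n) (g' n))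
    (hu : Filter.Tendsto u' Filter.atTop (nhds u)) (hg : Filter.Tendsto g' Filter.atTop (nhds g)) :
    HasWD D j u g := fun φ hφ =>
  tendsto_nhds_unique (hu.inner tendsto_const_nhds)
    (((hg.inner tendsto_const_nhds).neg).congr fun n => (hw n φ hφ).symm)

theorem restrict {T : Set Plane} (hD : MeasurableSet D) (hT : T ⊆ D) (hu : HasWD D j u g) :
    HasWD T j (restrictL2 hT u) (restrictL2 hT g) := fun φ hφ => by
  rw [inner_restrictL2_test hD hT _ (hφ.dd j), inner_restrictL2_test hD hT _ hφ,
    hu φ (hφ.mono hT)]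

theorem of_smc {f : Plane → ℝ} (hf : Smc f) (j : Fin 2) :
    HasWD D j (toL2 D f) (toL2 D (dd j f)) := fun φ hφ => by
  rw [inner_toL2_toL2 (hf.memLp D) ((hφ.smc.dd j).memLp D),
    inner_toL2_toL2 ((hf.dd j).memLp D) (hφ.smc.memLp D),
    setIntegral_eq_integral_of_forall_compl_eq_zero
      (fun x hx => by rw [(hφ.dd j).eq_zero hx, mul_zero]),
    setIntegral_eq_integral_of_forall_compl_eq_zero
      (fun x hx => by rw [hφ.eq_zero hx, mul_zero]), integral_mul_dd hf hφ.smc]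

end HasWD

/-- With inner products the relation is visibly continuous in `u` and `g`, which is what limits in
`L²` need. -/
theorem isWeakDeriv_iff {D : Set Plane} {m : ℕ} {u : L2 D} {g : L2Tensor D m} :
    IsWeakDeriv D m u g ↔ ∀ φ : Plane → ℝ, IsTestFunction D φ → ∀ i : Fin m → Fin 2,
      ⟪u, toL2 D (partialDeriv i φ)⟫_ℝ = (-1 : ℝ) ^ m * ⟪g i, toL2 D φ⟫_ℝ := by
  refine forall₂_congr fun φ hφ => forall_congr' fun i => ?_
  rw [inner_toL2 _ ((hφ.smc.partialDeriv i).memLp D), inner_toL2 _ (hφ.smc.memLp D)]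

theorem isWeakDeriv_zero_iff {D : Set Plane} {u : L2 D} {g : L2Tensor D 0}
    (h : ∀ i, g i = u) : IsWeakDeriv D 0 u g :=
  isWeakDeriv_iff.2 fun φ _ i => by rw [partialDeriv_zero, h]; simp

theorem isWeakDeriv_one_iff {D : Set Plane} {u : L2 D} {g : L2Tensor D 1} :
    IsWeakDeriv D 1 u g ↔ ∀ j, HasWD D j u (g ![j]) := by
  rw [isWeakDeriv_iff]
  constructor
  · intro h j φ hφ
    have := h φ hφ ![j]
    rw [partialDeriv_one hφ.1] at this
    simpa using this
  · intro h φ hφ i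
    rw [partialDeriv_one hφ.1, h (i 0) φ hφ]
    have : ![i 0] = i := by ext a; fin_cases a; rfl
    rw [this]; simp

/-- Testing the first-order relation with `dd k φ` and comparing. Together with the third-order
analogue this replaces tensors by chains of first-order derivatives, the last index being the newest
derivative. -/
theorem IsWeakDeriv.hasWD_two {D : Set Plane} {u : L2 D} {g : L2Tensor D 1} {g' : L2Tensor D 2}
    (h : IsWeakDeriv D 1 u g) (h' : IsWeakDeriv D 2 u g') (j k : Fin 2) :
    HasWD D k (g ![j]) (g' ![j, k]) := fun φ hφ => by
  have h1 := isWeakDeriv_iff.1 h (dd k φ) (hφ.dd k) ![j]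
  have h2 := isWeakDeriv_iff.1 h' φ hφ ![j, k]
  rw [partialDeriv_one (hφ.dd k).1] at h1
  rw [partialDeriv_two hφ.1] at h2
  simp only [Matrix.cons_val_zero, Matrix.cons_val_one] at h1 h2
  linarith

theorem IsWeakDeriv.hasWD_three {D : Set Plane} {u : L2 D} {g : L2Tensor D 2}
    {g' : L2Tensor D 3} (h : IsWeakDeriv D 2 u g) (h' : IsWeakDeriv D 3 u g') (j k l : Fin 2) :
    HasWD D l (g ![j, k]) (g' ![j, k, l]) := fun φ hφ => by
  have h1 := isWeakDeriv_iff.1 h (dd l φ) (hφ.dd l) ![j, k]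
  have h2 := isWeakDeriv_iff.1 h' φ hφ ![j, k, l]
  rw [partialDeriv_two (hφ.dd l).1] at h1
  rw [partialDeriv_three hφ.1] at h2
  simp only [Matrix.cons_val_zero, Matrix.cons_val_one, Matrix.cons_val] at h1 h2
  linarith

/-- The tensor with the given entries. -/
noncomputable def tensor1 {D : Set Plane} (g : Fin 2 → L2 D) : L2Tensor D 1 :=
  WithLp.toLp 2 fun i => g (i 0)

/-- The matrix with the given entries. -/
noncomputable def tensor2 {D : Set Plane} (g : Fin 2 → Fin 2 → L2 D) : L2Tensor D 2 :=
  WithLp.toLp 2 fun i => g (i 0) (i 1)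

@[simp] theorem tensor1_apply {D : Set Plane} (g : Fin 2 → L2 D) (i) :
    tensor1 g i = g (i 0) := rfl

@[simp] theorem tensor2_apply {D : Set Plane} (g : Fin 2 → Fin 2 → L2 D) (i) :
    tensor2 g i = g (i 0) (i 1) := rfl

theorem norm_tensor1_sq {D : Set Plane} (g : L2Tensor D 1) : ‖g‖ ^ 2 = ∑ j, ‖g ![j]‖ ^ 2 := by
  rw [PiLp.norm_sq_eq_of_L2, sum_fin_one_index]

theorem norm_tensor2_sq {D : Set Plane} (g : L2Tensor D 2) :
    ‖g‖ ^ 2 = ∑ j, ∑ k, ‖g ![j, k]‖ ^ 2 := by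
  rw [PiLp.norm_sq_eq_of_L2, sum_fin_two_index]

theorem norm_tensor3_sq {D : Set Plane} (g : L2Tensor D 3) :
    ‖g‖ ^ 2 = ∑ j, ∑ k, ∑ l, ‖g ![j, k, l]‖ ^ 2 := by
  rw [PiLp.norm_sq_eq_of_L2, sum_fin_three_index]

theorem isWeakDeriv_one_of {D : Set Plane} {u : L2 D} {g : Fin 2 → L2 D}
    (h : ∀ j, HasWD D j u (g j)) : IsWeakDeriv D 1 u (tensor1 g) :=
  isWeakDeriv_one_iff.2 fun j => h j

theorem isWeakDeriv_two_of {D : Set Plane} {u : L2 D} {g : Fin 2 → L2 D}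
    {g' : Fin 2 → Fin 2 → L2 D} (h : ∀ j, HasWD D j u (g j))
    (h' : ∀ j k, HasWD D k (g j) (g' j k)) : IsWeakDeriv D 2 u (tensor2 g') :=
  isWeakDeriv_iff.2 fun φ hφ i => by
    rw [partialDeriv_two hφ.1, h (i 0) _ (hφ.dd _), h' (i 0) (i 1) _ hφ]
    simp

theorem IsWeakDeriv.weakDeriv_eq {D : Set Plane} (hD : IsOpen D) {m : ℕ} {u : L2 D}
    {g : L2Tensor D m} (h : IsWeakDeriv D m u g) : weakDeriv D m u = g := by
  have he : ∃ g, IsWeakDeriv D m u g := ⟨g, h⟩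
  rw [weakDeriv, dif_pos he]
  exact IsWeakDeriv.unique hD he.choose_spec h

theorem isWeakDeriv_weakDeriv {D : Set Plane} {m : ℕ} {u : L2 D}
    (he : ∃ g, IsWeakDeriv D m u g) : IsWeakDeriv D m u (weakDeriv D m u) := by
  rw [weakDeriv, dif_pos he]; exact he.choose_spec

/-- The transposed matrix is a second weak derivative as well, since partial derivatives of test
functions commute; uniqueness identifies the two. -/
theorem IsWeakDeriv.symm_two {D : Set Plane} (hD : IsOpen D) {u : L2 D} {g : L2Tensor D 2}
    (h : IsWeakDeriv D 2 u g) (j k : Fin 2) : g ![j, k] = g ![k, j] := by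
  have h2 : IsWeakDeriv D 2 u (tensor2 fun j k => g ![k, j]) :=
    isWeakDeriv_iff.2 fun φ hφ i => by
      have := isWeakDeriv_iff.1 h φ hφ ![i 1, i 0]
      rw [partialDeriv_two hφ.1] at this ⊢
      rw [dd_comm hφ.1]
      exact this
  have := congrArg (fun t : L2Tensor D 2 => t ![j, k]) (IsWeakDeriv.unique hD h h2)
  simpa using this

theorem mem_Hk_one {D : Set Plane} {u : L2 D} {g : Fin 2 → L2 D} (h : ∀ j, HasWD D j u (g j)) :
    u ∈ Hk D 1 := fun m hm => by
  interval_cases m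
  · exact ⟨WithLp.toLp 2 fun _ => u, isWeakDeriv_zero_iff fun _ => rfl⟩
  · exact ⟨_, isWeakDeriv_one_of h⟩

theorem mem_Hk_two {D : Set Plane} {u : L2 D} {g : Fin 2 → L2 D} {g' : Fin 2 → Fin 2 → L2 D}
    (h : ∀ j, HasWD D j u (g j)) (h' : ∀ j k, HasWD D k (g j) (g' j k)) :
    u ∈ Hk D 2 := fun m hm => by
  interval_cases m
  · exact ⟨WithLp.toLp 2 fun _ => u, isWeakDeriv_zero_iff fun _ => rfl⟩
  · exact ⟨_, isWeakDeriv_one_of h⟩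
  · exact ⟨_, isWeakDeriv_two_of h h'⟩

theorem Hk_mono {D : Set Plane} {k l : ℕ} (h : k ≤ l) : Hk D l ⊆ Hk D k :=
  fun _ hu m hm => hu m (hm.trans h)

/-- The first weak derivatives of `u ∈ H¹(D)`. -/
noncomputable def wd1 (D : Set Plane) (u : L2 D) (j : Fin 2) : L2 D := weakDeriv D 1 u ![j]

/-- The second weak derivatives of `u ∈ H²(D)`. -/
noncomputable def wd2 (D : Set Plane) (u : L2 D) (j k : Fin 2) : L2 D := weakDeriv D 2 u ![j, k]

theorem hasWD_wd1 {D : Set Plane} {u : L2 D} (hu : u ∈ Hk D 1) (j : Fin 2) :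
    HasWD D j u (wd1 D u j) :=
  isWeakDeriv_one_iff.1 (isWeakDeriv_weakDeriv (hu 1 le_rfl)) j

theorem hasWD_wd2 {D : Set Plane} {u : L2 D} (hu : u ∈ Hk D 2) (j k : Fin 2) :
    HasWD D k (wd1 D u j) (wd2 D u j k) :=
  (isWeakDeriv_weakDeriv (hu 1 (by norm_num))).hasWD_two (isWeakDeriv_weakDeriv (hu 2 le_rfl)) j k

theorem hasWD_wd3 {D : Set Plane} {u : L2 D} (hu : u ∈ Hk D 3) (j k l : Fin 2) :
    HasWD D l (wd2 D u j k) (weakDeriv D 3 u ![j, k, l]) :=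
  (isWeakDeriv_weakDeriv (hu 2 (by norm_num))).hasWD_three
    (isWeakDeriv_weakDeriv (hu 3 le_rfl)) j k l

theorem wd1_eq {D : Set Plane} (hD : IsOpen D) {u : L2 D} {g : Fin 2 → L2 D}
    (h : ∀ j, HasWD D j u (g j)) (j : Fin 2) : wd1 D u j = g j := by
  rw [wd1, (isWeakDeriv_one_of h).weakDeriv_eq hD]; simp

theorem weakDeriv_one_eq {D : Set Plane} (hD : IsOpen D) {u : L2 D} {g : Fin 2 → L2 D}
    (h : ∀ j, HasWD D j u (g j)) : weakDeriv D 1 u = tensor1 g :=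
  (isWeakDeriv_one_of h).weakDeriv_eq hD

theorem weakDeriv_two_eq {D : Set Plane} (hD : IsOpen D) {u : L2 D} {g : Fin 2 → L2 D}
    {g' : Fin 2 → Fin 2 → L2 D} (h : ∀ j, HasWD D j u (g j))
    (h' : ∀ j k, HasWD D k (g j) (g' j k)) : weakDeriv D 2 u = tensor2 g' :=
  (isWeakDeriv_two_of h h').weakDeriv_eq hD

theorem HkNorm_one_sq {D : Set Plane} (hD : IsOpen D) {u : L2 D} {g : Fin 2 → L2 D}
    (h : ∀ j, HasWD D j u (g j)) : HkNorm D 1 u ^ 2 = ‖u‖ ^ 2 + ∑ j, ‖g j‖ ^ 2 := by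
  rw [HkNorm, Real.sq_sqrt (by positivity), weakDeriv_one_eq hD h, norm_tensor1_sq]; simp

theorem HkNorm_two_sq {D : Set Plane} (hD : IsOpen D) {u : L2 D} {g : Fin 2 → L2 D}
    {g' : Fin 2 → Fin 2 → L2 D} (h : ∀ j, HasWD D j u (g j))
    (h' : ∀ j k, HasWD D k (g j) (g' j k)) :
    HkNorm D 2 u ^ 2 = ‖u‖ ^ 2 + ∑ j, ∑ k, ‖g' j k‖ ^ 2 := by
  rw [HkNorm, Real.sq_sqrt (by positivity), weakDeriv_two_eq hD h h', norm_tensor2_sq]; simp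

theorem HkNorm_nonneg (D : Set Plane) (k : ℕ) (u : L2 D) : 0 ≤ HkNorm D k u := Real.sqrt_nonneg _

theorem HkNorm_three_sq (D : Set Plane) (u : L2 D) : HkNorm D 3 u ^ 2 =
    ‖u‖ ^ 2 + ∑ j, ∑ k, ∑ l, ‖weakDeriv D 3 u ![j, k, l]‖ ^ 2 := by
  rw [HkNorm, Real.sq_sqrt (by positivity), norm_tensor3_sq]

end

section

open Filter Metric Topology

/-! ### Mollification combined with a dilation -/

/-- A smooth probability density supported in the closed ball of radius `R` around `c`. -/
structure IsKernel (k : Plane → ℝ) (c : Plane) (R : ℝ) : Prop where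
  smooth : ContDiff ℝ ∞ k
  nonneg : ∀ y, 0 ≤ k y
  integral_eq : ∫ y, k y = 1
  tsupport_subset : tsupport k ⊆ closedBall c R

theorem exists_isKernel (c : Plane) {R : ℝ} (hR : 0 < R) : ∃ k, IsKernel k c R := by
  let b : ContDiffBump c := ⟨R / 2, R, by positivity, by linarith⟩
  exact ⟨b.normed volume, b.contDiff_normed, b.nonneg_normed, b.integral_normed,
    (b.tsupport_normed_eq (μ := volume)).subset⟩

/-- The average of `f` around `a • x` with weight `k`. -/
noncomputable def moll (k : Plane → ℝ) (a : ℝ) (f : Plane → ℝ) (x : Plane) : ℝ :=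
  convolution f k (ContinuousLinearMap.lsmul ℝ ℝ) volume (a • x)

namespace IsKernel

variable {k : Plane → ℝ} {c : Plane} {R a : ℝ} {f : Plane → ℝ}

theorem hasCompactSupport (hk : IsKernel k c R) : HasCompactSupport k :=
  (isCompact_closedBall c R).of_isClosed_subset (isClosed_tsupport k) hk.tsupport_subset

theorem eq_zero (hk : IsKernel k c R) {y : Plane} (hy : y ∉ closedBall c R) : k y = 0 :=
  image_eq_zero_of_notMem_tsupport fun h => hy (hk.tsupport_subset h)

theorem moll_eq (f : Plane → ℝ) (x : Plane) : moll k a f x = ∫ t, f t * k (a • x - t) := rfl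

theorem moll_eq_swap (f : Plane → ℝ) (x : Plane) :
    moll k a f x = ∫ y, f (a • x - y) * k y :=
  convolution_eq_swap _

theorem contDiff_moll (hk : IsKernel k c R) (hf : LocallyIntegrable f) :
    ContDiff ℝ ∞ (moll k a f) :=
  (hk.hasCompactSupport.contDiff_convolution_right _ hf hk.smooth).comp (contDiff_const_smul a)

theorem hasCompactSupport_moll (hk : IsKernel k c R) (ha : a ≠ 0) (hf : HasCompactSupport f) :
    HasCompactSupport (moll k a f) :=
  (hf.convolution _ hk.hasCompactSupport).comp_homeomorph (Homeomorph.smulOfNeZero a ha)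

theorem integrable_swap (hk : IsKernel k c R) (hf : LocallyIntegrable f) (x : Plane) :
    Integrable fun y => f (x - y) * k y :=
  (hk.hasCompactSupport.convolutionExists_right (ContinuousLinearMap.lsmul ℝ ℝ) hf
    hk.smooth.continuous x).integrable_swap

theorem integrable (hk : IsKernel k c R) : Integrable k :=
  hk.smooth.continuous.integrable_of_hasCompactSupport hk.hasCompactSupport

theorem abs_moll_sub_le (hk : IsKernel k c R) (hf : LocallyIntegrable f) {x : Plane} {b ε : ℝ}
    (h : ∀ y ∈ closedBall c R, |f (a • x - y) - b| ≤ ε) : |moll k a f x - b| ≤ ε := by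
  have h1 : moll k a f x - b = ∫ y, (f (a • x - y) - b) * k y := by
    simp only [sub_mul]
    rw [integral_sub (hk.integrable_swap hf _) (hk.integrable.const_mul b), integral_const_mul,
      hk.integral_eq, mul_one, moll_eq_swap]
  rw [h1, ← Real.norm_eq_abs]
  have h2 : ∫ y, ε * k y = ε := by rw [integral_const_mul, hk.integral_eq, mul_one]
  rw [← h2]
  refine norm_integral_le_of_norm_le (hk.integrable.const_mul ε) (.of_forall fun y => ?_)
  by_cases hy : y ∈ closedBall c R
  · rw [norm_mul, Real.norm_eq_abs, Real.norm_of_nonneg (hk.nonneg y)]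
    exact mul_le_mul_of_nonneg_right (h y hy) (hk.nonneg y)
  · rw [hk.eq_zero hy]; simp

/-- The derivative falls on the kernel, and `t ↦ k (a • x - t)` is a test function in `D` because
`hx` keeps its support inside. The definition of the weak derivative moves it back onto `u`; the
factor `a` is the chain rule. -/
theorem dd_moll (hk : IsKernel k c R) {D : Set Plane} (hD : MeasurableSet D) {j : Fin 2}
    {u g : L2 D} (hu : HasWD D j u g) {x : Plane}
    (hx : ∀ y ∈ closedBall c R, a • x - y ∈ D) (hloc : LocallyIntegrable (D.indicator u))
     :
    dd j (moll k a (D.indicator u)) x = a * moll k a (D.indicator g) x := by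
  have hcs : HasCompactSupport (fderiv ℝ k) := hk.hasCompactSupport.fderiv (𝕜 := ℝ)
  have hk1 : ContDiff ℝ 1 k := hk.smooth.of_le (by exact_mod_cast le_top)
  have hd := hk.hasCompactSupport.hasFDerivAt_convolution_right (ContinuousLinearMap.lsmul ℝ ℝ)
    hloc hk1 (a • x)
  have hd2 : HasFDerivAt (fun y : Plane => a • y)
      (a • ContinuousLinearMap.id ℝ Plane) x := (hasFDerivAt_id x).const_smul a
  have hd3 := (hd.comp x hd2).fderiv
  have e1 : dd j (moll k a (D.indicator u)) x = a * convolution (D.indicator u)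
      (fun y => fderiv ℝ k y (EuclideanSpace.single j (1 : ℝ)))
      (ContinuousLinearMap.lsmul ℝ ℝ) volume (a • x) := by
    rw [← convolution_precompR_apply _ hloc hcs (hk1.continuous_fderiv (by simp))]
    change fderiv ℝ (convolution (D.indicator u) k (ContinuousLinearMap.lsmul ℝ ℝ) volume ∘
      fun y => a • y) x _ = _
    rw [hd3]
    simp
  set φ : Plane → ℝ := fun t => k (a • x - t) with hφ
  have hφs : ContDiff ℝ ∞ φ := hk.smooth.comp (contDiff_const.sub contDiff_id)
  have hφt : IsTestFunction D φ := by
    refine ⟨hφs, hk.hasCompactSupport.comp_homeomorph (Homeomorph.subLeft (a • x)), ?_⟩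
    have : tsupport φ = (Homeomorph.subLeft (a • x)) ⁻¹' tsupport k :=
      tsupport_comp_eq_preimage k (Homeomorph.subLeft (a • x))
    intro t ht
    rw [this] at ht
    have := hx _ (hk.tsupport_subset ht)
    simpa using this
  have hdφ : ∀ t, dd j φ t = -fderiv ℝ k (a • x - t) (EuclideanSpace.single j (1 : ℝ)) := by
    intro t
    have h1 : HasFDerivAt (fun t : Plane => a • x - t) (-ContinuousLinearMap.id ℝ Plane) t := by
      have := (hasFDerivAt_id (𝕜 := ℝ) t).const_sub (a • x)
      exact this
    have h2 := (hk1.differentiable (by simp) (a • x - t)).hasFDerivAt.comp t h1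
    change fderiv ℝ (k ∘ fun t => a • x - t) t _ = _
    rw [h2.fderiv]; simp
  have key := hu φ hφt
  rw [inner_toL2 _ ((hφt.smc.dd j).memLp D), inner_toL2 _ (hφt.smc.memLp D)] at key
  have ind : ∀ (v : Plane → ℝ) (ψ : Plane → ℝ),
      ∫ t, D.indicator v t * ψ t = ∫ t in D, v t * ψ t := fun v ψ => by
    rw [← integral_indicator hD]
    refine integral_congr_ae (.of_forall fun t => ?_)
    by_cases ht : t ∈ D <;> simp [ht]
  have e2 : convolution (D.indicator u)
      (fun y => fderiv ℝ k y (EuclideanSpace.single j (1 : ℝ)))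
      (ContinuousLinearMap.lsmul ℝ ℝ) volume (a • x) = -∫ t in D, u t * dd j φ t := by
    rw [← ind u, ← integral_neg]
    refine integral_congr_ae (.of_forall fun t => ?_)
    simp [hdφ]
  rw [e1, e2, key, neg_neg, moll_eq, ind]

theorem lintegral_comp_dilation (ha : a ≠ 0) (F : Plane → ENNReal) (hF : Measurable F)
    (y : Plane) : ∫⁻ x, F (a • x - y) = ENNReal.ofReal ((a ^ 2)⁻¹) * ∫⁻ x, F x := by
  have h1 : ∫⁻ x, F (a • x - y) = ∫⁻ x, F (x - y) ∂(Measure.map (fun x : Plane => a • x) volume) := by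
    rw [lintegral_map (f := fun x => F (x - y)) (hF.comp (measurable_id.sub_const y))
      (measurable_const_smul a)]
  rw [h1, Measure.map_addHaar_smul _ ha, lintegral_smul_measure, lintegral_sub_right_eq_self F y]
  simp [abs_of_nonneg (sq_nonneg a)]

/-- The kernel is a probability density, so Jensen's inequality bounds the squared average by the
average of the squares (here through monotonicity of `eLpNorm` in the exponent). Tonelli and the
dilation factor `a⁻²` finish. -/
theorem lintegral_moll_le (hk : IsKernel k c R) (ha : a ≠ 0) (hf : Measurable f) :
    ∫⁻ x, ‖moll k a f x‖ₑ ^ (2 : ℝ) ≤ ENNReal.ofReal ((a ^ 2)⁻¹) * ∫⁻ x, ‖f x‖ₑ ^ (2 : ℝ) := by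
  set w : Plane → ENNReal := fun y => ENNReal.ofReal (k y) with hw
  have hwm : Measurable w := hk.smooth.continuous.measurable.ennreal_ofReal
  set μ : Measure Plane := volume.withDensity w with hμ
  have hprob : IsProbabilityMeasure μ := ⟨by
    rw [hμ, withDensity_apply _ MeasurableSet.univ, Measure.restrict_univ,
      ← ofReal_integral_eq_lintegral_ofReal hk.integrable (.of_forall hk.nonneg), hk.integral_eq,
      ENNReal.ofReal_one]⟩
  have hg : ∀ x : Plane, Measurable fun y => f (a • x - y) := fun x =>
    hf.comp (measurable_const.sub measurable_id)
  have step : ∀ x, ‖moll k a f x‖ₑ ^ (2 : ℝ) ≤ ∫⁻ y, ‖f (a • x - y)‖ₑ ^ (2 : ℝ) ∂μ := by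
    intro x
    have h1 : ‖moll k a f x‖ₑ ≤ eLpNorm (fun y => f (a • x - y)) 1 μ := by
      rw [eLpNorm_one_eq_lintegral_enorm, moll_eq_swap, hμ,
        lintegral_withDensity_eq_lintegral_mul _ hwm (hg x).enorm]
      refine (enorm_integral_le_lintegral_enorm _).trans (le_of_eq ?_)
      refine lintegral_congr fun y => ?_
      rw [enorm_mul, Pi.mul_apply, mul_comm, hw, Real.enorm_of_nonneg (hk.nonneg y)]
    have h2 := h1.trans (eLpNorm_le_eLpNorm_of_exponent_le (q := 2) (by norm_num)
      (hg x).aestronglyMeasurable)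
    rw [eLpNorm_eq_lintegral_rpow_enorm_toReal (by norm_num) (by norm_num)] at h2
    have h3 := ENNReal.rpow_le_rpow h2 (z := 2) (by norm_num)
    rw [← ENNReal.rpow_mul] at h3
    simpa using h3
  have hjm : Measurable (fun p : Plane × Plane => ‖f (a • p.1 - p.2)‖ₑ ^ (2 : ℝ)) :=
    ((hf.comp ((measurable_fst.const_smul a).sub measurable_snd)).enorm).pow_const _
  calc ∫⁻ x, ‖moll k a f x‖ₑ ^ (2 : ℝ) ≤ ∫⁻ x, ∫⁻ y, ‖f (a • x - y)‖ₑ ^ (2 : ℝ) ∂μ :=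
        lintegral_mono step
    _ = ∫⁻ y, (∫⁻ x, ‖f (a • x - y)‖ₑ ^ (2 : ℝ)) ∂μ :=
        lintegral_lintegral_swap hjm.aemeasurable
    _ = ∫⁻ _, (ENNReal.ofReal ((a ^ 2)⁻¹) * ∫⁻ x, ‖f x‖ₑ ^ (2 : ℝ)) ∂μ :=
        lintegral_congr fun y =>
          lintegral_comp_dilation ha (fun x => ‖f x‖ₑ ^ (2 : ℝ)) (hf.enorm.pow_const _) y
    _ = _ := by rw [lintegral_const, measure_univ, mul_one]

theorem eLpNorm_moll_le (hk : IsKernel k c R) (ha : 1 / 2 ≤ a) (hf : Measurable f) :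
    eLpNorm (moll k a f) 2 volume ≤ 2 * eLpNorm f 2 volume := by
  have h := hk.lintegral_moll_le (by linarith : a ≠ 0) hf
  -- `a ≥ 1/2` gives `a⁻² ≤ 4`, whose square root is the factor 2.
  have h0 : ENNReal.ofReal ((a ^ 2)⁻¹) ≤ 2 ^ (2 : ℝ) := by
    rw [← ENNReal.ofReal_ofNat, ENNReal.ofReal_rpow_of_pos (by norm_num)]
    refine ENNReal.ofReal_le_ofReal ?_
    rw [inv_le_comm₀ (by positivity) (by positivity)]
    norm_num
    nlinarith
  rw [eLpNorm_eq_lintegral_rpow_enorm_toReal (by norm_num) (by norm_num),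
    eLpNorm_eq_lintegral_rpow_enorm_toReal (by norm_num) (by norm_num)]
  have h3 := ENNReal.rpow_le_rpow (h.trans (mul_le_mul_left h0 _)) (z := 1 / 2) (by norm_num)
  rw [ENNReal.mul_rpow_of_nonneg _ _ (by norm_num), ← ENNReal.rpow_mul] at h3
  simpa using h3

end IsKernel

theorem IsKernel.norm_le_of_mem {c y : Plane} {R : ℝ} (hy : y ∈ closedBall c R) :
    ‖y‖ ≤ ‖c‖ + R := by
  rw [mem_closedBall, dist_eq_norm] at hy
  calc ‖y‖ = ‖c + (y - c)‖ := by rw [add_sub_cancel]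
    _ ≤ ‖c‖ + ‖y - c‖ := norm_add_le _ _
    _ ≤ ‖c‖ + R := by gcongr

theorem tendsto_eLpNorm_moll_of_continuous {k : ℕ → Plane → ℝ} {c : ℕ → Plane} {R a : ℕ → ℝ}
    (hk : ∀ n, IsKernel (k n) (c n) (R n)) (hc : Tendsto c atTop (𝓝 0))
    (hR : Tendsto R atTop (𝓝 0)) (ha : Tendsto a atTop (𝓝 1)) {g : Plane → ℝ}
    (hg : Continuous g) (hgs : HasCompactSupport g) :
    Tendsto (fun n => eLpNorm (fun x => moll (k n) (a n) g x - g x) 2 volume) atTop (𝓝 0) := by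
  have hδ : Tendsto (fun n => ‖c n‖ + R n) atTop (𝓝 0) := by
    simpa using (hc.norm).add hR
  have hloc : LocallyIntegrable g volume := hg.locallyIntegrable
  obtain ⟨B, hB⟩ := hgs.exists_bound_of_continuous hg
  have hB0 : 0 ≤ B := (norm_nonneg _).trans (hB 0)
  obtain ⟨r, hr0, hr⟩ := hgs.isCompact.isBounded.subset_closedBall_lt 0 (0 : Plane)
  have hpt : ∀ x, Tendsto (fun n => moll (k n) (a n) g x) atTop (𝓝 (g x)) := by
    intro x
    rw [Metric.tendsto_atTop']
    intro ε hε
    obtain ⟨δ, hδ0, hδ'⟩ := Metric.continuous_iff.1 hg x (ε / 2) (by positivity)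
    have h1 : Tendsto (fun n => |a n - 1| * ‖x‖ + (‖c n‖ + R n)) atTop (𝓝 0) := by
      have : Tendsto (fun n => |a n - 1|) atTop (𝓝 0) := by
        simpa using (ha.sub_const 1).abs
      simpa using (this.mul_const ‖x‖).add hδ
    obtain ⟨N, hN⟩ := eventually_atTop.1 (h1.eventually_lt_const hδ0)
    refine ⟨N, fun n hn => ?_⟩
    rw [Real.dist_eq]
    refine ((hk n).abs_moll_sub_le hloc (ε := ε / 2) fun y hy => ?_).trans_lt (by linarith)
    rw [← Real.dist_eq]
    refine (hδ' _ ?_).le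
    rw [dist_eq_norm]
    calc ‖a n • x - y - x‖ = ‖(a n - 1) • x - y‖ := by rw [sub_smul, one_smul]; congr 1; abel
      _ ≤ ‖(a n - 1) • x‖ + ‖y‖ := norm_sub_le _ _
      _ ≤ |a n - 1| * ‖x‖ + (‖c n‖ + R n) := by
        rw [norm_smul, Real.norm_eq_abs]; gcongr; exact IsKernel.norm_le_of_mem hy
      _ < δ := hN n hn.le
  have hlim : Tendsto (fun n => ∫⁻ x, ‖moll (k n) (a n) g x - g x‖ₑ ^ (2 : ℝ)) atTop
      (𝓝 (∫⁻ _ : Plane, 0)) := by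
    -- The dominating function lives on the ball of radius `2 (r + 1)`: if `a n > 1/2` and the
    -- kernel sits in the unit ball, then `‖x‖ > 2 (r + 1)` forces `‖a n • x - y‖ > r`, beyond the
    -- support of `g`.
    refine tendsto_lintegral_filter_of_dominated_convergence
      ((closedBall (0 : Plane) (2 * (r + 1))).indicator
        fun _ => ENNReal.ofReal (2 * B) ^ (2 : ℝ)) ?_ ?_ ?_ ?_
    · exact .of_forall fun n =>
        ((((hk n).contDiff_moll hloc).continuous.sub hg).measurable.enorm.pow_const _)
    · filter_upwards [ha.eventually_const_lt (show (1 / 2 : ℝ) < 1 by norm_num),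
        hδ.eventually_lt_const one_pos] with n hn1 hn2
      refine .of_forall fun x => ?_
      by_cases hx : x ∈ closedBall (0 : Plane) (2 * (r + 1))
      · rw [indicator_of_mem hx]
        refine ENNReal.rpow_le_rpow ?_ (by norm_num)
        rw [Real.enorm_eq_ofReal_abs]
        refine ENNReal.ofReal_le_ofReal ((hk n).abs_moll_sub_le hloc fun y _ => ?_)
        have h1 := hB (a n • x - y)
        have h2 := hB x
        rw [Real.norm_eq_abs] at h1 h2
        exact (abs_sub _ _).trans (by linarith)
      · rw [mem_closedBall_zero_iff, not_le] at hx
        have hz : ∀ z : Plane, r < ‖z‖ → g z = 0 := fun z hz => by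
          refine image_eq_zero_of_notMem_tsupport fun h => ?_
          have := hr h
          rw [mem_closedBall_zero_iff] at this
          linarith
        have hgx : g x = 0 := hz x (by linarith)
        have := (hk n).abs_moll_sub_le hloc (a := a n) (x := x) (b := 0) (ε := 0) fun y hy => by
          have h3 := IsKernel.norm_le_of_mem hy
          have h4 : ‖a n • x‖ = a n * ‖x‖ := by
            rw [norm_smul, Real.norm_of_nonneg (by linarith)]
          have h5 : ‖a n • x‖ - ‖y‖ ≤ ‖a n • x - y‖ := norm_sub_norm_le _ _
          rw [hz _ (by nlinarith [norm_nonneg x])]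
          simp
        have h0 : moll (k n) (a n) g x = 0 := by simpa using this
        rw [h0, hgx]; simp
    · rw [lintegral_indicator measurableSet_closedBall, setLIntegral_const]
      exact ENNReal.mul_ne_top (ENNReal.rpow_ne_top_of_nonneg (by norm_num) ENNReal.ofReal_ne_top)
        measure_closedBall_lt_top.ne
    · refine .of_forall fun x => ?_
      have h1 : Tendsto (fun n => ‖moll (k n) (a n) g x - g x‖ₑ) atTop (𝓝 0) := by
        simpa using ((hpt x).sub_const (g x)).enorm
      have h2 := ((ENNReal.continuous_rpow_const (y := 2)).tendsto 0).comp h1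
      simpa [Function.comp_def] using h2
  rw [lintegral_zero] at hlim
  have h2 := ((ENNReal.continuous_rpow_const (y := 1 / 2)).tendsto 0).comp hlim
  refine (h2.congr fun n => ?_).trans (by simp)
  rw [eLpNorm_eq_lintegral_rpow_enorm_toReal (by norm_num) (by norm_num)]
  simp

/-- Density of continuous functions with compact support, combined with the bound 2 for the
operators, uniform once `a n > 1/2`. The four quarters of `ε` are two from `moll (f - g)`, one from
`f - g` and one from the continuous case. -/
theorem tendsto_eLpNorm_moll {k : ℕ → Plane → ℝ} {c : ℕ → Plane} {R a : ℕ → ℝ}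
    (hk : ∀ n, IsKernel (k n) (c n) (R n)) (hc : Tendsto c atTop (𝓝 0))
    (hR : Tendsto R atTop (𝓝 0)) (ha : Tendsto a atTop (𝓝 1)) {f : Plane → ℝ}
    (hf : Measurable f) (hf2 : MemLp f 2 volume) :
    Tendsto (fun n => eLpNorm (fun x => moll (k n) (a n) f x - f x) 2 volume) atTop (𝓝 0) := by
  have hlf : LocallyIntegrable f volume := hf2.locallyIntegrable (by norm_num)
  rw [ENNReal.tendsto_nhds_zero]
  intro ε hε
  obtain ⟨g, hgs, hfg, hg, hg2⟩ := hf2.exists_hasCompactSupport_eLpNorm_sub_le (by norm_num)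
    (ε := ε / 4) (by simp [hε.ne'])
  have hlg : LocallyIntegrable g volume := hg.locallyIntegrable
  have h1 := tendsto_eLpNorm_moll_of_continuous hk hc hR ha hg hgs
  rw [ENNReal.tendsto_nhds_zero] at h1
  filter_upwards [h1 (ε / 4) (ENNReal.div_pos hε.ne' (by norm_num)),
    ha.eventually_const_lt (show (1 / 2 : ℝ) < 1 by norm_num)] with n hn1 hn2
  have hm : ∀ {v : Plane → ℝ}, LocallyIntegrable v volume →
      AEStronglyMeasurable (moll (k n) (a n) v) volume := fun hv =>
    ((hk n).contDiff_moll hv).continuous.aestronglyMeasurable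
  have e : (fun x => moll (k n) (a n) f x - f x) = fun x =>
      (moll (k n) (a n) (f - g) x - (f - g) x) + (moll (k n) (a n) g x - g x) := by
    funext x
    have : moll (k n) (a n) (f - g) x = moll (k n) (a n) f x - moll (k n) (a n) g x := by
      rw [IsKernel.moll_eq_swap, IsKernel.moll_eq_swap, IsKernel.moll_eq_swap,
        ← integral_sub ((hk n).integrable_swap hlf _) ((hk n).integrable_swap hlg _)]
      simp only [Pi.sub_apply, sub_mul]
    rw [this, Pi.sub_apply]; ring
  have hmfg := hm (hlf.sub hlg)
  rw [e]
  calc eLpNorm (fun x => (moll (k n) (a n) (f - g) x - (f - g) x) +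
          (moll (k n) (a n) g x - g x)) 2 volume
      ≤ eLpNorm (fun x => moll (k n) (a n) (f - g) x - (f - g) x) 2 volume +
        eLpNorm (fun x => moll (k n) (a n) g x - g x) 2 volume :=
      eLpNorm_add_le (hmfg.sub (hf2.1.sub hg2.1)) ((hm hlg).sub hg2.1) (by norm_num)
    _ ≤ (eLpNorm (moll (k n) (a n) (f - g)) 2 volume + eLpNorm (f - g) 2 volume) + ε / 4 := by
      gcongr
      exact eLpNorm_sub_le hmfg (hf2.1.sub hg2.1) (by norm_num)
    _ ≤ (2 * eLpNorm (f - g) 2 volume + eLpNorm (f - g) 2 volume) + ε / 4 := by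
      gcongr
      exact (hk n).eLpNorm_moll_le hn2.le (hf.sub hg.measurable)
    _ ≤ (2 * (ε / 4) + ε / 4) + ε / 4 := by gcongr
    _ = 4 * (ε / 4) := by ring
    _ = ε := ENNReal.mul_div_cancel (by norm_num) (by norm_num)

theorem memLp_of_continuous {D : Set Plane} (hb : Bornology.IsBounded D) {f : Plane → ℝ}
    (hf : Continuous f) : MemLp f 2 (volume.restrict D) := by
  obtain ⟨B, hB⟩ := (hb.isCompact_closure).exists_bound_of_continuousOn hf.continuousOn
  have : IsFiniteMeasure (volume.restrict (closure D)) :=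
    ⟨by simpa using hb.isCompact_closure.measure_lt_top⟩
  refine MemLp.restrict_mono subset_closure (MemLp.of_bound hf.aestronglyMeasurable B ?_)
  exact (ae_restrict_iff' isClosed_closure.measurableSet).2 (.of_forall hB)

theorem measurable_indicator_L2 {D : Set Plane} (hD : MeasurableSet D) (u : L2 D) :
    Measurable (D.indicator u) := (Lp.stronglyMeasurable u).measurable.indicator hD

theorem memLp_indicator_L2 {D : Set Plane} (hD : MeasurableSet D) (u : L2 D) :
    MemLp (D.indicator u) 2 volume := (memLp_indicator_iff_restrict hD).2 (Lp.memLp u)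

/-- Density of smooth functions on bounded convex open sets, realised by one sequence of linear
regularisations for all orders of differentiation. -/
theorem exists_mollifier {D : Set Plane} (hD : IsOpen D) (hconv : Convex ℝ D)
    (hb : Bornology.IsBounded D) (hne : D.Nonempty) :
    ∃ (M : ℕ → L2 D → Plane → ℝ) (a : ℕ → ℝ), Tendsto a atTop (𝓝 1) ∧
      (∀ n u, Smc (M n u)) ∧
      (∀ n j u g, HasWD D j u g → ∀ x ∈ D, dd j (M n u) x = a n * M n g x) ∧
      (∀ u, Tendsto (fun n => toL2 D (M n u)) atTop (𝓝 u)) ∧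
      ∀ (f : Plane → ℝ) (K : NNReal), LipschitzWith K f → ∃ δ : ℕ → ℝ, Tendsto δ atTop (𝓝 0) ∧
        ∀ n, ∀ x ∈ closure D, |M n (toL2 D f) x - f x| ≤ δ n := by
  obtain ⟨x₀, hx₀⟩ := hne
  obtain ⟨r, hr0, hr⟩ := Metric.nhds_basis_closedBall.mem_iff.1 (hD.mem_nhds hx₀)
  obtain ⟨ρ, hρ⟩ := hb.closure.exists_norm_le
  -- The shift by two keeps `ε n < 1` already for `n = 0`, so that the dilation factor `1 - ε n` is
  -- positive.
  set ε : ℕ → ℝ := fun n => 1 / ((n : ℝ) + 1 + 1) with hεd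
  have hε0 : ∀ n, 0 < ε n := fun n => by positivity
  have hε1 : ∀ n, ε n < 1 := fun n => by
    rw [hεd]; simp only; rw [div_lt_one (by positivity)]; linarith [n.cast_nonneg (α := ℝ)]
  have hεt : Tendsto ε atTop (𝓝 0) := by
    have := (tendsto_add_atTop_iff_nat 1).2 (tendsto_one_div_add_atTop_nhds_zero_nat (𝕜 := ℝ))
    simpa [hεd] using this
  -- The kernels are centred at `-ε x₀` and not at the origin: then `-y / ε` lies in the ball around
  -- `x₀` for every `y` in the support, and `(1 - ε) x - y` is a convex combination of a point of
  -- the closure and an interior point. No values outside `D` enter, even for `x` on the boundary.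
  choose k hk using fun n => exists_isKernel (-(ε n • x₀)) (mul_pos (hε0 n) hr0)
  have ha : Tendsto (fun n => 1 - ε n) atTop (𝓝 1) := by simpa using hεt.const_sub 1
  have hc : Tendsto (fun n => -(ε n • x₀)) atTop (𝓝 0) := by
    simpa using (hεt.smul_const x₀).neg
  have hR : Tendsto (fun n => ε n * r) atTop (𝓝 0) := by simpa using hεt.mul_const r
  have hmem : ∀ n, ∀ x ∈ closure D, ∀ y ∈ closedBall (-(ε n • x₀)) (ε n * r),
      (1 - ε n) • x - y ∈ D := by
    intro n x hx y hy
    have hz : -((ε n)⁻¹ • y) ∈ D := hr (by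
      rw [mem_closedBall, dist_eq_norm] at hy ⊢
      have : -((ε n)⁻¹ • y) - x₀ = -((ε n)⁻¹ • (y - -(ε n • x₀))) := by
        rw [smul_sub, smul_neg, smul_smul, inv_mul_cancel₀ (hε0 n).ne', one_smul]; abel
      rw [this, norm_neg, norm_smul, norm_inv, Real.norm_of_nonneg (hε0 n).le,
        inv_mul_le_iff₀ (hε0 n)]
      exact hy)
    have h1 := hconv.combo_closure_interior_mem_interior hx (hD.interior_eq.symm ▸ hz)
      (a := 1 - ε n) (b := ε n) (by linarith [hε1 n]) (hε0 n) (by ring)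
    rw [hD.interior_eq, smul_neg, smul_smul, mul_inv_cancel₀ (hε0 n).ne', one_smul] at h1
    simpa [sub_eq_add_neg] using h1
  have hloc : ∀ u : L2 D, LocallyIntegrable (D.indicator u) volume := fun u =>
    (memLp_indicator_L2 hD.measurableSet u).locallyIntegrable (by norm_num)
  refine ⟨fun n u => moll (k n) (1 - ε n) (D.indicator u), fun n => 1 - ε n, ha,
    fun n u => ⟨(hk n).contDiff_moll (hloc u), ?_⟩, fun n j u g hw x hx => ?_, fun u => ?_, ?_⟩
  · refine (hk n).hasCompactSupport_moll (by linarith [hε1 n]) ?_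
    exact HasCompactSupport.of_support_subset_isCompact hb.isCompact_closure
      ((support_indicator_subset).trans subset_closure)
  · exact (hk n).dd_moll hD.measurableSet hw (hmem n x (subset_closure hx)) (hloc u)
  · have h := tendsto_eLpNorm_moll hk hc hR ha (measurable_indicator_L2 hD.measurableSet u)
      (memLp_indicator_L2 hD.measurableSet u)
    rw [Lp.tendsto_Lp_iff_tendsto_eLpNorm']
    refine tendsto_of_tendsto_of_tendsto_of_le_of_le tendsto_const_nhds h (fun _ => zero_le)
      fun n => ?_
    refine le_trans (le_of_eq (eLpNorm_congr_ae ?_))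
      (eLpNorm_mono_measure _ (Measure.restrict_le_self (s := D)))
    have hs : Smc (moll (k n) (1 - ε n) (D.indicator u)) := ⟨(hk n).contDiff_moll (hloc u),
      (hk n).hasCompactSupport_moll (by linarith [hε1 n])
        (HasCompactSupport.of_support_subset_isCompact hb.isCompact_closure
          ((support_indicator_subset).trans subset_closure))⟩
    filter_upwards [coeFn_toL2 (hs.memLp D), ae_restrict_mem hD.measurableSet] with x h1 h2
    rw [Pi.sub_apply, h1, indicator_of_mem h2]
  · intro f K hf
    refine ⟨fun n => K * (ε n * ρ + (‖-(ε n • x₀)‖ + ε n * r)), ?_, fun n x hx => ?_⟩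
    · simpa using ((hεt.mul_const ρ).add (hc.norm.add hR)).const_mul (K : ℝ)
    · have hfm := memLp_of_continuous hb hf.continuous
      have hli : LocallyIntegrable (D.indicator f) volume :=
        ((memLp_indicator_iff_restrict hD.measurableSet).2 hfm).locallyIntegrable (by norm_num)
      have e : moll (k n) (1 - ε n) (D.indicator (toL2 D f)) x =
          moll (k n) (1 - ε n) (D.indicator f) x := by
        rw [IsKernel.moll_eq, IsKernel.moll_eq]
        refine integral_congr_ae ?_
        filter_upwards [(ae_restrict_iff' hD.measurableSet).1 (coeFn_toL2 hfm)] with t ht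
        by_cases h : t ∈ D
        · rw [indicator_of_mem h, indicator_of_mem h, ht h]
        · rw [indicator_of_notMem h, indicator_of_notMem h]
      beta_reduce
      rw [e]
      refine (hk n).abs_moll_sub_le hli fun y hy => ?_
      rw [indicator_of_mem (hmem n x hx y hy), ← Real.dist_eq]
      refine (hf.dist_le_mul _ _).trans (mul_le_mul_of_nonneg_left ?_ K.2)
      rw [dist_eq_norm]
      calc ‖(1 - ε n) • x - y - x‖ = ‖(-ε n) • x - y‖ := by
            rw [sub_smul, one_smul, neg_smul]; congr 1; abel
        _ ≤ ‖(-ε n) • x‖ + ‖y‖ := norm_sub_le _ _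
        _ ≤ ε n * ρ + (‖-(ε n • x₀)‖ + ε n * r) := by
          rw [norm_smul, norm_neg, Real.norm_of_nonneg (hε0 n).le]
          have := IsKernel.norm_le_of_mem hy
          have := hρ x hx
          gcongr

/-- Density of smooth functions in the Sobolev spaces of bounded convex open sets. -/
theorem exists_smoothing {D : Set Plane} (hD : IsOpen D) (hconv : Convex ℝ D)
    (hb : Bornology.IsBounded D) (hne : D.Nonempty) :
    ∃ M : ℕ → L2 D → Plane → ℝ, (∀ n u, Smc (M n u)) ∧
      (∀ u, Tendsto (fun n => toL2 D (M n u)) atTop (𝓝 u)) ∧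
      (∀ j u g, HasWD D j u g → Tendsto (fun n => toL2 D (dd j (M n u))) atTop (𝓝 g)) ∧
      (∀ j k u g g', HasWD D j u g → HasWD D k g g' →
        Tendsto (fun n => toL2 D (dd k (dd j (M n u)))) atTop (𝓝 g')) ∧
      (∀ j k l u g g' g'', HasWD D j u g → HasWD D k g g' → HasWD D l g' g'' →
        Tendsto (fun n => toL2 D (dd l (dd k (dd j (M n u))))) atTop (𝓝 g'')) ∧
      ∀ (f : Plane → ℝ) (K : NNReal), LipschitzWith K f → ∃ δ : ℕ → ℝ, Tendsto δ atTop (𝓝 0) ∧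
        ∀ n, ∀ x ∈ closure D, |M n (toL2 D f) x - f x| ≤ δ n := by
  obtain ⟨M, a, ha, hs, hd, ht, hl⟩ := exists_mollifier hD hconv hb hne
  -- The form "`b n` times the regularisation of a fixed `g`, with `b n → 1`" is preserved by
  -- differentiation, with `b n` replaced by `b n * a n`. Iterating it gives all orders.
  have step : ∀ (ψ : ℕ → Plane → ℝ) (b : ℕ → ℝ) (g : L2 D), Tendsto b atTop (𝓝 1) →
      (∀ n, EqOn (ψ n) (fun x => b n * M n g x) D) →
      Tendsto (fun n => toL2 D (ψ n)) atTop (𝓝 g) ∧ ∀ k g', HasWD D k g g' →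
        ∀ n, EqOn (dd k (ψ n)) (fun x => (b n * a n) * M n g' x) D := by
    intro ψ b g hb hψ
    constructor
    · have := hb.smul (ht g)
      rw [one_smul] at this
      refine this.congr fun n => ?_
      rw [toL2_congr hD.measurableSet (hψ n), toL2_const_mul ((hs n g).memLp D)]
    · intro k g' hk n x hx
      rw [dd_congr_of_isOpen hD (hψ n) k hx, dd_const_mul ((hs n g).differentiable x),
        hd n k g g' hk x hx]
      ring
  have hone : Tendsto (fun _ : ℕ => (1 : ℝ)) atTop (𝓝 1) := tendsto_const_nhds
  have h0 := fun u : L2 D => step (fun n => M n u) (fun _ => 1) u hone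
    (fun n x _ => (one_mul _).symm)
  have h1 := fun j (u g : L2 D) hg => step (fun n => dd j (M n u)) (fun n => 1 * a n) g
    (by simpa using ha) ((h0 u).2 j g hg)
  have h2 := fun j k (u g g' : L2 D) hg hg' => step (fun n => dd k (dd j (M n u)))
    (fun n => 1 * a n * a n) g' (by simpa using ha.mul ha) ((h1 j u g hg).2 k g' hg')
  have h3 := fun j k l (u g g' g'' : L2 D) hg hg' hg'' =>
    step (fun n => dd l (dd k (dd j (M n u)))) (fun n => 1 * a n * a n * a n) g''
      (by simpa using (ha.mul ha).mul ha) ((h2 j k u g g' hg hg').2 l g'' hg'')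
  exact ⟨M, hs, ht, fun j u g hg => (h1 j u g hg).1,
    fun j k u g g' hg hg' => (h2 j k u g g' hg hg').1,
    fun j k l u g g' g'' hg hg' hg'' => (h3 j k l u g g' g'' hg hg' hg'').1, hl⟩

end

section

open Filter Metric Topology

/-! ### Estimates for smooth functions on bounded convex sets -/

section segment

variable {f : Plane → ℝ}

/-- The sum of the absolute values of the first partial derivatives. -/
noncomputable def absD1 (f : Plane → ℝ) (x : Plane) : ℝ := ∑ j, |dd j f x|

/-- The sum of the absolute values of the second partial derivatives. -/
noncomputable def absD2 (f : Plane → ℝ) (x : Plane) : ℝ := ∑ j, ∑ k, |dd k (dd j f) x|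

theorem Smc.continuous_absD1 (hf : Smc f) : Continuous (absD1 f) :=
  continuous_finsetSum _ fun j _ => (hf.dd j).continuous.abs

theorem Smc.continuous_absD2 (hf : Smc f) : Continuous (absD2 f) :=
  continuous_finsetSum _ fun j _ => continuous_finsetSum _ fun k _ =>
    ((hf.dd j).dd k).continuous.abs

theorem absD1_nonneg (x : Plane) : 0 ≤ absD1 f x := Finset.sum_nonneg fun _ _ => abs_nonneg _

theorem absD2_nonneg (x : Plane) : 0 ≤ absD2 f x :=
  Finset.sum_nonneg fun _ _ => Finset.sum_nonneg fun _ _ => abs_nonneg _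

theorem absD1_sq_le (x : Plane) : absD1 f x ^ 2 ≤ 2 * ∑ j, dd j f x ^ 2 := by
  simp only [absD1, Fin.sum_univ_two]
  nlinarith [sq_nonneg (|dd 0 f x| - |dd 1 f x|), sq_abs (dd 0 f x), sq_abs (dd 1 f x)]

theorem absD2_sq_le (x : Plane) : absD2 f x ^ 2 ≤ 4 * ∑ j, ∑ k, dd k (dd j f) x ^ 2 := by
  simp only [absD2, Fin.sum_univ_two]
  rw [← sq_abs (dd 0 (dd 0 f) x), ← sq_abs (dd 0 (dd 1 f) x), ← sq_abs (dd 1 (dd 0 f) x),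
    ← sq_abs (dd 1 (dd 1 f) x)]
  generalize |dd 0 (dd 0 f) x| = a
  generalize |dd 0 (dd 1 f) x| = b
  generalize |dd 1 (dd 0 f) x| = c
  generalize |dd 1 (dd 1 f) x| = e
  nlinarith [sq_nonneg (a - b), sq_nonneg (a - c), sq_nonneg (a - e), sq_nonneg (b - c),
    sq_nonneg (b - e), sq_nonneg (c - e)]

theorem plane_abs_apply_le (w : Plane) (j : Fin 2) : |w j| ≤ ‖w‖ := by
  simpa using PiLp.norm_apply_le w j

theorem Smc.hasDerivAt_line (hf : Smc f) (z w : Plane) (s : ℝ) :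
    HasDerivAt (fun s : ℝ => f (z + s • w)) (∑ j, w j * dd j f (z + s • w)) s := by
  have h1 : HasDerivAt (fun s : ℝ => z + s • w) w s := by
    simpa using ((hasDerivAt_id s).smul_const w).const_add z
  have h2 := (hf.differentiable (z + s • w)).hasFDerivAt.comp_hasDerivAt s h1
  rwa [fderiv_eq_sum_dd] at h2

theorem Smc.hasDerivAt_line_two (hf : Smc f) (z w : Plane) (s : ℝ) :
    HasDerivAt (fun s : ℝ => ∑ j, w j * dd j f (z + s • w))
      (∑ j, ∑ k, w j * w k * dd k (dd j f) (z + s • w)) s := by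
  have := HasDerivAt.fun_sum (u := Finset.univ) fun j _ =>
    ((hf.dd j).hasDerivAt_line z w s).const_mul (w j)
  refine this.congr_deriv (Finset.sum_congr rfl fun j _ => ?_)
  rw [Finset.mul_sum]
  exact Finset.sum_congr rfl fun k _ => by ring

theorem continuous_line (z w : Plane) : Continuous fun s : ℝ => z + s • w := by fun_prop

theorem abs_first_le (w x : Plane) : |∑ j, w j * dd j f x| ≤ ‖w‖ * absD1 f x := by
  rw [absD1, Finset.mul_sum]
  refine (Finset.abs_sum_le_sum_abs _ _).trans (Finset.sum_le_sum fun j _ => ?_)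
  rw [abs_mul]
  gcongr
  exact plane_abs_apply_le w j

theorem abs_second_le (w x : Plane) :
    |∑ j, ∑ k, w j * w k * dd k (dd j f) x| ≤ ‖w‖ ^ 2 * absD2 f x := by
  rw [absD2, Finset.mul_sum]
  refine (Finset.abs_sum_le_sum_abs _ _).trans (Finset.sum_le_sum fun j _ => ?_)
  rw [Finset.mul_sum]
  refine (Finset.abs_sum_le_sum_abs _ _).trans (Finset.sum_le_sum fun k _ => ?_)
  rw [abs_mul, abs_mul, pow_two]
  gcongr <;> exact plane_abs_apply_le w _

theorem abs_intervalIntegral_le_of_abs_le {F G : ℝ → ℝ} (hG : Continuous G)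
    (h : ∀ s ∈ Ioc (0 : ℝ) 1, |F s| ≤ G s) : |∫ s in (0 : ℝ)..1, F s| ≤ ∫ s in (0 : ℝ)..1, G s := by
  rw [← Real.norm_eq_abs]
  exact intervalIntegral.norm_integral_le_of_norm_le zero_le_one (.of_forall h)
    (hG.intervalIntegrable _ _)

theorem Smc.abs_sub_le (hf : Smc f) (z w : Plane) :
    |f (z + w) - f z| ≤ ‖w‖ * ∫ s in (0 : ℝ)..1, absD1 f (z + s • w) := by
  have hc : Continuous fun s : ℝ => ∑ j, w j * dd j f (z + s • w) :=
    continuous_finsetSum _ fun j _ => ((hf.dd j).continuous.comp (continuous_line z w)).const_mul _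
  have h := intervalIntegral.integral_eq_sub_of_hasDerivAt (a := 0) (b := 1)
    (fun s _ => hf.hasDerivAt_line z w s) (hc.intervalIntegrable _ _)
  simp only [one_smul, zero_smul, add_zero] at h
  rw [← h, ← intervalIntegral.integral_const_mul]
  exact abs_intervalIntegral_le_of_abs_le
    ((hf.continuous_absD1.comp (continuous_line z w)).const_mul _) fun s _ => abs_first_le w _

theorem Smc.continuous_second (hf : Smc f) (z w : Plane) :
    Continuous fun s : ℝ => ∑ j, ∑ k, w j * w k * dd k (dd j f) (z + s • w) :=
  continuous_finsetSum _ fun j _ => continuous_finsetSum _ fun k _ =>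
    (((hf.dd j).dd k).continuous.comp (continuous_line z w)).const_mul _

theorem Smc.abs_taylor_zero_le (hf : Smc f) (z w : Plane) :
    |f (z + w) - f z - ∑ j, w j * dd j f z| ≤
      ‖w‖ ^ 2 * ∫ s in (0 : ℝ)..1, absD2 f (z + s • w) := by
  have hd : ∀ s : ℝ, HasDerivAt
      (fun s : ℝ => (1 - s) * (∑ j, w j * dd j f (z + s • w)) + f (z + s • w))
      ((1 - s) * ∑ j, ∑ k, w j * w k * dd k (dd j f) (z + s • w)) s := fun s => by
    have h1 : HasDerivAt (fun s : ℝ => 1 - s) (-1) s := by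
      simpa using (hasDerivAt_id s).const_sub 1
    have := (h1.fun_mul (hf.hasDerivAt_line_two z w s)).fun_add (hf.hasDerivAt_line z w s)
    exact this.congr_deriv (by ring)
  have h := intervalIntegral.integral_eq_sub_of_hasDerivAt (a := 0) (b := 1)
    (fun s _ => hd s) ((Continuous.mul (by fun_prop) (hf.continuous_second z w)).intervalIntegrable _ _)
  simp only [one_smul, zero_smul, add_zero, sub_self, zero_mul, zero_add, sub_zero, one_mul] at h
  rw [show f (z + w) - f z - ∑ j, w j * dd j f z = f (z + w) - (∑ j, w j * dd j f z + f z) by ring,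
    ← h, ← intervalIntegral.integral_const_mul]
  refine abs_intervalIntegral_le_of_abs_le
    ((hf.continuous_absD2.comp (continuous_line z w)).const_mul _) fun s hs => ?_
  rw [abs_mul, abs_of_nonneg (by linarith [hs.2])]
  refine le_trans ?_ (abs_second_le w _)
  exact mul_le_of_le_one_left (abs_nonneg _) (by linarith [hs.1])

/-- The expansion is around the far end `z + w` and evaluated at `z`. The weight `s` must be kept:
averaging over `z + w` will produce homotheties of ratio `s`, whose Jacobian costs exactly one
factor `s⁻¹` in `L²`. -/
theorem Smc.abs_taylor_one_le (hf : Smc f) (z w : Plane) :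
    |f z - (f (z + w) - ∑ j, w j * dd j f (z + w))| ≤
      ‖w‖ ^ 2 * ∫ s in (0 : ℝ)..1, s * absD2 f (z + s • w) := by
  have hd : ∀ s : ℝ, HasDerivAt
      (fun s : ℝ => s * (∑ j, w j * dd j f (z + s • w)) - f (z + s • w))
      (s * ∑ j, ∑ k, w j * w k * dd k (dd j f) (z + s • w)) s := fun s => by
    have := ((hasDerivAt_id' s).fun_mul (hf.hasDerivAt_line_two z w s)).fun_sub
      (hf.hasDerivAt_line z w s)
    exact this.congr_deriv (by ring)
  have h := intervalIntegral.integral_eq_sub_of_hasDerivAt (a := 0) (b := 1)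
    (fun s _ => hd s) ((continuous_id.mul (hf.continuous_second z w)).intervalIntegrable _ _)
  simp only [one_smul, zero_smul, add_zero, zero_mul, one_mul] at h
  rw [show f z - (f (z + w) - ∑ j, w j * dd j f (z + w)) =
      ∑ j, w j * dd j f (z + w) - f (z + w) - (0 - f z) by ring,
    ← h, ← intervalIntegral.integral_const_mul]
  refine abs_intervalIntegral_le_of_abs_le
    ((continuous_id.mul (hf.continuous_absD2.comp (continuous_line z w))).const_mul _) fun s hs => ?_
  rw [abs_mul, abs_of_nonneg hs.1.le]
  have := mul_le_mul_of_nonneg_left (abs_second_le (f := f) w (z + s • w)) hs.1.le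
  beta_reduce
  linarith

/-- The variance `∫ (F - I)²` is nonnegative. -/
theorem sq_intervalIntegral_le {F : ℝ → ℝ} (hF : Continuous F) :
    (∫ s in (0 : ℝ)..1, F s) ^ 2 ≤ ∫ s in (0 : ℝ)..1, F s ^ 2 := by
  set I := ∫ s in (0 : ℝ)..1, F s with hI
  have h : 0 ≤ ∫ s in (0 : ℝ)..1, (F s - I) ^ 2 :=
    intervalIntegral.integral_nonneg zero_le_one fun _ _ => sq_nonneg _
  have e : ∫ s in (0 : ℝ)..1, (F s - I) ^ 2 =
      (∫ s in (0 : ℝ)..1, F s ^ 2) - 2 * I * I + I ^ 2 := by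
    have : ∀ s, (F s - I) ^ 2 = F s ^ 2 - 2 * I * F s + I ^ 2 := fun s => by ring
    simp only [this]
    rw [intervalIntegral.integral_add (Continuous.intervalIntegrable (by fun_prop) _ _)
      (by simp), intervalIntegral.integral_sub (Continuous.intervalIntegrable (by fun_prop) _ _)
      (Continuous.intervalIntegrable (by fun_prop) _ _), intervalIntegral.integral_const_mul,
      ← hI]
    simp
  rw [e] at h
  nlinarith

end segment

theorem integrableOn_of_continuous {D : Set Plane} (hb : Bornology.IsBounded D) {F : Plane → ℝ}
    (hF : Continuous F) : IntegrableOn F D :=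
  (hF.continuousOn.integrableOn_compact hb.isCompact_closure).mono_set subset_closure

theorem integrable_prod_of_continuous {D : Set Plane} (hb : Bornology.IsBounded D)
    {F : Plane × ℝ → ℝ} (hF : Continuous F) :
    Integrable F ((volume.restrict D).prod (volume.restrict (Ioc (0 : ℝ) 1))) := by
  rw [Measure.prod_restrict]
  exact (hF.continuousOn.integrableOn_compact (hb.isCompact_closure.prod isCompact_Icc)).mono_set
    (prod_mono subset_closure Ioc_subset_Icc_self)

theorem integrable_prod_plane_of_continuous {D : Set Plane} (hb : Bornology.IsBounded D)
    {F : Plane × Plane → ℝ} (hF : Continuous F) :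
    Integrable F ((volume.restrict D).prod (volume.restrict D)) := by
  rw [Measure.prod_restrict]
  exact (hF.continuousOn.integrableOn_compact
    (hb.isCompact_closure.prod hb.isCompact_closure)).mono_set
    (prod_mono subset_closure subset_closure)

section convexSet

variable {D : Set Plane} (hD : IsOpen D) (hconv : Convex ℝ D) (hb : Bornology.IsBounded D)
include hD hconv hb

/-- A homothety with centre in the closure maps the convex set `D` into itself; the change of
variables costs `σ⁻²`. -/
theorem setIntegral_homothety_le {F : Plane → ℝ} (hF : Continuous F) (hF0 : ∀ x, 0 ≤ F x)
    {y : Plane} (hy : y ∈ closure D) {σ : ℝ} (h0 : 0 < σ) (h1 : σ ≤ 1) :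
    ∫ z in D, F (y + σ • (z - y)) ≤ (σ ^ 2)⁻¹ * ∫ z in D, F z := by
  have hm : ∀ z ∈ D, y + σ • (z - y) ∈ D := fun z hz => by
    have := hconv.combo_closure_interior_mem_interior hy (hD.interior_eq.symm ▸ hz)
      (a := 1 - σ) (b := σ) (by linarith) h0 (by ring)
    rw [hD.interior_eq] at this
    convert this using 1
    rw [smul_sub, sub_smul, one_smul]; abel
  have hi : Integrable (D.indicator F) volume :=
    (integrable_indicator_iff hD.measurableSet).2 (integrableOn_of_continuous hb hF)
  have e : ∫ z, D.indicator F (y + σ • (z - y)) = (σ ^ 2)⁻¹ * ∫ z in D, F z := by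
    have h2 : ∀ z, y + σ • (z - y) = σ • z + (1 - σ) • y := fun z => by
      rw [smul_sub, sub_smul, one_smul]; abel
    simp only [h2]
    rw [Measure.integral_comp_smul volume (fun x => D.indicator F (x + (1 - σ) • y)) σ,
      integral_add_right_eq_self, integral_indicator hD.measurableSet]
    simp
  rw [← e, ← integral_indicator hD.measurableSet]
  have hi2 : Integrable (fun z => D.indicator F (y + σ • (z - y))) volume := by
    have := ((hi.comp_add_right ((1 - σ) • y)).comp_smul h0.ne')
    refine this.congr (.of_forall fun z => ?_)
    beta_reduce
    congr 1
    module
  refine integral_mono_of_nonneg (.of_forall fun z => indicator_nonneg (fun _ _ => hF0 _) _) hi2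
    (.of_forall fun z => ?_)
  by_cases hz : z ∈ D
  · simp only [indicator_of_mem hz, indicator_of_mem (hm z hz)]; exact le_rfl
  · simp only [indicator_of_notMem hz]; exact indicator_nonneg (fun _ _ => hF0 _) _

/-- For fixed `s` the map `z ↦ z + s τ (y - z)` is a homothety of ratio `1 - s τ ≥ 1/2`, so its
Jacobian factor is at most 4. Moving at most halfway to `y` avoids the singularity at `y`. -/
theorem setIntegral_segment_le {F : Plane → ℝ} (hF : Continuous F) (hF0 : ∀ x, 0 ≤ F x)
    {y : Plane} (hy : y ∈ closure D) {τ : ℝ} (h0 : 0 ≤ τ) (h1 : τ ≤ 1 / 2) :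
    ∫ z in D, (∫ s in (0 : ℝ)..1, F (z + s • τ • (y - z))) ≤ 4 * ∫ z in D, F z := by
  simp only [intervalIntegral.integral_of_le zero_le_one]
  rw [integral_integral_swap (integrable_prod_of_continuous hb (F := fun p =>
    F (p.1 + p.2 • τ • (y - p.1))) (by fun_prop))]
  have hs : ∀ s ∈ Ioc (0 : ℝ) 1, ∫ z in D, F (z + s • τ • (y - z)) ≤ 4 * ∫ z in D, F z := by
    intro s hs
    have h2 : 1 / 2 ≤ 1 - s * τ := by nlinarith [hs.1, hs.2]
    have h := setIntegral_homothety_le hD hconv hb hF hF0 hy (σ := 1 - s * τ) (by linarith)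
      (by nlinarith [hs.1])
    have e : ∀ z : Plane, y + (1 - s * τ) • (z - y) = z + s • τ • (y - z) := fun z => by
      module
    simp only [e] at h
    refine h.trans (mul_le_mul_of_nonneg_right ?_ (integral_nonneg hF0))
    rw [inv_le_comm₀ (by positivity) (by norm_num)]
    nlinarith
  calc ∫ s in Ioc (0 : ℝ) 1, (∫ z in D, F (z + s • τ • (y - z)))
      ≤ ∫ s in Ioc (0 : ℝ) 1, (4 * ∫ z in D, F z) := by
        refine setIntegral_mono_on ?_ (integrable_const _) measurableSet_Ioc hs
        exact (integrable_prod_of_continuous hb (F := fun p =>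
          F (p.1 + p.2 • τ • (y - p.1))) (by fun_prop)).integral_prod_right
    _ = 4 * ∫ z in D, F z := by simp

/-- From `z` one moves the fraction `ε` towards the two poles `x₀` and `x₀ + ρ e_j`. The endpoints
differ by `ε ρ e_j`, so the difference of the two Taylor expansions isolates `ε ρ ∂_j f(z)`. Values
and remainders are then integrated by homotheties with ratios at least 1/2. -/
theorem sq_integral_le_of_interp {f : Plane → ℝ} (hf : Smc f) {x₀ : Plane} {ρ d ε : ℝ}
    (hρ : 0 < ρ) (hball : closedBall x₀ ρ ⊆ D) (hd : ∀ x ∈ D, ∀ y ∈ D, ‖x - y‖ ≤ d)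
    (hε : 0 < ε) (hε2 : ε ≤ 1 / 2) (j : Fin 2) :
    ∫ z in D, dd j f z ^ 2 ≤ 32 / ρ ^ 2 * ((ε ^ 2)⁻¹ * (∫ z in D, f z ^ 2) +
      ε ^ 2 * d ^ 4 * ∫ z in D, absD2 f z ^ 2) := by
  set e : Plane := EuclideanSpace.single j (1 : ℝ) with he
  have hx₀ : x₀ ∈ D := hball (mem_closedBall_self hρ.le)
  have hx₁ : x₀ + ρ • e ∈ D := hball (by
    simp [he, norm_smul, abs_of_pos hρ])
  set Q : Plane → Plane → ℝ := fun y z => ∫ s in (0 : ℝ)..1, absD2 f (z + s • ε • (y - z)) ^ 2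
    with hQ
  have hH := hf.continuous_absD2
  have hrem : ∀ y ∈ D, ∀ z ∈ D, (f (z + ε • (y - z)) - f z -
      ∑ i, (ε • (y - z)) i * dd i f z) ^ 2 ≤ ε ^ 4 * d ^ 4 * Q y z := by
    intro y hy z hz
    have h1 := hf.abs_taylor_zero_le z (ε • (y - z))
    have h2 : ‖ε • (y - z)‖ ^ 2 ≤ ε ^ 2 * d ^ 2 := by
      rw [norm_smul, Real.norm_of_nonneg hε.le, mul_pow]
      have := hd y hy z hz
      gcongr
    have h3 := sq_intervalIntegral_le (hH.comp (continuous_line z (ε • (y - z))))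
    simp only [Function.comp_apply] at h3
    have h4 : 0 ≤ ∫ s in (0 : ℝ)..1, absD2 f (z + s • ε • (y - z)) :=
      intervalIntegral.integral_nonneg zero_le_one fun _ _ => absD2_nonneg _
    rw [← sq_abs]
    calc _ ≤ (ε ^ 2 * d ^ 2 * ∫ s in (0 : ℝ)..1, absD2 f (z + s • ε • (y - z))) ^ 2 := by
          refine pow_le_pow_left₀ (abs_nonneg _) (h1.trans ?_) 2
          exact mul_le_mul_of_nonneg_right h2 h4
      _ = ε ^ 4 * d ^ 4 * (∫ s in (0 : ℝ)..1, absD2 f (z + s • ε • (y - z))) ^ 2 := by ring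
      _ ≤ _ := by
        refine mul_le_mul_of_nonneg_left h3 (by positivity)
  have hpt : ∀ z ∈ D, (ε * ρ) ^ 2 * dd j f z ^ 2 ≤
      4 * (f (x₀ + ρ • e + (1 - ε) • (z - (x₀ + ρ • e))) ^ 2 + f (x₀ + (1 - ε) • (z - x₀)) ^ 2 +
        ε ^ 4 * d ^ 4 * (Q (x₀ + ρ • e) z + Q x₀ z)) := by
    intro z hz
    have h1 := hrem _ hx₀ z hz
    have h2 := hrem _ hx₁ z hz
    have e1 : z + ε • (x₀ - z) = x₀ + (1 - ε) • (z - x₀) := by module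
    have e2 : z + ε • (x₀ + ρ • e - z) = x₀ + ρ • e + (1 - ε) • (z - (x₀ + ρ • e)) := by module
    have e3 : ∑ i, (ε • (x₀ + ρ • e - z)) i * dd i f z =
        ∑ i, (ε • (x₀ - z)) i * dd i f z + ε * ρ * dd j f z := by
      rw [← fderiv_eq_sum_dd, ← fderiv_eq_sum_dd,
        show ε • (x₀ + ρ • e - z) = ε • (x₀ - z) + (ε * ρ) • e by module]
      simp only [map_add, map_smul, smul_eq_mul]
      rfl
    rw [e1] at h1
    rw [e2, e3] at h2
    generalize f (x₀ + (1 - ε) • (z - x₀)) = A at *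
    generalize f (x₀ + ρ • e + (1 - ε) • (z - (x₀ + ρ • e))) = B at *
    generalize ∑ i, (ε • (x₀ - z)) i * dd i f z = S at *
    -- With remainders `r` and `r'` of the two expansions this is `ε ρ ∂_j f = B - A + r - r'`; four
    -- terms squared explain the factor 4.
    have h5 : (ε * ρ) ^ 2 * dd j f z ^ 2 = (B - A + (A - f z - S) -
      (B - f z - (S + ε * ρ * dd j f z))) ^ 2 := by ring
    rw [h5]
    generalize A - f z - S = r at *
    generalize B - f z - (S + ε * ρ * dd j f z) = r' at *
    nlinarith [sq_nonneg (B + A), sq_nonneg (B - r), sq_nonneg (B + r'), sq_nonneg (A + r),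
      sq_nonneg (A - r'), sq_nonneg (r + r')]
  have hIQ : ∀ y ∈ D, IntegrableOn (Q y) D ∧ ∫ z in D, Q y z ≤ 4 * ∫ z in D, absD2 f z ^ 2 := by
    intro y hy
    refine ⟨?_, setIntegral_segment_le hD hconv hb (hH.pow 2) (fun _ => sq_nonneg _)
      (subset_closure hy) hε.le hε2⟩
    have := (integrable_prod_of_continuous hb (F := fun p =>
      absD2 f (p.1 + p.2 • ε • (y - p.1)) ^ 2) (by fun_prop)).integral_prod_left
    refine this.congr (.of_forall fun z => ?_)
    simp only [hQ, intervalIntegral.integral_of_le zero_le_one]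
  have hA : ∀ y ∈ D, ∫ z in D, f (y + (1 - ε) • (z - y)) ^ 2 ≤ 4 * ∫ z in D, f z ^ 2 := by
    intro y hy
    refine (setIntegral_homothety_le hD hconv hb (F := fun x => f x ^ 2) (hf.continuous.pow 2)
      (fun _ => sq_nonneg _) (subset_closure hy) (σ := 1 - ε) (by linarith) (by linarith)).trans ?_
    refine mul_le_mul_of_nonneg_right ?_ (integral_nonneg fun _ => sq_nonneg _)
    rw [inv_le_comm₀ (by nlinarith) (by norm_num)]
    nlinarith
  have hcf := hf.continuous
  have hiA : ∀ y, IntegrableOn (fun z => f (y + (1 - ε) • (z - y)) ^ 2) D := fun y =>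
    integrableOn_of_continuous hb (by fun_prop)
  have hfin := setIntegral_mono_on
    ((integrableOn_of_continuous hb ((hf.dd j).continuous.pow 2)).const_mul ((ε * ρ) ^ 2))
    (((((hiA (x₀ + ρ • e)).add (hiA x₀)).add
      (((hIQ _ hx₁).1.add (hIQ _ hx₀).1).const_mul (ε ^ 4 * d ^ 4))).const_mul 4))
    hD.measurableSet hpt
  simp only [Pi.add_apply, Pi.pow_apply] at hfin
  rw [integral_const_mul, integral_const_mul, integral_add (by exact (hiA _).add (hiA _))
    (by exact ((hIQ _ hx₁).1.add (hIQ _ hx₀).1).const_mul (ε ^ 4 * d ^ 4)),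
    integral_add (by exact hiA _) (by exact hiA _), integral_const_mul,
    integral_add (by exact (hIQ _ hx₁).1) (by exact (hIQ _ hx₀).1)] at hfin
  have a1 := hA _ hx₀
  have a2 := hA _ hx₁
  have a3 := (hIQ _ hx₀).2
  have a4 := (hIQ _ hx₁).2
  have h6 : (ε * ρ) ^ 2 * ∫ z in D, dd j f z ^ 2 ≤ 32 * (∫ z in D, f z ^ 2) +
      32 * (ε ^ 4 * d ^ 4) * ∫ z in D, absD2 f z ^ 2 := by
    have h7 := mul_le_mul_of_nonneg_left (add_le_add a4 a3) (show 0 ≤ ε ^ 4 * d ^ 4 by positivity)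
    linarith
  rw [← le_div_iff₀' (by positivity)] at h6
  refine h6.trans (le_of_eq ?_)
  field_simp

/-- Interpolation of the first derivatives between a function and its second derivatives. -/
theorem exists_interp_two (hne : D.Nonempty) : ∃ K > 0, ∀ f, Smc f → ∀ ε > 0, ε ≤ 1 / 2 → ∀ j,
    ∫ z in D, dd j f z ^ 2 ≤ K * ((ε ^ 2)⁻¹ * (∫ z in D, f z ^ 2) +
      ε ^ 2 * ∑ k, ∑ l, ∫ z in D, dd l (dd k f) z ^ 2) := by
  obtain ⟨x₀, hx₀⟩ := hne
  obtain ⟨ρ, hρ, hball⟩ := Metric.nhds_basis_closedBall.mem_iff.1 (hD.mem_nhds hx₀)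
  have hdd : ∀ x ∈ D, ∀ y ∈ D, ‖x - y‖ ≤ Metric.diam D := fun x hx y hy => by
    rw [← dist_eq_norm]; exact dist_le_diam_of_mem hb hx hy
  refine ⟨32 / ρ ^ 2 * (1 + 4 * Metric.diam D ^ 4), by positivity, fun f hf ε hε hε2 j => ?_⟩
  refine (sq_integral_le_of_interp hD hconv hb hf hρ hball hdd hε hε2 j).trans ?_
  rw [mul_assoc (32 / ρ ^ 2)]
  refine mul_le_mul_of_nonneg_left ?_ (show (0 : ℝ) ≤ 32 / ρ ^ 2 by positivity)
  have hi : ∀ k l, IntegrableOn (fun z => dd l (dd k f) z ^ 2) D := fun k l =>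
    integrableOn_of_continuous hb (((hf.dd k).dd l).continuous.pow 2)
  have h1 : ∫ z in D, absD2 f z ^ 2 ≤ 4 * ∑ k, ∑ l, ∫ z in D, dd l (dd k f) z ^ 2 := by
    have := setIntegral_mono (integrableOn_of_continuous hb (hf.continuous_absD2.pow 2))
      ((integrable_finsetSum _ fun k _ => integrable_finsetSum _ fun l _ => hi k l).const_mul 4)
      (fun x => absD2_sq_le (f := f) x)
    refine this.trans (le_of_eq ?_)
    rw [integral_const_mul, integral_finsetSum _ fun k _ => integrable_finsetSum _ fun l _ => hi k l]
    congr 1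
    refine Finset.sum_congr rfl fun k _ => ?_
    rw [integral_finsetSum _ fun l _ => hi k l]
  have h0 : 0 ≤ ∫ z in D, f z ^ 2 := integral_nonneg fun _ => sq_nonneg _
  have h2 : 0 ≤ ∑ k, ∑ l, ∫ z in D, dd l (dd k f) z ^ 2 := Finset.sum_nonneg fun k _ =>
    Finset.sum_nonneg fun l _ => integral_nonneg fun _ => sq_nonneg _
  have h3 := mul_le_mul_of_nonneg_left h1 (show 0 ≤ ε ^ 2 * Metric.diam D ^ 4 by positivity)
  have h4 : 0 ≤ 4 * Metric.diam D ^ 4 * ((ε ^ 2)⁻¹ * ∫ z in D, f z ^ 2) := by positivity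
  have h5 : 0 ≤ ε ^ 2 * ∑ k, ∑ l, ∫ z in D, dd l (dd k f) z ^ 2 := by positivity
  linarith

omit hD hconv hb in
-- `A`, `B`, `E` stand for the squared norms of first, second and third derivatives. Inserting `h2`
-- into `h1` puts the coefficient `16 (K ε)² ≤ 1/4` in front of `A`, which is absorbed on the left.
theorem interp_arith {K ε N A B E : ℝ} (hK : 0 < K) (hε : 0 < ε) (hεK : K * ε ≤ 1 / 8)
    (hN0 : 0 ≤ N) (hA0 : 0 ≤ A) (hE0 : 0 ≤ E) (h1 : A ≤ 2 * K * ((ε ^ 2)⁻¹ * N + ε ^ 2 * B))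
    (h2 : B ≤ 2 * K * (4 * A + 1 / 4 * E)) : A ≤ (4 * K * (ε ^ 2)⁻¹ + 1) * (N + E) := by
  have h3 : A ≤ 2 * K * (ε ^ 2)⁻¹ * N + 4 * (K * ε) ^ 2 * (4 * A + 1 / 4 * E) := by
    have := mul_le_mul_of_nonneg_left h2 (show 0 ≤ 2 * K * ε ^ 2 by positivity)
    linarith
  have h4 : (K * ε) ^ 2 ≤ 1 / 64 := by
    have : 0 ≤ K * ε := by positivity
    nlinarith
  have h5 : 4 * (K * ε) ^ 2 * (4 * A + 1 / 4 * E) ≤ 4 * (1 / 64) * (4 * A + 1 / 4 * E) := by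
    gcongr
  have h6 : 0 ≤ 4 * K * (ε ^ 2)⁻¹ * E := by positivity
  have h7 : 0 ≤ 4 * K * (ε ^ 2)⁻¹ * N := by positivity
  linarith

/-- Interpolation of the first derivatives between a function and its third derivatives. -/
theorem exists_interp_three (hne : D.Nonempty) : ∃ K > 0, ∀ f, Smc f →
    ∑ j, ∫ z in D, dd j f z ^ 2 ≤ K * ((∫ z in D, f z ^ 2) +
      ∑ j, ∑ k, ∑ l, ∫ z in D, dd l (dd k (dd j f)) z ^ 2) := by
  obtain ⟨K, hK, h⟩ := exists_interp_two hD hconv hb hne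
  -- The bound `1/2` is required by `exists_interp_two`; the bound `1 / (8 K)` makes the absorption
  -- possible.
  set ε : ℝ := min (1 / 2) (1 / (8 * K)) with hε
  have hε0 : 0 < ε := by positivity
  have hεK : K * ε ≤ 1 / 8 := by
    have : ε ≤ 1 / (8 * K) := min_le_right _ _
    rw [le_div_iff₀ (by positivity)] at this
    linarith
  refine ⟨4 * K * (ε ^ 2)⁻¹ + 1, by positivity, fun f hf => ?_⟩
  have h1 := Finset.sum_le_sum fun j (_ : j ∈ Finset.univ) => h f hf ε hε0 (min_le_left _ _) j
  -- For the derivatives `dd j f` no smallness is needed: the parameter `1/2` produces the constants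
  -- `4` and `1/4` in `interp_arith`.
  have h2 := Finset.sum_le_sum fun j (_ : j ∈ Finset.univ) => Finset.sum_le_sum fun l
    (_ : l ∈ Finset.univ) => h (dd j f) (hf.dd j) (1 / 2) (by norm_num) le_rfl l
  simp only [Finset.sum_const, Finset.card_univ, Fintype.card_fin, nsmul_eq_mul,
    ← Finset.mul_sum, Finset.sum_add_distrib] at h1 h2
  refine interp_arith hK hε0 hεK (integral_nonneg fun _ => sq_nonneg _)
    (Finset.sum_nonneg fun _ _ => integral_nonneg fun _ => sq_nonneg _)
    (Finset.sum_nonneg fun _ _ => Finset.sum_nonneg fun k _ => Finset.sum_nonneg fun l _ =>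
      integral_nonneg fun _ => sq_nonneg _)
    (h1.trans (le_of_eq ?_)) (h2.trans (le_of_eq ?_)) <;> push_cast <;> ring

end convexSet

end

/-! ### Averaged Taylor polynomials, Sobolev's and Poincaré's inequalities. -/

section

open Filter Metric Topology

/-- Cauchy–Schwarz against the constant 1, read off from `∫ (V F - I)² ≥ 0`. -/
theorem sq_integral_le {α : Type*} [MeasurableSpace α] (ν : Measure α) [IsFiniteMeasure ν]
    (hν : 0 < ν.real univ) {F : α → ℝ} (hF : Integrable F ν) (hF2 : Integrable (fun x => F x ^ 2) ν) :
    (∫ x, F x ∂ν) ^ 2 ≤ ν.real univ * ∫ x, F x ^ 2 ∂ν := by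
  set V := ν.real univ with hV
  set I := ∫ x, F x ∂ν with hI
  have h : 0 ≤ ∫ x, (V * F x - I) ^ 2 ∂ν := integral_nonneg fun _ => sq_nonneg _
  have e : ∫ x, (V * F x - I) ^ 2 ∂ν = V ^ 2 * (∫ x, F x ^ 2 ∂ν) - 2 * V * I * I + V * I ^ 2 := by
    have : ∀ x, (V * F x - I) ^ 2 = V ^ 2 * F x ^ 2 - 2 * V * I * F x + I ^ 2 := fun x => by ring
    simp only [this]
    rw [integral_add (by exact (hF2.const_mul _).sub (hF.const_mul _)) (integrable_const _),
      integral_sub (by exact hF2.const_mul _) (by exact hF.const_mul _), integral_const_mul, integral_const_mul,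
      integral_const, smul_eq_mul]
  rw [e] at h
  have : 0 ≤ V * (V * (∫ x, F x ^ 2 ∂ν) - I ^ 2) := by linarith
  linarith [nonneg_of_mul_nonneg_right this hν]

section convexSet

variable {D : Set Plane} (hD : IsOpen D) (hconv : Convex ℝ D) (hb : Bornology.IsBounded D)

include hb in
theorem isFiniteMeasure_restrict_of_isBounded : IsFiniteMeasure (volume.restrict D) :=
  ⟨by simpa using hb.measure_lt_top⟩

include hD hb in
theorem volume_real_pos (hne : D.Nonempty) : 0 < volume.real D :=
  ENNReal.toReal_pos (hD.measure_pos volume hne).ne' hb.measure_lt_top.ne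

include hb in
theorem sq_setIntegral_le (hV : 0 < volume.real D) {F : Plane → ℝ} (hF : Continuous F) :
    (∫ x in D, F x) ^ 2 ≤ volume.real D * ∫ x in D, F x ^ 2 := by
  have := isFiniteMeasure_restrict_of_isBounded hb
  have := sq_integral_le (volume.restrict D) (by simpa using hV) (integrableOn_of_continuous hb hF)
    (integrableOn_of_continuous hb (hF.pow 2))
  simpa using this

include hD hconv hb

/-- The first-order Taylor polynomial at `y`, evaluated at `z`, is averaged over `y ∈ D`. Each
remainder is an integral of `absD2 f` over the segment from `z` to `y` with weight `s`; Fubini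
exchanges the two integrations. This single estimate yields both Sobolev's inequality and the
quadratic approximation on triangles. -/
theorem abs_sub_average_taylor_le {f : Plane → ℝ} (hf : Smc f) (hne : D.Nonempty) {z : Plane}
    (hz : z ∈ closure D) {d : ℝ} (hd : ∀ y ∈ D, ‖y - z‖ ≤ d) :
    |f z - (volume.real D)⁻¹ * ∫ y in D, (f y - ∑ j, (y - z) j * dd j f y)| ≤
      d ^ 2 * (√(volume.real D))⁻¹ * √(∫ y in D, absD2 f y ^ 2) := by
  have := isFiniteMeasure_restrict_of_isBounded hb
  set V := volume.real D with hV
  have hV0 : 0 < V := volume_real_pos hD hb hne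
  set N := √(∫ y in D, absD2 f y ^ 2) with hN
  have hH := hf.continuous_absD2
  have hcf := hf.continuous
  have hcd := fun j => (hf.dd j).continuous
  have hcT : Continuous fun y => f y - ∑ j, (y - z) j * dd j f y := by fun_prop
  have hiP := integrable_prod_of_continuous hb (F := fun p : Plane × ℝ =>
      p.2 * absD2 f (z + p.2 • (p.1 - z))) (by fun_prop)
  have hpt : ∀ y ∈ D, |f z - (f y - ∑ j, (y - z) j * dd j f y)| ≤
      d ^ 2 * ∫ s in Ioc (0 : ℝ) 1, s * absD2 f (z + s • (y - z)) := by
    intro y hy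
    have h1 := hf.abs_taylor_one_le z (y - z)
    rw [add_sub_cancel, intervalIntegral.integral_of_le zero_le_one] at h1
    refine h1.trans (mul_le_mul_of_nonneg_right ?_ ?_)
    · have := hd y hy; gcongr
    · exact setIntegral_nonneg measurableSet_Ioc fun s hs => mul_nonneg hs.1.le (absD2_nonneg _)
  -- Cauchy–Schwarz and the homothety of ratio `s` around `z` give `s * √V * s⁻¹ * N`: the weight
  -- cancels the singularity.
  have hs : ∀ s ∈ Ioc (0 : ℝ) 1, ∫ y in D, s * absD2 f (z + s • (y - z)) ≤ √V * N := by
    intro s hs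
    rw [integral_const_mul]
    have h1 := sq_setIntegral_le hb hV0 (F := fun y => absD2 f (z + s • (y - z))) (by fun_prop)
    have h2 := setIntegral_homothety_le hD hconv hb (hH.pow 2) (fun _ => sq_nonneg _) hz hs.1 hs.2
    have h3 : 0 ≤ ∫ y in D, absD2 f (z + s • (y - z)) := integral_nonneg fun _ => absD2_nonneg _
    refine (le_abs_self _).trans (abs_le_of_sq_le_sq ?_ (by positivity))
    rw [mul_pow, mul_pow, Real.sq_sqrt hV0.le, hN, Real.sq_sqrt (integral_nonneg fun _ => sq_nonneg _)]
    have hs2 : 0 < s ^ 2 := by have := hs.1; positivity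
    calc s ^ 2 * (∫ y in D, absD2 f (z + s • (y - z))) ^ 2
        ≤ s ^ 2 * (V * ((s ^ 2)⁻¹ * ∫ y in D, absD2 f y ^ 2)) := by
          refine mul_le_mul_of_nonneg_left (h1.trans ?_) hs2.le
          exact mul_le_mul_of_nonneg_left h2 hV0.le
      _ = V * ∫ y in D, absD2 f y ^ 2 := by
          have := hs.1.ne'
          field_simp
  have hmain : ∫ y in D, |f z - (f y - ∑ j, (y - z) j * dd j f y)| ≤ d ^ 2 * (√V * N) := by
    calc _ ≤ ∫ y in D, d ^ 2 * ∫ s in Ioc (0 : ℝ) 1, s * absD2 f (z + s • (y - z)) :=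
          setIntegral_mono_on (integrableOn_of_continuous hb (by fun_prop))
            (hiP.integral_prod_left.const_mul _) hD.measurableSet hpt
      _ = d ^ 2 * ∫ y in D, (∫ s in Ioc (0 : ℝ) 1, s * absD2 f (z + s • (y - z))) :=
          integral_const_mul _ _
      _ = d ^ 2 * ∫ s in Ioc (0 : ℝ) 1, (∫ y in D, s * absD2 f (z + s • (y - z))) := by
          rw [integral_integral_swap hiP]
      _ ≤ d ^ 2 * ∫ s in Ioc (0 : ℝ) 1, √V * N := by
          refine mul_le_mul_of_nonneg_left ?_ (sq_nonneg d)
          exact setIntegral_mono_on hiP.integral_prod_right (integrable_const _) measurableSet_Ioc hs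
      _ = d ^ 2 * (√V * N) := by simp
  have e : f z - V⁻¹ * ∫ y in D, (f y - ∑ j, (y - z) j * dd j f y) =
      V⁻¹ * ∫ y in D, (f z - (f y - ∑ j, (y - z) j * dd j f y)) := by
    rw [integral_sub (integrable_const _) (integrableOn_of_continuous hb hcT), integral_const]
    simp only [measureReal_restrict_apply_univ, smul_eq_mul, ← hV]
    field_simp
  rw [e, abs_mul, abs_of_pos (inv_pos.2 hV0)]
  calc V⁻¹ * |∫ y in D, (f z - (f y - ∑ j, (y - z) j * dd j f y))|
      ≤ V⁻¹ * (d ^ 2 * (√V * N)) :=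
        mul_le_mul_of_nonneg_left ((abs_integral_le_integral_abs).trans hmain) (inv_pos.2 hV0).le
    _ = d ^ 2 * (√V)⁻¹ * N := by
        have h : V⁻¹ * √V = (√V)⁻¹ := by
          have h1 := Real.mul_self_sqrt hV0.le
          have h2 : √V ≠ 0 := (Real.sqrt_pos.2 hV0).ne'
          field_simp
          linarith
        rw [← h]; ring

omit hD hconv in
theorem setIntegral_absD2_sq_le {f : Plane → ℝ} (hf : Smc f) :
    ∫ z in D, absD2 f z ^ 2 ≤ 4 * ∑ j, ∑ k, ∫ z in D, dd k (dd j f) z ^ 2 := by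
  have hi : ∀ k l, IntegrableOn (fun z => dd l (dd k f) z ^ 2) D := fun k l =>
    integrableOn_of_continuous hb (((hf.dd k).dd l).continuous.pow 2)
  have := setIntegral_mono (integrableOn_of_continuous hb (hf.continuous_absD2.pow 2))
    ((integrable_finsetSum _ fun k _ => integrable_finsetSum _ fun l _ => hi k l).const_mul 4)
    (fun x => absD2_sq_le (f := f) x)
  refine this.trans (le_of_eq ?_)
  rw [integral_const_mul, integral_finsetSum _ fun k _ => integrable_finsetSum _ fun l _ => hi k l]
  congr 1
  refine Finset.sum_congr rfl fun k _ => ?_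
  rw [integral_finsetSum _ fun l _ => hi k l]

omit hD hconv in
theorem setIntegral_absD1_sq_le {f : Plane → ℝ} (hf : Smc f) :
    ∫ z in D, absD1 f z ^ 2 ≤ 2 * ∑ j, ∫ z in D, dd j f z ^ 2 := by
  have hi : ∀ k, IntegrableOn (fun z => dd k f z ^ 2) D := fun k =>
    integrableOn_of_continuous hb ((hf.dd k).continuous.pow 2)
  rw [← integral_finsetSum _ fun k _ => hi k, ← integral_const_mul]
  exact setIntegral_mono (integrableOn_of_continuous hb (hf.continuous_absD1.pow 2))
    ((integrable_finsetSum _ fun k _ => hi k).const_mul 2) fun x => absD1_sq_le x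

/-- Sobolev's inequality. -/
theorem exists_sobolev (hne : D.Nonempty) : ∃ C > 0, ∀ f, Smc f → ∀ z ∈ closure D,
    f z ^ 2 ≤ C * ((∫ y in D, f y ^ 2) + ∑ j, (∫ y in D, dd j f y ^ 2) +
      ∑ j, ∑ k, ∫ y in D, dd k (dd j f) y ^ 2) := by
  have hV0 : 0 < volume.real D := volume_real_pos hD hb hne
  obtain ⟨d, hd⟩ : ∃ d, d = Metric.diam (closure D) := ⟨_, rfl⟩
  obtain ⟨V, hV⟩ : ∃ V, V = volume.real D := ⟨_, rfl⟩
  rw [← hV] at hV0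
  have hd0 : 0 ≤ d := hd ▸ diam_nonneg
  refine ⟨V⁻¹ * (6 + 6 * d ^ 2 + 8 * d ^ 4), by positivity, fun f hf z hz => ?_⟩
  have hdz : ∀ y ∈ D, ‖y - z‖ ≤ d := fun y hy => by
    rw [← dist_eq_norm, hd]; exact dist_le_diam_of_mem hb.closure (subset_closure hy) hz
  have h1 := abs_sub_average_taylor_le hD hconv hb hf hne hz hdz
  rw [← hV] at h1
  have hcf := hf.continuous
  have hcd := fun j => (hf.dd j).continuous
  have hcT : Continuous fun y => f y - ∑ j, (y - z) j * dd j f y := by fun_prop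
  have h2 := sq_setIntegral_le hb (hV ▸ hV0) hcT
  have h3 : ∫ y in D, (f y - ∑ j, (y - z) j * dd j f y) ^ 2 ≤
      ∫ y in D, (2 * f y ^ 2 + 2 * d ^ 2 * absD1 f y ^ 2) := by
    have hcG := hf.continuous_absD1
    refine setIntegral_mono_on (integrableOn_of_continuous hb (by fun_prop))
      (integrableOn_of_continuous hb (by fun_prop)) hD.measurableSet fun y hy => ?_
    have a1 := abs_first_le (f := f) (y - z) y
    have a2 : |∑ j, (y - z) j * dd j f y| ^ 2 ≤ (d * absD1 f y) ^ 2 :=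
      pow_le_pow_left₀ (abs_nonneg _)
        (a1.trans (mul_le_mul_of_nonneg_right (hdz y hy) (absD1_nonneg _))) 2
    rw [sq_abs] at a2
    nlinarith [sq_nonneg (f y + ∑ j, (y - z) j * dd j f y)]
  have hcG := hf.continuous_absD1
  rw [integral_add (integrableOn_of_continuous hb (by fun_prop))
    (integrableOn_of_continuous hb (by fun_prop)), integral_const_mul, integral_const_mul] at h3
  have h4 := setIntegral_absD1_sq_le hb hf
  have h5 := setIntegral_absD2_sq_le hb hf
  have n0 : 0 ≤ ∫ y in D, f y ^ 2 := integral_nonneg fun _ => sq_nonneg _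
  have n1 : 0 ≤ ∑ j, ∫ y in D, dd j f y ^ 2 :=
    Finset.sum_nonneg fun _ _ => integral_nonneg fun _ => sq_nonneg _
  have n2 : 0 ≤ ∑ j, ∑ k, ∫ y in D, dd k (dd j f) y ^ 2 :=
    Finset.sum_nonneg fun _ _ => Finset.sum_nonneg fun _ _ => integral_nonneg fun _ => sq_nonneg _
  have n3 : 0 ≤ ∫ y in D, absD2 f y ^ 2 := integral_nonneg fun _ => sq_nonneg _
  rw [← hV] at h2
  generalize ∫ y in D, (f y - ∑ j, (y - z) j * dd j f y) = I at *
  generalize ∫ y in D, (f y - ∑ j, (y - z) j * dd j f y) ^ 2 = I2 at *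
  generalize ∫ y in D, f y ^ 2 = a at *
  generalize ∑ j, ∫ y in D, dd j f y ^ 2 = b at *
  generalize ∑ j, ∑ k, ∫ y in D, dd k (dd j f) y ^ 2 = c at *
  generalize ∫ y in D, absD2 f y ^ 2 = N2 at *
  generalize ∫ y in D, absD1 f y ^ 2 = N1 at *
  have h6 : (f z - V⁻¹ * I) ^ 2 ≤ d ^ 4 * V⁻¹ * N2 := by
    have := pow_le_pow_left₀ (abs_nonneg _) h1 2
    rw [sq_abs, mul_pow, mul_pow, inv_pow, Real.sq_sqrt hV0.le, Real.sq_sqrt n3] at this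
    linarith
  have h7 : (V⁻¹ * I) ^ 2 ≤ V⁻¹ * (2 * a + 4 * d ^ 2 * b) := by
    have e : V⁻¹ ^ 2 * (V * (2 * a + 4 * d ^ 2 * b)) = V⁻¹ * (2 * a + 4 * d ^ 2 * b) := by
      field_simp
    rw [← e, mul_pow]
    have : 2 * d ^ 2 * N1 ≤ 2 * d ^ 2 * (2 * b) := mul_le_mul_of_nonneg_left h4 (by positivity)
    have h8 : I2 ≤ 2 * a + 4 * d ^ 2 * b := by linarith
    exact mul_le_mul_of_nonneg_left (h2.trans (mul_le_mul_of_nonneg_left h8 hV0.le)) (by positivity)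
  have h9 : d ^ 4 * V⁻¹ * N2 ≤ d ^ 4 * V⁻¹ * (4 * c) :=
    mul_le_mul_of_nonneg_left h5 (by positivity)
  -- `V⁻¹ * I` is the averaged Taylor polynomial; it is bounded by `f` and its first derivatives,
  -- the remainder by the second derivatives.
  have h10 : f z ^ 2 ≤ 2 * (f z - V⁻¹ * I) ^ 2 + 2 * (V⁻¹ * I) ^ 2 := by
    nlinarith [sq_nonneg (f z - V⁻¹ * I - V⁻¹ * I)]
  have h11 : f z ^ 2 ≤ V⁻¹ * (4 * a + 8 * d ^ 2 * b + 8 * d ^ 4 * c) := by linarith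
  refine h11.trans ?_
  rw [mul_assoc V⁻¹]
  refine mul_le_mul_of_nonneg_left ?_ (inv_pos.2 hV0).le
  have p1 : 0 ≤ d ^ 2 := sq_nonneg d
  have p2 : 0 ≤ d ^ 4 := by positivity
  have q1 := mul_nonneg p1 n0
  have q2 := mul_nonneg p2 n0
  have q3 := mul_nonneg p1 n2
  have q4 := mul_nonneg p2 n1
  have q5 := mul_nonneg p1 n1
  have q6 := mul_nonneg p2 n2
  -- The only comparison that is not termwise is `8 d² ≤ 6 + 6 d² + 8 d⁴` in front of the first
  -- derivatives; the hint supplies `d² ≤ d⁴ + 1/4`.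
  nlinarith [sq_nonneg (d ^ 2 - 1 / 2)]

omit hconv in
-- By Fubini both summands have the same double integral, so a bound for the integral over the first
-- variable suffices.
theorem setIntegral_symmetrized_le {P : Plane → Plane → ℝ}
    (hPc : Continuous fun p : Plane × Plane => P p.1 p.2) {B : ℝ}
    (hPz : ∀ y ∈ D, ∫ z in D, P z y ≤ B) :
    ∫ z in D, (∫ y in D, (P z y + P y z)) ≤ volume.real D * (2 * B) := by
  have := isFiniteMeasure_restrict_of_isBounded hb
  have hPi := integrable_prod_plane_of_continuous hb hPc
  have hPi' := integrable_prod_plane_of_continuous hb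
    (F := fun p : Plane × Plane => P p.2 p.1) (hPc.comp continuous_swap)
  have h1 : ∫ y in D, (∫ z in D, P z y) ≤ ∫ y in D, B :=
    setIntegral_mono_on hPi.integral_prod_right (integrable_const _) hD.measurableSet hPz
  simp only [integral_const, measureReal_restrict_apply_univ, smul_eq_mul] at h1
  have e : ∫ z in D, (∫ y in D, (P z y + P y z)) =
      ∫ z in D, ((∫ y in D, P z y) + ∫ y in D, P y z) := by
    refine setIntegral_congr_fun hD.measurableSet fun z _ => integral_add ?_ ?_
    · exact integrableOn_of_continuous hb (hPc.comp (by fun_prop : Continuous fun y => (z, y)))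
    · exact integrableOn_of_continuous hb (hPc.comp (by fun_prop : Continuous fun y => (y, z)))
  rw [e, integral_add hPi.integral_prod_left hPi'.integral_prod_left,
    integral_integral_swap hPi]
  linarith

omit hconv in
theorem sq_sub_average_le {f : Plane → ℝ} (hf : Continuous f) (hne : D.Nonempty) (z : Plane) :
    (f z - (volume.real D)⁻¹ * ∫ y in D, f y) ^ 2 ≤
      (volume.real D)⁻¹ * ∫ y in D, (f z - f y) ^ 2 := by
  have := isFiniteMeasure_restrict_of_isBounded hb
  have hV0 : 0 < volume.real D := volume_real_pos hD hb hne
  have e : f z - (volume.real D)⁻¹ * ∫ y in D, f y =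
      (volume.real D)⁻¹ * ∫ y in D, (f z - f y) := by
    rw [integral_sub (integrable_const _) (integrableOn_of_continuous hb hf), integral_const]
    simp only [measureReal_restrict_apply_univ, smul_eq_mul]
    field_simp
  rw [e, mul_pow]
  have h1 := sq_setIntegral_le hb hV0 (F := fun y => f z - f y) (by fun_prop)
  calc (volume.real D)⁻¹ ^ 2 * (∫ y in D, (f z - f y)) ^ 2
      ≤ (volume.real D)⁻¹ ^ 2 * (volume.real D * ∫ y in D, (f z - f y) ^ 2) :=
        mul_le_mul_of_nonneg_left h1 (by positivity)
    _ = _ := by field_simp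

omit hD hconv hb in
theorem Smc.sq_sub_midpoint_le {f : Plane → ℝ} (hf : Smc f) {y z : Plane} {d : ℝ}
    (hd : ‖y - z‖ ≤ d) : (f (z + (1 / 2 : ℝ) • (y - z)) - f z) ^ 2 ≤
      d ^ 2 / 4 * ∫ s in (0 : ℝ)..1, absD1 f (z + s • (1 / 2 : ℝ) • (y - z)) ^ 2 := by
  have h1 := hf.abs_sub_le z ((1 / 2 : ℝ) • (y - z))
  have h2 := sq_intervalIntegral_le
    (hf.continuous_absD1.comp (continuous_line z ((1 / 2 : ℝ) • (y - z))))
  simp only [Function.comp_apply] at h2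
  have h3 : 0 ≤ ∫ s in (0 : ℝ)..1, absD1 f (z + s • (1 / 2 : ℝ) • (y - z)) ^ 2 :=
    intervalIntegral.integral_nonneg zero_le_one fun _ _ => sq_nonneg _
  rw [← sq_abs]
  calc _ ≤ (‖(1 / 2 : ℝ) • (y - z)‖ *
        ∫ s in (0 : ℝ)..1, absD1 f (z + s • (1 / 2 : ℝ) • (y - z))) ^ 2 :=
        pow_le_pow_left₀ (abs_nonneg _) h1 2
    _ = ‖y - z‖ ^ 2 / 4 *
        (∫ s in (0 : ℝ)..1, absD1 f (z + s • (1 / 2 : ℝ) • (y - z))) ^ 2 := by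
        rw [norm_smul, Real.norm_of_nonneg (by norm_num)]; ring
    _ ≤ _ := by gcongr

/-- Poincaré's inequality. -/
theorem poincare {f : Plane → ℝ} (hf : Smc f) (hne : D.Nonempty) {d : ℝ}
    (hd : ∀ x ∈ D, ∀ y ∈ D, ‖y - x‖ ≤ d) :
    ∫ z in D, (f z - (volume.real D)⁻¹ * ∫ y in D, f y) ^ 2 ≤
      8 * d ^ 2 * ∑ j, ∫ z in D, dd j f z ^ 2 := by
  have hV0 : 0 < volume.real D := volume_real_pos hD hb hne
  have hG := hf.continuous_absD1
  have hcf := hf.continuous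
  obtain ⟨P, hP⟩ : ∃ P : Plane → Plane → ℝ, ∀ z y, P z y =
    ∫ s in (0 : ℝ)..1, absD1 f (z + s • (1 / 2 : ℝ) • (y - z)) ^ 2 := ⟨_, fun _ _ => rfl⟩
  have hPc : Continuous fun p : Plane × Plane => P p.1 p.2 := by
    simp only [hP]
    exact intervalIntegral.continuous_parametric_intervalIntegral_of_continuous'
      (f := fun (p : Plane × Plane) s => absD1 f (p.1 + s • (1 / 2 : ℝ) • (p.2 - p.1)) ^ 2)
      (by fun_prop) 0 1
  -- The comparison of `f z` with `f y` passes through the midpoint. Each half of the segment is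
  -- then integrated over its own starting point, with homotheties of ratio at least 1/2 instead of
  -- ones degenerating at the far end.
  have hdiff : ∀ z ∈ D, ∀ y ∈ D, (f z - f y) ^ 2 ≤ d ^ 2 / 2 * (P z y + P y z) := by
    intro z hz y hy
    have h1 := hf.sq_sub_midpoint_le (hd z hz y hy)
    have h2 := hf.sq_sub_midpoint_le (hd y hy z hz)
    rw [← hP] at h1 h2
    rw [show y + (1 / 2 : ℝ) • (z - y) = z + (1 / 2 : ℝ) • (y - z) by module] at h2
    nlinarith [sq_nonneg (f (z + (1 / 2 : ℝ) • (y - z)) - f z +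
      (f (z + (1 / 2 : ℝ) • (y - z)) - f y))]
  have hPz : ∀ y ∈ D, ∫ z in D, P z y ≤ 4 * ∫ z in D, absD1 f z ^ 2 := fun y hy => by
    simp only [hP]
    exact setIntegral_segment_le hD hconv hb (hG.pow 2) (fun _ => sq_nonneg _) (subset_closure hy)
      (by norm_num) le_rfl
  have hsum := setIntegral_symmetrized_le hD hb hPc hPz
  have hPs : Continuous fun p : Plane × Plane => P p.1 p.2 + P p.2 p.1 :=
    hPc.add (hPc.comp continuous_swap)
  have hint : ∀ z ∈ D, (f z - (volume.real D)⁻¹ * ∫ y in D, f y) ^ 2 ≤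
      (volume.real D)⁻¹ * (d ^ 2 / 2) * ∫ y in D, (P z y + P y z) := by
    intro z hz
    refine (sq_sub_average_le hD hb hcf hne z).trans ?_
    rw [mul_assoc]
    refine mul_le_mul_of_nonneg_left ?_ (inv_pos.2 hV0).le
    rw [← integral_const_mul]
    refine setIntegral_mono_on (integrableOn_of_continuous hb (by fun_prop))
      (integrableOn_of_continuous hb ?_) hD.measurableSet (hdiff z hz)
    exact (hPs.comp (by fun_prop : Continuous fun y => (z, y))).const_mul _
  have hJ2 := setIntegral_absD1_sq_le hb hf
  calc ∫ z in D, (f z - (volume.real D)⁻¹ * ∫ y in D, f y) ^ 2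
      ≤ ∫ z in D, (volume.real D)⁻¹ * (d ^ 2 / 2) * ∫ y in D, (P z y + P y z) := by
        refine setIntegral_mono_on (integrableOn_of_continuous hb (by fun_prop)) ?_
          hD.measurableSet hint
        exact (integrable_prod_plane_of_continuous hb hPs).integral_prod_left.const_mul _
    _ = (volume.real D)⁻¹ * (d ^ 2 / 2) * ∫ z in D, (∫ y in D, (P z y + P y z)) :=
        integral_const_mul _ _
    _ ≤ (volume.real D)⁻¹ * (d ^ 2 / 2) *
          (volume.real D * (2 * (4 * ∫ z in D, absD1 f z ^ 2))) :=
        mul_le_mul_of_nonneg_left hsum (by positivity)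
    _ = 4 * d ^ 2 * ∫ z in D, absD1 f z ^ 2 := by field_simp
    _ ≤ 4 * d ^ 2 * (2 * ∑ j, ∫ z in D, dd j f z ^ 2) :=
        mul_le_mul_of_nonneg_left hJ2 (by positivity)
    _ = _ := by ring

end convexSet

end

section

open Filter Metric Topology

/-! ### Consequences for Sobolev functions -/

theorem tendsto_setIntegral_sq {D : Set Plane} {φ : ℕ → Plane → ℝ} (hφ : ∀ n, Smc (φ n)) {u : L2 D}
    (h : Tendsto (fun n => toL2 D (φ n)) atTop (𝓝 u)) :
    Tendsto (fun n => ∫ x in D, φ n x ^ 2) atTop (𝓝 (‖u‖ ^ 2)) :=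
  (h.norm.pow 2).congr fun n => norm_toL2_sq ((hφ n).memLp D)

section convexSet

variable {D : Set Plane} (hD : IsOpen D) (hconv : Convex ℝ D) (hb : Bornology.IsBounded D)
  (hne : D.Nonempty)
include hD hconv hb hne

/-- The smooth inequality with parameter `1/2`, passed to the limit. It is needed because `HkNorm`
contains no intermediate derivatives: convergence of `u` and `D² u` must imply convergence of the
gradient. -/
theorem exists_interp_Hk_two : ∃ K > 0, ∀ (u : L2 D) (g : Fin 2 → L2 D)
    (g' : Fin 2 → Fin 2 → L2 D), (∀ j, HasWD D j u (g j)) → (∀ j k, HasWD D k (g j) (g' j k)) →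
    ∀ j, ‖g j‖ ^ 2 ≤ K * (‖u‖ ^ 2 + ∑ k, ∑ l, ‖g' k l‖ ^ 2) := by
  obtain ⟨K, hK, h⟩ := exists_interp_two hD hconv hb hne
  obtain ⟨M, hs, h0, h1, h2, -, -⟩ := exists_smoothing hD hconv hb hne
  refine ⟨4 * K, by positivity, fun u g g' hg hg' j => ?_⟩
  have a0 := tendsto_setIntegral_sq (fun n => hs n u) (h0 u)
  have a1 := tendsto_setIntegral_sq (fun n => (hs n u).dd j) (h1 j u (g j) (hg j))
  have a2 := tendsto_finsetSum Finset.univ fun k _ => tendsto_finsetSum Finset.univ fun l _ =>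
    tendsto_setIntegral_sq (fun n => ((hs n u).dd k).dd l) (h2 k l u _ _ (hg k) (hg' k l))
  refine le_of_tendsto_of_tendsto' a1 ((a0.add a2).const_mul (4 * K)) fun n => ?_
  refine (h _ (hs n u) (1 / 2) (by norm_num) le_rfl j).trans ?_
  have n0 : 0 ≤ ∫ x in D, M n u x ^ 2 := integral_nonneg fun _ => sq_nonneg _
  have n2 : 0 ≤ ∑ k, ∑ l, ∫ x in D, dd l (dd k (M n u)) x ^ 2 :=
    Finset.sum_nonneg fun _ _ => Finset.sum_nonneg fun _ _ => integral_nonneg fun _ => sq_nonneg _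
  rw [mul_comm 4 K, mul_assoc]
  refine mul_le_mul_of_nonneg_left ?_ hK.le
  have e : ((1 / 2 : ℝ) ^ 2)⁻¹ = 4 := by norm_num
  rw [e]
  linarith

theorem exists_interp_Hk_three : ∃ K > 0, ∀ (u : L2 D) (g : Fin 2 → L2 D)
    (g' : Fin 2 → Fin 2 → L2 D) (g'' : Fin 2 → Fin 2 → Fin 2 → L2 D),
    (∀ j, HasWD D j u (g j)) → (∀ j k, HasWD D k (g j) (g' j k)) →
    (∀ j k l, HasWD D l (g' j k) (g'' j k l)) →
    ∑ j, ‖g j‖ ^ 2 ≤ K * (‖u‖ ^ 2 + ∑ j, ∑ k, ∑ l, ‖g'' j k l‖ ^ 2) := by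
  obtain ⟨K, hK, h⟩ := exists_interp_three hD hconv hb hne
  obtain ⟨M, hs, h0, h1, h2, h3, -⟩ := exists_smoothing hD hconv hb hne
  refine ⟨K, hK, fun u g g' g'' hg hg' hg'' => ?_⟩
  have a0 := tendsto_setIntegral_sq (fun n => hs n u) (h0 u)
  have a1 := tendsto_finsetSum Finset.univ fun j _ =>
    tendsto_setIntegral_sq (fun n => (hs n u).dd j) (h1 j u (g j) (hg j))
  have a3 := tendsto_finsetSum Finset.univ fun j _ => tendsto_finsetSum Finset.univ fun k _ =>
    tendsto_finsetSum Finset.univ fun l _ =>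
    tendsto_setIntegral_sq (fun n => (((hs n u).dd j).dd k).dd l)
      (h3 j k l u _ _ _ (hg j) (hg' j k) (hg'' j k l))
  exact le_of_tendsto_of_tendsto' a1 ((a0.add a3).const_mul K) fun n => h _ (hs n u)

end convexSet

/-- The Hilbert space `L²(D) × L²(D)^{2×2}`. -/
abbrev PairSpace (D : Set Plane) : Type := WithLp 2 (L2 D × L2Tensor D 2)

theorem IsWeakDeriv.add {D : Set Plane} {m : ℕ} {u v : L2 D} {g h : L2Tensor D m}
    (hu : IsWeakDeriv D m u g) (hv : IsWeakDeriv D m v h) : IsWeakDeriv D m (u + v) (g + h) :=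
  isWeakDeriv_iff.2 fun φ hφ i => by
    rw [inner_add_left, PiLp.add_apply, inner_add_left, isWeakDeriv_iff.1 hu φ hφ,
      isWeakDeriv_iff.1 hv φ hφ]; ring

theorem IsWeakDeriv.smul {D : Set Plane} {m : ℕ} {u : L2 D} {g : L2Tensor D m}
    (hu : IsWeakDeriv D m u g) (c : ℝ) : IsWeakDeriv D m (c • u) (c • g) :=
  isWeakDeriv_iff.2 fun φ hφ i => by
    rw [real_inner_smul_left, PiLp.smul_apply, real_inner_smul_left, isWeakDeriv_iff.1 hu φ hφ]
    ring

theorem IsWeakDeriv.zero {D : Set Plane} {m : ℕ} : IsWeakDeriv D m (0 : L2 D) 0 :=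
  isWeakDeriv_iff.2 fun φ hφ i => by simp

theorem Hk_add {D : Set Plane} {k : ℕ} {u v : L2 D} (hu : u ∈ Hk D k) (hv : v ∈ Hk D k) :
    u + v ∈ Hk D k := fun m hm => by
  obtain ⟨g, hg⟩ := hu m hm
  obtain ⟨h, hh⟩ := hv m hm
  exact ⟨_, hg.add hh⟩

theorem Hk_smul {D : Set Plane} {k : ℕ} {u : L2 D} (c : ℝ) (hu : u ∈ Hk D k) :
    c • u ∈ Hk D k := fun m hm => by
  obtain ⟨g, hg⟩ := hu m hm
  exact ⟨_, hg.smul c⟩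

theorem Hk_zero {D : Set Plane} {k : ℕ} : (0 : L2 D) ∈ Hk D k := fun _ _ => ⟨_, IsWeakDeriv.zero⟩

theorem Hk_sub {D : Set Plane} {k : ℕ} {u v : L2 D} (hu : u ∈ Hk D k) (hv : v ∈ Hk D k) :
    u - v ∈ Hk D k := by
  rw [sub_eq_add_neg, ← neg_one_smul ℝ v]; exact Hk_add hu (Hk_smul _ hv)

theorem weakDeriv_add {D : Set Plane} (hD : IsOpen D) {m : ℕ} {u v : L2 D} (hu : u ∈ Hk D m)
    (hv : v ∈ Hk D m) : weakDeriv D m (u + v) = weakDeriv D m u + weakDeriv D m v :=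
  ((isWeakDeriv_weakDeriv (hu m le_rfl)).add (isWeakDeriv_weakDeriv (hv m le_rfl))).weakDeriv_eq hD

theorem weakDeriv_smul {D : Set Plane} (hD : IsOpen D) {m : ℕ} {u : L2 D} (c : ℝ)
    (hu : u ∈ Hk D m) : weakDeriv D m (c • u) = c • weakDeriv D m u :=
  ((isWeakDeriv_weakDeriv (hu m le_rfl)).smul c).weakDeriv_eq hD

theorem weakDeriv_sub {D : Set Plane} (hD : IsOpen D) {m : ℕ} {u v : L2 D} (hu : u ∈ Hk D m)
    (hv : v ∈ Hk D m) : weakDeriv D m (u - v) = weakDeriv D m u - weakDeriv D m v := by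
  rw [sub_eq_add_neg, ← neg_one_smul ℝ v, weakDeriv_add hD hu (Hk_smul _ hv),
    weakDeriv_smul hD _ hv, neg_one_smul, ← sub_eq_add_neg]

theorem weakDeriv_zero {D : Set Plane} (hD : IsOpen D) {m : ℕ} : weakDeriv D m (0 : L2 D) = 0 :=
  IsWeakDeriv.zero.weakDeriv_eq hD

/-- The graph of `D²` on `H²(D)`. -/
noncomputable def graph2 (D : Set Plane) : Submodule ℝ (PairSpace D) where
  carrier := {p | p.fst ∈ Hk D 2 ∧ IsWeakDeriv D 2 p.fst p.snd}
  add_mem' := fun ha hb => ⟨Hk_add ha.1 hb.1, ha.2.add hb.2⟩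
  zero_mem' := ⟨Hk_zero, IsWeakDeriv.zero⟩
  smul_mem' := fun c _ h => ⟨Hk_smul c h.1, h.2.smul c⟩

/-- The pair `(v, D² v)`. -/
noncomputable def pair2 (D : Set Plane) (v : L2 D) : PairSpace D :=
  WithLp.toLp 2 (v, weakDeriv D 2 v)

theorem pair2_mem {D : Set Plane} {v : L2 D} (hv : v ∈ Hk D 2) : pair2 D v ∈ graph2 D :=
  ⟨hv, isWeakDeriv_weakDeriv (hv 2 le_rfl)⟩

theorem eq_pair2 {D : Set Plane} (hD : IsOpen D) {p : PairSpace D} (hp : p ∈ graph2 D) :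
    p = pair2 D p.fst := by
  have := hp.2.weakDeriv_eq hD
  rw [pair2, this]; rfl

theorem norm_pair2 {D : Set Plane} (v : L2 D) : ‖pair2 D v‖ = HkNorm D 2 v := by
  have h := WithLp.prod_norm_sq_eq_of_L2 (pair2 D v)
  rw [HkNorm, show ‖v‖ ^ 2 + ‖weakDeriv D 2 v‖ ^ 2 = ‖pair2 D v‖ ^ 2 from h.symm,
    Real.sqrt_sq (norm_nonneg _)]

theorem pair2_add {D : Set Plane} (hD : IsOpen D) {u v : L2 D} (hu : u ∈ Hk D 2)
    (hv : v ∈ Hk D 2) : pair2 D (u + v) = pair2 D u + pair2 D v := by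
  rw [pair2, weakDeriv_add hD hu hv]; rfl

theorem pair2_smul {D : Set Plane} (hD : IsOpen D) {u : L2 D} (c : ℝ) (hu : u ∈ Hk D 2) :
    pair2 D (c • u) = c • pair2 D u := by
  rw [pair2, weakDeriv_smul hD c hu]; rfl

theorem pair2_sub {D : Set Plane} (hD : IsOpen D) {u v : L2 D} (hu : u ∈ Hk D 2)
    (hv : v ∈ Hk D 2) : pair2 D (u - v) = pair2 D u - pair2 D v := by
  rw [pair2, weakDeriv_sub hD hu hv]; rfl

/-- If the pairs `(u_n, D² u_n)` converge, then their limit is a pair `(u, D² u)` and the first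
derivatives converge, too. -/
theorem tendsto_graph2 {D : Set Plane} (hD : IsOpen D) (hconv : Convex ℝ D)
    (hb : Bornology.IsBounded D) (hne : D.Nonempty) {p : ℕ → PairSpace D} {q : PairSpace D}
    (hp : ∀ n, p n ∈ graph2 D) (hq : Tendsto p atTop (𝓝 q)) :
    q ∈ graph2 D ∧ ∀ j, Tendsto (fun n => wd1 D (p n).fst j) atTop (𝓝 (wd1 D q.fst j)) := by
  obtain ⟨K, hK, h⟩ := exists_interp_Hk_two hD hconv hb hne
  have hfst : Tendsto (fun n => (p n).fst) atTop (𝓝 q.fst) :=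
    ((WithLp.fstL 2 ℝ (L2 D) (L2Tensor D 2)).continuous.tendsto q).comp hq
  have hsnd : ∀ i, Tendsto (fun n => (p n).snd i) atTop (𝓝 (q.snd i)) := fun i =>
    ((PiLp.proj (𝕜 := ℝ) 2 (fun _ : Fin 2 → Fin 2 => L2 D) i).continuous.tendsto q.snd).comp
      (((WithLp.sndL 2 ℝ (L2 D) (L2Tensor D 2)).continuous.tendsto q).comp hq)
  -- Interpolation applied to differences makes the gradients a Cauchy sequence; its limit is
  -- identified because weak derivatives are closed under `L²` limits.
  have hbound : ∀ j n m, dist (wd1 D (p n).fst j) (wd1 D (p m).fst j) ≤ √K * dist (p n) (p m) := by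
    intro j n m
    have hmem := (graph2 D).sub_mem (hp n) (hp m)
    have hwd : ∀ j k, wd2 D (p n - p m).fst j k = (p n - p m).snd ![j, k] := fun j k => by
      rw [wd2, hmem.2.weakDeriv_eq hD]
    have h1 := h _ _ _ (hasWD_wd1 (Hk_mono (by norm_num) hmem.1)) (hasWD_wd2 hmem.1) j
    simp only [hwd] at h1
    rw [← norm_tensor2_sq, ← WithLp.prod_norm_sq_eq_of_L2] at h1
    have e : wd1 D (p n - p m).fst j = wd1 D (p n).fst j - wd1 D (p m).fst j :=
      wd1_eq hD (fun j => (hasWD_wd1 (Hk_mono (by norm_num) (hp n).1) j).sub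
        (hasWD_wd1 (Hk_mono (by norm_num) (hp m).1) j)) j
    rw [dist_eq_norm, dist_eq_norm, ← e]
    refine (le_abs_self _).trans (abs_le_of_sq_le_sq ?_ (by positivity))
    rwa [mul_pow, Real.sq_sqrt hK.le]
  have hcau : ∀ j, CauchySeq fun n => wd1 D (p n).fst j := fun j => by
    rw [Metric.cauchySeq_iff]
    intro ε hε
    obtain ⟨N, hN⟩ := Metric.cauchySeq_iff.1 hq.cauchySeq (ε / (√K + 1)) (by positivity)
    refine ⟨N, fun m hm n hn => (hbound j m n).trans_lt ?_⟩
    have h2 := hN m hm n hn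
    rw [lt_div_iff₀ (by positivity)] at h2
    nlinarith [dist_nonneg (x := p m) (y := p n)]
  choose g hg using fun j => cauchySeq_tendsto_of_complete (hcau j)
  have w1 : ∀ j, HasWD D j q.fst (g j) := fun j =>
    HasWD.of_tendsto (fun n => hasWD_wd1 (Hk_mono (by norm_num) (hp n).1) j) hfst (hg j)
  have w2 : ∀ j k, HasWD D k (g j) (q.snd ![j, k]) := fun j k => by
    refine HasWD.of_tendsto (fun n => hasWD_wd2 (hp n).1 j k) (hg j) ((hsnd ![j, k]).congr fun n => ?_)
    rw [wd2, (hp n).2.weakDeriv_eq hD]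
  have hmem := mem_Hk_two w1 w2
  refine ⟨⟨hmem, ?_⟩, fun j => ?_⟩
  · have := isWeakDeriv_two_of w1 w2
    have e : tensor2 (fun j k => q.snd ![j, k]) = q.snd := by
      ext1 i
      have hi : ![i 0, i 1] = i := by ext a; fin_cases a <;> rfl
      rw [tensor2_apply, hi]
    rwa [e] at this
  · rw [wd1_eq hD w1]; exact hg j

theorem isClosed_graph2 {D : Set Plane} (hD : IsOpen D) (hconv : Convex ℝ D)
    (hb : Bornology.IsBounded D) (hne : D.Nonempty) :
    IsClosed (graph2 D : Set (PairSpace D)) :=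
  IsSeqClosed.isClosed fun _ _ hp hq => (tendsto_graph2 hD hconv hb hne hp hq).1

theorem WithLp.norm_fst_le_norm {E F : Type*} [SeminormedAddCommGroup E]
    [SeminormedAddCommGroup F] (p : WithLp 2 (E × F)) : ‖p.fst‖ ≤ ‖p‖ := by
  have := WithLp.prod_norm_sq_eq_of_L2 p
  exact le_of_sq_le_sq (by nlinarith [sq_nonneg ‖p.snd‖]) (norm_nonneg _)

theorem WithLp.norm_snd_le_norm {E F : Type*} [SeminormedAddCommGroup E]
    [SeminormedAddCommGroup F] (p : WithLp 2 (E × F)) : ‖p.snd‖ ≤ ‖p‖ := by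
  have := WithLp.prod_norm_sq_eq_of_L2 p
  exact le_of_sq_le_sq (by nlinarith [sq_nonneg ‖p.fst‖]) (norm_nonneg _)

/-- The trace operator as a function of the pair `(u, D² u)`. -/
noncomputable def traceL (D : Set Plane) : PairSpace D →L[ℝ] StrongDual ℝ (HdivDiv D) :=
  LinearMap.mkContinuous
    { toFun := fun p => ((innerSL ℝ p.fst).comp (WithLp.sndL 2 ℝ (L2Tensor D 2) (L2 D)) -
        (innerSL ℝ p.snd).comp (WithLp.fstL 2 ℝ (L2Tensor D 2) (L2 D))).comp (HdivDiv D).subtypeL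
      map_add' := fun p q => by
        ext Q
        simp only [ContinuousLinearMap.comp_apply, sub_apply,
          add_apply, innerSL_apply_apply, WithLp.add_fst, WithLp.add_snd,
          inner_add_left]
        ring
      map_smul' := fun c p => by
        ext Q
        simp only [ContinuousLinearMap.comp_apply, sub_apply,
          smul_apply, innerSL_apply_apply, WithLp.smul_fst, WithLp.smul_snd,
          real_inner_smul_left, smul_eq_mul, RingHom.id_apply]
        ring } 2 fun p => ContinuousLinearMap.opNorm_le_bound _ (by positivity) fun Q => by
      have h1 := abs_real_inner_le_norm p.fst (Q : WithLp 2 (L2Tensor D 2 × L2 D)).snd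
      have h2 := abs_real_inner_le_norm p.snd (Q : WithLp 2 (L2Tensor D 2 × L2 D)).fst
      have h3 := mul_le_mul (WithLp.norm_fst_le_norm p)
        (WithLp.norm_snd_le_norm (Q : WithLp 2 (L2Tensor D 2 × L2 D))) (norm_nonneg _)
        (norm_nonneg _)
      have h4 := mul_le_mul (WithLp.norm_snd_le_norm p)
        (WithLp.norm_fst_le_norm (Q : WithLp 2 (L2Tensor D 2 × L2 D))) (norm_nonneg _)
        (norm_nonneg _)
      have h5 := abs_sub ⟪p.fst, (Q : WithLp 2 (L2Tensor D 2 × L2 D)).snd⟫_ℝ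
        ⟪p.snd, (Q : WithLp 2 (L2Tensor D 2 × L2 D)).fst⟫_ℝ
      rw [Real.norm_eq_abs]
      refine h5.trans ?_
      rw [Submodule.norm_coe] at *
      linarith

theorem traceL_apply (D : Set Plane) (p : PairSpace D) (Q : HdivDiv D) :
    traceL D p Q = ⟪p.fst, (Q : WithLp 2 (L2Tensor D 2 × L2 D)).snd⟫_ℝ -
      ⟪p.snd, (Q : WithLp 2 (L2Tensor D 2 × L2 D)).fst⟫_ℝ := rfl

theorem traceL_pair2 (D : Set Plane) (u : L2 D) : traceL D (pair2 D u) = trace2 D u := rfl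

end

section

open Filter Metric Topology

/-! ### Edge traces -/

theorem Smc.mem_Hk_two {D : Set Plane} {φ : Plane → ℝ} (h : Smc φ) : toL2 D φ ∈ Hk D 2 :=
  _root_.mem_Hk_two (fun j => HasWD.of_smc h j) fun j k => HasWD.of_smc (h.dd j) k

theorem Smc.wd1 {D : Set Plane} (hD : IsOpen D) {φ : Plane → ℝ} (h : Smc φ) (j : Fin 2) :
    wd1 D (toL2 D φ) j = toL2 D (dd j φ) :=
  wd1_eq hD (fun j => HasWD.of_smc h j) j

theorem wd1_add {D : Set Plane} (hD : IsOpen D) {u v : L2 D} (hu : u ∈ Hk D 1) (hv : v ∈ Hk D 1)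
    (j : Fin 2) : wd1 D (u + v) j = wd1 D u j + wd1 D v j :=
  wd1_eq hD (fun j => (hasWD_wd1 hu j).add (hasWD_wd1 hv j)) j

theorem wd1_smul {D : Set Plane} (hD : IsOpen D) {u : L2 D} (c : ℝ) (hu : u ∈ Hk D 1)
    (j : Fin 2) : wd1 D (c • u) j = c • wd1 D u j :=
  wd1_eq hD (fun j => (hasWD_wd1 hu j).smul c) j

theorem continuous_comp_lineMap {φ : Plane → ℝ} (h : Continuous φ) (a b : Plane) :
    Continuous fun t : ℝ => φ (AffineMap.lineMap a b t) :=
  h.comp AffineMap.lineMap_continuous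

/-- The functions `φ_n` converge to `w` in `H¹(D)` and their values on the segment from `a` to `b`
converge to `g` in `L²`. -/
def EdgeSeq (D : Set Plane) (a b : Plane) (w : L2 D) (g : ℝ → ℝ) (φ : ℕ → Plane → ℝ) : Prop :=
  (∀ n, Smc (φ n)) ∧ Tendsto (fun n => toL2 D (φ n)) atTop (𝓝 w) ∧
    (∀ j, Tendsto (fun n => toL2 D (dd j (φ n))) atTop (𝓝 (wd1 D w j))) ∧
    Tendsto (fun n => ∫ t in (0 : ℝ)..1, (φ n (AffineMap.lineMap a b t) - g t) ^ 2) atTop (𝓝 0)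

theorem HkNorm_sub_smc {D : Set Plane} (hD : IsOpen D) {w : L2 D} (hw : w ∈ Hk D 1)
    {φ : Plane → ℝ} (h : Smc φ) : HkNorm D 1 (w - toL2 D φ) ^ 2 =
      ‖w - toL2 D φ‖ ^ 2 + ∑ j, ‖wd1 D w j - toL2 D (dd j φ)‖ ^ 2 := by
  exact HkNorm_one_sq hD fun j => (hasWD_wd1 hw j).sub (HasWD.of_smc h j)

theorem tendsto_of_norm_sub_le {E : Type*} [SeminormedAddCommGroup E] {w : E} {v : ℕ → E}
    {δ : ℕ → ℝ} (hδ : Tendsto δ atTop (𝓝 0)) (h : ∀ n, ‖w - v n‖ ≤ δ n) :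
    Tendsto v atTop (𝓝 w) := by
  rw [tendsto_iff_norm_sub_tendsto_zero]
  exact squeeze_zero (fun _ => norm_nonneg _) (fun n => (norm_sub_rev _ _).trans_le (h n)) hδ

/-- One sequence serves `H¹` and the edge simultaneously, which makes sums, multiples and limits of
traces accessible. -/
theorem hasEdgeTrace_iff {D : Set Plane} (hD : IsOpen D) {a b : Plane} {w : L2 D} {g : ℝ → ℝ} :
    HasEdgeTrace D a b w g ↔ w ∈ Hk D 1 ∧ ∃ φ, EdgeSeq D a b w g φ := by
  constructor
  · rintro ⟨hw, h⟩
    refine ⟨hw, ?_⟩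
    choose φ hφ1 hφ2 v hv h1 h2 using fun n : ℕ => h (1 / (n + 1)) Nat.one_div_pos_of_nat
    have hs : ∀ n, Smc (φ n) := fun n => ⟨hφ1 n, hφ2 n⟩
    have hδ := tendsto_one_div_add_atTop_nhds_zero_nat (𝕜 := ℝ)
    have key : ∀ n, ‖w - toL2 D (φ n)‖ ^ 2 + ∑ j, ‖wd1 D w j - toL2 D (dd j (φ n))‖ ^ 2 ≤
        (1 / ((n : ℝ) + 1)) ^ 2 := fun n => by
      rw [← HkNorm_sub_smc hD hw (hs n), ← eq_toL2 (hv n)]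
      exact pow_le_pow_left₀ (HkNorm_nonneg _ _ _) (h1 n).le 2
    refine ⟨φ, hs, tendsto_of_norm_sub_le hδ fun n => ?_, fun j => tendsto_of_norm_sub_le hδ
      fun n => ?_, squeeze_zero (fun n => ?_) (fun n => (h2 n).le) hδ⟩
    · refine le_of_sq_le_sq ((key n).trans' (le_add_of_nonneg_right ?_)) (by positivity)
      exact Finset.sum_nonneg fun _ _ => sq_nonneg _
    · refine le_of_sq_le_sq ((key n).trans' ?_) (by positivity)
      refine (Finset.single_le_sum (f := fun j => ‖wd1 D w j - toL2 D (dd j (φ n))‖ ^ 2)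
        (fun _ _ => sq_nonneg _) (Finset.mem_univ j)).trans (le_add_of_nonneg_left (sq_nonneg _))
    · exact intervalIntegral.integral_nonneg zero_le_one fun _ _ => sq_nonneg _
  · rintro ⟨hw, φ, hs, h0, h1, h2⟩
    refine ⟨hw, fun ε hε => ?_⟩
    have l0 : Tendsto (fun n => ‖w - toL2 D (φ n)‖ ^ 2 +
        ∑ j, ‖wd1 D w j - toL2 D (dd j (φ n))‖ ^ 2) atTop (𝓝 0) := by
      have a0 := (((tendsto_const_nhds (x := w)).sub h0).norm.pow 2)
      have a1 := tendsto_finsetSum Finset.univ fun j _ =>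
        (((tendsto_const_nhds (x := wd1 D w j)).sub (h1 j)).norm.pow 2)
      simpa using a0.add a1
    obtain ⟨n, hn1, hn2⟩ := ((l0.eventually_lt_const (show (0 : ℝ) < ε ^ 2 by positivity)).and
      (h2.eventually_lt_const hε)).exists
    refine ⟨φ n, (hs n).1, (hs n).2, toL2 D (φ n), coeFn_toL2 ((hs n).memLp D), ?_, hn2⟩
    rw [← HkNorm_sub_smc hD hw (hs n)] at hn1
    exact lt_of_pow_lt_pow_left₀ 2 hε.le hn1

theorem EdgeSeq.add {D : Set Plane} (hD : IsOpen D) {a b : Plane} {w w' : L2 D} {g g' : ℝ → ℝ}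
    {φ φ' : ℕ → Plane → ℝ} (hw : w ∈ Hk D 1) (hw' : w' ∈ Hk D 1) (hg : Continuous g)
    (hg' : Continuous g') (h : EdgeSeq D a b w g φ) (h' : EdgeSeq D a b w' g' φ') :
    EdgeSeq D a b (w + w') (fun t => g t + g' t) fun n x => φ n x + φ' n x := by
  obtain ⟨hs, h0, h1, h2⟩ := h
  obtain ⟨hs', h0', h1', h2'⟩ := h'
  refine ⟨fun n => (hs n).add (hs' n), (h0.add h0').congr fun n => ?_, fun j => ?_, ?_⟩
  · exact (toL2_add ((hs n).memLp D) ((hs' n).memLp D)).symm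
  · rw [wd1_add hD hw hw']
    refine ((h1 j).add (h1' j)).congr fun n => ?_
    rw [← toL2_add (((hs n).dd j).memLp D) (((hs' n).dd j).memLp D)]
    congr 1
    funext x
    exact (dd_add ((hs n).differentiable x) ((hs' n).differentiable x) j).symm
  · have l := (h2.add h2').const_mul 2
    simp only [add_zero, mul_zero] at l
    refine squeeze_zero (fun n => intervalIntegral.integral_nonneg zero_le_one
      fun _ _ => sq_nonneg _) (fun n => ?_) l
    have c1 : Continuous fun t => (φ n (AffineMap.lineMap a b t) - g t) ^ 2 :=
      ((continuous_comp_lineMap (hs n).continuous a b).sub hg).pow 2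
    have c2 : Continuous fun t => (φ' n (AffineMap.lineMap a b t) - g' t) ^ 2 :=
      ((continuous_comp_lineMap (hs' n).continuous a b).sub hg').pow 2
    rw [← intervalIntegral.integral_add (c1.intervalIntegrable 0 1) (c2.intervalIntegrable 0 1),
      ← intervalIntegral.integral_const_mul]
    refine intervalIntegral.integral_mono_on zero_le_one ?_
      (((c1.add c2).const_mul 2).intervalIntegrable 0 1) fun t _ => ?_
    · exact ((((continuous_comp_lineMap (hs n).continuous a b).add
        (continuous_comp_lineMap (hs' n).continuous a b)).sub (hg.add hg')).pow 2).intervalIntegrable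
          0 1
    · nlinarith [sq_nonneg (φ n (AffineMap.lineMap a b t) - g t -
        (φ' n (AffineMap.lineMap a b t) - g' t))]

theorem EdgeSeq.smul {D : Set Plane} (hD : IsOpen D) {a b : Plane} {w : L2 D} {g : ℝ → ℝ}
    {φ : ℕ → Plane → ℝ} (hw : w ∈ Hk D 1) (c : ℝ) (h : EdgeSeq D a b w g φ) :
    EdgeSeq D a b (c • w) (fun t => c * g t) fun n x => c * φ n x := by
  obtain ⟨hs, h0, h1, h2⟩ := h
  refine ⟨fun n => (hs n).const_mul c, (h0.const_smul c).congr fun n => ?_, fun j => ?_, ?_⟩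
  · exact (toL2_const_mul ((hs n).memLp D) c).symm
  · rw [wd1_smul hD c hw]
    refine ((h1 j).const_smul c).congr fun n => ?_
    rw [← toL2_const_mul (((hs n).dd j).memLp D)]
    congr 1
    funext x
    exact (dd_const_mul ((hs n).differentiable x) c j).symm
  · have l := h2.const_mul (c ^ 2)
    rw [mul_zero] at l
    refine l.congr fun n => ?_
    rw [← intervalIntegral.integral_const_mul]
    congr 1
    funext t
    ring

theorem HasEdgeTrace.add {D : Set Plane} (hD : IsOpen D) {a b : Plane} {w w' : L2 D}
    {g g' : ℝ → ℝ} (hg : Continuous g) (hg' : Continuous g') (h : HasEdgeTrace D a b w g)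
    (h' : HasEdgeTrace D a b w' g') : HasEdgeTrace D a b (w + w') fun t => g t + g' t := by
  rw [hasEdgeTrace_iff hD] at *
  obtain ⟨hw, φ, hφ⟩ := h
  obtain ⟨hw', φ', hφ'⟩ := h'
  exact ⟨Hk_add hw hw', _, hφ.add hD hw hw' hg hg' hφ'⟩

theorem HasEdgeTrace.smul {D : Set Plane} (hD : IsOpen D) {a b : Plane} {w : L2 D}
    {g : ℝ → ℝ} (c : ℝ) (h : HasEdgeTrace D a b w g) :
    HasEdgeTrace D a b (c • w) fun t => c * g t := by
  rw [hasEdgeTrace_iff hD] at *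
  obtain ⟨hw, φ, hφ⟩ := h
  exact ⟨Hk_smul c hw, _, hφ.smul hD hw c⟩

/-- Limits of test functions in `H¹(D)` have the trace zero on every segment outside of `D`. -/
theorem hasEdgeTrace_zero_of_tendsto {D : Set Plane} (hD : IsOpen D) {a b : Plane}
    (hab : ∀ t ∈ Icc (0 : ℝ) 1, AffineMap.lineMap a b t ∉ D) {w : L2 D} (hw : w ∈ Hk D 1)
    {φ : ℕ → Plane → ℝ} (hφ : ∀ n, IsTestFunction D (φ n))
    (h0 : Tendsto (fun n => toL2 D (φ n)) atTop (𝓝 w))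
    (h1 : ∀ j, Tendsto (fun n => toL2 D (dd j (φ n))) atTop (𝓝 (wd1 D w j))) :
    HasEdgeTrace D a b w fun _ => 0 := by
  refine (hasEdgeTrace_iff hD).2 ⟨hw, φ, fun n => (hφ n).smc, h0, h1, ?_⟩
  refine tendsto_const_nhds.congr fun n => ?_
  have e : ∀ t ∈ uIcc (0 : ℝ) 1, (φ n (AffineMap.lineMap a b t) - 0) ^ 2 = 0 := fun t ht => by
    rw [uIcc_of_le zero_le_one] at ht
    rw [(hφ n).eq_zero (hab t ht)]; ring
  rw [intervalIntegral.integral_congr e, intervalIntegral.integral_zero]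

theorem HasPolyEdgeTrace.add {D : Set Plane} (hD : IsOpen D) {a b : Plane} {w w' : L2 D} {p : ℕ}
    (h : HasPolyEdgeTrace D a b w p) (h' : HasPolyEdgeTrace D a b w' p) :
    HasPolyEdgeTrace D a b (w + w') p := by
  obtain ⟨q, hq, h⟩ := h
  obtain ⟨q', hq', h'⟩ := h'
  refine ⟨q + q', (Polynomial.natDegree_add_le _ _).trans (max_le hq hq'), ?_⟩
  simpa only [Polynomial.eval_add] using h.add hD q.continuous q'.continuous h'

theorem HasPolyEdgeTrace.smul {D : Set Plane} (hD : IsOpen D) {a b : Plane} {w : L2 D} {p : ℕ}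
    (c : ℝ) (h : HasPolyEdgeTrace D a b w p) : HasPolyEdgeTrace D a b (c • w) p := by
  obtain ⟨q, hq, h⟩ := h
  refine ⟨Polynomial.C c * q, (Polynomial.natDegree_C_mul_le c q).trans hq, ?_⟩
  simpa only [Polynomial.eval_mul, Polynomial.eval_C] using h.smul hD c

theorem HasEdgeTrace.hasPolyEdgeTrace {D : Set Plane} {a b : Plane} {w : L2 D} (p : ℕ)
    (h : HasEdgeTrace D a b w fun _ => 0) : HasPolyEdgeTrace D a b w p :=
  ⟨0, by simp, by simpa using h⟩

theorem dirDeriv_eq {D : Set Plane} (n : Plane) (v : L2 D) :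
    dirDeriv D n v = ∑ j, n j • wd1 D v j := rfl

theorem dirDeriv_add {D : Set Plane} (hD : IsOpen D) (n : Plane) {u v : L2 D} (hu : u ∈ Hk D 1)
    (hv : v ∈ Hk D 1) : dirDeriv D n (u + v) = dirDeriv D n u + dirDeriv D n v := by
  simp only [dirDeriv_eq, wd1_add hD hu hv, smul_add, Finset.sum_add_distrib]

theorem dirDeriv_smul {D : Set Plane} (hD : IsOpen D) (n : Plane) {u : L2 D} (c : ℝ)
    (hu : u ∈ Hk D 1) : dirDeriv D n (c • u) = c • dirDeriv D n u := by
  simp only [dirDeriv_eq, wd1_smul hD c hu, Finset.smul_sum]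
  exact Finset.sum_congr rfl fun j _ => smul_comm _ _ _

theorem wd1_mem_Hk_one {D : Set Plane} {v : L2 D} (hv : v ∈ Hk D 2) (j : Fin 2) :
    wd1 D v j ∈ Hk D 1 := mem_Hk_one fun k => hasWD_wd2 hv j k

theorem wd1_wd1 {D : Set Plane} (hD : IsOpen D) {v : L2 D} (hv : v ∈ Hk D 2) (j k : Fin 2) :
    wd1 D (wd1 D v j) k = wd2 D v j k := wd1_eq hD (fun k => hasWD_wd2 hv j k) k

/-! ### The local space -/

theorem IsTestFunction.add {D : Set Plane} {φ ψ : Plane → ℝ} (h : IsTestFunction D φ)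
    (h' : IsTestFunction D ψ) : IsTestFunction D fun x => φ x + ψ x :=
  ⟨h.1.add h'.1, h.2.1.add h'.2.1, (tsupport_add φ ψ).trans (union_subset h.2.2 h'.2.2)⟩

theorem IsTestFunction.const_mul {D : Set Plane} {φ : Plane → ℝ} (h : IsTestFunction D φ) (c : ℝ) :
    IsTestFunction D fun x => c * φ x :=
  ⟨contDiff_const.mul h.1, h.2.1.mul_left, (tsupport_mul_subset_right).trans h.2.2⟩

theorem IsTestFunction.zero {D : Set Plane} : IsTestFunction D fun _ => 0 :=
  ⟨contDiff_const, HasCompactSupport.zero, by simp [tsupport, Function.support]⟩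

theorem toL2_zero {D : Set Plane} : toL2 D (fun _ => 0) = 0 :=
  (eq_toL2 (Lp.coeFn_zero _ _ _)).symm

theorem Smc.wd2 {D : Set Plane} (hD : IsOpen D) {φ : Plane → ℝ} (h : Smc φ) (j k : Fin 2) :
    wd2 D (toL2 D φ) j k = toL2 D (dd k (dd j φ)) := by
  rw [← wd1_wd1 hD h.mem_Hk_two, h.wd1 hD, (h.dd j).wd1 hD]

theorem inner_pairSpace {D : Set Plane} (p q : PairSpace D) :
    ⟪p, q⟫_ℝ = ⟪p.fst, q.fst⟫_ℝ + ∑ j, ∑ k, ⟪p.snd ![j, k], q.snd ![j, k]⟫_ℝ := by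
  rw [WithLp.prod_inner_apply, ← sum_fin_two_index fun i => ⟪p.snd i, q.snd i⟫_ℝ]
  rfl

/-- The pairs `(φ, D² φ)` with test functions `φ`. -/
noncomputable def testGraph (D : Set Plane) (hD : IsOpen D) : Submodule ℝ (PairSpace D) where
  carrier := {p | ∃ φ, IsTestFunction D φ ∧ p = pair2 D (toL2 D φ)}
  add_mem' := by
    rintro _ _ ⟨φ, hφ, rfl⟩ ⟨ψ, hψ, rfl⟩
    refine ⟨_, hφ.add hψ, ?_⟩
    rw [toL2_add (hφ.smc.memLp D) (hψ.smc.memLp D),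
      pair2_add hD hφ.smc.mem_Hk_two hψ.smc.mem_Hk_two]
  zero_mem' := by
    refine ⟨_, IsTestFunction.zero, ?_⟩
    rw [toL2_zero, pair2, weakDeriv_zero hD]; rfl
  smul_mem' := by
    rintro c _ ⟨φ, hφ, rfl⟩
    refine ⟨_, hφ.const_mul c, ?_⟩
    rw [toL2_const_mul (hφ.smc.memLp D), pair2_smul hD c hφ.smc.mem_Hk_two]

/-- The functional is continuous and the smooth fields span a dense subspace, so it may be tested
entry by entry with scalar functions. These `ψ` are smooth up to the boundary and not test functions
in `D`. -/
theorem traceL_eq_zero_of {D : Set Plane} {p : PairSpace D}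
    (h : ∀ (j k : Fin 2) (ψ : Plane → ℝ), Smc ψ →
      ⟪p.fst, toL2 D (dd j (dd k ψ))⟫_ℝ = ⟪p.snd ![j, k], toL2 D ψ⟫_ℝ) : traceL D p = 0 := by
  ext Q
  rw [traceL_apply, zero_apply, sub_eq_zero]
  have hQ : (Q : WithLp 2 (L2Tensor D 2 × L2 D)) ∈ closure
      (Submodule.span ℝ (smoothDivDiv D) : Set (WithLp 2 (L2Tensor D 2 × L2 D))) := by
    rw [← Submodule.topologicalClosure_coe]; exact Q.2
  generalize (Q : WithLp 2 (L2Tensor D 2 × L2 D)) = q at hQ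
  refine closure_minimal (t := {q | ⟪p.fst, q.snd⟫_ℝ = ⟪p.snd, q.fst⟫_ℝ}) ?_ ?_ hQ
  · intro q hq
    induction hq using Submodule.span_induction with
    | mem q hq =>
      obtain ⟨Φ, hΦ, hsym, h1, h2⟩ := hq
      have e1 : ∀ i, q.fst i = toL2 D (Φ i) := fun i => eq_toL2 (h1 i)
      have e2 : q.snd = ∑ j, ∑ k, toL2 D (dd j (dd k (Φ ![j, k]))) := by
        have hsm : ∀ j k, MemLp (dd j (dd k (Φ ![j, k]))) 2 (volume.restrict D) := fun j k =>
          ((Smc.dd (f := Φ ![j, k]) (hΦ _) k).dd j).memLp D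
        rw [eq_toL2 h2]
        simp only [Fin.sum_univ_two]
        rw [← toL2_add (hsm 0 0) (hsm 0 1), ← toL2_add (hsm 1 0) (hsm 1 1), ← toL2_add
          (f := fun x => dd 0 (dd 0 (Φ ![0, 0])) x + dd 0 (dd 1 (Φ ![0, 1])) x)
          (g := fun x => dd 1 (dd 0 (Φ ![1, 0])) x + dd 1 (dd 1 (Φ ![1, 1])) x)
          ((hsm 0 0).add (hsm 0 1)) ((hsm 1 0).add (hsm 1 1))]
        congr 1
        funext x
        rw [divDiv, sum_fin_two_index]
        simp only [partialDeriv_two (hΦ _).1, Fin.sum_univ_two]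
        rfl
      show ⟪p.fst, q.snd⟫_ℝ = ⟪p.snd, q.fst⟫_ℝ
      rw [e2, PiLp.inner_apply, sum_fin_two_index fun i => ⟪p.snd i, q.fst i⟫_ℝ]
      simp only [inner_sum, e1]
      exact Finset.sum_congr rfl fun j _ => Finset.sum_congr rfl fun k _ => h j k _ (hΦ _)
    | zero => simp
    | add x y _ _ hx hy =>
      simp only [mem_ofPred_eq, WithLp.add_fst, WithLp.add_snd, inner_add_right] at *
      rw [hx, hy]
    | smul c x _ hx =>
      simp only [mem_ofPred_eq, WithLp.smul_fst, WithLp.smul_snd, real_inner_smul_right] at *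
      rw [hx]
  · exact isClosed_eq (continuous_const.inner (WithLp.sndL 2 ℝ (L2Tensor D 2) (L2 D)).continuous)
      (continuous_const.inner (WithLp.fstL 2 ℝ (L2Tensor D 2) (L2 D)).continuous)

/-- The closure of `testGraph` plays the role of `H₀²(D)`. For a test function two integrations by
parts have no boundary terms, and the kernel of `traceL` is closed. -/
theorem traceL_eq_zero_of_mem_closure {D : Set Plane} (hD : IsOpen D) {p : PairSpace D}
    (hp : p ∈ (testGraph D hD).topologicalClosure) : traceL D p = 0 := by
  refine closure_minimal (s := (testGraph D hD : Set (PairSpace D))) (t := {p | traceL D p = 0}) ?_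
    (isClosed_eq (traceL D).continuous continuous_const) hp
  rintro _ ⟨φ, hφ, rfl⟩
  refine traceL_eq_zero_of fun j k ψ hψ => ?_
  show ⟪toL2 D φ, _⟫_ℝ = ⟪wd2 D (toL2 D φ) j k, _⟫_ℝ
  rw [hφ.smc.wd2 hD, real_inner_comm, real_inner_comm (toL2 D ψ)]
  have h1 := HasWD.of_smc (D := D) (hψ.dd k) j φ hφ
  have h2 := HasWD.of_smc (D := D) hψ k (dd j φ) (hφ.dd j)
  rw [h2, h1, neg_neg]

theorem laplacian_eq_sum_dd {φ : Plane → ℝ} (hφ : ContDiff ℝ ∞ φ) :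
    Laplacian.laplacian φ = fun x => ∑ j, dd j (dd j φ) x := by
  rw [InnerProductSpace.laplacian_eq_iteratedFDeriv_orthonormalBasis φ
    (EuclideanSpace.basisFun (Fin 2) ℝ)]
  funext x
  refine Finset.sum_congr rfl fun j _ => ?_
  have := congrFun (partialDeriv_two hφ ![j, j]) x
  simp only [Matrix.cons_val_zero, Matrix.cons_val_one] at this
  rw [← this, partialDeriv]
  congr 1
  ext a : 1
  fin_cases a <;> simp

theorem laplacian_laplacian_eq {φ : Plane → ℝ} (hφ : Smc φ) :
    Laplacian.laplacian (Laplacian.laplacian φ) =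
      fun x => ∑ j, ∑ k, dd j (dd k (dd k (dd j φ))) x := by
  have e := laplacian_eq_sum_dd hφ.1
  have hs : Smc (Laplacian.laplacian φ) := by
    rw [e]; exact Smc.sum _ fun j => (hφ.dd j).dd j
  rw [laplacian_eq_sum_dd hs.1, e]
  have a : ∀ (l : Fin 2) {f g : Plane → ℝ}, Smc f → Smc g →
      dd l (fun x => f x + g x) = fun x => dd l f x + dd l g x := fun l f g hf hg =>
    funext fun x => dd_add (hf.differentiable x) (hg.differentiable x) l
  have c : ∀ k j, dd k (dd k (dd j (dd j φ))) = dd j (dd k (dd k (dd j φ))) := fun k j => by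
    rw [dd_comm (hφ.dd j).1 k j, dd_comm ((hφ.dd j).dd k).1 k j]
  have s := fun j k => ((hφ.dd j).dd j).dd k
  funext x
  simp only [Fin.sum_univ_two]
  simp only [a _ ((hφ.dd 0).dd 0) ((hφ.dd 1).dd 1), a _ (s 0 0) (s 1 0), a _ (s 0 1) (s 1 1)]
  rw [c 0 1, c 1 0]
  ring

/-- Moving all derivatives onto `φ` gives `(D² v, D² φ) = (v, Δ² φ)`. So the distributional equation
`Δ² v + v = 0` is orthogonality to `testGraph`. -/
theorem inner_pair2_test {D : Set Plane} (hD : IsOpen D) {v : L2 D} (hv : v ∈ Hk D 2)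
    {φ : Plane → ℝ} (hφ : IsTestFunction D φ) : ⟪pair2 D v, pair2 D (toL2 D φ)⟫_ℝ =
      ∫ x in D, v x * (Laplacian.laplacian (Laplacian.laplacian φ) x + φ x) := by
  have hs := hφ.smc
  have h1 : ∀ j k, ⟪wd2 D v j k, toL2 D (dd k (dd j φ))⟫_ℝ =
      ⟪v, toL2 D (dd j (dd k (dd k (dd j φ))))⟫_ℝ := fun j k => by
    have t := (hφ.dd j).dd k
    rw [hasWD_wd1 (Hk_mono (by norm_num) hv) j _ (t.dd k), hasWD_wd2 hv j k _ t, neg_neg]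
  have hi : ∀ {f : Plane → ℝ}, Smc f → Integrable (fun x => v x * f x) (volume.restrict D) :=
    fun hf => (Lp.memLp v).integrable_mul (hf.memLp D)
  have hi4 : ∀ j k, Integrable (fun x => v x * dd j (dd k (dd k (dd j φ))) x)
    (volume.restrict D) := fun j k => hi ((((hs.dd j).dd k).dd k).dd j)
  calc ⟪pair2 D v, pair2 D (toL2 D φ)⟫_ℝ
      = ⟪v, toL2 D φ⟫_ℝ + ∑ j, ∑ k, ⟪wd2 D v j k, wd2 D (toL2 D φ) j k⟫_ℝ := inner_pairSpace _ _
    _ = ∫ x in D, (v x * φ x + ∑ j, ∑ k, v x * dd j (dd k (dd k (dd j φ))) x) := by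
        simp only [hs.wd2 hD, h1]
        rw [integral_add (hi hs) (integrable_finsetSum _ fun j _ => integrable_finsetSum _ fun k _ =>
          hi4 j k), integral_finsetSum _ fun j _ => integrable_finsetSum _ fun k _ => hi4 j k,
          inner_toL2 _ (hs.memLp D)]
        congr 1
        refine Finset.sum_congr rfl fun j _ => ?_
        rw [integral_finsetSum _ fun k _ => hi4 j k]
        exact Finset.sum_congr rfl fun k _ => inner_toL2 _ (((((hs.dd j).dd k).dd k).dd j).memLp D)
    _ = _ := by
        congr 1
        funext x
        rw [laplacian_laplacian_eq hs, mul_add, add_comm]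
        simp only [Finset.mul_sum]

theorem mem_localSpace_iff {s : Finset Plane} {v : L2 (cell s)} : v ∈ localSpace s ↔
    v ∈ Hk (cell s) 2 ∧ (∀ p ∈ testGraph (cell s) isOpen_interior, ⟪pair2 (cell s) v, p⟫_ℝ = 0) ∧
      ∀ a ∈ s, ∀ b ∈ s, a ≠ b → HasPolyEdgeTrace (cell s) a b v 3 ∧
        ∀ n : Plane, ⟪n, b - a⟫_ℝ = 0 →
          HasPolyEdgeTrace (cell s) a b (dirDeriv (cell s) n v) 1 := by
  refine and_congr_right fun hv => and_congr_left fun _ => ?_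
  constructor
  · rintro h _ ⟨φ, hφ, rfl⟩
    exact (inner_pair2_test isOpen_interior hv hφ).trans (h φ hφ)
  · intro h φ hφ
    exact (inner_pair2_test isOpen_interior hv hφ).symm.trans (h _ ⟨φ, hφ, rfl⟩)

theorem localSpace_add {s : Finset Plane} {u v : L2 (cell s)} (hu : u ∈ localSpace s)
    (hv : v ∈ localSpace s) : u + v ∈ localSpace s := by
  have hD : IsOpen (cell s) := isOpen_interior
  rw [mem_localSpace_iff] at *
  have hu1 := Hk_mono one_le_two hu.1
  have hv1 := Hk_mono one_le_two hv.1
  refine ⟨Hk_add hu.1 hv.1, fun p hp => ?_, fun a ha b hb hab => ⟨?_, fun n hn => ?_⟩⟩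
  · rw [pair2_add hD hu.1 hv.1, inner_add_left, hu.2.1 p hp, hv.2.1 p hp, add_zero]
  · exact (hu.2.2 a ha b hb hab).1.add hD (hv.2.2 a ha b hb hab).1
  · rw [dirDeriv_add hD n hu1 hv1]
    exact ((hu.2.2 a ha b hb hab).2 n hn).add hD ((hv.2.2 a ha b hb hab).2 n hn)

theorem localSpace_smul {s : Finset Plane} {u : L2 (cell s)} (c : ℝ) (hu : u ∈ localSpace s) :
    c • u ∈ localSpace s := by
  have hD : IsOpen (cell s) := isOpen_interior
  rw [mem_localSpace_iff] at *
  have hu1 := Hk_mono one_le_two hu.1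
  refine ⟨Hk_smul c hu.1, fun p hp => ?_, fun a ha b hb hab => ⟨?_, fun n hn => ?_⟩⟩
  · rw [pair2_smul hD c hu.1, real_inner_smul_left, hu.2.1 p hp, mul_zero]
  · exact (hu.2.2 a ha b hb hab).1.smul hD c
  · rw [dirDeriv_smul hD n c hu1]
    exact ((hu.2.2 a ha b hb hab).2 n hn).smul hD c

/-! ### Triangles -/

theorem exists_affineBasis {s : Finset Plane} (hc : s.card = 3)
    (hi : AffineIndependent ℝ ((↑) : s → Plane)) :
    ∃ b : AffineBasis (Fin 3) ℝ Plane, range b = s := by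
  let e : Fin 3 ≃ s := (s.equivFinOfCardEq hc).symm
  have h1 : AffineIndependent ℝ fun i => (e i : Plane) := hi.comp_embedding e.toEmbedding
  have h2 : affineSpan ℝ (range fun i => (e i : Plane)) = ⊤ := by
    rw [h1.affineSpan_eq_top_iff_card_eq_finrank_add_one]
    simp
  refine ⟨⟨fun i => (e i : Plane), h1, h2⟩, ?_⟩
  ext x
  constructor
  · rintro ⟨i, rfl⟩; exact (e i).2
  · intro hx; exact ⟨e.symm ⟨x, hx⟩, congrArg Subtype.val (e.apply_symm_apply ⟨x, hx⟩)⟩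

theorem coord_lineMap (b : AffineBasis (Fin 3) ℝ Plane) (a c : Plane) (t : ℝ) (k : Fin 3) :
    b.coord k (AffineMap.lineMap a c t) = (1 - t) * b.coord k a + t * b.coord k c := by
  rw [AffineMap.apply_lineMap, AffineMap.lineMap_apply_ring]

theorem exists_ne_ne : ∀ i j : Fin 3, ∃ k : Fin 3, k ≠ i ∧ k ≠ j := by decide

section triangle

variable {s : Finset Plane} {b : AffineBasis (Fin 3) ℝ Plane} (hb : range b = (s : Set Plane))
include hb

theorem mem_hull_iff {x : Plane} : x ∈ convexHull ℝ (s : Set Plane) ↔ ∀ i, 0 ≤ b.coord i x := by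
  rw [← hb, b.convexHull_eq_nonneg_coord]; rfl

theorem mem_cell_iff {x : Plane} : x ∈ cell s ↔ ∀ i, 0 < b.coord i x := by
  rw [cell, ← hb, b.interior_convexHull]; rfl

theorem cell_nonempty : (cell s).Nonempty :=
  ⟨Finset.univ.centroid ℝ b, (mem_cell_iff hb).2 fun i => by
    rw [b.coord_apply_centroid (Finset.mem_univ i)]; simp⟩

theorem mem_vertices_iff {x : Plane} : x ∈ s ↔ ∃ i, b i = x := by
  rw [← Finset.mem_coe, ← hb]; rfl

theorem lineMap_notMem_cell {a c : Plane} (ha : a ∈ s) (hc : c ∈ s) (t : ℝ) :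
    AffineMap.lineMap a c t ∉ cell s := fun h => by
  obtain ⟨i, rfl⟩ := (mem_vertices_iff hb).1 ha
  obtain ⟨j, rfl⟩ := (mem_vertices_iff hb).1 hc
  obtain ⟨k, hk⟩ := exists_ne_ne i j
  have := (mem_cell_iff hb).1 h k
  rw [coord_lineMap b, b.coord_apply_ne hk.1, b.coord_apply_ne hk.2] at this
  simp at this

end triangle

theorem isOpen_cell (s : Finset Plane) : IsOpen (cell s) := isOpen_interior

theorem convex_cell (s : Finset Plane) : Convex ℝ (cell s) := (convex_convexHull ℝ (s : Set Plane)).interior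

theorem isCompact_hull (s : Finset Plane) : IsCompact (convexHull ℝ (s : Set Plane)) :=
  s.finite_toSet.isCompact_convexHull ℝ

theorem isBounded_cell (s : Finset Plane) : Bornology.IsBounded (cell s) :=
  (isCompact_hull s).isBounded.subset interior_subset

theorem closure_cell {s : Finset Plane} (h : (cell s).Nonempty) :
    closure (cell s) = convexHull ℝ (s : Set Plane) := by
  rw [cell, (convex_convexHull ℝ (s : Set Plane)).closure_interior_eq_closure_of_nonempty_interior h,
    (isCompact_hull s).isClosed.closure_eq]

/-- Orthogonal projection onto the complement of `H₀²` yields a function in the local space with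
the same trace. -/
theorem exists_mem_localSpace {s : Finset Plane} (hne : (cell s).Nonempty)
    (hs : ∀ a ∈ s, ∀ b ∈ s, ∀ t : ℝ, AffineMap.lineMap a b t ∉ cell s) {v : L2 (cell s)}
    (hv : v ∈ Hk (cell s) 2)
    (hedge : ∀ a ∈ s, ∀ b ∈ s, a ≠ b → HasPolyEdgeTrace (cell s) a b v 3 ∧
      ∀ n : Plane, ⟪n, b - a⟫_ℝ = 0 →
        HasPolyEdgeTrace (cell s) a b (dirDeriv (cell s) n v) 1) :
    ∃ w ∈ localSpace s, trace2 (cell s) w = trace2 (cell s) v := by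
  have hD := isOpen_cell s
  -- `v` minus its projection onto this realisation of `H₀²` is orthogonal to all test functions,
  -- hence solves the equation.
  let Z := (testGraph (cell s) hD).topologicalClosure
  have : CompleteSpace Z := (testGraph (cell s) hD).isClosed_topologicalClosure.completeSpace_coe
  let z := Z.starProjection (pair2 (cell s) v)
  have hz : z ∈ Z := Z.starProjection_apply_mem _
  have hzo : pair2 (cell s) v - z ∈ Zᗮ := Submodule.sub_starProjection_mem_orthogonal _
  -- The projection is a limit of test functions together with all derivatives up to order two.
  -- Therefore it and its gradient have zero edge traces, and subtracting it preserves the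
  -- polynomial edge conditions.
  obtain ⟨q, hq, hqz⟩ := mem_closure_iff_seq_limit.1
    (show z ∈ closure (testGraph (cell s) hD : Set (PairSpace (cell s))) from hz)
  choose φ hφ hqφ using hq
  have hqg : ∀ n, q n ∈ graph2 (cell s) := fun n => by
    rw [hqφ]; exact pair2_mem (hφ n).smc.mem_Hk_two
  obtain ⟨hzg, hz1⟩ := tendsto_graph2 hD (convex_cell s) (isBounded_cell s) hne hqg hqz
  have hz0 : Tendsto (fun n => toL2 (cell s) (φ n)) atTop (𝓝 z.fst) := by
    refine (((WithLp.fstL 2 ℝ (L2 (cell s)) (L2Tensor (cell s) 2)).continuous.tendsto z).comp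
      hqz).congr fun n => ?_
    rw [Function.comp_apply, hqφ]; rfl
  have hz1' : ∀ j, Tendsto (fun n => toL2 (cell s) (dd j (φ n))) atTop
      (𝓝 (wd1 (cell s) z.fst j)) := fun j => by
    refine (hz1 j).congr fun n => ?_
    rw [hqφ]; exact (hφ n).smc.wd1 hD j
  have hzH := hzg.1
  have hz2 := (tendsto_graph2 hD (convex_cell s) (isBounded_cell s) hne hqg hqz).1
  have hdd : ∀ j k, Tendsto (fun n => toL2 (cell s) (dd k (dd j (φ n)))) atTop
      (𝓝 (wd1 (cell s) (wd1 (cell s) z.fst j) k)) := fun j k => by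
    have e : wd1 (cell s) (wd1 (cell s) z.fst j) k = z.snd ![j, k] := by
      rw [wd1_wd1 hD hzH, wd2, hzg.2.weakDeriv_eq hD]
    rw [e]
    refine (((PiLp.proj (𝕜 := ℝ) 2 (fun _ : Fin 2 → Fin 2 => L2 (cell s)) ![j, k]).continuous.tendsto
      z.snd).comp (((WithLp.sndL 2 ℝ (L2 (cell s)) (L2Tensor (cell s) 2)).continuous.tendsto
      z).comp hqz)).congr fun n => ?_
    rw [Function.comp_apply, Function.comp_apply, hqφ]
    exact (hφ n).smc.wd2 hD j k
  have t0 : ∀ a ∈ s, ∀ b ∈ s, HasEdgeTrace (cell s) a b z.fst fun _ => 0 := fun a ha b hb =>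
    hasEdgeTrace_zero_of_tendsto hD (fun t _ => hs a ha b hb t) (Hk_mono one_le_two hzH) hφ hz0 hz1'
  have t1 : ∀ a ∈ s, ∀ b ∈ s, ∀ j, HasEdgeTrace (cell s) a b (wd1 (cell s) z.fst j) fun _ => 0 :=
    fun a ha b hb j => hasEdgeTrace_zero_of_tendsto hD (fun t _ => hs a ha b hb t)
      (wd1_mem_Hk_one hzH j) (fun n => (hφ n).dd j) (hz1' j) (hdd j)
  have t2 : ∀ a ∈ s, ∀ b ∈ s, ∀ n : Plane,
      HasEdgeTrace (cell s) a b (dirDeriv (cell s) n z.fst) fun _ => 0 := fun a ha b hb n => by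
    rw [dirDeriv_eq, Fin.sum_univ_two]
    have := ((t1 a ha b hb 0).smul hD (n 0)).add hD (by fun_prop) (by fun_prop)
      ((t1 a ha b hb 1).smul hD (n 1))
    simpa using this
  have ez := eq_pair2 hD hzg
  have esub : v - z.fst = v + (-1 : ℝ) • z.fst := by rw [neg_one_smul, sub_eq_add_neg]
  refine ⟨v - z.fst, mem_localSpace_iff.2 ⟨Hk_sub hv hzH, fun p hp => ?_, fun a ha b hb hab =>
    ⟨?_, fun n hn => ?_⟩⟩, ?_⟩
  · rw [pair2_sub hD hv hzH, ← ez]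
    exact (Submodule.mem_orthogonal' _ _).1 hzo p (Submodule.le_topologicalClosure _ hp)
  · rw [esub]
    exact (hedge a ha b hb hab).1.add hD (((t0 a ha b hb).hasPolyEdgeTrace 3).smul hD _)
  · rw [esub, dirDeriv_add hD n (Hk_mono one_le_two hv) (Hk_smul _ (Hk_mono one_le_two hzH)),
      dirDeriv_smul hD n _ (Hk_mono one_le_two hzH)]
    exact ((hedge a ha b hb hab).2 n hn).add hD (((t2 a ha b hb n).hasPolyEdgeTrace 1).smul hD _)
  -- The trace functional does not change since `Z` lies in the kernel of `traceL`.
  · rw [← traceL_pair2, ← traceL_pair2, pair2_sub hD hv hzH, ← ez, map_sub,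
      traceL_eq_zero_of_mem_closure hD hz, sub_zero]

end

section

open Filter Metric Topology

/-! ### The Gauss–Green formula on triangles -/

theorem forall_fin_three_of_ne : ∀ {i j k : Fin 3}, i ≠ j → i ≠ k → j ≠ k → ∀ l, l = i ∨ l = j ∨ l = k := by
  decide

/-- The open reference triangle. -/
def refTriangle : Set (ℝ × ℝ) := {p | 0 < p.1 ∧ 0 < p.2 ∧ p.1 + p.2 < 1}

theorem isOpen_refTriangle : IsOpen refTriangle :=
  (isOpen_lt continuous_const continuous_fst).inter ((isOpen_lt continuous_const continuous_snd).inter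
    (isOpen_lt (continuous_fst.add continuous_snd) continuous_const))

/-- Affine parametrisation of the plane. -/
def affineParam (o a c : Plane) (p : ℝ × ℝ) : Plane := o + (p.1 • (a - o) + p.2 • (c - o))

theorem continuous_affineParam (o a c : Plane) : Continuous (affineParam o a c) := by
  unfold affineParam; fun_prop

theorem coord_affineParam (b : AffineBasis (Fin 3) ℝ Plane) (i j k l : Fin 3) (p : ℝ × ℝ) :
    b.coord l (affineParam (b i) (b j) (b k) p) = (1 - p.1 - p.2) * b.coord l (b i) +
      p.1 * b.coord l (b j) + p.2 * b.coord l (b k) := by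
  have h : ∀ x y : Plane, b.coord l (y - x + x) = (b.coord l).linear (y - x) + b.coord l x :=
    fun x y => (b.coord l).map_vadd x (y - x)
  have h1 := h (b i) (b j)
  have h2 := h (b i) (b k)
  rw [sub_add_cancel] at h1 h2
  have h3 := (b.coord l).map_vadd (b i) (p.1 • (b j - b i) + p.2 • (b k - b i))
  simp only [vadd_eq_add, map_add, map_smul, smul_eq_mul] at h3
  rw [affineParam, add_comm, h3, h1, h2]
  ring

/-- The Jacobian enters only as some nonzero constant, so it is taken from the uniqueness of Haar
measure instead of a determinant. The barycentric coordinates of the parametrised point identify the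
preimage of the cell. -/
theorem exists_setIntegral_cell_eq {s : Finset Plane} {b : AffineBasis (Fin 3) ℝ Plane}
    (hb : range b = (s : Set Plane)) {i j k : Fin 3} (hij : i ≠ j) (hik : i ≠ k) (hjk : j ≠ k) :
    ∃ m : ℝ, m ≠ 0 ∧ ∀ F : Plane → ℝ, ∫ x in cell s, F x =
      m * ∫ p in refTriangle, F (affineParam (b i) (b j) (b k) p) := by
  let L : ℝ × ℝ →ₗ[ℝ] Plane := (LinearMap.fst ℝ ℝ ℝ).smulRight (b j - b i) +
    (LinearMap.snd ℝ ℝ ℝ).smulRight (b k - b i)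
  have hL : ∀ p, affineParam (b i) (b j) (b k) p = b i + L p := fun p => rfl
  have hc : ∀ l p, b.coord l (b i + L p) = (1 - p.1 - p.2) * b.coord l (b i) +
      p.1 * b.coord l (b j) + p.2 * b.coord l (b k) := fun l p => coord_affineParam b i j k l p
  have hci : ∀ p, b.coord i (b i + L p) = 1 - p.1 - p.2 := fun p => by
    rw [hc, b.coord_apply_eq, b.coord_apply_ne hij, b.coord_apply_ne hik]; ring
  have hcj : ∀ p, b.coord j (b i + L p) = p.1 := fun p => by
    rw [hc, b.coord_apply_eq, b.coord_apply_ne hij.symm, b.coord_apply_ne hjk]; ring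
  have hck : ∀ p, b.coord k (b i + L p) = p.2 := fun p => by
    rw [hc, b.coord_apply_eq, b.coord_apply_ne hik.symm, b.coord_apply_ne hjk.symm]; ring
  have hinj : Function.Injective L := fun p q h => by
    refine Prod.ext ?_ ?_
    · rw [← hcj p, ← hcj q, h]
    · rw [← hck p, ← hck q, h]
  let E : (ℝ × ℝ) ≃L[ℝ] Plane :=
    (LinearMap.linearEquivOfInjective L hinj (by simp)).toContinuousLinearEquiv
  have hE : ∀ p, E p = L p := fun p => rfl
  have : (Measure.map E (volume : Measure (ℝ × ℝ))).IsAddHaarMeasure :=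
    E.isAddHaarMeasure_map volume
  have hcE := Measure.isAddLeftInvariant_eq_smul (volume : Measure Plane)
    (Measure.map E (volume : Measure (ℝ × ℝ)))
  have hc0 := Measure.addHaarScalarFactor_pos_of_isAddHaarMeasure (volume : Measure Plane)
    (Measure.map E (volume : Measure (ℝ × ℝ)))
  generalize Measure.addHaarScalarFactor (volume : Measure Plane)
    (Measure.map E (volume : Measure (ℝ × ℝ))) = c at hcE hc0
  refine ⟨c, by exact_mod_cast hc0.ne', fun F => ?_⟩
  have hmem : ∀ p, b i + E p ∈ cell s ↔ p ∈ refTriangle := fun p => by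
    rw [mem_cell_iff hb, hE]
    constructor
    · intro h
      have h1 := h i
      have h2 := h j
      have h3 := h k
      rw [hci] at h1
      rw [hcj] at h2
      rw [hck] at h3
      exact ⟨h2, h3, by linarith⟩
    · rintro ⟨h2, h3, h1⟩ l
      rcases forall_fin_three_of_ne hij hik hjk l with rfl | rfl | rfl
      · rw [hci]; linarith
      · rwa [hcj]
      · rwa [hck]
  rw [← integral_indicator (isOpen_cell s).measurableSet,
    ← integral_add_left_eq_self (μ := (volume : Measure Plane)) _ (b i), hcE,
    integral_smul_nnreal_measure, NNReal.smul_def, smul_eq_mul]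
  congr 1
  have hme : MeasurableEmbedding E := E.toHomeomorph.measurableEmbedding
  rw [hme.integral_map, ← integral_indicator isOpen_refTriangle.measurableSet]
  congr 1
  funext p
  by_cases hp : p ∈ refTriangle
  · rw [indicator_of_mem hp, indicator_of_mem ((hmem p).2 hp)]; rfl
  · rw [indicator_of_notMem hp, indicator_of_notMem fun h => hp ((hmem p).1 h)]

theorem setIntegral_refTriangle {F : ℝ × ℝ → ℝ} (hF : Continuous F) :
    ∫ p in refTriangle, F p = ∫ y in (0 : ℝ)..1, ∫ x in (0 : ℝ)..(1 - y), F (x, y) := by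
  have hbd : IntegrableOn F refTriangle := by
    refine (hF.continuousOn.integrableOn_compact
      ((isCompact_Icc (a := (0 : ℝ)) (b := 1)).prod (isCompact_Icc (a := (0 : ℝ)) (b := 1)))).mono_set
      fun p hp => ⟨⟨hp.1.le, ?_⟩, ⟨hp.2.1.le, ?_⟩⟩
    · linarith [hp.2.1, hp.2.2]
    · linarith [hp.1, hp.2.2]
  rw [← integral_indicator isOpen_refTriangle.measurableSet]
  have hi : Integrable (refTriangle.indicator F) ((volume : Measure ℝ).prod volume) :=
    (integrable_indicator_iff isOpen_refTriangle.measurableSet).2 hbd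
  rw [Measure.volume_eq_prod, integral_prod_symm _ hi, intervalIntegral.integral_of_le zero_le_one,
    integral_Ioc_eq_integral_Ioo, ← integral_indicator measurableSet_Ioo]
  congr 1
  funext y
  by_cases hy : y ∈ Ioo (0 : ℝ) 1
  · rw [indicator_of_mem hy, intervalIntegral.integral_of_le (by linarith [hy.2]),
      integral_Ioc_eq_integral_Ioo, ← integral_indicator measurableSet_Ioo]
    congr 1
    funext x
    by_cases hx : x ∈ Ioo (0 : ℝ) (1 - y)
    · rw [indicator_of_mem hx, indicator_of_mem]
      exact ⟨hx.1, hy.1, by show x + y < 1; linarith [hx.2]⟩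
    · rw [indicator_of_notMem hx, indicator_of_notMem]
      exact fun h => hx ⟨h.1, by linarith [show x + y < 1 from h.2.2]⟩
  · rw [indicator_of_notMem hy]
    refine integral_eq_zero_of_ae (.of_forall fun x => ?_)
    refine indicator_of_notMem ?_ _
    exact fun h => hy ⟨h.2.1, by linarith [show x + y < 1 from h.2.2, show 0 < x from h.1]⟩

/-- Gauss–Green for the derivative in the direction of an edge. -/
theorem exists_setIntegral_fderiv_eq {s : Finset Plane} {b : AffineBasis (Fin 3) ℝ Plane}
    (hb : range b = (s : Set Plane)) {i j k : Fin 3} (hij : i ≠ j) (hik : i ≠ k) (hjk : j ≠ k) :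
    ∃ m : ℝ, m ≠ 0 ∧ ∀ g, Smc g → ∫ x in cell s, fderiv ℝ g x (b j - b i) =
      m * ((∫ t in (0 : ℝ)..1, g (AffineMap.lineMap (b j) (b k) t)) -
        ∫ t in (0 : ℝ)..1, g (AffineMap.lineMap (b i) (b k) t)) := by
  obtain ⟨m, hm, h⟩ := exists_setIntegral_cell_eq hb hij hik hjk
  refine ⟨m, hm, fun g hg => ?_⟩
  have hg' : Continuous fun x => fderiv ℝ g x (b j - b i) :=
    (hg.1.continuous_fderiv (by simp)).clm_apply continuous_const
  rw [h, setIntegral_refTriangle (F := fun p => fderiv ℝ g (affineParam (b i) (b j) (b k) p)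
    (b j - b i)) (hg'.comp (continuous_affineParam _ _ _)), ← intervalIntegral.integral_sub
    ((continuous_comp_lineMap hg.continuous _ _).intervalIntegrable 0 1)
    ((continuous_comp_lineMap hg.continuous _ _).intervalIntegrable 0 1)]
  congr 1
  refine intervalIntegral.integral_congr fun y _ => ?_
  have hd : ∀ x, HasDerivAt (fun x => g (affineParam (b i) (b j) (b k) (x, y)))
      (fderiv ℝ g (affineParam (b i) (b j) (b k) (x, y)) (b j - b i)) x := fun x => by
    refine (hg.differentiable _).hasFDerivAt.comp_hasDerivAt x ?_
    have := (((hasDerivAt_id x).smul_const (b j - b i)).add_const (y • (b k - b i))).const_add (b i)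
    simp only [one_smul] at this
    exact this
  have hcont : Continuous fun x => fderiv ℝ g (affineParam (b i) (b j) (b k) (x, y)) (b j - b i) :=
    hg'.comp ((continuous_affineParam _ _ _).comp (by fun_prop))
  -- For fixed `y` the fundamental theorem of calculus is applied in the direction `b j - b i`. The
  -- end `x = 1 - y` lies on the edge from `b j` to `b k`, the end `x = 0` on the edge from `b i` to
  -- `b k`.
  show ∫ x in (0 : ℝ)..(1 - y), _ = _
  rw [intervalIntegral.integral_eq_sub_of_hasDerivAt (fun x _ => hd x)
    (hcont.intervalIntegrable _ _)]
  congr 2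
  · simp only [affineParam, AffineMap.lineMap_apply_module]; module
  · simp only [affineParam, AffineMap.lineMap_apply_module]; module

end

section

open Filter Metric Topology

/-! ### Barycentric coordinates and the trace inequality -/

/-- The linear part of a barycentric coordinate. -/
noncomputable def coordL (b : AffineBasis (Fin 3) ℝ Plane) (i : Fin 3) : Plane →L[ℝ] ℝ :=
  LinearMap.toContinuousLinearMap (b.coord i).linear

theorem coord_sub (b : AffineBasis (Fin 3) ℝ Plane) (i : Fin 3) (x y : Plane) :
    b.coord i y - b.coord i x = coordL b i (y - x) :=
  ((b.coord i).linearMap_vsub y x).symm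

theorem hasFDerivAt_coord (b : AffineBasis (Fin 3) ℝ Plane) (i : Fin 3) (x : Plane) :
    HasFDerivAt (b.coord i) (coordL b i) x := by
  have h : (b.coord i : Plane → ℝ) = fun y => coordL b i y + b.coord i 0 := funext fun y => by
    have := coord_sub b i 0 y
    rw [sub_zero] at this; linarith
  rw [h]
  exact (coordL b i).hasFDerivAt.add_const _

theorem contDiff_coord (b : AffineBasis (Fin 3) ℝ Plane) (i : Fin 3) :
    ContDiff ℝ ∞ (b.coord i) := by
  have h : (b.coord i : Plane → ℝ) = fun y => coordL b i y + b.coord i 0 := funext fun y => by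
    have := coord_sub b i 0 y
    rw [sub_zero] at this; linarith
  rw [h]
  exact (coordL b i).contDiff.add contDiff_const

theorem sum_coordL (b : AffineBasis (Fin 3) ℝ Plane) (v : Plane) : ∑ i, coordL b i v = 0 := by
  have h : ∀ i, coordL b i v = b.coord i v - b.coord i 0 := fun i => by rw [coord_sub, sub_zero]
  simp only [h, Finset.sum_sub_distrib, b.sum_coord_apply_eq_one, sub_self]

theorem sum_coordL_smul (b : AffineBasis (Fin 3) ℝ Plane) (v : Plane) :
    ∑ i, coordL b i v • b i = v := by
  have h : ∀ i, coordL b i v = b.coord i v - b.coord i 0 := fun i => by rw [coord_sub, sub_zero]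
  simp only [h, sub_smul, Finset.sum_sub_distrib, b.linear_combination_coord_eq_self, sub_zero]

theorem sum_coordL_smul_sub (b : AffineBasis (Fin 3) ℝ Plane) (v x : Plane) :
    ∑ i, coordL b i v • (b i - x) = v := by
  simp only [smul_sub, Finset.sum_sub_distrib, sum_coordL_smul, ← Finset.sum_smul, sum_coordL,
    zero_smul, sub_zero]

theorem coord_mem_Icc {b : AffineBasis (Fin 3) ℝ Plane} {x : Plane} (hx : ∀ i, 0 ≤ b.coord i x) (i : Fin 3) :
    b.coord i x ∈ Icc (0 : ℝ) 1 := by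
  refine ⟨hx i, ?_⟩
  rw [← b.sum_coord_apply_eq_one x]
  exact Finset.single_le_sum (f := fun i => b.coord i x) (fun i _ => hx i) (Finset.mem_univ i)

theorem tendsto_integral_mul_zero {ψ : ℝ → ℝ} (hψ : Continuous ψ) {f : ℕ → ℝ → ℝ}
    (hf : ∀ n, Continuous (f n))
    (h : Tendsto (fun n => ∫ t in (0 : ℝ)..1, f n t ^ 2) atTop (𝓝 0)) :
    Tendsto (fun n => ∫ t in (0 : ℝ)..1, ψ t * f n t) atTop (𝓝 0) := by
  obtain ⟨B, hB⟩ := isCompact_Icc.exists_bound_of_continuousOn (s := Icc (0 : ℝ) 1) hψ.continuousOn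
  have l := (h.const_mul (B ^ 2)).sqrt
  rw [mul_zero, Real.sqrt_zero] at l
  refine squeeze_zero_norm (fun n => Real.le_sqrt_of_sq_le ?_) l
  rw [Real.norm_eq_abs, sq_abs]
  refine (sq_intervalIntegral_le (hψ.mul (hf n))).trans ?_
  rw [← intervalIntegral.integral_const_mul]
  refine intervalIntegral.integral_mono_on zero_le_one
    (((hψ.mul (hf n)).pow 2).intervalIntegrable 0 1)
    ((continuous_const.mul ((hf n).pow 2)).intervalIntegrable 0 1) fun t ht => ?_
  simp only [Pi.mul_apply]
  rw [mul_pow]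
  refine mul_le_mul_of_nonneg_right ?_ (sq_nonneg _)
  rw [← sq_abs]
  exact pow_le_pow_left₀ (abs_nonneg _) (hB t ht) 2

/-- The Gauss–Green formula above is available only in edge directions. Edges issuing from one
vertex span the plane, so this is enough for both partial derivatives. -/
theorem eq_zero_of_edges {b : AffineBasis (Fin 3) ℝ Plane} {X : Fin 2 → ℝ}
    (h : ∀ i j : Fin 3, i ≠ j → ∑ l, (b j - b i) l * X l = 0) (l : Fin 2) : X l = 0 := by
  let B : Plane →ₗ[ℝ] ℝ :=
    { toFun := fun v => ∑ l, v l * X l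
      map_add' := fun u v => by simp only [PiLp.add_apply, add_mul, Finset.sum_add_distrib]
      map_smul' := fun c v => by
        simp only [PiLp.smul_apply, smul_eq_mul, Finset.mul_sum, mul_assoc, RingHom.id_apply] }
  have hB : ∀ v, B v = ∑ l, v l * X l := fun v => rfl
  have h0 : ∀ v, B v = 0 := fun v => by
    rw [← sum_coordL_smul_sub b v (b 0), map_sum]
    refine Finset.sum_eq_zero fun i _ => ?_
    rw [map_smul, hB]
    rcases eq_or_ne i 0 with rfl | hi
    · simp
    · rw [h 0 i hi.symm, smul_zero]
  have := h0 (EuclideanSpace.single l 1)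
  rw [hB] at this
  simpa using this

/-- The squared norm of `H¹(D)` for smooth functions. -/
noncomputable def energy1 (D : Set Plane) (g : Plane → ℝ) : ℝ :=
  (∫ x in D, g x ^ 2) + ∑ l, ∫ x in D, dd l g x ^ 2

theorem energy1_eq {D : Set Plane} {g : Plane → ℝ} (hg : Smc g) :
    energy1 D g = ‖toL2 D g‖ ^ 2 + ∑ l, ‖toL2 D (dd l g)‖ ^ 2 := by
  rw [energy1, norm_toL2_sq (hg.memLp D)]
  simp only [norm_toL2_sq ((hg.dd _).memLp D)]

section triangle

variable {s : Finset Plane} {b : AffineBasis (Fin 3) ℝ Plane} (hb : range b = (s : Set Plane))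
include hb

/-- Gauss–Green for `λ_j g²` in the direction `b j - b i`, with `λ_j` the barycentric coordinate of
`b j`. It vanishes on the edge from `b i` to `b k`, equals `1 - t` on the edge from `b j` to `b k`,
and has directional derivative 1. -/
theorem exists_weighted_trace_le {i j k : Fin 3} (hij : i ≠ j) (hik : i ≠ k) (hjk : j ≠ k) :
    ∃ C > 0, ∀ g, Smc g → ∫ t in (0 : ℝ)..1, (1 - t) * g (AffineMap.lineMap (b j) (b k) t) ^ 2 ≤
      C * energy1 (cell s) g := by
  obtain ⟨m, hm, h⟩ := exists_setIntegral_fderiv_eq hb hij hik hjk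
  set v := b j - b i with hv
  refine ⟨|m|⁻¹ * (1 + 2 * ‖v‖), by positivity, fun g hg => ?_⟩
  have hs : Smc fun x => b.coord j x * (g x * g x) := (hg.mul hg).mul_left (contDiff_coord b j)
  have h1 := h _ hs
  have e1 : ∀ t, b.coord j (AffineMap.lineMap (b j) (b k) t) = 1 - t := fun t => by
    rw [coord_lineMap, b.coord_apply_eq, b.coord_apply_ne hjk]; ring
  have e2 : ∀ t, b.coord j (AffineMap.lineMap (b i) (b k) t) = 0 := fun t => by
    rw [coord_lineMap, b.coord_apply_ne hij.symm, b.coord_apply_ne hjk]; ring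
  simp only [e1, e2, zero_mul, intervalIntegral.integral_zero, sub_zero, ← pow_two] at h1
  have hd : ∀ x, fderiv ℝ (fun x => b.coord j x * g x ^ 2) x v =
      g x ^ 2 + 2 * b.coord j x * g x * ∑ l, v l * dd l g x := fun x => by
    have hg' := (hg.differentiable x).hasFDerivAt
    have hfd : HasFDerivAt (fun x => b.coord j x * g x ^ 2) _ x :=
      (hasFDerivAt_coord b j x).mul (hg'.pow 2)
    rw [hfd.fderiv, ← fderiv_eq_sum_dd]
    have hj : coordL b j v = 1 := by
      rw [hv, ← coord_sub, b.coord_apply_eq, b.coord_apply_ne hij.symm, sub_zero]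
    simp [hj]
    ring
  simp only [hd] at h1
  have key : |∫ x in cell s, (g x ^ 2 + 2 * b.coord j x * g x * ∑ l, v l * dd l g x)| ≤
      (1 + 2 * ‖v‖) * energy1 (cell s) g := by
    have hi0 : Integrable (fun x => g x ^ 2) (volume.restrict (cell s)) := (hg.memLp _).integrable_sq
    have hi1 : ∀ l, Integrable (fun x => dd l g x ^ 2) (volume.restrict (cell s)) :=
      fun l => ((hg.dd l).memLp _).integrable_sq
    have hi : Integrable (fun x => (1 + 2 * ‖v‖) * (g x ^ 2 + ∑ l, dd l g x ^ 2))
      (volume.restrict (cell s)) := (hi0.add (integrable_finsetSum Finset.univ fun l _ => hi1 l)).const_mul (1 + 2 * ‖v‖)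
    have e : (1 + 2 * ‖v‖) * energy1 (cell s) g =
        ∫ x in cell s, (1 + 2 * ‖v‖) * (g x ^ 2 + ∑ l, dd l g x ^ 2) := by
      rw [integral_const_mul, integral_add hi0 (integrable_finsetSum Finset.univ fun l _ => hi1 l),
        integral_finsetSum _ fun l _ => hi1 l, energy1]
    rw [e, ← Real.norm_eq_abs]
    refine norm_integral_le_of_norm_le hi ((ae_restrict_iff' (isOpen_cell s).measurableSet).2
      (.of_forall fun x hx => ?_))
    have hc := coord_mem_Icc (fun i => ((mem_cell_iff hb).1 hx i).le) j
    have h2 : |∑ l, v l * dd l g x| ≤ ‖v‖ * ∑ l, |dd l g x| := by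
      rw [Finset.mul_sum]
      refine (Finset.abs_sum_le_sum_abs _ _).trans (Finset.sum_le_sum fun l _ => ?_)
      rw [abs_mul]
      exact mul_le_mul_of_nonneg_right (plane_abs_apply_le v l) (abs_nonneg _)
    have h3 : |2 * b.coord j x * g x * ∑ l, v l * dd l g x| ≤
        2 * |g x| * (‖v‖ * ∑ l, |dd l g x|) := by
      rw [abs_mul, abs_mul, abs_mul, abs_of_nonneg hc.1, abs_two]
      refine mul_le_mul ?_ h2 (abs_nonneg _) (by positivity)
      nlinarith [abs_nonneg (g x), hc.1, hc.2]
    rw [Real.norm_eq_abs]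
    refine (abs_add_le _ _).trans ?_
    rw [abs_of_nonneg (sq_nonneg (g x))]
    have h4 : 2 * |g x| * ∑ l, |dd l g x| ≤ 2 * (g x ^ 2 + ∑ l, dd l g x ^ 2) := by
      simp only [Fin.sum_univ_two]
      have := sq_nonneg (|g x| - |dd 0 g x|)
      have := sq_nonneg (|g x| - |dd 1 g x|)
      have := sq_abs (g x)
      have := sq_abs (dd 0 g x)
      have := sq_abs (dd 1 g x)
      nlinarith [sq_nonneg (dd 0 g x), sq_nonneg (dd 1 g x)]
    have h5 := mul_le_mul_of_nonneg_left h4 (norm_nonneg v)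
    have h6 : 0 ≤ ∑ l, dd l g x ^ 2 := Finset.sum_nonneg fun _ _ => sq_nonneg _
    nlinarith [h3]
  rw [h1, abs_mul] at key
  rw [mul_assoc, ← div_eq_inv_mul, le_div_iff₀ (abs_pos.2 hm), mul_comm]
  exact (mul_le_mul_of_nonneg_left (le_abs_self _) (abs_nonneg m)).trans key

/-- Exchanging the roles of the two endpoints gives the weight `t`, and `(1 - t) + t = 1`. -/
theorem exists_trace_le {j k : Fin 3} (hjk : j ≠ k) :
    ∃ C > 0, ∀ g, Smc g → ∫ t in (0 : ℝ)..1, g (AffineMap.lineMap (b j) (b k) t) ^ 2 ≤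
      C * energy1 (cell s) g := by
  obtain ⟨i, hij, hik⟩ := exists_ne_ne j k
  obtain ⟨C, hC, h⟩ := exists_weighted_trace_le hb hij hik hjk
  obtain ⟨C', hC', h'⟩ := exists_weighted_trace_le hb hik hij hjk.symm
  refine ⟨C + C', by positivity, fun g hg => ?_⟩
  have h1 := h g hg
  have h2 := h' g hg
  have e := intervalIntegral.integral_comp_sub_left (a := 0) (b := 1)
    (fun t => (1 - t) * g (AffineMap.lineMap (b k) (b j) t) ^ 2) 1
  simp only [sub_sub_cancel, sub_self, sub_zero, AffineMap.lineMap_apply_one_sub] at e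
  rw [← e] at h2
  have hc := (continuous_comp_lineMap hg.continuous (b j) (b k)).pow 2
  rw [add_mul]
  refine le_trans (le_of_eq ?_) (add_le_add h1 h2)
  rw [← intervalIntegral.integral_add]
  · congr 1; funext t; ring
  · exact ((continuous_const.sub continuous_id).mul hc).intervalIntegrable 0 1
  · exact (continuous_id.mul hc).intervalIntegrable 0 1

/-- The edge traces of smooth functions converging in `H¹` converge to the edge trace. -/
theorem HasEdgeTrace.tendsto {j k : Fin 3} (hjk : j ≠ k) {w : L2 (cell s)} {g : ℝ → ℝ}
    (hg : Continuous g) (h : HasEdgeTrace (cell s) (b j) (b k) w g) {φ : ℕ → Plane → ℝ}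
    (hφ : ∀ n, Smc (φ n)) (h0 : Tendsto (fun n => toL2 (cell s) (φ n)) atTop (𝓝 w))
    (h1 : ∀ l, Tendsto (fun n => toL2 (cell s) (dd l (φ n))) atTop (𝓝 (wd1 (cell s) w l))) :
    Tendsto (fun n => ∫ t in (0 : ℝ)..1, (φ n (AffineMap.lineMap (b j) (b k) t) - g t) ^ 2) atTop
      (𝓝 0) := by
  obtain ⟨C, hC, hT⟩ := exists_trace_le hb hjk
  obtain ⟨hw, ψ, hψ, g0, g1, g2⟩ := (hasEdgeTrace_iff (isOpen_cell s)).1 h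
  -- The given sequence and the one defining the trace differ by a null sequence in `H¹`, whose edge
  -- values tend to zero by the trace inequality.
  have l0 : Tendsto (fun n => energy1 (cell s) fun x => φ n x - ψ n x) atTop (𝓝 0) := by
    have a0 := ((h0.sub g0).norm.pow 2)
    have a1 := tendsto_finsetSum Finset.univ fun l _ => (((h1 l).sub (g1 l)).norm.pow 2)
    have a2 := a0.add a1
    simp only [sub_self, norm_zero, ne_eq, OfNat.ofNat_ne_zero, not_false_eq_true, zero_pow,
      Finset.sum_const_zero, add_zero] at a2
    refine a2.congr fun n => ?_
    rw [energy1_eq ((hφ n).sub (hψ n)), (hφ n).toL2_sub (hψ n)]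
    simp only [(hφ n).dd_sub (hψ n), ((hφ n).dd _).toL2_sub ((hψ n).dd _)]
  have l := ((l0.const_mul C).add g2).const_mul 2
  simp only [mul_zero, add_zero] at l
  refine squeeze_zero (fun n => intervalIntegral.integral_nonneg zero_le_one
    fun _ _ => sq_nonneg _) (fun n => ?_) l
  refine le_trans ?_ (mul_le_mul_of_nonneg_left (add_le_add_left (hT _ ((hφ n).sub (hψ n))) _)
    zero_le_two)
  have c1 : Continuous fun t => (φ n (AffineMap.lineMap (b j) (b k) t) -
      ψ n (AffineMap.lineMap (b j) (b k) t)) ^ 2 :=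
    (continuous_comp_lineMap ((hφ n).sub (hψ n)).continuous _ _).pow 2
  have c2 : Continuous fun t => (ψ n (AffineMap.lineMap (b j) (b k) t) - g t) ^ 2 :=
    ((continuous_comp_lineMap (hψ n).continuous _ _).sub hg).pow 2
  have c3 : Continuous fun t => (φ n (AffineMap.lineMap (b j) (b k) t) - g t) ^ 2 :=
    ((continuous_comp_lineMap (hφ n).continuous _ _).sub hg).pow 2
  rw [← intervalIntegral.integral_add (c1.intervalIntegrable 0 1) (c2.intervalIntegrable 0 1),
    ← intervalIntegral.integral_const_mul]
  refine intervalIntegral.integral_mono_on zero_le_one (c3.intervalIntegrable 0 1)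
    (((c1.add c2).const_mul 2).intervalIntegrable 0 1) fun t _ => ?_
  nlinarith [sq_nonneg (φ n (AffineMap.lineMap (b j) (b k) t) -
      ψ n (AffineMap.lineMap (b j) (b k) t) - (ψ n (AffineMap.lineMap (b j) (b k) t) - g t))]

/-- Functions in `H¹` of a triangle with zero edge traces can be integrated by parts without
boundary terms. -/
theorem inner_toL2_dd_eq_neg {w : L2 (cell s)}
    (h : ∀ i j : Fin 3, i ≠ j → HasEdgeTrace (cell s) (b i) (b j) w fun _ => 0)
    {ψ : Plane → ℝ} (hψ : Smc ψ) (l : Fin 2) :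
    ⟪w, toL2 (cell s) (dd l ψ)⟫_ℝ = -⟪wd1 (cell s) w l, toL2 (cell s) ψ⟫_ℝ := by
  obtain ⟨hw, φ, hφ, h0, h1, -⟩ := (hasEdgeTrace_iff (isOpen_cell s)).1 (h 0 1 (by decide))
  have ht : ∀ i j : Fin 3, i ≠ j → Tendsto (fun n => ∫ t in (0 : ℝ)..1,
      ψ (AffineMap.lineMap (b i) (b j) t) * φ n (AffineMap.lineMap (b i) (b j) t)) atTop (𝓝 0) := by
    intro i j hij
    refine tendsto_integral_mul_zero (continuous_comp_lineMap hψ.continuous _ _)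
      (fun n => continuous_comp_lineMap (hφ n).continuous _ _) ?_
    simpa using (h i j hij).tendsto hb hij continuous_const hφ h0 h1
  rw [← sub_eq_zero, sub_neg_eq_add]
  -- For `ψ φ_n` the Gauss–Green formula in an edge direction has only integrals over the two other
  -- edges; these tend to zero as the traces of `φ_n` do.
  refine eq_zero_of_edges (b := b) (X := fun l => ⟪w, toL2 (cell s) (dd l ψ)⟫_ℝ +
    ⟪wd1 (cell s) w l, toL2 (cell s) ψ⟫_ℝ) (fun i j hij => ?_) l
  obtain ⟨k, hki, hkj⟩ := exists_ne_ne i j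
  obtain ⟨m, -, hm⟩ := exists_setIntegral_fderiv_eq hb hij hki.symm hkj.symm
  have a1 := ((ht j k hkj.symm).sub (ht i k hki.symm)).const_mul m
  rw [sub_zero, mul_zero] at a1
  have a2 := tendsto_finsetSum Finset.univ fun l _ => ((h0.inner (tendsto_const_nhds
    (x := toL2 (cell s) (dd l ψ)))).add ((h1 l).inner (tendsto_const_nhds
      (x := toL2 (cell s) ψ)))).const_mul ((b j - b i) l)
  refine tendsto_nhds_unique a2 (a1.congr fun n => ?_)
  rw [← hm _ (hψ.mul (hφ n))]
  have hi : ∀ {f g : Plane → ℝ}, Smc f → Smc g → Integrable (fun x => f x * g x)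
    (volume.restrict (cell s)) := fun hf hg => (hf.mul hg).integrable
  have e : ∀ x, fderiv ℝ (fun x => ψ x * φ n x) x (b j - b i) =
      ∑ l, (b j - b i) l * (φ n x * dd l ψ x + dd l (φ n) x * ψ x) := fun x => by
    rw [fderiv_eq_sum_dd]
    refine Finset.sum_congr rfl fun l _ => ?_
    rw [dd_mul (hψ.differentiable x) ((hφ n).differentiable x)]
    ring
  simp only [e]
  have hterm : ∀ l, Integrable (fun x => (b j - b i) l * (φ n x * dd l ψ x + dd l (φ n) x * ψ x))
      (volume.restrict (cell s)) := fun l =>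
    ((hi (hφ n) (hψ.dd l)).add (hi ((hφ n).dd l) hψ)).const_mul _
  rw [integral_finsetSum _ fun l _ => hterm l]
  refine Finset.sum_congr rfl fun l _ => ?_
  rw [integral_const_mul, integral_add (hi (hφ n) (hψ.dd l)) (hi ((hφ n).dd l) hψ),
    inner_toL2_toL2 ((hφ n).memLp _) ((hψ.dd l).memLp _),
    inner_toL2_toL2 (((hφ n).dd l).memLp _) (hψ.memLp _)]

end triangle

end

section

open Filter Metric Topology

/-! ### Vanishing traces -/

/-- The integral of the derivative of `(t - 1/2) f²`, with Young's inequality for the mixed term.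
The factor `η` in front of the derivative can be made small, so endpoint values tend to zero if `f_n
→ 0` in `L²` and the derivatives are merely bounded. -/
theorem add_sq_endpoints_le {f f' : ℝ → ℝ} (hf : ∀ t, HasDerivAt f (f' t) t) (hf' : Continuous f')
    {η : ℝ} (hη : 0 < η) : (f 0 ^ 2 + f 1 ^ 2) / 2 ≤
      (1 + η⁻¹) * (∫ t in (0 : ℝ)..1, f t ^ 2) + η * ∫ t in (0 : ℝ)..1, f' t ^ 2 := by
  have hc : Continuous f := continuous_iff_continuousAt.2 fun t => (hf t).continuousAt
  have hd : ∀ t, HasDerivAt (fun t => (t - 1 / 2) * f t ^ 2)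
      (f t ^ 2 + (2 * t - 1) * (f t * f' t)) t := fun t => by
    have := ((hasDerivAt_id t).sub_const (1 / 2 : ℝ)).mul ((hf t).pow 2)
    refine this.congr_deriv ?_
    simp; ring
  have hcd : Continuous fun t => f t ^ 2 + (2 * t - 1) * (f t * f' t) := by fun_prop
  have e := intervalIntegral.integral_eq_sub_of_hasDerivAt (a := 0) (b := 1) (fun t _ => hd t)
    (hcd.intervalIntegrable 0 1)
  have e' : (f 0 ^ 2 + f 1 ^ 2) / 2 =
      ∫ t in (0 : ℝ)..1, (f t ^ 2 + (2 * t - 1) * (f t * f' t)) := by rw [e]; ring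
  have c1 : Continuous fun t => f t ^ 2 := by fun_prop
  have c2 : Continuous fun t => f' t ^ 2 := by fun_prop
  rw [e', ← intervalIntegral.integral_const_mul, ← intervalIntegral.integral_const_mul,
    ← intervalIntegral.integral_add ((c1.const_mul _).intervalIntegrable 0 1)
      ((c2.const_mul _).intervalIntegrable 0 1)]
  refine intervalIntegral.integral_mono_on zero_le_one (hcd.intervalIntegrable 0 1)
    (((c1.const_mul _).add (c2.const_mul _)).intervalIntegrable 0 1) fun t ht => ?_
  have h1 : (2 * t - 1) * (f t * f' t) ≤ |f t| * |f' t| := by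
    rw [← abs_mul]
    refine (le_abs_self _).trans ?_
    rw [abs_mul]
    refine mul_le_of_le_one_left (abs_nonneg _) (abs_le.2 ⟨?_, ?_⟩) <;> linarith [ht.1, ht.2]
  have h2 : |f t| * |f' t| ≤ η⁻¹ * f t ^ 2 + η * f' t ^ 2 := by
    have h3 : 0 ≤ η⁻¹ * (|f t| - η * |f' t|) ^ 2 := by positivity
    have h4 : η⁻¹ * (|f t| - η * |f' t|) ^ 2 =
        η⁻¹ * f t ^ 2 + η * f' t ^ 2 - 2 * (|f t| * |f' t|) := by
      rw [← sq_abs (f t), ← sq_abs (f' t)]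
      field_simp
      ring
    have : 0 ≤ |f t| * |f' t| := by positivity
    linarith
  linarith

/-- If `f_n → 0` in `L²` and the derivatives form a Cauchy sequence, then they converge to zero. -/
theorem tendsto_integral_deriv_sq {f f' f'' : ℕ → ℝ → ℝ} (hf : ∀ n t, HasDerivAt (f n) (f' n t) t)
    (hf' : ∀ n t, HasDerivAt (f' n) (f'' n t) t) (hf'' : ∀ n, Continuous (f'' n))
    (h0 : Tendsto (fun n => ∫ t in (0 : ℝ)..1, f n t ^ 2) atTop (𝓝 0))
    (hC : ∀ ε > 0, ∃ N, ∀ n ≥ N, ∀ m ≥ N, ∫ t in (0 : ℝ)..1, (f' n t - f' m t) ^ 2 ≤ ε) :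
    Tendsto (fun n => ∫ t in (0 : ℝ)..1, f' n t ^ 2) atTop (𝓝 0) := by
  have c0 : ∀ n, Continuous (f n) := fun n => continuous_iff_continuousAt.2 fun t =>
    (hf n t).continuousAt
  have c1 : ∀ n, Continuous (f' n) := fun n => continuous_iff_continuousAt.2 fun t =>
    (hf' n t).continuousAt
  have ii : ∀ {g : ℝ → ℝ}, Continuous g → IntervalIntegrable g volume 0 1 :=
    fun hg => hg.intervalIntegrable 0 1
  obtain ⟨N₁, hN₁⟩ := hC 1 one_pos
  set S := 2 * (∫ t in (0 : ℝ)..1, f' N₁ t ^ 2) + 2 with hS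
  have hSn : 0 ≤ ∫ t in (0 : ℝ)..1, f' N₁ t ^ 2 :=
    intervalIntegral.integral_nonneg zero_le_one fun _ _ => sq_nonneg _
  have hbd : ∀ n ≥ N₁, ∫ t in (0 : ℝ)..1, f' n t ^ 2 ≤ S := fun n hn => by
    have d1 := c1 n
    have d2 := c1 N₁
    have e1 : Continuous fun t => 2 * f' N₁ t ^ 2 := by fun_prop
    have e2 : Continuous fun t => 2 * (f' n t - f' N₁ t) ^ 2 := by fun_prop
    have h1 : ∫ t in (0 : ℝ)..1, f' n t ^ 2 ≤
        ∫ t in (0 : ℝ)..1, (2 * f' N₁ t ^ 2 + 2 * (f' n t - f' N₁ t) ^ 2) :=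
      intervalIntegral.integral_mono_on zero_le_one (ii (d1.pow 2)) (ii (e1.add e2))
        fun t _ => by nlinarith [sq_nonneg (2 * f' N₁ t - f' n t)]
    rw [intervalIntegral.integral_add (ii e1) (ii e2), intervalIntegral.integral_const_mul,
      intervalIntegral.integral_const_mul] at h1
    have h2 := hN₁ n hn N₁ le_rfl
    linarith
  -- The choice of `η` bounds the derivative term by `ε / 4`; the remaining term tends to zero with
  -- `f n`.
  have hend : Tendsto (fun n => f n 0 ^ 2 + f n 1 ^ 2) atTop (𝓝 0) := by
    rw [Metric.tendsto_atTop]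
    intro ε hε
    set η := ε / (4 * (S + 1)) with hη
    have hηp : 0 < η := by positivity
    have hηS : η * S ≤ ε / 4 := by
      rw [hη, div_mul_eq_mul_div, div_le_div_iff₀ (by positivity) (by norm_num)]
      nlinarith
    obtain ⟨N₂, hN₂⟩ := eventually_atTop.1 ((h0.const_mul (1 + η⁻¹)).eventually_lt_const
      (show (1 + η⁻¹) * 0 < ε / 4 by rw [mul_zero]; positivity))
    refine ⟨max N₁ N₂, fun n hn => ?_⟩
    have h1 := add_sq_endpoints_le (hf n) (c1 n) hηp
    have h2 := hN₂ n ((le_max_right _ _).trans hn)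
    have h3 := mul_le_mul_of_nonneg_left (hbd n ((le_max_left _ _).trans hn)) hηp.le
    rw [Real.dist_0_eq_abs, abs_of_nonneg (by positivity)]
    linarith
  have hsq := hend.sqrt
  rw [Real.sqrt_zero] at hsq
  have hend0 : Tendsto (fun n => f n 0) atTop (𝓝 0) :=
    squeeze_zero_norm (fun n => Real.abs_le_sqrt (le_add_of_nonneg_right (sq_nonneg _))) hsq
  have hend1 : Tendsto (fun n => f n 1) atTop (𝓝 0) :=
    squeeze_zero_norm (fun n => Real.abs_le_sqrt (le_add_of_nonneg_left (sq_nonneg _))) hsq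
  -- For fixed `n`, integration by parts moves the derivative off `f m`; boundary terms and integral
  -- tend to zero. This is weak convergence of `f' m` to zero, tested with `f' n` only.
  have hmix : ∀ n, Tendsto (fun m => ∫ t in (0 : ℝ)..1, f' n t * f' m t) atTop (𝓝 0) := fun n => by
    have l := ((hend1.const_mul (f' n 1)).sub (hend0.const_mul (f' n 0))).sub
      (tendsto_integral_mul_zero (hf'' n) c0 h0)
    simp only [mul_zero, sub_zero] at l
    refine l.congr fun m => ?_
    rw [intervalIntegral.integral_mul_deriv_eq_deriv_mul (fun t _ => hf' n t) (fun t _ => hf m t)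
      (ii (hf'' n)) (ii (c1 m))]
  rw [Metric.tendsto_atTop]
  intro ε hε
  obtain ⟨N₂, hN₂⟩ := hC (ε / 2) (by positivity)
  refine ⟨N₂, fun n hn => ?_⟩
  have l1 : ∀ᶠ m in atTop, 2 * ∫ t in (0 : ℝ)..1, f' n t * f' m t < ε / 4 :=
    ((hmix n).const_mul 2).eventually_lt_const (by rw [mul_zero]; positivity)
  obtain ⟨m, hm, hm1⟩ := (l1.and (eventually_ge_atTop N₂)).exists
  have h2 := hN₂ n hn m hm1
  have d1 := c1 n
  have d2 := c1 m
  have e1 : Continuous fun t => (f' n t - f' m t) ^ 2 := by fun_prop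
  have e2 : Continuous fun t => 2 * (f' n t * f' m t) := by fun_prop
  -- `‖f'_n‖² ≤ ‖f'_n - f'_m‖² + 2 (f'_n, f'_m)`: the first term is small by the Cauchy property,
  -- the second for suitable `m`.
  have h3 : ∫ t in (0 : ℝ)..1, f' n t ^ 2 ≤
      ∫ t in (0 : ℝ)..1, ((f' n t - f' m t) ^ 2 + 2 * (f' n t * f' m t)) :=
    intervalIntegral.integral_mono_on zero_le_one (ii (d1.pow 2)) (ii (e1.add e2)) fun t _ => by
      nlinarith [sq_nonneg (f' m t)]
  rw [intervalIntegral.integral_add (ii e1) (ii e2), intervalIntegral.integral_const_mul] at h3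
  rw [Real.dist_0_eq_abs, abs_of_nonneg (intervalIntegral.integral_nonneg zero_le_one
    fun _ _ => sq_nonneg _)]
  linarith

section triangle

variable {s : Finset Plane} {b : AffineBasis (Fin 3) ℝ Plane} (hb : range b = (s : Set Plane))
include hb

/-- Vanishing traces of `v` and of a normal derivative imply vanishing traces of the gradient. -/
theorem hasEdgeTrace_wd1_zero {j k : Fin 3} (hjk : j ≠ k) {v : L2 (cell s)} (hv : v ∈ Hk (cell s) 2)
    (h : HasEdgeTrace (cell s) (b j) (b k) v fun _ => 0) {n : Plane} (hn0 : n ≠ 0)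
    (hn : ⟪n, b k - b j⟫_ℝ = 0)
    (h' : HasEdgeTrace (cell s) (b j) (b k) (dirDeriv (cell s) n v) fun _ => 0) (l : Fin 2) :
    HasEdgeTrace (cell s) (b j) (b k) (wd1 (cell s) v l) fun _ => 0 := by
  have hD := isOpen_cell s
  have hv1 := Hk_mono one_le_two hv
  obtain ⟨M, hs, h0, h1, h2, -⟩ := exists_smoothing hD (convex_cell s) (isBounded_cell s)
    (cell_nonempty hb)
  obtain ⟨C, hC, hT⟩ := exists_trace_le hb hjk
  set φ : ℕ → Plane → ℝ := fun m => M m v with hφ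
  have φs : ∀ m, Smc (φ m) := fun m => hs m v
  have t0 : Tendsto (fun m => toL2 (cell s) (φ m)) atTop (𝓝 v) := h0 v
  have t1 : ∀ i, Tendsto (fun m => toL2 (cell s) (dd i (φ m))) atTop (𝓝 (wd1 (cell s) v i)) :=
    fun i => h1 i _ _ (hasWD_wd1 hv1 i)
  have t2 : ∀ i i', Tendsto (fun m => toL2 (cell s) (dd i' (dd i (φ m)))) atTop
      (𝓝 (wd1 (cell s) (wd1 (cell s) v i) i')) := fun i i' => by
    rw [wd1_wd1 hD hv]; exact h2 i i' _ _ _ (hasWD_wd1 hv1 i) (hasWD_wd2 hv i i')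
  have ii : ∀ {g : ℝ → ℝ}, Continuous g → IntervalIntegrable g volume 0 1 :=
    fun hg => hg.intervalIntegrable 0 1
  set τ := b k - b j with hτ
  set L : ℝ → Plane := fun t => AffineMap.lineMap (b j) (b k) t with hL
  have hLeq : ∀ t, L t = b j + t • τ := fun t => by
    simp only [hL, AffineMap.lineMap_apply_module', hτ, add_comm]
  -- The gradients converge in `H¹` of the triangle, so by the trace inequality their edge values
  -- form a Cauchy sequence in `L²`, although the limit is not yet known.
  have hcau : ∀ i, ∀ ε > 0, ∃ N, ∀ m ≥ N, ∀ m' ≥ N,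
      ∫ t in (0 : ℝ)..1, (dd i (φ m) (L t) - dd i (φ m') (L t)) ^ 2 ≤ ε := fun i ε hε => by
    have hc : ∀ δ > 0, ∃ N, ∀ m ≥ N, ∀ m' ≥ N,
        energy1 (cell s) (fun x => dd i (φ m) x - dd i (φ m') x) ≤ δ := fun δ hδ => by
      have c0 := Metric.cauchySeq_iff.1 (t1 i).cauchySeq (√(δ / 3)) (by positivity)
      have c1 := fun i' => Metric.cauchySeq_iff.1 (t2 i i').cauchySeq (√(δ / 3)) (by positivity)
      obtain ⟨N, hN⟩ := c0
      choose N' hN' using c1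
      refine ⟨max N (max (N' 0) (N' 1)), fun m hm m' hm' => ?_⟩
      simp only [ge_iff_le, max_le_iff] at hm hm'
      have a0 := hN m hm.1 m' hm'.1
      have a1 := hN' 0 m hm.2.1 m' hm'.2.1
      have a2 := hN' 1 m hm.2.2 m' hm'.2.2
      rw [dist_eq_norm, Real.lt_sqrt (norm_nonneg _)] at a0 a1 a2
      rw [energy1_eq (((φs m).dd i).sub ((φs m').dd i)), ((φs m).dd i).toL2_sub ((φs m').dd i)]
      simp only [((φs m).dd i).dd_sub ((φs m').dd i),
        (((φs m).dd i).dd _).toL2_sub (((φs m').dd i).dd _), Fin.sum_univ_two]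
      linarith
    obtain ⟨N, hN⟩ := hc (ε / C) (by positivity)
    refine ⟨N, fun m hm m' hm' => (hT _ (((φs m).dd i).sub ((φs m').dd i))).trans ?_⟩
    refine (mul_le_mul_of_nonneg_left (hN m hm m' hm') hC.le).trans (le_of_eq ?_)
    field_simp
  have cL : Continuous L := AffineMap.lineMap_continuous
  have cd : ∀ i m, Continuous fun t => dd i (φ m) (L t) := fun i m =>
    ((φs m).dd i).continuous.comp cL
  have two_sq : ∀ x y : ℝ, (x + y) ^ 2 ≤ 2 * x ^ 2 + 2 * y ^ 2 := fun x y => by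
    nlinarith [sq_nonneg (x - y)]
  -- The tangential derivative on the edge is the derivative of the edge values, which tend to zero;
  -- with the Cauchy property its limit is zero.
  have htan : Tendsto (fun m => ∫ t in (0 : ℝ)..1, (∑ i, τ i * dd i (φ m) (L t)) ^ 2) atTop
      (𝓝 0) := by
    refine tendsto_integral_deriv_sq (f := fun m t => φ m (L t))
      (f'' := fun m t => ∑ i, ∑ i', τ i * τ i' * dd i' (dd i (φ m)) (L t))
      (fun m t => ?_) (fun m t => ?_) (fun m => ?_) ?_ fun ε hε => ?_
    · simp only [hLeq]; exact (φs m).hasDerivAt_line _ _ t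
    · simp only [hLeq]; exact (φs m).hasDerivAt_line_two _ _ t
    · exact continuous_finsetSum _ fun i _ => continuous_finsetSum _ fun i' _ =>
        continuous_const.mul ((((φs m).dd i).dd i').continuous.comp cL)
    · simpa using h.tendsto hb hjk continuous_const φs t0 t1
    · obtain ⟨N₀, hN₀⟩ := hcau 0 (ε / (4 * (τ 0 ^ 2 + 1))) (by positivity)
      obtain ⟨N₁, hN₁⟩ := hcau 1 (ε / (4 * (τ 1 ^ 2 + 1))) (by positivity)
      refine ⟨max N₀ N₁, fun m hm m' hm' => ?_⟩
      have a0 := hN₀ m ((le_max_left _ _).trans hm) m' ((le_max_left _ _).trans hm')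
      have a1 := hN₁ m ((le_max_right _ _).trans hm) m' ((le_max_right _ _).trans hm')
      have d0 := cd 0 m
      have d0' := cd 0 m'
      have d1 := cd 1 m
      have d1' := cd 1 m'
      have e0 : Continuous fun t => 2 * τ 0 ^ 2 * (dd 0 (φ m) (L t) - dd 0 (φ m') (L t)) ^ 2 := by
        fun_prop
      have e1 : Continuous fun t => 2 * τ 1 ^ 2 * (dd 1 (φ m) (L t) - dd 1 (φ m') (L t)) ^ 2 := by
        fun_prop
      simp only [Fin.sum_univ_two]
      have hle : ∫ t in (0 : ℝ)..1, (τ 0 * dd 0 (φ m) (L t) + τ 1 * dd 1 (φ m) (L t) -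
          (τ 0 * dd 0 (φ m') (L t) + τ 1 * dd 1 (φ m') (L t))) ^ 2 ≤
          ∫ t in (0 : ℝ)..1, (2 * τ 0 ^ 2 * (dd 0 (φ m) (L t) - dd 0 (φ m') (L t)) ^ 2 +
            2 * τ 1 ^ 2 * (dd 1 (φ m) (L t) - dd 1 (φ m') (L t)) ^ 2) := by
        refine intervalIntegral.integral_mono_on zero_le_one (ii (by fun_prop)) (ii (e0.add e1))
          fun t _ => ?_
        have := two_sq (τ 0 * (dd 0 (φ m) (L t) - dd 0 (φ m') (L t)))
          (τ 1 * (dd 1 (φ m) (L t) - dd 1 (φ m') (L t)))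
        nlinarith
      rw [intervalIntegral.integral_add (ii e0) (ii e1), intervalIntegral.integral_const_mul,
        intervalIntegral.integral_const_mul] at hle
      have b0 : 2 * τ 0 ^ 2 * (ε / (4 * (τ 0 ^ 2 + 1))) ≤ ε / 2 := by
        rw [mul_div_assoc', div_le_div_iff₀ (by positivity) two_pos]; nlinarith
      have b1 : 2 * τ 1 ^ 2 * (ε / (4 * (τ 1 ^ 2 + 1))) ≤ ε / 2 := by
        rw [mul_div_assoc', div_le_div_iff₀ (by positivity) two_pos]; nlinarith
      have g0 := mul_le_mul_of_nonneg_left a0 (show 0 ≤ 2 * τ 0 ^ 2 by positivity)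
      have g1 := mul_le_mul_of_nonneg_left a1 (show 0 ≤ 2 * τ 1 ^ 2 by positivity)
      linarith
  -- The combination with coefficients `n` converges in `H¹` to the directional derivative, whose
  -- trace vanishes by hypothesis.
  have hnor : Tendsto (fun m => ∫ t in (0 : ℝ)..1, (∑ i, n i * dd i (φ m) (L t)) ^ 2) atTop
      (𝓝 0) := by
    have hd1 : dirDeriv (cell s) n v ∈ Hk (cell s) 1 := h'.1
    have ns : ∀ m, Smc fun x => ∑ i, n i * dd i (φ m) x := fun m =>
      Smc.sum _ fun i => ((φs m).dd i).const_mul (n i)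
    have key : ∀ {ψ : ℕ → Fin 2 → Plane → ℝ} {w : Fin 2 → L2 (cell s)}, (∀ m i, Smc (ψ m i)) →
        (∀ i, Tendsto (fun m => toL2 (cell s) (ψ m i)) atTop (𝓝 (w i))) →
        Tendsto (fun m => toL2 (cell s) fun x => ∑ i, n i * ψ m i x) atTop (𝓝 (∑ i, n i • w i)) := by
      intro ψ w hψ hw
      refine (tendsto_finsetSum Finset.univ fun i _ => (hw i).const_smul (n i)).congr fun m => ?_
      simp only [Fin.sum_univ_two]
      rw [toL2_add (((hψ m 0).const_mul _).memLp _) (((hψ m 1).const_mul _).memLp _),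
        toL2_const_mul ((hψ m 0).memLp _), toL2_const_mul ((hψ m 1).memLp _)]
    have e1 : ∀ i', wd1 (cell s) (dirDeriv (cell s) n v) i' =
        ∑ i, n i • wd1 (cell s) (wd1 (cell s) v i) i' := fun i' => by
      rw [dirDeriv_eq]
      simp only [Fin.sum_univ_two]
      rw [wd1_add hD (Hk_smul _ (wd1_mem_Hk_one hv 0)) (Hk_smul _ (wd1_mem_Hk_one hv 1)),
        wd1_smul hD _ (wd1_mem_Hk_one hv 0), wd1_smul hD _ (wd1_mem_Hk_one hv 1)]
    have := h'.tendsto hb hjk continuous_const ns (key (fun m i => (φs m).dd i) t1) fun i' => by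
      rw [e1]
      refine (key (ψ := fun m i => dd i' (dd i (φ m))) (fun m i => ((φs m).dd i).dd i')
        fun i => t2 i i').congr fun m => ?_
      congr 1
      funext x
      simp only [Fin.sum_univ_two]
      rw [dd_add ((((φs m).dd 0).const_mul _).differentiable x)
        ((((φs m).dd 1).const_mul _).differentiable x),
        dd_const_mul (((φs m).dd 0).differentiable x), dd_const_mul (((φs m).dd 1).differentiable x)]
    simpa using this
  have hτ0 : τ ≠ 0 := sub_ne_zero.2 fun e => hjk (b.ind.injective e.symm)
  -- The tangent and the vector orthogonal to it form a basis, so every partial derivative is a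
  -- combination of the two directional ones.
  obtain ⟨α, β, hαβ⟩ : ∃ α β : ℝ, ∀ X : Fin 2 → ℝ,
      X l = α * (∑ i, τ i * X i) + β * ∑ i, n i * X i := by
    have hτ2 : 0 < τ 0 ^ 2 + τ 1 ^ 2 := by
      have := EuclideanSpace.real_norm_sq_eq τ
      rw [Fin.sum_univ_two] at this
      rw [← this]; have := norm_pos_iff.2 hτ0; positivity
    have hn2 : 0 < n 0 ^ 2 + n 1 ^ 2 := by
      have := EuclideanSpace.real_norm_sq_eq n
      rw [Fin.sum_univ_two] at this
      rw [← this]; have := norm_pos_iff.2 hn0; positivity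
    have hort : n 0 * τ 0 + n 1 * τ 1 = 0 := by
      have := hn
      rw [PiLp.inner_apply, Fin.sum_univ_two] at this
      simp only [RCLike.inner_apply, conj_trivial] at this
      linarith
    refine ⟨τ l / (τ 0 ^ 2 + τ 1 ^ 2), n l / (n 0 ^ 2 + n 1 ^ 2), fun X => ?_⟩
    obtain ⟨c, h0, h1⟩ : ∃ c, n 0 = -c * τ 1 ∧ n 1 = c * τ 0 := by
      refine ⟨(n 1 * τ 0 - n 0 * τ 1) / (τ 0 ^ 2 + τ 1 ^ 2), ?_, ?_⟩
      · rw [neg_mul, div_mul_eq_mul_div, ← neg_div, eq_div_iff hτ2.ne']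
        linear_combination τ 0 * hort
      · rw [div_mul_eq_mul_div, eq_div_iff hτ2.ne']
        linear_combination τ 1 * hort
    rw [Fin.sum_univ_two, Fin.sum_univ_two, div_mul_eq_mul_div, div_mul_eq_mul_div,
      div_add_div _ _ hτ2.ne' hn2.ne', eq_div_iff (mul_pos hτ2 hn2).ne']
    fin_cases l
    · simp only [Fin.zero_eta, h0, h1]; ring
    · simp only [Fin.mk_one, h0, h1]; ring
  refine (hasEdgeTrace_iff hD).2 ⟨wd1_mem_Hk_one hv l, fun m => dd l (φ m), fun m => (φs m).dd l,
    t1 l, t2 l, ?_⟩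
  have lim := (htan.const_mul (2 * α ^ 2)).add (hnor.const_mul (2 * β ^ 2))
  simp only [mul_zero, add_zero] at lim
  refine squeeze_zero (fun m => intervalIntegral.integral_nonneg zero_le_one
    fun _ _ => sq_nonneg _) (fun m => ?_) lim
  have d0 := cd 0 m
  have d1 := cd 1 m
  have dl := cd l m
  simp only [Fin.sum_univ_two] at hαβ ⊢
  have e0 : Continuous fun t => 2 * α ^ 2 * (τ 0 * dd 0 (φ m) (L t) + τ 1 * dd 1 (φ m) (L t)) ^ 2 := by
    fun_prop
  have e1 : Continuous fun t => 2 * β ^ 2 * (n 0 * dd 0 (φ m) (L t) + n 1 * dd 1 (φ m) (L t)) ^ 2 := by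
    fun_prop
  rw [← intervalIntegral.integral_const_mul, ← intervalIntegral.integral_const_mul,
    ← intervalIntegral.integral_add (ii e0) (ii e1)]
  refine intervalIntegral.integral_mono_on zero_le_one (ii ((dl.sub continuous_const).pow 2))
    (ii (e0.add e1)) fun t _ => ?_
  rw [hαβ fun i => dd i (φ m) (L t), sub_zero]
  refine (two_sq _ _).trans (le_of_eq (by ring))

/-- The trace functional of a function in `H²` of a triangle with zero Dirichlet and Neumann traces
vanishes. -/
theorem trace2_eq_zero {v : L2 (cell s)} (hv : v ∈ Hk (cell s) 2)
    (h : ∀ i j : Fin 3, i ≠ j → HasEdgeTrace (cell s) (b i) (b j) v (fun _ => 0) ∧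
      ∃ n : Plane, n ≠ 0 ∧ ⟪n, b j - b i⟫_ℝ = 0 ∧
        HasEdgeTrace (cell s) (b i) (b j) (dirDeriv (cell s) n v) fun _ => 0) :
    trace2 (cell s) v = 0 := by
  rw [← traceL_pair2]
  refine traceL_eq_zero_of fun j k ψ hψ => ?_
  have hg : ∀ l, ∀ i j : Fin 3, i ≠ j → HasEdgeTrace (cell s) (b i) (b j) (wd1 (cell s) v l)
      fun _ => 0 := fun l i j hij => by
    obtain ⟨h0, n, hn0, hn, h1⟩ := h i j hij
    exact hasEdgeTrace_wd1_zero hb hij hv h0 hn0 hn h1 l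
  show ⟪v, _⟫_ℝ = ⟪wd2 (cell s) v j k, _⟫_ℝ
  -- One integration by parts uses the zero trace of `v`, the other the zero traces of its gradient.
  rw [inner_toL2_dd_eq_neg hb (fun i j hij => (h i j hij).1) (hψ.dd k) j,
    inner_toL2_dd_eq_neg hb (hg j) hψ k, wd1_wd1 (isOpen_cell s) hv, neg_neg]

end triangle

end

section

open Filter Metric Topology

/-! ### Restriction to subdomains -/

/-- Restriction of pairs. -/
noncomputable def restrictPair {T D : Set Plane} (h : T ⊆ D) : PairSpace D →L[ℝ] PairSpace T :=
  ((WithLp.prodContinuousLinearEquiv 2 ℝ (L2 T) (L2Tensor T 2)).symm :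
      (L2 T × L2Tensor T 2) →L[ℝ] PairSpace T).comp
    (((restrictCLM h).comp (WithLp.fstL 2 ℝ (L2 D) (L2Tensor D 2))).prod
      (((PiLp.continuousLinearEquiv 2 ℝ fun _ : Fin 2 → Fin 2 => L2 T).symm :
        ((Fin 2 → Fin 2) → L2 T) →L[ℝ] L2Tensor T 2).comp
        (ContinuousLinearMap.pi fun i => (restrictCLM h).comp
          ((PiLp.proj (𝕜 := ℝ) 2 (fun _ : Fin 2 → Fin 2 => L2 D) i).comp
            (WithLp.sndL 2 ℝ (L2 D) (L2Tensor D 2))))))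

theorem IsWeakDeriv.restrict {T D : Set Plane} (hD : MeasurableSet D) (h : T ⊆ D) {m : ℕ} {u : L2 D}
    {g : L2Tensor D m} (hu : IsWeakDeriv D m u g) :
    IsWeakDeriv T m (restrictL2 h u) (WithLp.toLp 2 fun i => restrictL2 h (g i)) :=
  isWeakDeriv_iff.2 fun φ hφ i => by
    rw [inner_restrictL2_test hD h _ (hφ.partialDeriv i), inner_restrictL2_test hD h _ hφ]
    exact isWeakDeriv_iff.1 hu φ (hφ.mono h) i

theorem Hk_restrict {T D : Set Plane} (hD : MeasurableSet D) (h : T ⊆ D) {k : ℕ} {u : L2 D}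
    (hu : u ∈ Hk D k) : restrictL2 h u ∈ Hk T k := fun m hm => by
  obtain ⟨g, hg⟩ := hu m hm
  exact ⟨_, hg.restrict hD h⟩

theorem restrictPair_pair2 {T D : Set Plane} (hT : IsOpen T) (hD : MeasurableSet D) (h : T ⊆ D)
    {u : L2 D} (hu : u ∈ Hk D 2) : restrictPair h (pair2 D u) = pair2 T (restrictL2 h u) := by
  rw [pair2, pair2, ((isWeakDeriv_weakDeriv (hu 2 le_rfl)).restrict hD h).weakDeriv_eq hT]
  rfl

theorem mem_H10_iff {D : Set Plane} (hD : IsOpen D) {u : L2 D} : u ∈ H10 D ↔ u ∈ Hk D 1 ∧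
    ∃ φ : ℕ → Plane → ℝ, (∀ n, IsTestFunction D (φ n)) ∧
      Tendsto (fun n => toL2 D (φ n)) atTop (𝓝 u) ∧
      ∀ j, Tendsto (fun n => toL2 D (dd j (φ n))) atTop (𝓝 (wd1 D u j)) := by
  constructor
  · rintro ⟨hu, h⟩
    refine ⟨hu, ?_⟩
    choose φ hφ v hv h1 using fun n : ℕ => h (1 / (n + 1)) Nat.one_div_pos_of_nat
    have hδ := tendsto_one_div_add_atTop_nhds_zero_nat (𝕜 := ℝ)
    have key : ∀ n, ‖u - toL2 D (φ n)‖ ^ 2 + ∑ j, ‖wd1 D u j - toL2 D (dd j (φ n))‖ ^ 2 ≤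
        (1 / ((n : ℝ) + 1)) ^ 2 := fun n => by
      rw [← HkNorm_sub_smc hD hu (hφ n).smc, ← eq_toL2 (hv n)]
      exact pow_le_pow_left₀ (HkNorm_nonneg _ _ _) (h1 n).le 2
    refine ⟨φ, hφ, tendsto_of_norm_sub_le hδ fun n => ?_, fun j => tendsto_of_norm_sub_le hδ
      fun n => ?_⟩
    · refine le_of_sq_le_sq ((key n).trans' (le_add_of_nonneg_right ?_)) (by positivity)
      exact Finset.sum_nonneg fun _ _ => sq_nonneg _
    · refine le_of_sq_le_sq ((key n).trans' ?_) (by positivity)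
      refine (Finset.single_le_sum (f := fun j => ‖wd1 D u j - toL2 D (dd j (φ n))‖ ^ 2)
        (fun _ _ => sq_nonneg _) (Finset.mem_univ j)).trans (le_add_of_nonneg_left (sq_nonneg _))
  · rintro ⟨hu, φ, hφ, h0, h1⟩
    refine ⟨hu, fun ε hε => ?_⟩
    have l0 : Tendsto (fun n => ‖u - toL2 D (φ n)‖ ^ 2 +
        ∑ j, ‖wd1 D u j - toL2 D (dd j (φ n))‖ ^ 2) atTop (𝓝 0) := by
      have a0 := (((tendsto_const_nhds (x := u)).sub h0).norm.pow 2)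
      have a1 := tendsto_finsetSum Finset.univ fun j _ =>
        (((tendsto_const_nhds (x := wd1 D u j)).sub (h1 j)).norm.pow 2)
      simpa using a0.add a1
    obtain ⟨n, hn1⟩ := (l0.eventually_lt_const (show (0 : ℝ) < ε ^ 2 by positivity)).exists
    refine ⟨φ n, hφ n, toL2 D (φ n), coeFn_toL2 ((hφ n).smc.memLp D), ?_⟩
    rw [← HkNorm_sub_smc hD hu (hφ n).smc] at hn1
    exact lt_of_pow_lt_pow_left₀ 2 hε.le hn1

theorem spaceX_add {D : Set Plane} (hD : IsOpen D) {u v : L2 D} (hu : u ∈ spaceX D)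
    (hv : v ∈ spaceX D) : u + v ∈ spaceX D := by
  refine ⟨Hk_add hu.1 hv.1, (mem_H10_iff hD).2 ?_⟩
  obtain ⟨hu1, φ, hφ, f0, f1⟩ := (mem_H10_iff hD).1 hu.2
  obtain ⟨hv1, ψ, hψ, g0, g1⟩ := (mem_H10_iff hD).1 hv.2
  refine ⟨Hk_add hu1 hv1, _, fun n => (hφ n).add (hψ n), (f0.add g0).congr fun n => ?_,
    fun j => ?_⟩
  · exact (toL2_add ((hφ n).smc.memLp D) ((hψ n).smc.memLp D)).symm
  · rw [wd1_add hD hu1 hv1]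
    refine ((f1 j).add (g1 j)).congr fun n => ?_
    rw [← toL2_add (((hφ n).smc.dd j).memLp D) (((hψ n).smc.dd j).memLp D)]
    congr 1
    funext x
    exact (dd_add ((hφ n).smc.differentiable x) ((hψ n).smc.differentiable x) j).symm

theorem spaceX_smul {D : Set Plane} (hD : IsOpen D) {u : L2 D} (c : ℝ) (hu : u ∈ spaceX D) :
    c • u ∈ spaceX D := by
  refine ⟨Hk_smul c hu.1, (mem_H10_iff hD).2 ?_⟩
  obtain ⟨hu1, φ, hφ, f0, f1⟩ := (mem_H10_iff hD).1 hu.2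
  refine ⟨Hk_smul c hu1, _, fun n => (hφ n).const_mul c, (f0.const_smul c).congr fun n => ?_,
    fun j => ?_⟩
  · exact (toL2_const_mul ((hφ n).smc.memLp D) c).symm
  · rw [wd1_smul hD c hu1]
    refine ((f1 j).const_smul c).congr fun n => ?_
    rw [← toL2_const_mul (((hφ n).smc.dd j).memLp D)]
    congr 1
    funext x
    exact (dd_const_mul ((hφ n).smc.differentiable x) c j).symm

theorem spaceX_zero {D : Set Plane} (hD : IsOpen D) : (0 : L2 D) ∈ spaceX D := by
  refine ⟨Hk_zero, (mem_H10_iff hD).2 ⟨Hk_zero, fun _ _ => 0, fun _ => IsTestFunction.zero, ?_,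
    fun j => ?_⟩⟩
  · show Tendsto (fun _ : ℕ => toL2 D fun _ => 0) atTop (𝓝 0)
    rw [toL2_zero]; exact tendsto_const_nhds
  · have h1 : wd1 D (0 : L2 D) j = 0 := by rw [wd1, weakDeriv_zero hD]; rfl
    have h2 : dd j (fun _ : Plane => (0 : ℝ)) = fun _ => 0 := by funext x; simp [dd]
    show Tendsto (fun _ : ℕ => toL2 D (dd j fun _ => 0)) atTop _
    rw [h1, h2, toL2_zero]; exact tendsto_const_nhds

/-! ### The skeleton trace operator -/

namespace Triangulation

variable {Ω : Set Plane} (𝒯 : Triangulation Ω)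

/-- The collective trace operator as a function of the pair `(u, D² u)`. -/
noncomputable def traceP (p : PairSpace Ω) : StrongDual ℝ 𝒯.HdivDivT :=
  ∑ s : 𝒯.tris, (traceL (cell s) (restrictPair (𝒯.cell_subset s s.2) p)).comp
    (PiLp.proj (𝕜 := ℝ) 2 (fun s : 𝒯.tris => HdivDiv (cell s)) s)

theorem traceP_pair2 (hΩ : IsOpen Ω) {u : L2 Ω} (hu : u ∈ Hk Ω 2) :
    𝒯.traceP (pair2 Ω u) = 𝒯.trace2T u := by
  refine Finset.sum_congr rfl fun s _ => ?_
  rw [restrictPair_pair2 (isOpen_cell s) hΩ.measurableSet _ hu, traceL_pair2]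

theorem continuous_traceP : Continuous 𝒯.traceP :=
  continuous_finsetSum _ fun _ _ => ((traceL _).continuous.comp
    (restrictPair _).continuous).clm_comp continuous_const

theorem traceP_add (p q : PairSpace Ω) : 𝒯.traceP (p + q) = 𝒯.traceP p + 𝒯.traceP q := by
  simp only [traceP, map_add, ContinuousLinearMap.add_comp, Finset.sum_add_distrib]

theorem traceP_smul (c : ℝ) (p : PairSpace Ω) : 𝒯.traceP (c • p) = c • 𝒯.traceP p := by
  simp only [traceP, map_smul, ContinuousLinearMap.smul_comp, Finset.smul_sum]

theorem trace2T_add (hΩ : IsOpen Ω) {u v : L2 Ω} (hu : u ∈ Hk Ω 2) (hv : v ∈ Hk Ω 2) :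
    𝒯.trace2T (u + v) = 𝒯.trace2T u + 𝒯.trace2T v := by
  rw [← 𝒯.traceP_pair2 hΩ (Hk_add hu hv), pair2_add hΩ hu hv, traceP_add, 𝒯.traceP_pair2 hΩ hu,
    𝒯.traceP_pair2 hΩ hv]

theorem trace2T_smul (hΩ : IsOpen Ω) {u : L2 Ω} (c : ℝ) (hu : u ∈ Hk Ω 2) :
    𝒯.trace2T (c • u) = c • 𝒯.trace2T u := by
  rw [← 𝒯.traceP_pair2 hΩ (Hk_smul c hu), pair2_smul hΩ c hu, traceP_smul, 𝒯.traceP_pair2 hΩ hu]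

theorem trace2T_sub (hΩ : IsOpen Ω) {u v : L2 Ω} (hu : u ∈ Hk Ω 2) (hv : v ∈ Hk Ω 2) :
    𝒯.trace2T (u - v) = 𝒯.trace2T u - 𝒯.trace2T v := by
  rw [sub_eq_add_neg, ← neg_one_smul ℝ v, 𝒯.trace2T_add hΩ hu (Hk_smul _ hv),
    𝒯.trace2T_smul hΩ _ hv]
  module

theorem trace2T_apply (u : L2 Ω) (Q : 𝒯.HdivDivT) : 𝒯.trace2T u Q =
    ∑ s : 𝒯.tris, trace2 (cell s) (restrictL2 (𝒯.cell_subset s s.2) u) (Q s) := by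
  rw [trace2T, sum_apply]; rfl

theorem sum_single (Q : 𝒯.HdivDivT) : ∑ s, PiLp.single 2 s (Q s) = Q := by
  ext t : 1
  rw [WithLp.ofLp_sum, Finset.sum_apply]
  simp

theorem trace2T_single (u : L2 Ω) (s : 𝒯.tris) (Q : HdivDiv (cell s)) :
    𝒯.trace2T u (PiLp.single 2 s Q) =
      trace2 (cell s) (restrictL2 (𝒯.cell_subset s s.2) u) Q := by
  rw [trace2T_apply, Finset.sum_eq_single s]
  · simp
  · intro t _ hts
    rw [PiLp.single_eq_of_ne 2 hts, map_zero]
  · simp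

theorem traceNorm_nonneg (w : StrongDual ℝ 𝒯.HdivDivT) : 0 ≤ 𝒯.traceNorm w :=
  Real.sInf_nonneg (by rintro _ ⟨v, -, rfl⟩; exact HkNorm_nonneg _ _ _)

theorem traceNorm_le {v : L2 Ω} (hv : v ∈ Hk Ω 2) : 𝒯.traceNorm (𝒯.trace2T v) ≤ HkNorm Ω 2 v :=
  csInf_le ⟨0, by rintro _ ⟨v, -, rfl⟩; exact HkNorm_nonneg _ _ _⟩ ⟨v, ⟨hv, rfl⟩, rfl⟩

end Triangulation

end

section

open Filter Metric Topology

/-! ### The discrete trace space -/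

/-- Rotation by a right angle. -/
noncomputable def rot (v : Plane) : Plane := !₂[-v 1, v 0]

theorem inner_rot (v : Plane) : ⟪rot v, v⟫_ℝ = 0 := by
  simp [rot, PiLp.inner_apply, Fin.sum_univ_two]; ring

theorem rot_ne_zero {v : Plane} (hv : v ≠ 0) : rot v ≠ 0 := fun h => hv (by
  have h0 := congrArg (fun w : Plane => w 0) h
  have h1 := congrArg (fun w : Plane => w 1) h
  simp [rot] at h0 h1
  ext i
  fin_cases i
  · exact h1
  · exact h0)

theorem hasEdgeTrace_zero_zero {D : Set Plane} (hD : IsOpen D) (a b : Plane) :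
    HasEdgeTrace D a b 0 fun _ => 0 := by
  refine (hasEdgeTrace_iff hD).2 ⟨Hk_zero, fun _ _ => 0, fun _ => Smc.zero, ?_, fun j => ?_, ?_⟩
  · show Tendsto (fun _ : ℕ => toL2 D fun _ => 0) atTop (𝓝 0)
    rw [toL2_zero]; exact tendsto_const_nhds
  · have h1 : wd1 D (0 : L2 D) j = 0 := by rw [wd1, weakDeriv_zero hD]; rfl
    have h2 : dd j (fun _ : Plane => (0 : ℝ)) = fun _ => 0 := by funext x; simp [dd]
    show Tendsto (fun _ : ℕ => toL2 D (dd j fun _ => 0)) atTop _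
    rw [h1, h2, toL2_zero]; exact tendsto_const_nhds
  · simp

theorem dirDeriv_zero {D : Set Plane} (hD : IsOpen D) (n : Plane) :
    dirDeriv D n (0 : L2 D) = 0 := by
  simp [dirDeriv_eq, wd1, weakDeriv_zero hD]

theorem zero_mem_localSpace (s : Finset Plane) : (0 : L2 (cell s)) ∈ localSpace s := by
  have hD := isOpen_cell s
  have h0 : pair2 (cell s) (0 : L2 (cell s)) = 0 := by rw [pair2, weakDeriv_zero hD]; rfl
  refine mem_localSpace_iff.2 ⟨Hk_zero, fun p _ => by rw [h0, inner_zero_left],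
    fun a _ b _ _ => ⟨(hasEdgeTrace_zero_zero hD a b).hasPolyEdgeTrace 3, fun n _ => ?_⟩⟩
  rw [dirDeriv_zero hD]
  exact (hasEdgeTrace_zero_zero hD a b).hasPolyEdgeTrace 1

namespace Triangulation

variable {Ω : Set Plane} (𝒯 : Triangulation Ω)

/-- `Û_h` as a linear space. -/
noncomputable def discreteTraceSubmodule (hΩ : IsOpen Ω) :
    Submodule ℝ (StrongDual ℝ 𝒯.HdivDivT) where
  carrier := 𝒯.discreteTraceSpace
  add_mem' := by
    rintro _ _ ⟨⟨u, hu, rfl⟩, h⟩ ⟨⟨u', hu', rfl⟩, h'⟩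
    refine ⟨⟨u + u', spaceX_add hΩ hu hu', 𝒯.trace2T_add hΩ hu.1 hu'.1⟩, fun s => ?_⟩
    obtain ⟨v, hv, e⟩ := h s
    obtain ⟨v', hv', e'⟩ := h' s
    refine ⟨v + v', localSpace_add hv hv', fun Q => ?_⟩
    rw [add_apply, e, e', ← traceL_pair2, ← traceL_pair2, ← traceL_pair2,
      pair2_add (isOpen_cell s) hv.1 hv'.1, map_add, add_apply]
  zero_mem' := by
    refine ⟨⟨0, spaceX_zero hΩ, ?_⟩, fun s => ⟨0, zero_mem_localSpace s, fun Q => ?_⟩⟩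
    · have := 𝒯.trace2T_smul hΩ 0 (Hk_zero (D := Ω) (k := 2))
      rwa [zero_smul, zero_smul] at this
    · rw [← traceL_pair2, pair2, weakDeriv_zero (isOpen_cell s)]
      exact (congrFun (congrArg DFunLike.coe (map_zero (traceL (cell s)))) Q).symm
  smul_mem' := by
    rintro c _ ⟨⟨u, hu, rfl⟩, h⟩
    refine ⟨⟨c • u, spaceX_smul hΩ c hu, 𝒯.trace2T_smul hΩ c hu.1⟩, fun s => ?_⟩
    obtain ⟨v, hv, e⟩ := h s
    refine ⟨c • v, localSpace_smul c hv, fun Q => ?_⟩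
    rw [smul_apply, e, ← traceL_pair2, ← traceL_pair2,
      pair2_smul (isOpen_cell s) c hv.1, map_smul, smul_apply]

/-- Pairs of polynomials of degree less than four, for every ordered pair of vertices of every
triangle. -/
abbrev EdgeData : Type :=
  (s : 𝒯.tris) → {x // x ∈ s.1} → {x // x ∈ s.1} →
    Polynomial.degreeLT ℝ 4 × Polynomial.degreeLT ℝ 4

/-- The traces and the normal derivatives of `v` are the given polynomials. -/
def IsEdgeData (s : 𝒯.tris) (v : L2 (cell s))
    (q : {x // x ∈ s.1} → {x // x ∈ s.1} →
      Polynomial.degreeLT ℝ 4 × Polynomial.degreeLT ℝ 4) : Prop :=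
  ∀ a b : {x // x ∈ s.1}, a ≠ b →
    HasEdgeTrace (cell s) a b v (fun t => (q a b).1.1.eval t) ∧
    HasEdgeTrace (cell s) a b (dirDeriv (cell s) (rot (b - a)) v) (fun t => (q a b).2.1.eval t)

/-- The relation between discrete traces and polynomial edge data. -/
def EdgeRelation (w : StrongDual ℝ 𝒯.HdivDivT) (q : 𝒯.EdgeData) : Prop :=
  ∀ s : 𝒯.tris, ∃ v ∈ localSpace s,
    (∀ Q : HdivDiv (cell s), w (PiLp.single 2 s Q) = trace2 (cell s) v Q) ∧
      𝒯.IsEdgeData s v (q s)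

theorem EdgeRelation.add {w w' : StrongDual ℝ 𝒯.HdivDivT} {q q' : 𝒯.EdgeData}
    (h : 𝒯.EdgeRelation w q) (h' : 𝒯.EdgeRelation w' q') :
    𝒯.EdgeRelation (w + w') (q + q') := fun s => by
  have hD := isOpen_cell (s : Finset Plane)
  obtain ⟨v, hv, e, d⟩ := h s
  obtain ⟨v', hv', e', d'⟩ := h' s
  refine ⟨v + v', localSpace_add hv hv', fun Q => ?_, fun a b hab => ⟨?_, ?_⟩⟩
  · rw [add_apply, e, e', ← traceL_pair2, ← traceL_pair2, ← traceL_pair2,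
      pair2_add hD hv.1 hv'.1, map_add, add_apply]
  · simpa using (d a b hab).1.add hD (Polynomial.continuous _) (Polynomial.continuous _)
      (d' a b hab).1
  · rw [dirDeriv_add hD _ (Hk_mono one_le_two hv.1) (Hk_mono one_le_two hv'.1)]
    simpa using (d a b hab).2.add hD (Polynomial.continuous _) (Polynomial.continuous _)
      (d' a b hab).2

theorem EdgeRelation.smul {w : StrongDual ℝ 𝒯.HdivDivT} {q : 𝒯.EdgeData} (c : ℝ)
    (h : 𝒯.EdgeRelation w q) : 𝒯.EdgeRelation (c • w) (c • q) := fun s => by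
  have hD := isOpen_cell (s : Finset Plane)
  obtain ⟨v, hv, e, d⟩ := h s
  refine ⟨c • v, localSpace_smul c hv, fun Q => ?_, fun a b hab => ⟨?_, ?_⟩⟩
  · rw [smul_apply, e, ← traceL_pair2, ← traceL_pair2, pair2_smul hD c hv.1, map_smul, smul_apply]
  · simpa using (d a b hab).1.smul hD c
  · rw [dirDeriv_smul hD _ c (Hk_mono one_le_two hv.1)]
    simpa using (d a b hab).2.smul hD c

/-- A functional on the product is the sum of its restrictions to the factors, and each of these
vanishes by `trace2_eq_zero`. This is the injectivity behind finite dimension. -/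
theorem EdgeRelation.eq_zero {w : StrongDual ℝ 𝒯.HdivDivT} (hw : 𝒯.EdgeRelation w 0) :
    w = 0 := by
  refine ContinuousLinearMap.ext fun Q => ?_
  have e : w Q = ∑ s, w (PiLp.single 2 s (Q s)) :=
    (congrArg w (𝒯.sum_single Q)).symm.trans
      (map_sum (ContinuousLinearMap.toLinearMap w) (fun s => PiLp.single 2 s (Q s)) Finset.univ)
  rw [e]
  refine Finset.sum_eq_zero fun s _ => ?_
  obtain ⟨v, hv, e, d⟩ := hw s
  obtain ⟨b, hb⟩ := exists_affineBasis (𝒯.card_eq s s.2) (𝒯.indep s s.2)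
  rw [e, trace2_eq_zero hb hv.1, zero_apply]
  intro i j hij
  have hd := d ⟨b i, (mem_vertices_iff hb).2 ⟨i, rfl⟩⟩ ⟨b j, (mem_vertices_iff hb).2 ⟨j, rfl⟩⟩
    fun h => hij (b.ind.injective (congrArg Subtype.val h))
  refine ⟨by simpa using hd.1, rot (b j - b i), rot_ne_zero ?_, inner_rot _, by simpa using hd.2⟩
  exact sub_ne_zero.2 fun h => hij (b.ind.injective h.symm)

theorem exists_edgeRelation {w : StrongDual ℝ 𝒯.HdivDivT}
    (hw : w ∈ 𝒯.discreteTraceSpace) : ∃ q, 𝒯.EdgeRelation w q := by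
  choose v hv e using hw.2
  have h : ∀ (s : 𝒯.tris) (a b : {x // x ∈ s.1}),
      ∃ q : Polynomial.degreeLT ℝ 4 × Polynomial.degreeLT ℝ 4, a ≠ b →
        HasEdgeTrace (cell s) a b (v s) (fun t => q.1.1.eval t) ∧
        HasEdgeTrace (cell s) a b (dirDeriv (cell s) (rot (b - a)) (v s))
          (fun t => q.2.1.eval t) := fun s a b => by
    by_cases hab : a = b
    · exact ⟨0, fun h => (h hab).elim⟩
    · obtain ⟨⟨q, hq, hq'⟩, h2⟩ := (hv s).2.2 a a.2 b b.2 fun h => hab (Subtype.ext h)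
      -- Normal derivatives have degree at most 1; placing them among polynomials of degree below 4
      -- loses nothing, as only finite dimension matters.
      obtain ⟨r, hr, hr'⟩ := h2 _ (inner_rot _)
      exact ⟨(⟨q, Polynomial.mem_degreeLT.2 (Polynomial.degree_le_of_natDegree_le hq |>.trans_lt
        (by norm_num))⟩, ⟨r, Polynomial.mem_degreeLT.2
          (Polynomial.degree_le_of_natDegree_le hr |>.trans_lt (by norm_num))⟩), fun _ => ⟨hq', hr'⟩⟩
  choose q hq using h
  exact ⟨q, fun s => ⟨v s, hv s, e s, fun a b hab => hq s a b hab⟩⟩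

/-- Using a linear relation avoids showing that the edge data depend uniquely and linearly on the
functional. The relation embeds into the finite-dimensional `E`, and its projection to `V` contains
`S`. -/
theorem finite_of_relation {V E : Type*} [AddCommGroup V] [Module ℝ V] [AddCommGroup E]
    [Module ℝ E] [Module.Finite ℝ E] (S : Submodule ℝ V) (R : V → E → Prop)
    (hadd : ∀ {v v' q q'}, R v q → R v' q' → R (v + v') (q + q'))
    (hsmul : ∀ (c : ℝ) {v q}, R v q → R (c • v) (c • q)) (hzero : ∀ {v}, R v 0 → v = 0)
    (hex : ∀ v ∈ S, ∃ q, R v q) : Module.Finite ℝ S := by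
  choose! q hq using hex
  let W : Submodule ℝ (V × E) :=
    { carrier := {p | R p.1 p.2}
      add_mem' := fun h h' => hadd h h'
      zero_mem' := by simpa using hsmul 0 (hq 0 (zero_mem S))
      smul_mem' := fun c _ h => hsmul c h }
  have h1 : Module.Finite ℝ W := by
    refine Module.Finite.of_injective ((LinearMap.snd ℝ V E).comp W.subtype) ?_
    rw [injective_iff_map_eq_zero]
    rintro ⟨⟨v, p⟩, hv⟩ h
    have hp : p = 0 := h
    subst hp
    exact Subtype.ext (Prod.ext (hzero hv) rfl)
  have h2 : S ≤ W.map (LinearMap.fst ℝ V E) := fun v hv => ⟨(v, q v), hq v hv, rfl⟩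
  exact Submodule.finiteDimensional_of_le h2

theorem finite_discreteTraceSubmodule (hΩ : IsOpen Ω) :
    Module.Finite ℝ (𝒯.discreteTraceSubmodule hΩ) :=
  finite_of_relation _ 𝒯.EdgeRelation (fun h h' => EdgeRelation.add 𝒯 h h')
    (fun c _ _ h => EdgeRelation.smul 𝒯 c h) (fun h => EdgeRelation.eq_zero 𝒯 h) fun _ hw => 𝒯.exists_edgeRelation hw

/-! ### Best approximations -/

/-- The functions in `H²(Ω)` with discrete traces. -/
noncomputable def discreteExtensions (hΩ : IsOpen Ω) : Submodule ℝ (PairSpace Ω) where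
  carrier := {p | p ∈ graph2 Ω ∧ 𝒯.traceP p ∈ 𝒯.discreteTraceSubmodule hΩ}
  add_mem' := fun h h' => ⟨add_mem h.1 h'.1, by rw [traceP_add]; exact add_mem h.2 h'.2⟩
  zero_mem' := ⟨zero_mem _, by
    have := 𝒯.traceP_smul 0 0
    rw [zero_smul, zero_smul] at this
    rw [this]; exact zero_mem _⟩
  smul_mem' := fun c _ h => ⟨Submodule.smul_mem _ c h.1, by
    rw [traceP_smul]; exact Submodule.smul_mem _ c h.2⟩

theorem isClosed_discreteExtensions (hΩ : IsOpen Ω) (hconv : Convex ℝ Ω)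
    (hbd : Bornology.IsBounded Ω) (hne : Ω.Nonempty) :
    IsClosed (𝒯.discreteExtensions hΩ : Set (PairSpace Ω)) := by
  have := 𝒯.finite_discreteTraceSubmodule hΩ
  exact (isClosed_graph2 hΩ hconv hbd hne).inter
    ((Submodule.closed_of_finiteDimensional (𝒯.discreteTraceSubmodule hΩ)).preimage
      𝒯.continuous_traceP)

/-- The trace norm is a quotient norm of `H²(Ω)`. The functions with discrete trace form a closed
subspace, and the trace of the orthogonal projection of `u` onto it is a best approximation. -/
theorem exists_best_trace (hΩ : IsOpen Ω) (hconv : Convex ℝ Ω)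
    (hbd : Bornology.IsBounded Ω) (hne : Ω.Nonempty) {u : L2 Ω} (hu : u ∈ Hk Ω 2) :
    ∃ w ∈ 𝒯.discreteTraceSpace, ∀ w' ∈ 𝒯.discreteTraceSpace,
      𝒯.traceNorm (𝒯.trace2T u - w) ≤ 𝒯.traceNorm (𝒯.trace2T u - w') := by
  let K := 𝒯.discreteExtensions hΩ
  have : CompleteSpace K :=
    (𝒯.isClosed_discreteExtensions hΩ hconv hbd hne).completeSpace_coe
  have hz : K.starProjection (pair2 Ω u) ∈ K := K.starProjection_apply_mem _
  have hmin : ∀ p ∈ K, ‖pair2 Ω u - K.starProjection (pair2 Ω u)‖ ≤ ‖pair2 Ω u - p‖ := fun p hp => by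
    rw [K.starProjection_minimal]
    exact ciInf_le ⟨0, by rintro _ ⟨x, rfl⟩; exact norm_nonneg _⟩ (⟨p, hp⟩ : K)
  generalize K.starProjection (pair2 Ω u) = z at hz hmin
  have hz1 := hz.1.1
  have ez := eq_pair2 hΩ hz.1
  refine ⟨𝒯.traceP z, hz.2, fun w' hw' => ?_⟩
  rw [ez, 𝒯.traceP_pair2 hΩ hz1, ← 𝒯.trace2T_sub hΩ hu hz1]
  refine (𝒯.traceNorm_le (Hk_sub hu hz1)).trans ?_
  rw [← norm_pair2, pair2_sub hΩ hu hz1, ← ez]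
  obtain ⟨x, hx, hxw⟩ := hw'.1
  refine le_csInf ⟨_, u - x, ⟨Hk_sub hu hx.1, ?_⟩, rfl⟩ ?_
  · rw [𝒯.trace2T_sub hΩ hu hx.1, hxw]
  -- If `v` has the trace of `u` minus `w'`, then `u - v` has the discrete trace `w'` and competes
  -- with the projection, at distance exactly `HkNorm Ω 2 v`.
  · rintro _ ⟨v, ⟨hv, hvt⟩, rfl⟩
    have huv := Hk_sub hu hv
    have hmem : pair2 Ω (u - v) ∈ K := by
      refine ⟨pair2_mem huv, ?_⟩
      rw [𝒯.traceP_pair2 hΩ huv, 𝒯.trace2T_sub hΩ hu hv, hvt, sub_sub_cancel]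
      exact hw'
    refine (hmin _ hmem).trans (le_of_eq ?_)
    rw [pair2_sub hΩ hu hv, sub_sub_cancel, norm_pair2]

theorem exists_best_of_isClosed {E : Type*} [NormedAddCommGroup E] [InnerProductSpace ℝ E]
    [CompleteSpace E] (K : Submodule ℝ E) (hK : IsClosed (K : Set E)) (x : E) :
    ∃ y ∈ K, ∀ z ∈ K, ‖x - y‖ ≤ ‖x - z‖ := by
  have : CompleteSpace K := hK.completeSpace_coe
  refine ⟨_, K.starProjection_apply_mem x, fun p hp => ?_⟩
  rw [K.starProjection_minimal]
  exact ciInf_le ⟨0, by rintro _ ⟨x, rfl⟩; exact norm_nonneg _⟩ (⟨p, hp⟩ : K)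

/-- Through restriction maps and the line spanned by the constant 1, the space becomes an
intersection of closed preimages. -/
theorem isPiecewiseConst_iff (v : L2 Ω) : 𝒯.IsPiecewiseConst v ↔ ∀ s (hs : s ∈ 𝒯.tris),
    restrictCLM (𝒯.cell_subset s hs) v ∈ Submodule.span ℝ {toL2 (cell s) fun _ => 1} := by
  refine forall₂_congr fun s hs => ?_
  have hfin : IsFiniteMeasure (volume.restrict (cell s)) :=
    isFiniteMeasure_restrict_of_isBounded (isBounded_cell s)
  have h1 : MemLp (fun _ : Plane => (1 : ℝ)) 2 (volume.restrict (cell s)) := memLp_const 1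
  rw [Submodule.mem_span_singleton]
  refine exists_congr fun c => ?_
  rw [← toL2_const_mul h1, mul_one, restrictCLM_apply]
  have h2 := coeFn_restrictL2 (𝒯.cell_subset s hs) v
  have h3 := coeFn_toL2 (D := cell s) (memLp_const c)
  constructor
  · intro h
    exact (eq_toL2 (h2.trans h)).symm
  · intro h
    rw [← h] at h2
    exact h2.symm.trans h3

/-- The space of piecewise constant functions. -/
noncomputable def piecewiseConst : Submodule ℝ (L2 Ω) :=
  ⨅ s, ⨅ hs : s ∈ 𝒯.tris, (Submodule.span ℝ {toL2 (cell s) fun _ => (1 : ℝ)}).comap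
    (restrictCLM (𝒯.cell_subset s hs) : L2 Ω →ₗ[ℝ] L2 (cell s))

theorem mem_piecewiseConst {v : L2 Ω} : v ∈ 𝒯.piecewiseConst ↔ 𝒯.IsPiecewiseConst v := by
  simp only [piecewiseConst, Submodule.mem_iInf, Submodule.mem_comap, isPiecewiseConst_iff]
  rfl

theorem isClosed_piecewiseConst : IsClosed (𝒯.piecewiseConst : Set (L2 Ω)) := by
  have : (𝒯.piecewiseConst : Set (L2 Ω)) = ⋂ s, ⋂ hs : s ∈ 𝒯.tris,
      (restrictCLM (𝒯.cell_subset s hs)) ⁻¹' (Submodule.span ℝ {toL2 (cell s) fun _ => (1 : ℝ)} :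
        Set (L2 (cell s))) := by
    simp only [piecewiseConst, Submodule.coe_iInf, Submodule.comap_coe]; rfl
  rw [this]
  exact isClosed_iInter fun s => isClosed_iInter fun hs =>
    (Submodule.closed_of_finiteDimensional _).preimage (restrictCLM _).continuous

/-- The space of symmetric piecewise constant matrices. -/
noncomputable def piecewiseConstSymm : Submodule ℝ (L2Tensor Ω 2) where
  carrier := {M | IsSymmL2 M ∧ ∀ i, M i ∈ 𝒯.piecewiseConst}
  add_mem' := fun h h' => ⟨fun j k => congrArg₂ (· + ·) (h.1 j k) (h'.1 j k),
    fun i => add_mem (h.2 i) (h'.2 i)⟩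
  zero_mem' := ⟨fun _ _ => rfl, fun _ => zero_mem _⟩
  smul_mem' := fun c _ h => ⟨fun j k => congrArg (c • ·) (h.1 j k),
    fun i => Submodule.smul_mem _ c (h.2 i)⟩

theorem isClosed_piecewiseConstSymm :
    IsClosed (𝒯.piecewiseConstSymm : Set (L2Tensor Ω 2)) := by
  have hp : ∀ i, Continuous fun M : L2Tensor Ω 2 => M i := fun i =>
    (PiLp.proj (𝕜 := ℝ) 2 (fun _ : Fin 2 → Fin 2 => L2 Ω) i).continuous
  have : (𝒯.piecewiseConstSymm : Set (L2Tensor Ω 2)) =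
      (⋂ j, ⋂ k, {M : L2Tensor Ω 2 | M ![j, k] = M ![k, j]}) ∩
        ⋂ i, {M : L2Tensor Ω 2 | M i ∈ (𝒯.piecewiseConst : Set (L2 Ω))} := by
    ext M
    simp only [mem_inter_iff, mem_iInter]
    rfl
  rw [this]
  exact (isClosed_iInter fun j => isClosed_iInter fun k => isClosed_eq (hp _) (hp _)).inter
    (isClosed_iInter fun i => 𝒯.isClosed_piecewiseConst.preimage (hp i))

/-- The minimum of the error is attained. -/
theorem exists_isLeast_error (hΩ : IsOpen Ω) (hconv : Convex ℝ Ω)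
    (hbd : Bornology.IsBounded Ω) (hne : Ω.Nonempty) {u : L2 Ω} (hu : u ∈ Hk Ω 2) :
    ∃ e : ℝ, IsLeast {r | ∃ w ∈ 𝒯.spaceUh, r = 𝒯.normU (𝒯.lift u - w)} e := by
  obtain ⟨c, hc, hc'⟩ := exists_best_of_isClosed _ 𝒯.isClosed_piecewiseConst u
  obtain ⟨M, hM, hM'⟩ := exists_best_of_isClosed _ 𝒯.isClosed_piecewiseConstSymm
    (weakDeriv Ω 2 u)
  obtain ⟨w, hw, hw'⟩ := 𝒯.exists_best_trace hΩ hconv hbd hne hu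
  refine ⟨_, ⟨(c, M, w), ⟨𝒯.mem_piecewiseConst.1 hc, hM.1, fun i => 𝒯.mem_piecewiseConst.1 (hM.2 i),
    hw⟩, rfl⟩, ?_⟩
  rintro _ ⟨⟨c₁, M₁, w₁⟩, ⟨h1, h2, h3, h4⟩, rfl⟩
  -- `U_h` is a product, so componentwise minimisers minimise the sum of squares.
  refine Real.sqrt_le_sqrt (add_le_add (add_le_add ?_ ?_) ?_)
  · exact pow_le_pow_left₀ (norm_nonneg _) (hc' c₁ (𝒯.mem_piecewiseConst.2 h1)) 2
  · exact pow_le_pow_left₀ (norm_nonneg _)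
      (hM' M₁ ⟨h2, fun i => 𝒯.mem_piecewiseConst.2 (h3 i)⟩) 2
  · exact pow_le_pow_left₀ (𝒯.traceNorm_nonneg _) (hw' w₁ h4) 2

end Triangulation

end

section

open Filter Metric Topology

/-! ### The reduced Hsieh–Clough–Tocher interpolant -/

/-- For gluing along closed pieces: away from the closed set differentiability within it is vacuous,
so `P` has to be differentiated only at points of `S`. -/
theorem HasFDerivAt.within_of_eqOn {f P : Plane → ℝ} {f' : Plane →L[ℝ] ℝ} {S : Set Plane} {x : Plane}
    (hS : IsClosed S) (h : x ∈ S → HasFDerivAt P f' x) (he : EqOn f P S) :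
    HasFDerivWithinAt f f' S x := by
  by_cases hx : x ∈ S
  · exact ((h hx).hasFDerivWithinAt).congr he (he hx)
  · exact HasFDerivWithinAt.of_notMem_closure (by rwa [hS.closure_eq])

/-- The bubble function `∫₀^m 6 (α - t) (β - t) dt`. -/
def bubble (m α β : ℝ) : ℝ := 6 * m * α * β - 3 * m ^ 2 * (α + β) + 2 * m ^ 3

/-- The derivative of `bubble` in its first argument is `6 (α - m) (β - m)`. It vanishes as soon as
`m` equals `α` or `β`, so the kinks of the minimum `m` are invisible to first order and one formula
with `ξ'` serves all three pieces. -/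
theorem hasFDerivAt_bubble {m ξ α β : Plane → ℝ} {ξ' α' β' : Plane →L[ℝ] ℝ} (hm : Continuous m)
    (hξ : ∀ x, HasFDerivAt ξ ξ' x) (hα : ∀ x, HasFDerivAt α α' x) (hβ : ∀ x, HasFDerivAt β β' x)
    (h : ∀ x, m x = ξ x ∨ m x = α x ∨ m x = β x) (x : Plane) :
    HasFDerivAt (fun x => bubble (m x) (α x) (β x))
      ((6 * (α x - m x) * (β x - m x)) • ξ' + (6 * m x * β x - 3 * m x ^ 2) • α' +
        (6 * m x * α x - 3 * m x ^ 2) • β') x := by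
  have key : ∀ {ζ : Plane → ℝ} {ζ' : Plane →L[ℝ] ℝ}, (∀ x, HasFDerivAt ζ ζ' x) →
      HasFDerivAt (fun x => bubble (ζ x) (α x) (β x))
        ((6 * (α x - ζ x) * (β x - ζ x)) • ζ' + (6 * ζ x * β x - 3 * ζ x ^ 2) • α' +
          (6 * ζ x * α x - 3 * ζ x ^ 2) • β') x := fun {ζ ζ'} hζ => by
    have h1 := ((((hζ x).const_mul 6).mul (hα x)).mul (hβ x)).sub
      ((((hζ x).pow 2).const_mul 3).mul ((hα x).add (hβ x)))
    have h2 := h1.add (((hζ x).pow 3).const_mul 2)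
    refine h2.congr_fderiv ?_
    ext v
    simp
    ring
  have cl : ∀ {ζ : Plane → ℝ} {ζ' : Plane →L[ℝ] ℝ}, (∀ x, HasFDerivAt ζ ζ' x) →
      IsClosed {x | m x = ζ x} := fun hζ =>
    isClosed_eq hm (continuous_iff_continuousAt.2 fun x => (hζ x).continuousAt)
  have hcov : (univ : Set Plane) = {x | m x = ξ x} ∪ ({x | m x = α x} ∪ {x | m x = β x}) :=
    (eq_univ_of_forall fun x => h x).symm
  rw [← hasFDerivWithinAt_univ, hcov]
  refine HasFDerivWithinAt.union ?_ (HasFDerivWithinAt.union ?_ ?_)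
  · refine HasFDerivAt.within_of_eqOn (cl hξ) (fun hx => (key hξ).congr_fderiv ?_)
      fun y (hy : m y = ξ y) => by rw [hy]
    rw [show m x = ξ x from hx]
  · refine HasFDerivAt.within_of_eqOn (cl hα) (fun hx => (key hα).congr_fderiv ?_)
      fun y (hy : m y = α y) => by rw [hy]
    rw [show m x = α x from hx]
    ext v
    simp
  · refine HasFDerivAt.within_of_eqOn (cl hβ) (fun hx => (key hβ).congr_fderiv ?_)
      fun y (hy : m y = β y) => by rw [hy]
    rw [show m x = β x from hx]
    ext v
    simp

section hct

variable (b : AffineBasis (Fin 3) ℝ Plane)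

/-- The smallest barycentric coordinate. -/
noncomputable def minCoord (x : Plane) : ℝ :=
  min (b.coord 0 x) (min (b.coord 1 x) (b.coord 2 x))

/-- The vector orthogonal to the edge opposite to the vertex `k`. -/
noncomputable def edgeNormal (k : Fin 3) : Plane := rot (b (k + 2) - b (k + 1))

/-- The ratio of two normal derivatives of barycentric coordinates. -/
noncomputable def normalRatio (k i : Fin 3) : ℝ :=
  coordL b i (edgeNormal b k) / coordL b k (edgeNormal b k)

/-- The coefficients of the bubble functions. -/
noncomputable def hctCoeff (U : Fin 3 → ℝ) (d : Fin 3 → Fin 3 → ℝ) (k : Fin 3) : ℝ :=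
  (d (k + 1) k + d (k + 2) k +
    normalRatio b k (k + 1) * (-6 * U (k + 1) - 2 * d (k + 1) (k + 2) + d (k + 2) (k + 1)) +
    normalRatio b k (k + 2) * (-6 * U (k + 2) - 2 * d (k + 2) (k + 1) + d (k + 1) (k + 2))) / 6

/-- The interpolant with vertex values `U i` and edge derivatives `d i j` at the vertex `i` in the
direction of the vertex `j`. -/
noncomputable def hct (U : Fin 3 → ℝ) (d : Fin 3 → Fin 3 → ℝ) (x : Plane) : ℝ :=
  ∑ i, (U i * (3 * b.coord i x ^ 2 - 2 * b.coord i x ^ 3) +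
    d i (i + 1) * (b.coord i x ^ 2 * b.coord (i + 1) x) +
    d i (i + 2) * (b.coord i x ^ 2 * b.coord (i + 2) x) +
    hctCoeff b U d i * bubble (minCoord b x) (b.coord (i + 1) x) (b.coord (i + 2) x))

/-- The derivative of the interpolant. -/
noncomputable def hctD (U : Fin 3 → ℝ) (d : Fin 3 → Fin 3 → ℝ) (x : Plane) : Plane →L[ℝ] ℝ :=
  ∑ i, ((U i * (6 * b.coord i x - 6 * b.coord i x ^ 2)) • coordL b i +
    d i (i + 1) • ((2 * b.coord i x * b.coord (i + 1) x) • coordL b i +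
      (b.coord i x ^ 2) • coordL b (i + 1)) +
    d i (i + 2) • ((2 * b.coord i x * b.coord (i + 2) x) • coordL b i +
      (b.coord i x ^ 2) • coordL b (i + 2)) +
    hctCoeff b U d i •
      ((6 * (b.coord (i + 1) x - minCoord b x) * (b.coord (i + 2) x - minCoord b x)) • coordL b i +
        (6 * minCoord b x * b.coord (i + 2) x - 3 * minCoord b x ^ 2) • coordL b (i + 1) +
        (6 * minCoord b x * b.coord (i + 1) x - 3 * minCoord b x ^ 2) • coordL b (i + 2)))

theorem continuous_coord (i : Fin 3) : Continuous (b.coord i) := (contDiff_coord b i).continuous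

theorem continuous_minCoord : Continuous (minCoord b) :=
  (continuous_coord b 0).min ((continuous_coord b 1).min (continuous_coord b 2))

theorem minCoord_eq (x : Plane) : minCoord b x = b.coord 0 x ∨ minCoord b x = b.coord 1 x ∨
    minCoord b x = b.coord 2 x := by
  unfold minCoord
  rcases min_choice (b.coord 0 x) (min (b.coord 1 x) (b.coord 2 x)) with h | h
  · exact Or.inl h
  · rw [h]; exact Or.inr (min_choice _ _)

theorem minCoord_eq' (i : Fin 3) (x : Plane) : minCoord b x = b.coord i x ∨
    minCoord b x = b.coord (i + 1) x ∨ minCoord b x = b.coord (i + 2) x := by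
  have := minCoord_eq b x
  fin_cases i
  · exact this
  · rcases this with h | h | h
    exacts [Or.inr (Or.inr h), Or.inl h, Or.inr (Or.inl h)]
  · rcases this with h | h | h
    exacts [Or.inr (Or.inl h), Or.inr (Or.inr h), Or.inl h]

theorem hasFDerivAt_hct (U : Fin 3 → ℝ) (d : Fin 3 → Fin 3 → ℝ) (x : Plane) :
    HasFDerivAt (hct b U d) (hctD b U d x) x := by
  have hc := fun i => hasFDerivAt_coord b i x
  refine HasFDerivAt.fun_sum fun i _ => ?_
  have h1 := ((((hc i).pow 2).const_mul 3).sub (((hc i).pow 3).const_mul 2)).const_mul (U i)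
  have h2 := (((hc i).pow 2).mul (hc (i + 1))).const_mul (d i (i + 1))
  have h3 := (((hc i).pow 2).mul (hc (i + 2))).const_mul (d i (i + 2))
  have h4 := (hasFDerivAt_bubble (continuous_minCoord b) (hasFDerivAt_coord b i)
    (hasFDerivAt_coord b (i + 1)) (hasFDerivAt_coord b (i + 2)) (minCoord_eq' b i) x).const_mul
      (hctCoeff b U d i)
  refine (((h1.add h2).add h3).add h4).congr_fderiv ?_
  ext v
  simp
  ring

/-- `e` and `rot e` are orthogonal and of equal length; multiplying by `‖e‖²` avoids division. -/
theorem inner_rot_left (e v : Plane) : ‖e‖ ^ 2 • v = ⟪e, v⟫_ℝ • e + ⟪rot e, v⟫_ℝ • rot e := by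
  have h := EuclideanSpace.real_norm_sq_eq e
  rw [Fin.sum_univ_two] at h
  rw [h]
  ext i
  fin_cases i <;> simp [rot, PiLp.inner_apply, Fin.sum_univ_two] <;> ring

theorem norm_rot (v : Plane) : ‖rot v‖ = ‖v‖ := by
  have h1 := EuclideanSpace.real_norm_sq_eq v
  have h2 := EuclideanSpace.real_norm_sq_eq (rot v)
  rw [Fin.sum_univ_two] at h1 h2
  have : ‖rot v‖ ^ 2 = ‖v‖ ^ 2 := by rw [h1, h2]; simp [rot]; ring
  exact (sq_eq_sq₀ (norm_nonneg _) (norm_nonneg _)).1 this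

theorem coordL_sub (i j k : Fin 3) :
    coordL b i (b k - b j) = b.coord i (b k) - b.coord i (b j) := (coord_sub b i _ _).symm

/-- The linear part of the coordinate `k` applied to the decomposition of `b k - b (k + 1)` along
the opposite edge and its normal: it annihilates the edge and has the value 1 on the whole vector.
The identity shows that the normal derivative is nonzero and bounds it from below. -/
theorem coordL_edgeNormal (k : Fin 3) : ‖b (k + 2) - b (k + 1)‖ ^ 2 =
    ⟪edgeNormal b k, b k - b (k + 1)⟫_ℝ * coordL b k (edgeNormal b k) := by
  have h := congrArg (coordL b k) (inner_rot_left (b (k + 2) - b (k + 1)) (b k - b (k + 1)))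
  have h1 : k ≠ k + 1 := by fin_cases k <;> decide
  have h2 : k ≠ k + 2 := by fin_cases k <;> decide
  simp only [map_smul, map_add, smul_eq_mul, coordL_sub, b.coord_apply_eq, b.coord_apply_ne h1,
    b.coord_apply_ne h2, sub_zero, mul_one, mul_zero, zero_add] at h
  exact h

theorem sub_vertices_ne_zero (k : Fin 3) : b (k + 2) - b (k + 1) ≠ 0 :=
  sub_ne_zero.2 fun h => by
    have := b.ind.injective h
    revert this; fin_cases k <;> decide

theorem coordL_edgeNormal_ne_zero (k : Fin 3) : coordL b k (edgeNormal b k) ≠ 0 := fun h => by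
  have := coordL_edgeNormal b k
  rw [h, mul_zero, sq_eq_zero_iff, norm_eq_zero] at this
  exact sub_vertices_ne_zero b k this

variable {b}

theorem minCoord_eq_zero {x : Plane} (hx : ∀ i, 0 ≤ b.coord i x) {k : Fin 3}
    (hk : b.coord k x = 0) : minCoord b x = 0 := by
  refine le_antisymm ?_ (le_min (hx 0) (le_min (hx 1) (hx 2)))
  rw [← hk]
  unfold minCoord
  fin_cases k
  · exact min_le_left _ _
  · exact (min_le_right _ _).trans (min_le_left _ _)
  · exact (min_le_right _ _).trans (min_le_right _ _)

/-- On the boundary of the triangle the smallest coordinate is zero, so the bubbles disappear and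
the cubic Hermite polynomial of the endpoint data remains. -/
theorem hct_edge (U : Fin 3 → ℝ) (d : Fin 3 → Fin 3 → ℝ) {x : Plane} (hx : ∀ i, 0 ≤ b.coord i x)
    {k : Fin 3} (hk : b.coord k x = 0) : hct b U d x =
      U (k + 1) * (3 * b.coord (k + 1) x ^ 2 - 2 * b.coord (k + 1) x ^ 3) +
      U (k + 2) * (3 * b.coord (k + 2) x ^ 2 - 2 * b.coord (k + 2) x ^ 3) +
      d (k + 1) (k + 2) * (b.coord (k + 1) x ^ 2 * b.coord (k + 2) x) +
      d (k + 2) (k + 1) * (b.coord (k + 2) x ^ 2 * b.coord (k + 1) x) := by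
  rw [hct, Fin.sum_univ_three, minCoord_eq_zero hx hk]
  simp only [bubble]
  fin_cases k
  all_goals simp at hk ⊢
  all_goals simp only [hk]
  all_goals ring_nf

/-- With smallest coordinate zero the gradient of the bubble of index `i` is `6 λ_{i+1} λ_{i+2}
∇λ_i`. On the edge opposite to `k` only `i = k` survives, so each coefficient `hctCoeff` can be
adjusted to one edge independently. -/
theorem hctD_edge (U : Fin 3 → ℝ) (d : Fin 3 → Fin 3 → ℝ) {x : Plane} (hx : ∀ i, 0 ≤ b.coord i x)
    {k : Fin 3} (hk : b.coord k x = 0) (v : Plane) : hctD b U d x v =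
      U (k + 1) * (6 * b.coord (k + 1) x - 6 * b.coord (k + 1) x ^ 2) * coordL b (k + 1) v +
      U (k + 2) * (6 * b.coord (k + 2) x - 6 * b.coord (k + 2) x ^ 2) * coordL b (k + 2) v +
      d (k + 1) (k + 2) * (2 * b.coord (k + 1) x * b.coord (k + 2) x * coordL b (k + 1) v +
        b.coord (k + 1) x ^ 2 * coordL b (k + 2) v) +
      d (k + 2) (k + 1) * (2 * b.coord (k + 1) x * b.coord (k + 2) x * coordL b (k + 2) v +
        b.coord (k + 2) x ^ 2 * coordL b (k + 1) v) +
      (d (k + 1) k * b.coord (k + 1) x ^ 2 + d (k + 2) k * b.coord (k + 2) x ^ 2 +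
        6 * hctCoeff b U d k * b.coord (k + 1) x * b.coord (k + 2) x) * coordL b k v := by
  rw [hctD, Fin.sum_univ_three, minCoord_eq_zero hx hk]
  simp only [add_apply, smul_apply, smul_eq_mul]
  generalize hctCoeff b U d = c
  fin_cases k
  all_goals simp at hk ⊢
  all_goals simp only [hk]
  all_goals ring_nf

theorem coord_other {k : Fin 3} {x : Plane} (hk : b.coord k x = 0) :
    b.coord (k + 1) x = 1 - b.coord (k + 2) x := by
  have := b.sum_coord_apply_eq_one x
  rw [Fin.sum_univ_three] at this
  fin_cases k
  all_goals simp at hk ⊢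
  all_goals linarith

theorem coordL_other (k : Fin 3) (v : Plane) :
    coordL b k v = -coordL b (k + 1) v - coordL b (k + 2) v := by
  have := sum_coordL b v
  rw [Fin.sum_univ_three] at this
  fin_cases k
  all_goals simp
  all_goals linarith

theorem succ_ne_self_fin_three : ∀ k : Fin 3, k ≠ k + 1 ∧ k ≠ k + 2 ∧ k + 1 ≠ k + 2 := by decide

theorem exists_opposite : ∀ i j : Fin 3, i ≠ j →
    ∃ k, (i = k + 1 ∧ j = k + 2) ∨ (i = k + 2 ∧ j = k + 1) := by decide

/-- The edge derivatives given by vertex gradients. -/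
noncomputable def edgeDeriv (b : AffineBasis (Fin 3) ℝ Plane) (G : Fin 3 → Plane) (i j : Fin 3) : ℝ :=
  ⟪G i, b j - b i⟫_ℝ

theorem inner_eq_edgeDeriv (G : Fin 3 → Plane) (i k : Fin 3) (v : Plane) :
    ⟪G i, v⟫_ℝ = edgeDeriv b G i k * coordL b k v +
      edgeDeriv b G i (k + 1) * coordL b (k + 1) v +
      edgeDeriv b G i (k + 2) * coordL b (k + 2) v := by
  conv_lhs => rw [← sum_coordL_smul_sub b v (b i)]
  rw [inner_sum, Fin.sum_univ_three]
  simp only [inner_smul_right, edgeDeriv]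
  fin_cases k
  all_goals simp
  all_goals ring

theorem edgeDeriv_self (G : Fin 3 → Plane) (i : Fin 3) : edgeDeriv b G i i = 0 := by
  simp [edgeDeriv]

/-- A quadratic normal derivative with prescribed endpoint values is linear up to a multiple of
`λ_{k+1} λ_{k+2}`. The coefficient `hctCoeff` is the one for which this multiple is zero, as the
identity `hc` expresses. -/
theorem hctD_edgeNormal (U : Fin 3 → ℝ) (G : Fin 3 → Plane) {x : Plane}
    (hx : ∀ i, 0 ≤ b.coord i x) {k : Fin 3} (hk : b.coord k x = 0) :
    hctD b U (edgeDeriv b G) x (edgeNormal b k) =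
      b.coord (k + 1) x * ⟪G (k + 1), edgeNormal b k⟫_ℝ +
        b.coord (k + 2) x * ⟪G (k + 2), edgeNormal b k⟫_ℝ := by
  have hn := coordL_edgeNormal_ne_zero b k
  have hc : 6 * hctCoeff b U (edgeDeriv b G) k * coordL b k (edgeNormal b k) =
      (edgeDeriv b G (k + 1) k + edgeDeriv b G (k + 2) k) * coordL b k (edgeNormal b k) +
      coordL b (k + 1) (edgeNormal b k) * (-6 * U (k + 1) - 2 * edgeDeriv b G (k + 1) (k + 2) +
        edgeDeriv b G (k + 2) (k + 1)) +
      coordL b (k + 2) (edgeNormal b k) * (-6 * U (k + 2) - 2 * edgeDeriv b G (k + 2) (k + 1) +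
        edgeDeriv b G (k + 1) (k + 2)) := by
    rw [hctCoeff, normalRatio, normalRatio]
    field_simp
  rw [hctD_edge U _ hx hk, inner_eq_edgeDeriv (b := b) G (k + 1) k, inner_eq_edgeDeriv (b := b) G (k + 2) k,
    edgeDeriv_self, edgeDeriv_self, coord_other hk]
  linear_combination (b.coord (k + 2) x * (1 - b.coord (k + 2) x)) * hc

theorem hctD_of_inner_eq_zero (U : Fin 3 → ℝ) (G : Fin 3 → Plane) {x : Plane}
    (hx : ∀ i, 0 ≤ b.coord i x) {k : Fin 3} (hk : b.coord k x = 0) {n : Plane}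
    (hn : ⟪n, b (k + 2) - b (k + 1)⟫_ℝ = 0) : hctD b U (edgeDeriv b G) x n =
      b.coord (k + 1) x * ⟪G (k + 1), n⟫_ℝ + b.coord (k + 2) x * ⟪G (k + 2), n⟫_ℝ := by
  have h := inner_rot_left (b (k + 2) - b (k + 1)) n
  rw [real_inner_comm, hn, zero_smul, zero_add] at h
  have h0 : ‖b (k + 2) - b (k + 1)‖ ^ 2 ≠ 0 :=
    pow_ne_zero _ (norm_ne_zero_iff.2 (sub_vertices_ne_zero b k))
  have e : n = (‖b (k + 2) - b (k + 1)‖ ^ 2)⁻¹ •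
      (⟪rot (b (k + 2) - b (k + 1)), n⟫_ℝ • edgeNormal b k) := by
    rw [eq_inv_smul_iff₀ h0, h]; rfl
  rw [e]
  simp only [map_smul, inner_smul_right, smul_eq_mul, hctD_edgeNormal U G hx hk]
  ring

section edge

variable (U : Fin 3 → ℝ) (G : Fin 3 → Plane) {i j : Fin 3} (hij : i ≠ j) {t : ℝ}
  (ht : t ∈ Icc (0 : ℝ) 1)
include hij ht

omit hij in
theorem coord_lineMap_nonneg (l : Fin 3) :
    0 ≤ b.coord l (AffineMap.lineMap (b i) (b j) t) := by
  rw [coord_lineMap, b.coord_apply, b.coord_apply]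
  have := ht.1
  have := ht.2
  split_ifs <;> linarith

omit ht in
theorem coord_lineMap_left : b.coord i (AffineMap.lineMap (b i) (b j) t) = 1 - t := by
  rw [coord_lineMap, b.coord_apply_eq, b.coord_apply_ne hij]; ring

omit ht in
theorem coord_lineMap_right : b.coord j (AffineMap.lineMap (b i) (b j) t) = t := by
  rw [coord_lineMap, b.coord_apply_eq, b.coord_apply_ne hij.symm]; ring

omit ht hij in
theorem coord_lineMap_opposite {k : Fin 3} (hki : k ≠ i) (hkj : k ≠ j) :
    b.coord k (AffineMap.lineMap (b i) (b j) t) = 0 := by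
  rw [coord_lineMap, b.coord_apply_ne hki, b.coord_apply_ne hkj]; ring

/-- Only data at the two endpoints enter. Together with the tangential and normal derivatives below
this makes interpolants on neighbouring triangles agree to first order along a common edge. -/
theorem hct_lineMap : hct b U (edgeDeriv b G) (AffineMap.lineMap (b i) (b j) t) =
    U i * (3 * (1 - t) ^ 2 - 2 * (1 - t) ^ 3) + U j * (3 * t ^ 2 - 2 * t ^ 3) +
      ⟪G i, b j - b i⟫_ℝ * ((1 - t) ^ 2 * t) - ⟪G j, b j - b i⟫_ℝ * (t ^ 2 * (1 - t)) := by
  have hl := coord_lineMap_left (b := b) hij (t := t)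
  have hr := coord_lineMap_right (b := b) hij (t := t)
  have e : edgeDeriv b G j i = -⟪G j, b j - b i⟫_ℝ := by
    rw [edgeDeriv, ← inner_neg_right, neg_sub]
  have e' : edgeDeriv b G i j = ⟪G i, b j - b i⟫_ℝ := rfl
  obtain ⟨k, ⟨rfl, rfl⟩ | ⟨rfl, rfl⟩⟩ := exists_opposite i j hij
  · rw [hct_edge U _ (coord_lineMap_nonneg ht) (coord_lineMap_opposite
      (succ_ne_self_fin_three k).1 (succ_ne_self_fin_three k).2.1), hl, hr, e, e']
    ring
  · rw [hct_edge U _ (coord_lineMap_nonneg ht) (coord_lineMap_opposite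
      (succ_ne_self_fin_three k).2.1 (succ_ne_self_fin_three k).1), hl, hr, e, e']
    ring

theorem hctD_lineMap_tangent :
    hctD b U (edgeDeriv b G) (AffineMap.lineMap (b i) (b j) t) (b j - b i) =
      (U j - U i) * (6 * t - 6 * t ^ 2) + ⟪G i, b j - b i⟫_ℝ * ((1 - t) ^ 2 - 2 * t * (1 - t)) -
        ⟪G j, b j - b i⟫_ℝ * (2 * t * (1 - t) - t ^ 2) := by
  have hl := coord_lineMap_left (b := b) hij (t := t)
  have hr := coord_lineMap_right (b := b) hij (t := t)
  have e : edgeDeriv b G j i = -⟪G j, b j - b i⟫_ℝ := by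
    rw [edgeDeriv, ← inner_neg_right, neg_sub]
  have e' : edgeDeriv b G i j = ⟪G i, b j - b i⟫_ℝ := rfl
  have d1 : coordL b i (b j - b i) = -1 := by
    rw [coordL_sub, b.coord_apply_eq, b.coord_apply_ne hij]; ring
  have d2 : coordL b j (b j - b i) = 1 := by
    rw [coordL_sub, b.coord_apply_eq, b.coord_apply_ne hij.symm]; ring
  have d3 : ∀ k, k ≠ i → k ≠ j → coordL b k (b j - b i) = 0 := fun k hi hj => by
    rw [coordL_sub, b.coord_apply_ne hi, b.coord_apply_ne hj]; ring
  obtain ⟨k, ⟨rfl, rfl⟩ | ⟨rfl, rfl⟩⟩ := exists_opposite i j hij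
  · have hk := succ_ne_self_fin_three k
    rw [hctD_edge U _ (coord_lineMap_nonneg ht) (coord_lineMap_opposite hk.1 hk.2.1), hl, hr, e,
      e', d1, d2, d3 k hk.1 hk.2.1]
    ring
  · have hk := succ_ne_self_fin_three k
    rw [hctD_edge U _ (coord_lineMap_nonneg ht) (coord_lineMap_opposite hk.2.1 hk.1), hl, hr, e,
      e', d1, d2, d3 k hk.2.1 hk.1]
    ring

theorem hctD_lineMap_normal {n : Plane} (hn : ⟪n, b j - b i⟫_ℝ = 0) :
    hctD b U (edgeDeriv b G) (AffineMap.lineMap (b i) (b j) t) n =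
      (1 - t) * ⟪G i, n⟫_ℝ + t * ⟪G j, n⟫_ℝ := by
  have hl := coord_lineMap_left (b := b) hij (t := t)
  have hr := coord_lineMap_right (b := b) hij (t := t)
  obtain ⟨k, ⟨rfl, rfl⟩ | ⟨rfl, rfl⟩⟩ := exists_opposite i j hij
  · have hk := succ_ne_self_fin_three k
    rw [hctD_of_inner_eq_zero U G (coord_lineMap_nonneg ht) (coord_lineMap_opposite hk.1 hk.2.1)
      hn, hl, hr]
  · have hk := succ_ne_self_fin_three k
    rw [hctD_of_inner_eq_zero U G (coord_lineMap_nonneg ht) (coord_lineMap_opposite hk.2.1 hk.1)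
      (by rw [← neg_sub, inner_neg_right, hn, neg_zero]), hl, hr, add_comm]

end edge

theorem hct_vertex (U : Fin 3 → ℝ) (G : Fin 3 → Plane) (i : Fin 3) :
    hct b U (edgeDeriv b G) (b i) = U i := by
  have h := hct_lineMap (b := b) U G (succ_ne_self_fin_three i).1 (t := 0) (by simp)
  rw [AffineMap.lineMap_apply_zero] at h
  rw [h]; ring

theorem hctD_vertex (U : Fin 3 → ℝ) (G : Fin 3 → Plane) (i : Fin 3) (v : Plane) :
    hctD b U (edgeDeriv b G) (b i) v = ⟪G i, v⟫_ℝ := by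
  set e := b (i + 1) - b i with he
  have hi := (succ_ne_self_fin_three i).1
  have h1 := hctD_lineMap_tangent (b := b) U G hi (t := 0) (by simp)
  have h2 := hctD_lineMap_normal (b := b) U G hi (t := 0) (by simp) (inner_rot e)
  rw [AffineMap.lineMap_apply_zero] at h1 h2
  have h0 : ‖e‖ ^ 2 ≠ 0 := pow_ne_zero _ (norm_ne_zero_iff.2 (sub_ne_zero.2 fun h =>
    hi (b.ind.injective h.symm)))
  have h3 := inner_rot_left e v
  have h4 := congrArg (hctD b U (edgeDeriv b G) (b i)) h3
  have h5 := congrArg (fun w => ⟪G i, w⟫_ℝ) h3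
  simp only [map_smul, map_add, smul_eq_mul, inner_add_right, inner_smul_right] at h4 h5
  rw [h1, h2] at h4
  refine mul_left_cancel₀ h0 ?_
  rw [h4, h5]
  ring

/-- The interpolation reproduces quadratic polynomials. -/
theorem hct_quadratic (a : Fin 3 → Fin 3 → ℝ) (ha : ∀ i j, a i j = a j i) (x : Plane) :
    hct b (fun i => a i i) (fun i j => 2 * a i j - 2 * a i i) x =
      ∑ i, ∑ j, a i j * (b.coord i x * b.coord j x) := by
  have hs : b.coord 0 x + b.coord 1 x + b.coord 2 x = 1 := by
    rw [← Fin.sum_univ_three (f := fun i => b.coord i x)]; exact b.sum_coord_apply_eq_one x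
  -- The gradients of the three coordinates add up to zero, so the two ratios add up to -1.
  have hr : ∀ k, normalRatio b k (k + 2) = -1 - normalRatio b k (k + 1) := fun k => by
    rw [normalRatio, normalRatio]
    have h := coordL_other (b := b) k (edgeNormal b k)
    have hn := coordL_edgeNormal_ne_zero b k
    rw [div_eq_iff hn, sub_mul, div_mul_cancel₀ _ hn]
    linarith
  -- The polynomial `∑ a_ij λ_i λ_j` has the vertex values `a_ii` and the edge derivatives `2 a_ij -
  -- 2 a_ii`; for such data the three bubble coefficients coincide.
  have hc : ∀ k, hctCoeff b (fun i => a i i) (fun i j => 2 * a i j - 2 * a i i) k =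
      (a 0 1 + a 1 2 + a 2 0) / 3 := fun k => by
    rw [hctCoeff, hr]
    have h01 := ha 0 1
    have h12 := ha 1 2
    have h20 := ha 2 0
    fin_cases k
    all_goals simp
    all_goals rw [h01, h12, h20]
    all_goals ring
  -- The three bubbles add up to the polynomial `6 λ_0 λ_1 λ_2`, whichever coordinate is the
  -- smallest; this removes the piecewise character.
  have hb : bubble (minCoord b x) (b.coord 1 x) (b.coord 2 x) +
      bubble (minCoord b x) (b.coord 2 x) (b.coord 0 x) +
      bubble (minCoord b x) (b.coord 0 x) (b.coord 1 x) =
        6 * (b.coord 0 x * b.coord 1 x * b.coord 2 x) := by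
    have e2 : b.coord 2 x = 1 - b.coord 0 x - b.coord 1 x := by linarith
    unfold bubble
    rcases minCoord_eq b x with h | h | h
    all_goals rw [h, e2]; ring
  have e2 : b.coord 2 x = 1 - b.coord 0 x - b.coord 1 x := by linarith
  rw [hct]
  simp only [hc, Fin.sum_univ_three]
  simp
  have h10 := ha 1 0
  have h21 := ha 2 1
  have h02 := ha 0 2
  rw [h10, h21, h02]
  generalize bubble (minCoord b x) (b.coord 1 x) (b.coord 2 x) = B₀ at hb ⊢
  generalize bubble (minCoord b x) (b.coord 2 x) (b.coord 0 x) = B₁ at hb ⊢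
  generalize bubble (minCoord b x) (b.coord 0 x) (b.coord 1 x) = B₂ at hb ⊢
  rw [e2] at hb ⊢
  linear_combination ((a 0 1 + a 1 2 + a 2 0) / 3) * hb

end hct

end

section

open Filter Metric Topology

/-! ### Bounds for the interpolant -/

section bounds

variable {b : AffineBasis (Fin 3) ℝ Plane}

theorem hct_sub (U V : Fin 3 → ℝ) (d e : Fin 3 → Fin 3 → ℝ) (x : Plane) :
    hct b U d x - hct b V e x = hct b (fun i => U i - V i) (fun i j => d i j - e i j) x := by
  simp only [hct, hctCoeff, Fin.sum_univ_three]
  ring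

theorem hctD_sub (U V : Fin 3 → ℝ) (d e : Fin 3 → Fin 3 → ℝ) (x : Plane) :
    hctD b U d x - hctD b V e x = hctD b (fun i => U i - V i) (fun i j => d i j - e i j) x := by
  ext v
  simp only [hctD, hctCoeff, Fin.sum_univ_three, add_apply, sub_apply, smul_apply, smul_eq_mul]
  ring

/-- The coordinate is at most 1 at the centre and positive in the ball, so it cannot drop by more
than 1 within distance `r`; replacing `w` by `-w` bounds the absolute value. -/
theorem abs_coordL_le {x₀ : Plane} {r : ℝ} (hr : 0 < r)
    (hball : ∀ x ∈ ball x₀ r, ∀ i, 0 < b.coord i x) (i : Fin 3) (v : Plane) :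
    |coordL b i v| ≤ ‖v‖ / r := by
  have h1 : ∀ w : Plane, ‖w‖ < r → -1 ≤ coordL b i w := fun w hw => by
    have h2 := hball (x₀ + w) (by simpa using hw) i
    have h3 := coord_sub b i x₀ (x₀ + w)
    rw [add_sub_cancel_left] at h3
    have h4 := (coord_mem_Icc (fun i => (hball x₀ (mem_ball_self hr) i).le) i).2
    linarith
  have h2 : ∀ w : Plane, ‖w‖ < r → |coordL b i w| ≤ 1 := fun w hw => by
    have := h1 w hw
    have h3 := h1 (-w) (by rwa [norm_neg])
    rw [map_neg] at h3
    exact abs_le.2 ⟨by linarith, by linarith⟩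
  rw [le_div_iff₀ hr]
  refine le_of_forall_pos_le_add fun ε hε => ?_
  by_contra! hlt
  -- The vector `c • v` has length below `r`. The extra summand keeps the denominator positive also
  -- for `v = 0` and is small enough to be lost against `ε`.
  set c := r / (‖v‖ + ε / (|coordL b i v| + 1)) with hc
  have hA : 0 ≤ |coordL b i v| := abs_nonneg _
  have hden : 0 < ‖v‖ + ε / (|coordL b i v| + 1) := by positivity
  have hc0 : 0 < c := div_pos hr hden
  have h3 := h2 (c • v) (by
    rw [norm_smul, Real.norm_of_nonneg hc0.le, hc, div_mul_eq_mul_div, div_lt_iff₀ hden]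
    have : 0 < ε / (|coordL b i v| + 1) := by positivity
    nlinarith)
  rw [map_smul, smul_eq_mul, abs_mul, abs_of_pos hc0, hc, div_mul_eq_mul_div, div_le_one hden] at h3
  have h4 : ε / (|coordL b i v| + 1) ≤ ε := div_le_self hε.le (by linarith)
  linarith [mul_comm r |coordL b i v|]

/-- The normal has the length of the edge. By `coordL_edgeNormal` the denominator is at least this
length divided by `h`, while the numerator is at most this length divided by `r`. -/
theorem abs_normalRatio_le {r h : ℝ} (hr : 0 < r) (hL : ∀ i v, |coordL b i v| ≤ ‖v‖ / r)
    (hh : ∀ i j, ‖b i - b j‖ ≤ h) (k i : Fin 3) : |normalRatio b k i| ≤ h / r := by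
  have hn := coordL_edgeNormal b k
  have hl : 0 < ‖b (k + 2) - b (k + 1)‖ := norm_pos_iff.2 (sub_vertices_ne_zero b k)
  have hnorm : ‖edgeNormal b k‖ = ‖b (k + 2) - b (k + 1)‖ := norm_rot _
  have h1 : ‖b (k + 2) - b (k + 1)‖ ≤ h * |coordL b k (edgeNormal b k)| := by
    have h2 : ‖b (k + 2) - b (k + 1)‖ ^ 2 ≤
        ‖b (k + 2) - b (k + 1)‖ * h * |coordL b k (edgeNormal b k)| := by
      rw [hn]
      refine (le_abs_self _).trans ?_
      rw [abs_mul]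
      refine mul_le_mul_of_nonneg_right ?_ (abs_nonneg _)
      refine (abs_real_inner_le_norm _ _).trans ?_
      rw [hnorm]
      exact mul_le_mul_of_nonneg_left (hh _ _) hl.le
    rw [sq, mul_assoc] at h2
    exact le_of_mul_le_mul_left h2 hl
  have h3 : 0 < |coordL b k (edgeNormal b k)| := abs_pos.2 (coordL_edgeNormal_ne_zero b k)
  rw [normalRatio, abs_div, div_le_div_iff₀ h3 hr]
  have h4 := hL i (edgeNormal b k)
  rw [hnorm, le_div_iff₀ hr] at h4
  exact h4.trans h1

theorem abs_le_mul_of_abs_le {x y A B : ℝ} (hx : |x| ≤ A) (hy : |y| ≤ B) : |x * y| ≤ A * B := by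
  rw [abs_mul]
  exact mul_le_mul hx hy (abs_nonneg _) ((abs_nonneg _).trans hx)

theorem abs_mul_sub_mul_le {p p' q q' B C E F : ℝ} (hp : |p| ≤ B) (hq : |q'| ≤ C) (h : |p - p'| ≤ E)
    (h' : |q - q'| ≤ F) : |p * q - p' * q'| ≤ B * F + E * C := by
  have : p * q - p' * q' = p * (q - q') + (p - p') * q' := by ring
  rw [this]
  exact (abs_add_le _ _).trans (add_le_add (abs_le_mul_of_abs_le hp h') (abs_le_mul_of_abs_le h hq))

theorem abs_hctCoeff_le {ρ A : ℝ} (hρ : 1 ≤ ρ) (hN : ∀ k i, |normalRatio b k i| ≤ ρ)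
    {U : Fin 3 → ℝ} {d : Fin 3 → Fin 3 → ℝ} (hU : ∀ i, |U i| ≤ A) (hd : ∀ i j, |d i j| ≤ A)
    (k : Fin 3) : |hctCoeff b U d k| ≤ 4 * ρ * A := by
  have hA : 0 ≤ A := (abs_nonneg _).trans (hU 0)
  have h1 : ∀ i j, |-6 * U i - 2 * d i j + d j i| ≤ 9 * A := fun i j => by
    have a1 := abs_le.1 (hU i)
    have a2 := abs_le.1 (hd i j)
    have a3 := abs_le.1 (hd j i)
    exact abs_le.2 ⟨by linarith, by linarith⟩
  have h2 := abs_le.1 (abs_le_mul_of_abs_le (hN k (k + 1)) (h1 (k + 1) (k + 2)))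
  have h3 := abs_le.1 (abs_le_mul_of_abs_le (hN k (k + 2)) (h1 (k + 2) (k + 1)))
  have h4 := abs_le.1 (hd (k + 1) k)
  have h5 := abs_le.1 (hd (k + 2) k)
  have h6 : A ≤ ρ * A := le_mul_of_one_le_left hA hρ
  rw [hctCoeff]
  exact abs_le.2 ⟨by linarith, by linarith⟩

theorem minCoord_mem_Icc {x : Plane} (hx : ∀ i, 0 ≤ b.coord i x) : minCoord b x ∈ Icc (0 : ℝ) 1 := by
  rcases minCoord_eq b x with h | h | h
  all_goals rw [h]; exact coord_mem_Icc hx _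

theorem abs_minCoord_sub_le {x y : Plane} {p : ℝ}
    (h : ∀ i, |b.coord i x - b.coord i y| ≤ p) : |minCoord b x - minCoord b y| ≤ p :=
  (abs_min_sub_min_le_max _ _ _ _).trans (max_le (h 0)
    ((abs_min_sub_min_le_max _ _ _ _).trans (max_le (h 1) (h 2))))

theorem abs_bubble_le {m α β : ℝ} (hm : m ∈ Icc (0 : ℝ) 1) (hα : α ∈ Icc (0 : ℝ) 1)
    (hβ : β ∈ Icc (0 : ℝ) 1) : |bubble m α β| ≤ 14 := by
  have h1 : |m| ≤ 1 := abs_le.2 ⟨by linarith [hm.1], hm.2⟩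
  have h2 : |α| ≤ 1 := abs_le.2 ⟨by linarith [hα.1], hα.2⟩
  have h3 : |β| ≤ 1 := abs_le.2 ⟨by linarith [hβ.1], hβ.2⟩
  have a1 := abs_le.1 (abs_le_mul_of_abs_le (abs_le_mul_of_abs_le h1 h2) h3)
  have a2 := abs_le.1 (abs_le_mul_of_abs_le (abs_le_mul_of_abs_le h1 h1) h2)
  have a3 := abs_le.1 (abs_le_mul_of_abs_le (abs_le_mul_of_abs_le h1 h1) h3)
  have a4 := abs_le.1 (abs_le_mul_of_abs_le (abs_le_mul_of_abs_le h1 h1) h1)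
  have e : bubble m α β = 6 * (m * α * β) - 3 * (m * m * α) - 3 * (m * m * β) + 2 * (m * m * m) := by
    unfold bubble; ring
  rw [e]
  exact abs_le.2 ⟨by linarith, by linarith⟩

/-- Per vertex: three terms bounded by `A`, and the coefficient `4 ρ A` times a bubble of size 14.
This makes 59, rounded to 60, for each of three vertices. -/
theorem abs_hct_le {ρ A : ℝ} (hρ : 1 ≤ ρ) (hN : ∀ k i, |normalRatio b k i| ≤ ρ)
    {U : Fin 3 → ℝ} {d : Fin 3 → Fin 3 → ℝ} (hU : ∀ i, |U i| ≤ A) (hd : ∀ i j, |d i j| ≤ A)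
    {x : Plane} (hx : ∀ i, 0 ≤ b.coord i x) : |hct b U d x| ≤ 180 * ρ * A := by
  have hA : 0 ≤ A := (abs_nonneg _).trans (hU 0)
  have h6 : A ≤ ρ * A := le_mul_of_one_le_left hA hρ
  have hc : ∀ i, |b.coord i x| ≤ 1 := fun i =>
    abs_le.2 ⟨by linarith [hx i], (coord_mem_Icc hx i).2⟩
  have h1 : ∀ i, |U i * (3 * b.coord i x ^ 2 - 2 * b.coord i x ^ 3) +
    d i (i + 1) * (b.coord i x ^ 2 * b.coord (i + 1) x) +
    d i (i + 2) * (b.coord i x ^ 2 * b.coord (i + 2) x) +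
    hctCoeff b U d i * bubble (minCoord b x) (b.coord (i + 1) x) (b.coord (i + 2) x)| ≤
      60 * ρ * A := fun i => by
    have a1 : |3 * b.coord i x ^ 2 - 2 * b.coord i x ^ 3| ≤ 1 := by
      have := coord_mem_Icc hx i
      rw [abs_le]
      constructor <;> nlinarith [this.1, this.2, mul_nonneg this.1 this.1,
        mul_nonneg (mul_nonneg this.1 this.1) this.1, mul_nonneg (mul_nonneg this.1 this.1)
          (sub_nonneg.2 this.2), mul_nonneg (sq_nonneg (1 - b.coord i x)) this.1]
    have a2 : ∀ j, |b.coord i x ^ 2 * b.coord j x| ≤ 1 := fun j => by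
      have := abs_le_mul_of_abs_le (abs_le_mul_of_abs_le (hc i) (hc i)) (hc j)
      rw [sq]; linarith
    have b1 := abs_le.1 (abs_le_mul_of_abs_le (hU i) a1)
    have b2 := abs_le.1 (abs_le_mul_of_abs_le (hd i (i + 1)) (a2 (i + 1)))
    have b3 := abs_le.1 (abs_le_mul_of_abs_le (hd i (i + 2)) (a2 (i + 2)))
    have b4 := abs_le.1 (abs_le_mul_of_abs_le (abs_hctCoeff_le hρ hN hU hd i)
      (abs_bubble_le (minCoord_mem_Icc hx) (coord_mem_Icc hx (i + 1)) (coord_mem_Icc hx (i + 2))))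
    exact abs_le.2 ⟨by linarith, by linarith⟩
  refine (Finset.abs_sum_le_sum_abs _ _).trans ((Finset.sum_le_sum fun i _ => h1 i).trans (le_of_eq ?_))
  simp
  ring

/-- A bound on second derivatives in the form of difference quotients, as the gradient is only
piecewise smooth inside the triangle. All coefficients are products of quantities bounded by 1 that
vary by at most a multiple of `‖x - y‖ / r`, since `minCoord` varies no more than the coordinates;
the linear parts contribute `‖v‖ / r`. -/
theorem abs_hctD_sub_le {ρ A r : ℝ} (hρ : 1 ≤ ρ) (hN : ∀ k i, |normalRatio b k i| ≤ ρ)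
    (hL : ∀ i v, |coordL b i v| ≤ ‖v‖ / r)
    {U : Fin 3 → ℝ} {d : Fin 3 → Fin 3 → ℝ} (hU : ∀ i, |U i| ≤ A) (hd : ∀ i j, |d i j| ≤ A)
    {x y : Plane} (hx : ∀ i, 0 ≤ b.coord i x) (hy : ∀ i, 0 ≤ b.coord i y) (v : Plane) :
    |hctD b U d x v - hctD b U d y v| ≤ 900 * ρ * A * (‖x - y‖ / r) * (‖v‖ / r) := by
  have hA : 0 ≤ A := (abs_nonneg _).trans (hU 0)
  set p := ‖x - y‖ / r with hp
  set q := ‖v‖ / r with hq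
  have hp0 : 0 ≤ p := (abs_nonneg _).trans (hL 0 _)
  have hq0 : 0 ≤ q := (abs_nonneg _).trans (hL 0 _)
  have h6 : A * p * q ≤ ρ * A * p * q := by
    have := le_mul_of_one_le_left (mul_nonneg (mul_nonneg hA hp0) hq0) hρ
    linarith
  have hd1 : ∀ i, |b.coord i x - b.coord i y| ≤ p := fun i => by rw [coord_sub]; exact hL i _
  have hdm := abs_minCoord_sub_le hd1
  have hc : ∀ {z}, (∀ i, 0 ≤ b.coord i z) → ∀ i, |b.coord i z| ≤ 1 := fun hz i =>
    abs_le.2 ⟨by linarith [hz i], (coord_mem_Icc hz i).2⟩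
  have hm : ∀ {z}, (∀ i, 0 ≤ b.coord i z) → |minCoord b z| ≤ 1 := fun hz =>
    abs_le.2 ⟨by linarith [(minCoord_mem_Icc hz).1], (minCoord_mem_Icc hz).2⟩
  have hcm : ∀ {z}, (∀ i, 0 ≤ b.coord i z) → ∀ i, |b.coord i z - minCoord b z| ≤ 1 := fun hz i => by
    have h1 := minCoord_mem_Icc hz
    have h2 := coord_mem_Icc hz i
    exact abs_le.2 ⟨by linarith [h1.2, h2.1], by linarith [h1.1, h2.2]⟩
  have hdcm : ∀ i, |(b.coord i x - minCoord b x) - (b.coord i y - minCoord b y)| ≤ 2 * p := fun i => by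
    have h1 := abs_le.1 (hd1 i)
    have h2 := abs_le.1 hdm
    exact abs_le.2 ⟨by linarith, by linarith⟩
  have hcc : ∀ i j, |b.coord i x * b.coord j x - b.coord i y * b.coord j y| ≤ 2 * p := fun i j => by
    linarith [abs_mul_sub_mul_le (hc hx i) (hc hy j) (hd1 i) (hd1 j)]
  have hmc : ∀ j, |minCoord b x * b.coord j x - minCoord b y * b.coord j y| ≤ 2 * p := fun j => by
    linarith [abs_mul_sub_mul_le (hm hx) (hc hy j) hdm (hd1 j)]
  have hmm : |minCoord b x * minCoord b x - minCoord b y * minCoord b y| ≤ 2 * p := by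
    linarith [abs_mul_sub_mul_le (hm hx) (hm hy) hdm hdm]
  have hss : ∀ i j, |(b.coord i x - minCoord b x) * (b.coord j x - minCoord b x) -
      (b.coord i y - minCoord b y) * (b.coord j y - minCoord b y)| ≤ 4 * p := fun i j => by
    linarith [abs_mul_sub_mul_le (hcm hx i) (hcm hy j) (hdcm i) (hdcm j)]
  have key : ∀ {c P B E : ℝ}, |c| ≤ B → |P| ≤ E → ∀ i, |c * P * coordL b i v| ≤ B * E * q :=
    fun h1 h2 i => abs_le_mul_of_abs_le (abs_le_mul_of_abs_le h1 h2) (hL i v)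
  simp only [hctD, sum_apply, add_apply, smul_apply, smul_eq_mul]
  rw [← Finset.sum_sub_distrib]
  refine (Finset.abs_sum_le_sum_abs _ _).trans ((Finset.sum_le_sum (g := fun _ =>
    300 * ρ * A * p * q) fun i _ => ?_).trans (le_of_eq ?_))
  · have hK := abs_hctCoeff_le hρ hN hU hd i
    have a1 := abs_le.1 (key (hU i) (hd1 i) i)
    have a2 := abs_le.1 (key (hU i) (hcc i i) i)
    have b1 := abs_le.1 (key (hd i (i + 1)) (hcc i (i + 1)) i)
    have b2 := abs_le.1 (key (hd i (i + 1)) (hcc i i) (i + 1))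
    have c1 := abs_le.1 (key (hd i (i + 2)) (hcc i (i + 2)) i)
    have c2 := abs_le.1 (key (hd i (i + 2)) (hcc i i) (i + 2))
    have d1 := abs_le.1 (key hK (hss (i + 1) (i + 2)) i)
    have d2 := abs_le.1 (key hK (hmc (i + 2)) (i + 1))
    have d3 := abs_le.1 (key hK hmm (i + 1))
    have d4 := abs_le.1 (key hK (hmc (i + 1)) (i + 2))
    have d5 := abs_le.1 (key hK hmm (i + 2))
    rw [abs_le]
    ring_nf at a1 a2 b1 b2 c1 c2 d1 d2 d3 d4 d5 h6 ⊢
    have h7 : 0 ≤ ρ * A * p * q := by positivity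
    constructor <;> linarith
  · simp
    ring

end bounds

end

section

open Filter Metric Topology

/-! ### Local interpolation error -/

/-- The quadratic polynomial `c + ∑ P_j x_j + ½ ∑ H_jk x_j x_k`. -/
noncomputable def quadratic (c : ℝ) (P : Fin 2 → ℝ) (H : Fin 2 → Fin 2 → ℝ) (x : Plane) : ℝ :=
  c + ∑ j, P j * x j + 1 / 2 * ∑ j, ∑ k, H j k * (x j * x k)

/-- The derivative of a quadratic polynomial. -/
noncomputable def quadraticD (P : Fin 2 → ℝ) (H : Fin 2 → Fin 2 → ℝ) (x v : Plane) : ℝ :=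
  ∑ j, v j * (P j + ∑ k, H j k * x k)

theorem hasFDerivAt_quadratic (c : ℝ) (P : Fin 2 → ℝ) {H : Fin 2 → Fin 2 → ℝ}
    (hH : ∀ j k, H j k = H k j) (x : Plane) :
    ∃ L : Plane →L[ℝ] ℝ, HasFDerivAt (quadratic c P H) L x ∧ ∀ v, L v = quadraticD P H x v := by
  have hp : ∀ j, HasFDerivAt (fun y : Plane => y j) (EuclideanSpace.proj j : Plane →L[ℝ] ℝ) x :=
    fun j => (EuclideanSpace.proj j : Plane →L[ℝ] ℝ).hasFDerivAt
  refine ⟨_, ((hasFDerivAt_const c x).add (HasFDerivAt.fun_sum (u := Finset.univ) fun j _ =>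
    (hp j).const_mul (P j))).add ((HasFDerivAt.fun_sum (u := Finset.univ) fun j _ =>
      HasFDerivAt.fun_sum (u := Finset.univ) fun k _ => ((hp j).mul (hp k)).const_mul (H j k)).const_mul
        (1 / 2)), fun v => ?_⟩
  have h10 := hH 1 0
  simp only [quadraticD, Fin.sum_univ_two, add_apply, smul_apply, zero_apply, smul_eq_mul, h10,
    show ∀ j, (EuclideanSpace.proj j : Plane →L[ℝ] ℝ) v = v j from fun _ => rfl]
  ring

theorem quadratic_eq_sum (b : AffineBasis (Fin 3) ℝ Plane) (c : ℝ) (P : Fin 2 → ℝ)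
    (H : Fin 2 → Fin 2 → ℝ) (x : Plane) : quadratic c P H x =
      ∑ i, ∑ j, (c + 1 / 2 * ∑ l, P l * (b i l + b j l) +
        1 / 2 * ∑ l, ∑ m, H l m * (b i l * b j m)) * (b.coord i x * b.coord j x) := by
  have hs : b.coord 0 x + b.coord 1 x + b.coord 2 x = 1 := by
    rw [← Fin.sum_univ_three (f := fun i => b.coord i x)]; exact b.sum_coord_apply_eq_one x
  have hx : ∀ l, x l = b.coord 0 x * b 0 l + b.coord 1 x * b 1 l + b.coord 2 x * b 2 l := fun l => by
    have := congrArg (fun y : Plane => y l) (b.linear_combination_coord_eq_self x)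
    simp only [Fin.sum_univ_three] at this
    simpa using this.symm
  have e0 : b.coord 0 x = 1 - b.coord 1 x - b.coord 2 x := by linarith
  unfold quadratic
  simp only [Fin.sum_univ_two, Fin.sum_univ_three, hx, e0]
  ring

/-- The interpolation reproduces quadratic polynomials. -/
theorem hct_eq_quadratic (b : AffineBasis (Fin 3) ℝ Plane) (c : ℝ) (P : Fin 2 → ℝ)
    {H : Fin 2 → Fin 2 → ℝ} (hH : ∀ j k, H j k = H k j) :
    hct b (fun i => quadratic c P H (b i)) (fun i j => quadraticD P H (b i) (b j - b i)) =
      quadratic c P H := by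
  ext x
  have h10 := hH 1 0
  rw [quadratic_eq_sum b, ← hct_quadratic]
  · congr 1
    · ext i
      simp only [quadratic, Fin.sum_univ_two]
      ring
    · ext i j
      simp only [quadraticD, Fin.sum_univ_two, PiLp.sub_apply, h10]
      ring
  · intro i j
    simp only [Fin.sum_univ_two, h10]
    ring

theorem hctD_eq_quadraticD (b : AffineBasis (Fin 3) ℝ Plane) (c : ℝ) (P : Fin 2 → ℝ)
    {H : Fin 2 → Fin 2 → ℝ} (hH : ∀ j k, H j k = H k j) (x v : Plane) :
    hctD b (fun i => quadratic c P H (b i)) (fun i j => quadraticD P H (b i) (b j - b i)) x v =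
      quadraticD P H x v := by
  have h := hasFDerivAt_hct b (fun i => quadratic c P H (b i))
    (fun i j => quadraticD P H (b i) (b j - b i)) x
  rw [hct_eq_quadratic b c P hH] at h
  obtain ⟨L, hL, hv⟩ := hasFDerivAt_quadratic c P hH x
  rw [h.unique hL, hv]

theorem abs_sum_mul_le {v : Plane} {w : Fin 2 → ℝ} {A : ℝ} (h : ∀ j, |w j| ≤ A) :
    |∑ j, v j * w j| ≤ 2 * A * ‖v‖ := by
  rw [Fin.sum_univ_two]
  have h0 := abs_le.1 (abs_le_mul_of_abs_le (plane_abs_apply_le v 0) (h 0))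
  have h1 := abs_le.1 (abs_le_mul_of_abs_le (plane_abs_apply_le v 1) (h 1))
  exact abs_le.2 ⟨by linarith, by linarith⟩

/-- Approximation of a smooth function by a quadratic polynomial. -/
theorem exists_quadratic_approx {D : Set Plane} (hD : IsOpen D) (hconv : Convex ℝ D)
    (hb : Bornology.IsBounded D) (hne : D.Nonempty) {f : Plane → ℝ} (hf : Smc f) {h A : ℝ}
    (hd : ∀ x ∈ closure D, ∀ y ∈ closure D, ‖x - y‖ ≤ h)
    (hA : A = 2 * h ^ 2 * (√(volume.real D))⁻¹ *
      √(∑ j, ∑ k, ∑ l, ∫ x in D, dd l (dd k (dd j f)) x ^ 2)) :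
    ∃ (c : ℝ) (P : Fin 2 → ℝ), ∀ H : Fin 2 → Fin 2 → ℝ,
      (∀ j k, H j k = (volume.real D)⁻¹ * ∫ y in D, dd k (dd j f) y) →
      (∀ x ∈ closure D, |f x - quadratic c P H x| ≤ 2 * A * h) ∧
      ∀ x ∈ closure D, ∀ v, |(∑ j, v j * dd j f x) - quadraticD P H x v| ≤ 2 * A * ‖v‖ := by
  have hint : ∀ {F : Plane → ℝ}, Continuous F → IntegrableOn F D := integrableOn_of_continuous hb
  -- `P` and `H` are the coefficients of the averaged Taylor polynomial of `dd j f`. Its linear part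
  -- is the mean Hessian, which is symmetric, so the vector of these polynomials is the gradient of
  -- a quadratic.
  set P : Fin 2 → ℝ := fun j => (volume.real D)⁻¹ *
    ∫ y in D, (dd j f y - ∑ k, y k * dd k (dd j f) y) with hP
  set H : Fin 2 → Fin 2 → ℝ := fun j k => (volume.real D)⁻¹ * ∫ y in D, dd k (dd j f) y with hH
  have hHs : ∀ j k, H j k = H k j := fun j k => by
    simp only [hH]
    rw [dd_comm hf.1 j k]
  have h1 : ∀ j, ∀ z ∈ closure D, |dd j f z - (P j + ∑ k, H j k * z k)| ≤ A := fun j z hz => by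
    have h2 := abs_sub_average_taylor_le hD hconv hb (hf.dd j) hne hz
      (fun y hy => hd y (subset_closure hy) z hz)
    have h3 : ∫ y in D, (dd j f y - ∑ k, (y - z) k * dd k (dd j f) y) =
        (∫ y in D, (dd j f y - ∑ k, y k * dd k (dd j f) y)) +
          ∑ k, z k * ∫ y in D, dd k (dd j f) y := by
      have c1 : Continuous fun y : Plane => dd j f y - ∑ k, y k * dd k (dd j f) y :=
        (hf.dd j).continuous.sub (continuous_finsetSum _ fun k _ =>
          (EuclideanSpace.proj k : Plane →L[ℝ] ℝ).continuous.mul ((hf.dd j).dd k).continuous)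
      have c2 : ∀ k, Continuous fun y : Plane => z k * dd k (dd j f) y := fun k =>
        continuous_const.mul ((hf.dd j).dd k).continuous
      simp only [← integral_const_mul]
      rw [← integral_finsetSum _ fun k _ => hint (c2 k), ← integral_add (hint c1)
        (hint (continuous_finsetSum _ fun k _ => c2 k))]
      refine integral_congr_ae (.of_forall fun y => ?_)
      simp only [Fin.sum_univ_two, PiLp.sub_apply]
      ring
    rw [h3, mul_add, Finset.mul_sum] at h2
    have h4 : ∀ k, (volume.real D)⁻¹ * (z k * ∫ y in D, dd k (dd j f) y) = H j k * z k := fun k => by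
      simp only [hH]; ring
    simp only [h4] at h2
    refine h2.trans ?_
    have h5 : √(∫ y in D, absD2 (dd j f) y ^ 2) ≤
        2 * √(∑ j, ∑ k, ∑ l, ∫ x in D, dd l (dd k (dd j f)) x ^ 2) := by
      refine Real.sqrt_le_iff.2 ⟨by positivity, ?_⟩
      rw [mul_pow, Real.sq_sqrt (by positivity)]
      refine (setIntegral_absD2_sq_le hb (hf.dd j)).trans ?_
      have : ∑ k, ∑ l, ∫ x in D, dd l (dd k (dd j f)) x ^ 2 ≤
          ∑ j, ∑ k, ∑ l, ∫ x in D, dd l (dd k (dd j f)) x ^ 2 :=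
        Finset.single_le_sum (f := fun j => ∑ k, ∑ l, ∫ x in D, dd l (dd k (dd j f)) x ^ 2)
          (fun j _ => by positivity) (Finset.mem_univ j)
      exact (mul_le_mul_of_nonneg_left this (by norm_num)).trans_eq (by norm_num)
    rw [hA]
    have := mul_le_mul_of_nonneg_left h5 (show 0 ≤ h ^ 2 * (√(volume.real D))⁻¹ by positivity)
    linarith
  obtain ⟨x₀, hx₀⟩ := hne
  -- The constant makes the quadratic agree with `f` at one point; the bound on values follows from
  -- the one on gradients by the mean value inequality.
  refine ⟨f x₀ - quadratic 0 P H x₀, P, fun H' hH' => ?_⟩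
  have hHH : H' = H := by ext j k; exact hH' j k
  rw [hHH]
  clear hH' hHH
  have h2 : ∀ x ∈ closure D, ∀ v, |(∑ j, v j * dd j f x) - quadraticD P H x v| ≤ 2 * A * ‖v‖ :=
    fun x hx v => by
      rw [quadraticD, ← Finset.sum_sub_distrib]
      simp only [← mul_sub]
      exact abs_sum_mul_le fun j => h1 j x hx
  refine ⟨fun x hx => ?_, h2⟩
  set c := f x₀ - quadratic 0 P H x₀ with hc
  choose L hL hLv using hasFDerivAt_quadratic c P hHs
  have hA0 : 0 ≤ A := by rw [hA]; positivity
  have h3 := hconv.closure.norm_image_sub_le_of_norm_hasFDerivWithin_le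
    (f := fun x => f x - quadratic c P H x) (f' := fun x => fderiv ℝ f x - L x) (C := 2 * A)
    (fun z _ => ((hf.differentiable z).hasFDerivAt.sub (hL z)).hasFDerivWithinAt)
    (fun z hz => ContinuousLinearMap.opNorm_le_bound _ (by positivity) fun v => by
      rw [sub_apply, hLv, fderiv_eq_sum_dd]
      exact h2 z hz v) (subset_closure hx₀) hx
  have h4 : f x₀ - quadratic c P H x₀ = 0 := by simp [quadratic, hc]; ring
  rw [h4, sub_zero, Real.norm_eq_abs] at h3
  exact h3.trans (mul_le_mul_of_nonneg_left (hd x hx x₀ (subset_closure hx₀)) (by positivity))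

/-- The error of the interpolant on one triangle. -/
theorem interpolation_error {b : AffineBasis (Fin 3) ℝ Plane} {s : Finset Plane}
    (hbs : range b = ↑s) {x₀ : Plane} {r h A A' δ : ℝ} (hr : 0 < r) (hball : ball x₀ r ⊆ cell s)
    (hd : ∀ x ∈ closure (cell s), ∀ y ∈ closure (cell s), ‖x - y‖ ≤ h) {f : Plane → ℝ} (hf : Smc f)
    (hA : A = 2 * h ^ 2 * (√(volume.real (cell s)))⁻¹ *
      √(∑ j, ∑ k, ∑ l, ∫ x in cell s, dd l (dd k (dd j f)) x ^ 2))
    {U : Fin 3 → ℝ} {G : Fin 3 → Plane} (hU : ∀ i, |U i - f (b i)| ≤ δ)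
    (hG : ∀ i j, |G i j - dd j f (b i)| ≤ δ) (hA' : A' = 2 * A * h + (1 + 2 * h) * δ)
    {H : Fin 2 → Fin 2 → ℝ}
    (hH : ∀ j k, H j k = (volume.real (cell s))⁻¹ * ∫ y in cell s, dd k (dd j f) y) :
    (∀ x ∈ closure (cell s), |f x - hct b U (edgeDeriv b G) x| ≤ 2 * A * h + 180 * (h / r) * A') ∧
    ∀ x ∈ closure (cell s), ∀ y ∈ closure (cell s), ∀ v,
      |hctD b U (edgeDeriv b G) x v - hctD b U (edgeDeriv b G) y v -
        ∑ j, ∑ k, v j * H j k * (x - y) k| ≤ 900 * (h / r) * A' * (‖x - y‖ / r) * (‖v‖ / r) := by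
  have hne := cell_nonempty hbs
  have hcl := closure_cell hne
  have hmem : ∀ i, b i ∈ closure (cell s) := fun i => by
    rw [hcl]; exact subset_convexHull ℝ _ ((mem_vertices_iff hbs).2 ⟨i, rfl⟩)
  have hnn : ∀ x ∈ closure (cell s), ∀ i, 0 ≤ b.coord i x := fun x hx => by
    rw [hcl] at hx; exact (mem_hull_iff hbs).1 hx
  obtain ⟨c, P, hq⟩ := exists_quadratic_approx (isOpen_cell s) (convex_cell s) (isBounded_cell s) hne hf
    hd hA
  obtain ⟨hq1, hq2⟩ := hq H hH
  have hHs : ∀ j k, H j k = H k j := fun j k => by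
    rw [hH, hH, dd_comm hf.1 j k]
  have hL := abs_coordL_le (b := b) hr fun x hx i => (mem_cell_iff hbs).1 (hball hx) i
  have hN := abs_normalRatio_le hr hL fun i j => hd _ (hmem i) _ (hmem j)
  have hδ : 0 ≤ δ := (abs_nonneg _).trans (hU 0)
  have hh : 0 ≤ h := (norm_nonneg _).trans (hd _ (hmem 0) _ (hmem 0))
  -- The coordinate of one vertex changes by 1 along an edge, while its gradient is at most `1 / r`.
  have hρ : 1 ≤ h / r := by
    have h1 := hL 0 (b 0 - b 1)
    rw [coordL_sub, b.coord_apply_eq, b.coord_apply_ne (by decide), sub_zero, abs_one] at h1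
    exact h1.trans (div_le_div_of_nonneg_right (hd _ (hmem 0) _ (hmem 1)) hr.le)
  have hA0 : 0 ≤ A := by rw [hA]; positivity
  -- `A'` majorises both deviations of the data from those of the quadratic: `2 A h + δ` for values
  -- and `2 A h + 2 h δ` for edge derivatives. The `δ` accounts for `U` and `G` being only uniformly
  -- close to the data of the smooth `f`.
  have hU' : ∀ i, |U i - quadratic c P H (b i)| ≤ A' := fun i => by
    have h1 := hq1 _ (hmem i)
    have h2 := abs_sub_le (U i) (f (b i)) (quadratic c P H (b i))
    have h3 : 0 ≤ h * δ := by positivity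
    rw [hA']
    linarith [hU i]
  have hd' : ∀ i j, |edgeDeriv b G i j - quadraticD P H (b i) (b j - b i)| ≤ A' := fun i j => by
    have h1 := hq2 _ (hmem i) (b j - b i)
    have h2 := abs_sub_le (edgeDeriv b G i j) (∑ l, (b j - b i) l * dd l f (b i))
      (quadraticD P H (b i) (b j - b i))
    have h3 : edgeDeriv b G i j - ∑ l, (b j - b i) l * dd l f (b i) =
        ∑ l, (b j - b i) l * (G i l - dd l f (b i)) := by
      simp only [edgeDeriv, PiLp.inner_apply, Fin.sum_univ_two, RCLike.inner_apply, conj_trivial]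
      ring
    rw [h3] at h2
    have h4 := abs_sum_mul_le (v := b j - b i) (hG i)
    have h5 := hd _ (hmem j) _ (hmem i)
    have h6 := mul_le_mul_of_nonneg_left h5 (show 0 ≤ 2 * A by positivity)
    have h7 := mul_le_mul_of_nonneg_left h5 (show 0 ≤ 2 * δ by positivity)
    rw [hA']
    linarith
  refine ⟨fun x hx => ?_, fun x hx y hy v => ?_⟩
  -- The interpolant reproduces the quadratic, so its distance from the quadratic is the interpolant
  -- of the data differences.
  · have h1 := abs_hct_le hρ hN hU' hd' (hnn x hx)
    rw [← hct_sub, hct_eq_quadratic b c P hHs] at h1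
    have h2 := abs_sub_le (f x) (quadratic c P H x) (hct b U (edgeDeriv b G) x)
    rw [abs_sub_comm (quadratic c P H x)] at h2
    linarith [hq1 x hx]
  · have h1 := abs_hctD_sub_le hρ hN hL hU' hd' (hnn x hx) (hnn y hy) v
    rw [← hctD_sub, ← hctD_sub, sub_apply, sub_apply, hctD_eq_quadraticD b c P hHs,
      hctD_eq_quadraticD b c P hHs] at h1
    refine le_of_eq_of_le (congrArg _ ?_) h1
    simp only [quadraticD, Fin.sum_univ_two, PiLp.sub_apply]
    ring

end

section

open Filter Metric Topology

/-! ### Gluing the local interpolants -/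

/-- Two different triangles share the hull of at most two vertices. At a common vertex value and
gradient are prescribed; on a common edge value, tangential and normal derivative depend on the
endpoint data alone, and the two directions determine the gradient. -/
theorem hct_compat {b b' : AffineBasis (Fin 3) ℝ Plane} {s t : Finset Plane} (hb : range b = ↑s)
    (hb' : range b' = ↑t) (hs : s.card = 3) (ht : t.card = 3) (hst : s ≠ t) (U : Plane → ℝ)
    (G : Plane → Plane) {x : Plane}
    (hx : x ∈ convexHull ℝ ((s : Set Plane) ∩ (t : Set Plane))) :
    hct b (U ∘ b) (edgeDeriv b (G ∘ b)) x = hct b' (U ∘ b') (edgeDeriv b' (G ∘ b')) x ∧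
      hctD b (U ∘ b) (edgeDeriv b (G ∘ b)) x = hctD b' (U ∘ b') (edgeDeriv b' (G ∘ b')) x := by
  classical
  rw [← Finset.coe_inter] at hx
  have hcard : (s ∩ t).card < 3 := by
    by_contra! h
    have h1 : s ∩ t = s := Finset.eq_of_subset_of_card_le Finset.inter_subset_left (by omega)
    have h2 : s ∩ t = t := Finset.eq_of_subset_of_card_le Finset.inter_subset_right (by omega)
    exact hst (h1.symm.trans h2)
  have hmem : ∀ p ∈ s ∩ t, (∃ i, b i = p) ∧ ∃ i, b' i = p := fun p hp =>
    ⟨(mem_vertices_iff hb).1 (Finset.mem_inter.1 hp).1, (mem_vertices_iff hb').1 (Finset.mem_inter.1 hp).2⟩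
  have hpos : 0 < (s ∩ t).card := by
    rw [Finset.card_pos]
    by_contra h
    rw [Finset.not_nonempty_iff_eq_empty] at h
    rw [h, Finset.coe_empty, convexHull_empty] at hx
    exact hx
  obtain h1 | h2 : (s ∩ t).card = 1 ∨ (s ∩ t).card = 2 := by omega
  · obtain ⟨p, hp⟩ := Finset.card_eq_one.1 h1
    rw [hp, Finset.coe_singleton, convexHull_singleton, mem_singleton_iff] at hx
    obtain ⟨⟨i, hi⟩, i', hi'⟩ := hmem p (by simp [hp])
    refine ⟨?_, ?_⟩
    · rw [hx]
      conv_lhs => rw [← hi]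
      conv_rhs => rw [← hi']
      rw [hct_vertex, hct_vertex, Function.comp_apply, Function.comp_apply, hi, hi']
    · ext v
      rw [hx]
      conv_lhs => rw [← hi]
      conv_rhs => rw [← hi']
      rw [hctD_vertex, hctD_vertex, Function.comp_apply, Function.comp_apply, hi, hi']
  · obtain ⟨p, q, hpq, he⟩ := Finset.card_eq_two.1 h2
    rw [he, Finset.coe_pair, convexHull_pair, segment_eq_image_lineMap] at hx
    obtain ⟨⟨i, hi⟩, i', hi'⟩ := hmem p (by simp [he])
    obtain ⟨⟨j, hj⟩, j', hj'⟩ := hmem q (by simp [he])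
    obtain ⟨τ, hτ, rfl⟩ := hx
    have hij : i ≠ j := fun h => hpq (by rw [← hi, h, hj])
    have hij' : i' ≠ j' := fun h => hpq (by rw [← hi', h, hj'])
    have e := congrArg₂ (fun y z : Plane => (AffineMap.lineMap y z τ : Plane)) hi hj
    have e' := congrArg₂ (fun y z : Plane => (AffineMap.lineMap y z τ : Plane)) hi' hj'
    refine ⟨?_, ?_⟩
    · conv_lhs => rw [← e]
      conv_rhs => rw [← e']
      rw [hct_lineMap _ _ hij hτ, hct_lineMap _ _ hij' hτ]
      simp only [Function.comp_apply, hi, hi', hj, hj']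
    · ext v
      have h0 : ‖q - p‖ ^ 2 ≠ 0 := pow_ne_zero _ (norm_ne_zero_iff.2 (sub_ne_zero.2 hpq.symm))
      refine mul_left_cancel₀ h0 ?_
      rw [← smul_eq_mul, ← smul_eq_mul, ← map_smul, ← map_smul, inner_rot_left]
      simp only [map_add, map_smul]
      have t1 := hctD_lineMap_tangent (b := b) (U ∘ b) (G ∘ b) hij hτ
      have t2 := hctD_lineMap_tangent (b := b') (U ∘ b') (G ∘ b') hij' hτ
      have n1 := hctD_lineMap_normal (b := b) (U ∘ b) (G ∘ b) hij hτ (n := rot (q - p))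
        (by rw [hi, hj]; exact inner_rot _)
      have n2 := hctD_lineMap_normal (b := b') (U ∘ b') (G ∘ b') hij' hτ (n := rot (q - p))
        (by rw [hi', hj']; exact inner_rot _)
      simp only [Function.comp_apply, hi, hi', hj, hj'] at t1 t2 n1 n2
      rw [t1, t2, n1, n2]

/-- A continuity argument along the segment from `x` to `y`. It needs neither continuity of `f` in
advance nor any geometry of the pieces beyond being finitely many and closed. -/
theorem abs_sub_le_of_finite_cover {ι : Type*} [Finite ι] {C : ι → Set Plane}
    (hC : ∀ i, IsClosed (C i)) {S : Set Plane} (hS : Convex ℝ S) (hSC : S ⊆ ⋃ i, C i)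
    {f : Plane → ℝ} {K : ℝ} (h : ∀ i, ∀ x ∈ C i, ∀ y ∈ C i, |f x - f y| ≤ K * ‖x - y‖)
    {x y : Plane} (hx : x ∈ S) (hy : y ∈ S) : |f y - f x| ≤ K * ‖y - x‖ := by
  set γ : ℝ → Plane := fun t => AffineMap.lineMap x y t with hγ
  have hγc : Continuous γ := AffineMap.lineMap_continuous
  have hγS : ∀ t ∈ Icc (0 : ℝ) 1, γ t ∈ S := fun t ht => hS.lineMap_mem hx hy ht
  have hγn : ∀ t t', ‖γ t - γ t'‖ = |t - t'| * ‖y - x‖ := fun t t' => by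
    rw [← norm_smul_of_nonneg (abs_nonneg _), ← Real.norm_eq_abs]
    simp only [hγ, AffineMap.lineMap_apply_module']
    rw [add_sub_add_right_eq_sub, ← sub_smul, norm_smul, norm_smul, norm_norm]
  have hlip : ∀ i, ∀ t t', γ t ∈ C i → γ t' ∈ C i →
      |f (γ t) - f (γ t')| ≤ K * ‖y - x‖ * |t - t'| := fun i t t' ht ht' => by
    refine (h i _ ht _ ht').trans (le_of_eq ?_)
    rw [hγn]; ring
  -- The set of times up to which the estimate holds; it is shown to be closed and to extend to the
  -- right.
  set A : Set ℝ := {t | |f (γ t) - f x| ≤ K * ‖y - x‖ * t} with hA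
  have hclosed : IsClosed (A ∩ Icc 0 1) := by
    have e : A ∩ Icc 0 1 = ⋃ i, (Icc 0 1 ∩ γ ⁻¹' C i) ∩
        (fun t => |f (γ t) - f x| - K * ‖y - x‖ * t) ⁻¹' Iic 0 := by
      ext t
      simp only [hA, mem_inter_iff, mem_ofPred_eq, mem_iUnion, mem_preimage, mem_Iic, sub_nonpos]
      constructor
      · rintro ⟨h1, h2⟩
        obtain ⟨i, hi⟩ := mem_iUnion.1 (hSC (hγS t h2))
        exact ⟨i, ⟨h2, hi⟩, h1⟩
      · rintro ⟨i, ⟨h2, -⟩, h1⟩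
        exact ⟨h1, h2⟩
    rw [e]
    refine isClosed_iUnion_of_finite fun i => ?_
    refine ContinuousOn.preimage_isClosed_of_isClosed ?_
      (isClosed_Icc.inter ((hC i).preimage hγc)) isClosed_Iic
    have hc : ContinuousOn (fun t => f (γ t)) (Icc 0 1 ∩ γ ⁻¹' C i) := by
      refine (LipschitzOnWith.of_dist_le_mul (K := (K * ‖y - x‖).toNNReal) fun t ht t' ht' => ?_).continuousOn
      refine (hlip i t t' ht.2 ht'.2).trans ?_
      rw [Real.dist_eq]
      exact mul_le_mul_of_nonneg_right (Real.le_coe_toNNReal _) (abs_nonneg _)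
    exact (hc.sub continuousOn_const).abs.sub (by fun_prop)
  have h0 : (0 : ℝ) ∈ A := by simp [hA, hγ]
  have h1 := hclosed.Icc_subset_of_forall_exists_gt h0 (fun t ht y' hy' => ?_)
    (right_mem_Icc.2 zero_le_one)
  · simpa [hA, hγ] using h1
  · have hlt : t < min y' 1 := lt_min hy' ht.2.2
    have hev : ∀ᶠ t' in 𝓝[>] t, t' ∈ Ioc t (min y' 1) :=
      Ioc_mem_nhdsGT hlt
    -- Finitely many pieces cover the segment, so one of them is met at times arbitrarily close to
    -- `t` from the right. Being closed it contains the point at time `t`, and its own bound extends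
    -- the estimate.
    obtain ⟨i, hi⟩ : ∃ i, ∃ᶠ t' in 𝓝[>] t, γ t' ∈ C i := by
      by_contra! hcon
      obtain ⟨t', h3, h4⟩ := ((eventually_all.2 hcon).and hev).exists
      obtain ⟨i, hi⟩ := mem_iUnion.1 (hSC (hγS t' ⟨ht.2.1.trans h4.1.le, h4.2.trans (min_le_right _ _)⟩))
      exact h3 i hi
    have ht0 : γ t ∈ C i := by
      have : t ∈ closure (γ ⁻¹' C i) :=
        mem_closure_iff_frequently.2 (hi.filter_mono nhdsWithin_le_nhds)
      rwa [((hC i).preimage hγc).closure_eq] at this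
    obtain ⟨t', h3, h4⟩ := (hi.and_eventually hev).exists
    refine ⟨t', ?_, h4.1, h4.2.trans (min_le_left _ _)⟩
    have h5 := hlip i t' t h3 ht0
    have h6 : |f (γ t) - f x| ≤ K * ‖y - x‖ * t := ht.1
    have h7 := abs_sub_le (f (γ t')) (f (γ t)) (f x)
    rw [abs_of_nonneg (sub_nonneg.2 h4.1.le)] at h5
    change |f (γ t') - f x| ≤ K * ‖y - x‖ * t'
    linarith

theorem hasFDerivWithinAt_biUnion {ι : Type*} {F : Finset ι} {C : ι → Set Plane} {f : Plane → ℝ}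
    {f' : Plane →L[ℝ] ℝ} {x : Plane} (h : ∀ i ∈ F, HasFDerivWithinAt f f' (C i) x) :
    HasFDerivWithinAt f f' (⋃ i ∈ F, C i) x := by
  classical
  induction F using Finset.induction_on with
  | empty => exact HasFDerivWithinAt.of_notMem_closure (by simp)
  | insert i F _ ih =>
    rw [Finset.set_biUnion_insert]
    exact (h i (Finset.mem_insert_self _ _)).union (ih fun j hj => h j (Finset.mem_insert_of_mem hj))

/-- The constant may depend on the triangle and the data: this only serves to make the glued
gradient Lipschitz, so that the interpolant is in `H²`. -/
theorem exists_abs_hctD_sub_le {b : AffineBasis (Fin 3) ℝ Plane} {s : Finset Plane}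
    (hbs : range b = ↑s) (U : Fin 3 → ℝ) (d : Fin 3 → Fin 3 → ℝ) :
    ∃ K : ℝ, 0 ≤ K ∧ ∀ x ∈ convexHull ℝ (s : Set Plane), ∀ y ∈ convexHull ℝ (s : Set Plane), ∀ v,
      |hctD b U d x v - hctD b U d y v| ≤ K * ‖v‖ * ‖x - y‖ := by
  obtain ⟨x₀, hx₀⟩ := cell_nonempty hbs
  obtain ⟨r, hr, hball⟩ := Metric.isOpen_iff.1 (isOpen_cell s) x₀ hx₀
  have hL := abs_coordL_le (b := b) hr fun x hx i => (mem_cell_iff hbs).1 (hball hx) i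
  set ρ := 1 + ∑ k, ∑ i, |normalRatio b k i| with hρ
  set A := ∑ i, |U i| + ∑ i, ∑ j, |d i j| with hA
  have hsum : ∀ (g : Fin 3 → Fin 3 → ℝ) (i j), |g i j| ≤ ∑ i, ∑ j, |g i j| := fun g i j =>
    (Finset.single_le_sum (f := fun j => |g i j|) (fun _ _ => abs_nonneg _) (Finset.mem_univ j)).trans
      (Finset.single_le_sum (f := fun i => ∑ j, |g i j|) (fun _ _ => by positivity) (Finset.mem_univ i))
  have hρ1 : 1 ≤ ρ := le_add_of_nonneg_right (by positivity)
  have hN : ∀ k i, |normalRatio b k i| ≤ ρ := fun k i =>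
    (hsum _ k i).trans (le_add_of_nonneg_left zero_le_one)
  have hU : ∀ i, |U i| ≤ A := fun i =>
    (Finset.single_le_sum (f := fun i => |U i|) (fun _ _ => abs_nonneg _) (Finset.mem_univ i)).trans
      (le_add_of_nonneg_right (by positivity))
  have hd : ∀ i j, |d i j| ≤ A := fun i j => (hsum d i j).trans (le_add_of_nonneg_left (by positivity))
  refine ⟨900 * ρ * A / (r * r), by positivity, fun x hx y hy v => ?_⟩
  refine (abs_hctD_sub_le hρ1 hN hL hU hd ((mem_hull_iff hbs).1 hx) ((mem_hull_iff hbs).1 hy) v).trans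
    (le_of_eq ?_)
  field_simp

namespace Triangulation

variable {Ω : Set Plane} (𝒯 : Triangulation Ω)

/-- The function `I` with gradient `I'` interpolates the values `U` and gradients `G` at the
vertices. -/
structure IsInterpolant (U : Plane → ℝ) (G : Plane → Plane)
    (B : 𝒯.tris → AffineBasis (Fin 3) ℝ Plane) (I : Plane → ℝ) (I' : Fin 2 → Plane → ℝ) (K : NNReal) :
    Prop where
  range_eq : ∀ s, range (B s) = ↑s.1
  lipschitz : LipschitzWith K I
  lipschitz' : ∀ j, LipschitzWith K (I' j)
  eq_hct : ∀ s, ∀ x ∈ convexHull ℝ (s.1 : Set Plane),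
    I x = hct (B s) (U ∘ B s) (edgeDeriv (B s) (G ∘ B s)) x
  eq_hctD : ∀ s, ∀ x ∈ convexHull ℝ (s.1 : Set Plane), ∀ v : Plane,
    ∑ j, v j * I' j x = hctD (B s) (U ∘ B s) (edgeDeriv (B s) (G ∘ B s)) x v
  differentiableAt : ∀ x ∈ interior (closure Ω), DifferentiableAt ℝ I x
  dd_eq : ∀ x ∈ interior (closure Ω), ∀ j, dd j I x = I' j x

/-- Interpolant and gradient are well defined on the closed triangles, Lipschitz on the closure of
`Ω`, and then extended to Lipschitz functions on the plane so that the theory of globally Lipschitz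
functions applies. -/
theorem exists_interpolant (hconv : Convex ℝ Ω) (hbd : Bornology.IsBounded Ω) (U : Plane → ℝ)
    (G : Plane → Plane) : ∃ B I I' K, 𝒯.IsInterpolant U G B I I' K := by
  classical
  choose B hB using fun s : 𝒯.tris => exists_affineBasis (𝒯.card_eq s s.2) (𝒯.indep s s.2)
  set P : 𝒯.tris → Plane → ℝ := fun s => hct (B s) (U ∘ B s) (edgeDeriv (B s) (G ∘ B s)) with hP
  set P' : 𝒯.tris → Plane → Plane →L[ℝ] ℝ :=
    fun s => hctD (B s) (U ∘ B s) (edgeDeriv (B s) (G ∘ B s)) with hP'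
  have compat : ∀ s t : 𝒯.tris, ∀ x ∈ convexHull ℝ (s.1 : Set Plane),
      x ∈ convexHull ℝ (t.1 : Set Plane) → P s x = P t x ∧ P' s x = P' t x := fun s t x hs ht => by
    by_cases hst : s = t
    · rw [hst]; exact ⟨rfl, rfl⟩
    · refine hct_compat (hB s) (hB t) (𝒯.card_eq s s.2) (𝒯.card_eq t t.2)
        (fun h => hst (Subtype.ext h)) U G ?_
      rw [← 𝒯.conforming s s.2 t t.2]
      exact ⟨hs, ht⟩
  -- Any triangle containing `x` may be chosen, by `compat`; the value 0 off all triangles is never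
  -- used.
  set F : Plane → ℝ := fun x => if h : ∃ s : 𝒯.tris, x ∈ convexHull ℝ (s.1 : Set Plane) then
    P h.choose x else 0 with hF
  set F' : Plane → Plane →L[ℝ] ℝ := fun x =>
    if h : ∃ s : 𝒯.tris, x ∈ convexHull ℝ (s.1 : Set Plane) then P' h.choose x else 0 with hF'
  have hFP : ∀ s : 𝒯.tris, ∀ x ∈ convexHull ℝ (s.1 : Set Plane), F x = P s x ∧ F' x = P' s x :=
    fun s x hx => by
      have h : ∃ s : 𝒯.tris, x ∈ convexHull ℝ (s.1 : Set Plane) := ⟨s, hx⟩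
      simp only [hF, hF', dif_pos h]
      exact compat _ s x h.choose_spec hx
  have hcov : closure Ω ⊆ ⋃ s : 𝒯.tris, convexHull ℝ (s.1 : Set Plane) := by
    rw [← 𝒯.cover, iUnion_subtype]
  choose K hK0 hK using fun s : 𝒯.tris => exists_abs_hctD_sub_le (hB s) (U ∘ B s)
    (edgeDeriv (B s) (G ∘ B s))
  set L : ℝ := ∑ s, K s with hL
  have hL0 : 0 ≤ L := Finset.sum_nonneg fun s _ => hK0 s
  have hF'L : ∀ x ∈ closure Ω, ∀ y ∈ closure Ω, ∀ v, |F' x v - F' y v| ≤ L * ‖v‖ * ‖x - y‖ :=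
    fun x hx y hy v => by
      refine abs_sub_le_of_finite_cover (f := fun z => F' z v)
        (fun s : 𝒯.tris => (isCompact_hull s.1).isClosed) hconv.closure hcov (fun s z hz w hw => ?_) hy hx
      rw [(hFP s z hz).2, (hFP s w hw).2]
      refine (hK s z hz w hw v).trans ?_
      gcongr
      exact Finset.single_le_sum (fun s _ => hK0 s) (Finset.mem_univ s)
  -- The local interpolants are differentiable in the whole plane with matching derivatives on the
  -- overlaps, so derivatives within the finitely many closed triangles combine.
  have hder : ∀ x, HasFDerivWithinAt F (F' x) (closure Ω) x := fun x => by
    rw [← 𝒯.cover]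
    refine hasFDerivWithinAt_biUnion fun s hs => ?_
    refine HasFDerivAt.within_of_eqOn (P := P ⟨s, hs⟩) (isCompact_hull s).isClosed (fun hx => ?_)
      fun z hz => (hFP ⟨s, hs⟩ z hz).1
    rw [(hFP ⟨s, hs⟩ x hx).2]
    exact hasFDerivAt_hct _ _ _ x
  obtain ⟨d, hd⟩ := hbd.closure.exists_norm_le
  have hFL : ∃ L' : ℝ, ∀ x ∈ closure Ω, ∀ y ∈ closure Ω, |F x - F y| ≤ L' * ‖x - y‖ := by
    rcases (closure Ω).eq_empty_or_nonempty with h | ⟨z, hz⟩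
    · exact ⟨0, by simp [h]⟩
    refine ⟨‖F' z‖ + L * (d + d), fun x hx y hy => ?_⟩
    refine hconv.closure.norm_image_sub_le_of_norm_hasFDerivWithin_le (fun w _ => hder w)
      (fun w hw => ?_) hy hx
    have h1 : ‖F' w - F' z‖ ≤ L * (d + d) := by
      have hdd : ‖w - z‖ ≤ d + d := (norm_sub_le _ _).trans (add_le_add (hd w hw) (hd z hz))
      refine ContinuousLinearMap.opNorm_le_bound _ (mul_nonneg hL0 ((norm_nonneg _).trans hdd)) fun v => ?_
      rw [sub_apply]
      refine (hF'L w hw z hz v).trans ?_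
      rw [mul_assoc, mul_assoc, mul_comm ‖v‖]
      gcongr
    have h2 := norm_add_le (F' z) (F' w - F' z)
    rw [add_sub_cancel] at h2
    linarith
  obtain ⟨L', hL'⟩ := hFL
  -- A common Lipschitz constant `L + |L'|` for the function and both components of the gradient.
  have ext : ∀ {f : Plane → ℝ} {k : ℝ}, (∀ x ∈ closure Ω, ∀ y ∈ closure Ω, |f x - f y| ≤ k * ‖x - y‖) →
      k ≤ L + |L'| → ∃ g : Plane → ℝ, LipschitzWith (L + |L'|).toNNReal g ∧ EqOn f g (closure Ω) :=
    fun {f k} hf hk => by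
      refine LipschitzOnWith.extend_real (LipschitzOnWith.of_dist_le_mul fun x hx y hy => ?_)
      rw [Real.dist_eq, dist_eq_norm]
      refine (hf x hx y hy).trans (mul_le_mul_of_nonneg_right ?_ (norm_nonneg _))
      exact hk.trans (Real.le_coe_toNNReal _)
  obtain ⟨I, hI, hIe⟩ := ext hL' (by linarith [le_abs_self L'])
  choose I' hI' hIe' using fun j => ext (f := fun x => F' x (EuclideanSpace.single j (1 : ℝ))) (k := L)
    (fun x hx y hy => by
      have := hF'L x hx y hy (EuclideanSpace.single j 1)
      simpa using this) (by linarith [abs_nonneg L'])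
  have hsub : ∀ s : 𝒯.tris, convexHull ℝ (s.1 : Set Plane) ⊆ closure Ω := fun s => by
    rw [← 𝒯.cover]; exact subset_biUnion_of_mem (u := fun s : Finset Plane => convexHull ℝ (s : Set Plane)) s.2
  have h1 : ∀ x ∈ interior (closure Ω), HasFDerivAt I (F' x) x := fun x hx => by
    refine ((hder x).hasFDerivAt (mem_interior_iff_mem_nhds.1 hx)).congr_of_eventuallyEq ?_
    filter_upwards [mem_interior_iff_mem_nhds.1 hx] with z hz using (hIe hz).symm
  refine ⟨B, I, I', _, hB, hI, hI', fun s x hx => ?_, fun s x hx v => ?_,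
    fun x hx => (h1 x hx).differentiableAt, fun x hx j => ?_⟩
  · rw [← hIe (hsub s hx)]; exact (hFP s x hx).1
  · have h1 : ∀ j, I' j x = P' s x (EuclideanSpace.single j (1 : ℝ)) := fun j => by
      rw [← hIe' j (hsub s hx)]
      simp only [(hFP s x hx).2]
    simp only [h1]
    conv_rhs => rw [plane_eq_sum v]
    rw [map_sum]
    simp only [map_smul, smul_eq_mul]
    rfl
  · rw [← hIe' j (interior_subset hx), dd, (h1 x hx).fderiv]

end Triangulation

end

section

open Filter Metric Topology

/-! ### Sobolev properties of Lipschitz functions -/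

/-- The partial derivative of a Lipschitz function. -/
noncomputable def ld (j : Fin 2) (f : Plane → ℝ) (x : Plane) : ℝ :=
  lineDeriv ℝ f x (EuclideanSpace.single j (1 : ℝ))

theorem abs_ld_le {f : Plane → ℝ} {K : NNReal} (hf : LipschitzWith K f) (j : Fin 2) (x : Plane) :
    |ld j f x| ≤ K := by
  have := norm_lineDeriv_le_of_lipschitz ℝ (x₀ := x) (v := EuclideanSpace.single j (1 : ℝ)) hf
  simpa [ld] using this

theorem measurable_ld {f : Plane → ℝ} (hf : Continuous f) (j : Fin 2) : Measurable (ld j f) :=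
  measurable_lineDeriv hf

theorem memLp_ld {D : Set Plane} (hb : Bornology.IsBounded D) {f : Plane → ℝ} {K : NNReal}
    (hf : LipschitzWith K f) (j : Fin 2) : MemLp (ld j f) 2 (volume.restrict D) := by
  have := isFiniteMeasure_restrict_of_isBounded hb
  exact MemLp.of_bound (measurable_ld hf.continuous j).aestronglyMeasurable K
    (.of_forall fun x => abs_ld_le hf j x)

/-- Integration by parts for Lipschitz functions: the almost everywhere derivative is the weak one.
-/
theorem HasWD.of_lipschitz {D : Set Plane} {f : Plane → ℝ} {K : NNReal} (hf : LipschitzWith K f)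
    (j : Fin 2) (h : MemLp f 2 (volume.restrict D)) (h' : MemLp (ld j f) 2 (volume.restrict D)) :
    HasWD D j (toL2 D f) (toL2 D (ld j f)) := fun φ hφ => by
  rw [inner_toL2_toL2 h ((hφ.smc.dd j).memLp D), inner_toL2_toL2 h' (hφ.smc.memLp D),
    setIntegral_eq_integral_of_forall_compl_eq_zero
      (fun x hx => by rw [(hφ.dd j).eq_zero hx, mul_zero]),
    setIntegral_eq_integral_of_forall_compl_eq_zero
      (fun x hx => by rw [hφ.eq_zero hx, mul_zero])]
  obtain ⟨C, hC⟩ := (hφ.1.of_le (by exact_mod_cast le_top : (1 : WithTop ℕ∞) ≤ ∞)).lipschitzWith_of_hasCompactSupport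
    hφ.2.1 one_ne_zero
  have key := hf.integral_lineDeriv_mul_eq hC hφ.2.1 (EuclideanSpace.single j (1 : ℝ)) (μ := volume)
  simp only [lineDeriv_neg] at key
  have e : ∀ x, lineDeriv ℝ φ x (EuclideanSpace.single j (1 : ℝ)) = dd j φ x := fun x =>
    (hφ.smc.differentiable x).lineDeriv_eq_fderiv
  simp only [e, neg_mul, integral_neg] at key
  unfold ld
  rw [key, neg_neg]
  simp only [mul_comm]

theorem IsKernel.moll_congr_ae {k : Plane → ℝ} {a : ℝ} {f g : Plane → ℝ} (h : f =ᵐ[volume] g) :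
    moll k a f = moll k a g := by
  ext x
  rw [IsKernel.moll_eq, IsKernel.moll_eq]
  refine integral_congr_ae ?_
  filter_upwards [h] with t ht
  rw [ht]

theorem tendsto_toL2_moll {k : ℕ → Plane → ℝ} {c : ℕ → Plane} {R a : ℕ → ℝ}
    (hk : ∀ n, IsKernel (k n) (c n) (R n)) (hc : Tendsto c atTop (𝓝 0))
    (hR : Tendsto R atTop (𝓝 0)) (ha : Tendsto a atTop (𝓝 1)) {f : Plane → ℝ}
    (hf : Measurable f) (hf2 : MemLp f 2 volume) {D : Set Plane}
    (hm : ∀ n, MemLp (moll (k n) (a n) f) 2 (volume.restrict D)) :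
    Tendsto (fun n => toL2 D (moll (k n) (a n) f)) atTop (𝓝 (toL2 D f)) := by
  have h := tendsto_eLpNorm_moll hk hc hR ha hf hf2
  have hfD : MemLp f 2 (volume.restrict D) := hf2.mono_measure Measure.restrict_le_self
  rw [Lp.tendsto_Lp_iff_tendsto_eLpNorm']
  refine tendsto_of_tendsto_of_tendsto_of_le_of_le tendsto_const_nhds h (fun _ => zero_le)
    fun n => ?_
  refine le_trans (le_of_eq (eLpNorm_congr_ae ?_))
    (eLpNorm_mono_measure _ (Measure.restrict_le_self (s := D)))
  filter_upwards [coeFn_toL2 (hm n), coeFn_toL2 hfD] with x h1 h2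
  rw [Pi.sub_apply, h1, h2]

theorem indicator_univ_toL2 {g : Plane → ℝ} (hg : MemLp g 2 volume) :
    (univ.indicator (toL2 univ g)) =ᵐ[volume] g := by
  have := (ae_restrict_iff' MeasurableSet.univ).1 (coeFn_toL2 (D := univ) (by simpa using hg))
  filter_upwards [this] with x hx
  rw [indicator_univ, hx (mem_univ x)]

/-- Lipschitz functions vanishing outside `Ω` belong to `H₀¹(Ω)`. -/
theorem mem_H10_of_lipschitz {Ω : Set Plane} (hΩ : IsOpen Ω) (hconv : Convex ℝ Ω)
    (hb : Bornology.IsBounded Ω) (hne : Ω.Nonempty) {f : Plane → ℝ} {K : NNReal}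
    (hf : LipschitzWith K f) (h0 : ∀ x, x ∉ Ω → f x = 0) : toL2 Ω f ∈ H10 Ω := by
  have hsupp : Function.support f ⊆ closure Ω := fun x hx =>
    subset_closure (by_contra fun h => hx (h0 x h))
  have hcs : HasCompactSupport f := HasCompactSupport.of_support_subset_isCompact hb.isCompact_closure hsupp
  have hf2 : MemLp f 2 volume := hf.continuous.memLp_of_hasCompactSupport hcs
  have hl2 : ∀ j, MemLp (ld j f) 2 volume := fun j => by
    have h1 : (closure Ω).indicator (ld j f) = ld j f := by
      refine indicator_eq_self.2 fun x hx => by_contra fun hxc => hx ?_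
      have h2 : f =ᶠ[𝓝 x] fun _ => 0 := by
        filter_upwards [isClosed_closure.isOpen_compl.mem_nhds hxc] with y hy
        exact h0 y fun h => hy (subset_closure h)
      rw [ld, h2.lineDeriv_eq]
      simp [lineDeriv]
    rw [← h1]
    exact (memLp_indicator_iff_restrict isClosed_closure.measurableSet).2 (memLp_ld hb.closure hf j)
  have hwd : ∀ j, HasWD univ j (toL2 univ f) (toL2 univ (ld j f)) := fun j =>
    HasWD.of_lipschitz hf j (by simpa using hf2) (by simpa using hl2 j)
  have hres : ∀ {g : Plane → ℝ}, MemLp g 2 volume → MemLp g 2 (volume.restrict Ω) := fun hg =>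
    hg.mono_measure Measure.restrict_le_self
  have hwΩ : ∀ j, HasWD Ω j (toL2 Ω f) (toL2 Ω (ld j f)) := fun j =>
    HasWD.of_lipschitz hf j (hres hf2) (hres (hl2 j))
  obtain ⟨x₀, hx₀⟩ := hne
  obtain ⟨r, hr0, hr⟩ := Metric.nhds_basis_closedBall.mem_iff.1 (hΩ.mem_nhds hx₀)
  set ε : ℕ → ℝ := fun n => 1 / ((n : ℝ) + 1) with hεd
  have hε0 : ∀ n, 0 < ε n := fun n => by positivity
  have hεt : Tendsto ε atTop (𝓝 0) := tendsto_one_div_add_atTop_nhds_zero_nat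
  -- Opposite to `exists_mollifier`, the factor `1 + ε` shrinks supports: the mollified function
  -- lives on `(x' + y) / (1 + ε)` with `x'` in the closure of `Ω` and `y / ε` near `x₀`. These are
  -- convex combinations with an interior point, hence form a compact subset of `Ω`.
  choose k hk using fun n => exists_isKernel (ε n • x₀) (mul_pos (hε0 n) hr0)
  have ha : Tendsto (fun n => 1 + ε n) atTop (𝓝 1) := by simpa using hεt.const_add 1
  have hc : Tendsto (fun n => ε n • x₀) atTop (𝓝 0) := by simpa using hεt.smul_const x₀
  have hR : Tendsto (fun n => ε n * r) atTop (𝓝 0) := by simpa using hεt.mul_const r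
  have hloc : LocallyIntegrable f volume := hf.continuous.locallyIntegrable
  have hsmc : ∀ n, Smc (moll (k n) (1 + ε n) f) := fun n =>
    ⟨(hk n).contDiff_moll hloc, (hk n).hasCompactSupport_moll (by linarith [hε0 n]) hcs⟩
  have htest : ∀ n, IsTestFunction Ω (moll (k n) (1 + ε n) f) := fun n => by
    refine ⟨(hsmc n).1, (hsmc n).2, ?_⟩
    set S : Set Plane := (fun p : Plane × Plane => (1 + ε n)⁻¹ • p.1 + (1 + ε n)⁻¹ • p.2) ''
      (closure Ω ×ˢ closedBall (ε n • x₀) (ε n * r)) with hS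
    have hScomp : IsCompact S := (hb.isCompact_closure.prod (isCompact_closedBall _ _)).image (by fun_prop)
    have h1n : 0 < 1 + ε n := by linarith [hε0 n]
    have hSΩ : S ⊆ Ω := by
      rintro _ ⟨⟨t, y⟩, ⟨ht, hy⟩, rfl⟩
      have hz : (ε n)⁻¹ • y ∈ interior Ω := by
        rw [hΩ.interior_eq]
        refine hr ?_
        simp only at hy
        rw [mem_closedBall, dist_eq_norm] at hy ⊢
        have : (ε n)⁻¹ • y - x₀ = (ε n)⁻¹ • (y - ε n • x₀) := by
          rw [smul_sub, smul_smul, inv_mul_cancel₀ (hε0 n).ne', one_smul]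
        rw [this, norm_smul, norm_inv, Real.norm_of_nonneg (hε0 n).le, inv_mul_le_iff₀ (hε0 n)]
        exact hy
      have h1 := hconv.combo_closure_interior_mem_interior ht hz
        (a := (1 + ε n)⁻¹) (b := (1 + ε n)⁻¹ * ε n) (by positivity)
        (mul_pos (inv_pos.2 h1n) (hε0 n)) (by field_simp)
      rw [hΩ.interior_eq, smul_smul, mul_assoc, mul_inv_cancel₀ (hε0 n).ne', mul_one] at h1
      exact h1
    refine (closure_minimal (fun x hx => ?_) hScomp.isClosed).trans hSΩ
    rw [Function.mem_support, IsKernel.moll_eq] at hx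
    obtain ⟨t, ht⟩ : ∃ t, f t * k n ((1 + ε n) • x - t) ≠ 0 := by
      by_contra! h
      exact hx (by simp [h])
    have h1 := left_ne_zero_of_mul ht
    have h2 := right_ne_zero_of_mul ht
    refine ⟨(t, (1 + ε n) • x - t), ⟨hsupp h1, by_contra fun h => h2 ((hk n).eq_zero h)⟩, ?_⟩
    simp only
    rw [← smul_add, add_sub_cancel, smul_smul, inv_mul_cancel₀ h1n.ne', one_smul]
  have hdd : ∀ n j x, dd j (moll (k n) (1 + ε n) f) x = (1 + ε n) * moll (k n) (1 + ε n) (ld j f) x :=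
    fun n j x => by
      rw [← IsKernel.moll_congr_ae (indicator_univ_toL2 hf2), ← IsKernel.moll_congr_ae (indicator_univ_toL2 (hl2 j))]
      exact (hk n).dd_moll MeasurableSet.univ (hwd j) (fun _ _ => mem_univ _)
        ((hloc.congr (indicator_univ_toL2 hf2).symm))
  refine (mem_H10_iff hΩ).2 ⟨mem_Hk_one hwΩ, fun n => moll (k n) (1 + ε n) f, htest, ?_, fun j => ?_⟩
  · exact tendsto_toL2_moll hk hc hR ha hf.continuous.measurable hf2 fun n => (hsmc n).memLp Ω
  · rw [wd1_eq hΩ hwΩ]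
    have hlj : ∀ n, MemLp (moll (k n) (1 + ε n) (ld j f)) 2 (volume.restrict Ω) := fun n => by
      have h1 : moll (k n) (1 + ε n) (ld j f) = fun x => (1 + ε n)⁻¹ * dd j (moll (k n) (1 + ε n) f) x := by
        ext x
        rw [hdd, inv_mul_cancel_left₀ (by linarith [hε0 n])]
      rw [h1]
      exact (((hsmc n).dd j).memLp Ω).const_mul _
    have h1 := ha.smul (tendsto_toL2_moll hk hc hR ha (measurable_ld hf.continuous j) (hl2 j) hlj)
    rw [one_smul] at h1
    refine h1.congr fun n => ?_
    rw [← toL2_const_mul (hlj n)]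
    congr 1
    ext x
    rw [hdd]

/-- The smoothing operator converges uniformly up to the boundary on Lipschitz functions, so the
edge trace consists of the pointwise values. -/
theorem hasEdgeTrace_of_lipschitz {D : Set Plane} (hD : IsOpen D) (hconv : Convex ℝ D)
    (hb : Bornology.IsBounded D) (hne : D.Nonempty) {f : Plane → ℝ} {K : NNReal}
    (hf : LipschitzWith K f) {a b : Plane} (ha : a ∈ closure D) (hbD : b ∈ closure D) {g : ℝ → ℝ}
    (hg : ∀ t ∈ Icc (0 : ℝ) 1, f (AffineMap.lineMap a b t) = g t) :
    HasEdgeTrace D a b (toL2 D f) g := by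
  have hwd : ∀ j, HasWD D j (toL2 D f) (toL2 D (ld j f)) := fun j =>
    HasWD.of_lipschitz hf j (memLp_of_continuous hb hf.continuous) (memLp_ld hb hf j)
  obtain ⟨M, hs, h0, h1, -, -, hl⟩ := exists_smoothing hD hconv hb hne
  obtain ⟨δ, hδ, hδM⟩ := hl f K hf
  refine (hasEdgeTrace_iff hD).2 ⟨mem_Hk_one hwd, fun n => M n (toL2 D f), fun n => hs n _, h0 _,
    fun j => ?_, ?_⟩
  · rw [wd1_eq hD hwd]
    exact h1 j _ _ (hwd j)
  · refine squeeze_zero (fun n => intervalIntegral.integral_nonneg zero_le_one fun _ _ => sq_nonneg _)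
      (fun n => ?_) (by simpa using hδ.pow 2)
    have hb1 : ∀ t ∈ Set.uIoc (0 : ℝ) 1,
        ‖(M n (toL2 D f) (AffineMap.lineMap a b t) - g t) ^ 2‖ ≤ δ n ^ 2 := fun t ht => by
      rw [uIoc_of_le zero_le_one] at ht
      have ht' := Ioc_subset_Icc_self ht
      rw [← hg t ht', norm_pow, Real.norm_eq_abs]
      exact pow_le_pow_left₀ (abs_nonneg _)
        (hδM n _ (hconv.closure.lineMap_mem ha hbD ht')) 2
    have := intervalIntegral.norm_integral_le_of_norm_le_const hb1
    rw [sub_zero, abs_one, mul_one] at this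
    exact (le_abs_self _).trans this

end

section

open Filter Metric Topology

/-! ### Boundary values of functions in `H₀¹` -/

theorem IsKernel.abs_moll_le {k : Plane → ℝ} {c : Plane} {R a : ℝ} (hk : IsKernel k c R)
    {f : Plane → ℝ} {B : ℝ} (h : ∀ᵐ t, |f t| ≤ B) (x : Plane) : |moll k a f x| ≤ B := by
  have h1 : ∫ t, B * k (a • x - t) = B := by
    rw [integral_const_mul, integral_sub_left_eq_self (fun t => k t), hk.integral_eq, mul_one]
  rw [IsKernel.moll_eq, ← Real.norm_eq_abs]
  refine (norm_integral_le_of_norm_le ((hk.integrable.comp_sub_left (a • x)).const_mul B) ?_).trans_eq h1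
  filter_upwards [h] with t ht
  rw [norm_mul, Real.norm_eq_abs, Real.norm_of_nonneg (hk.nonneg _)]
  exact mul_le_mul_of_nonneg_right ht (hk.nonneg _)

theorem tendsto_moll_of_continuousAt {k : ℕ → Plane → ℝ} {R : ℕ → ℝ}
    (hk : ∀ n, IsKernel (k n) 0 (R n)) (hR : Tendsto R atTop (𝓝 0)) {f : Plane → ℝ}
    (hf : LocallyIntegrable f) {x : Plane} (hx : ContinuousAt f x) :
    Tendsto (fun n => moll (k n) 1 f x) atTop (𝓝 (f x)) := by
  rw [Metric.tendsto_atTop]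
  intro ε hε
  obtain ⟨δ, hδ, h⟩ := Metric.continuousAt_iff.1 hx (ε / 2) (by positivity)
  obtain ⟨N, hN⟩ := eventually_atTop.1 (hR.eventually (gt_mem_nhds hδ))
  refine ⟨N, fun n hn => lt_of_le_of_lt ((hk n).abs_moll_sub_le (b := f x) (ε := ε / 2) hf fun y hy => ?_)
    (by linarith)⟩
  rw [one_smul, ← Real.dist_eq]
  refine (h ?_).le
  rw [dist_eq_norm, sub_sub_cancel_left, norm_neg]
  rw [mem_closedBall, dist_zero_right] at hy
  exact hy.trans_lt (hN n hn)

/-- Extension by zero of functions in `H₀¹`. -/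
theorem HasWD.extend_zero {Ω : Set Plane} (hΩ : IsOpen Ω) {u : L2 Ω} (hu : u ∈ H10 Ω) (j : Fin 2) :
    HasWD univ j (toL2 univ (Ω.indicator u)) (toL2 univ (Ω.indicator (wd1 Ω u j))) := fun ψ hψ => by
  obtain ⟨-, φ, hφ, h0, h1⟩ := (mem_H10_iff hΩ).1 hu
  have hm : ∀ v : L2 Ω, MemLp (Ω.indicator v) 2 (volume.restrict univ) := fun v => by
    rw [Measure.restrict_univ]; exact memLp_indicator_L2 hΩ.measurableSet v
  have key : ∀ (v : L2 Ω) {η : Plane → ℝ}, Smc η →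
      ⟪toL2 univ (Ω.indicator v), toL2 univ η⟫_ℝ = ⟪v, toL2 Ω η⟫_ℝ := fun v η hη => by
    rw [inner_toL2_toL2 (hm v) (hη.memLp univ), inner_toL2 _ (hη.memLp Ω), setIntegral_univ,
      ← integral_indicator hΩ.measurableSet]
    refine integral_congr_ae (.of_forall fun x => ?_)
    by_cases hx : x ∈ Ω <;> simp [hx]
  rw [key _ (hψ.smc.dd j), key _ hψ.smc]
  refine tendsto_nhds_unique ((h0.inner tendsto_const_nhds))
    ((((h1 j).inner tendsto_const_nhds).neg).congr fun n => ?_)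
  rw [inner_toL2_toL2 ((hφ n).smc.memLp Ω) ((hψ.smc.dd j).memLp Ω),
    inner_toL2_toL2 (((hφ n).dd j).smc.memLp Ω) (hψ.smc.memLp Ω),
    setIntegral_eq_integral_of_forall_compl_eq_zero
      (fun x hx => by rw [((hφ n).dd j).eq_zero hx, zero_mul]),
    setIntegral_eq_integral_of_forall_compl_eq_zero
      (fun x hx => by rw [(hφ n).eq_zero hx, zero_mul]), integral_mul_dd (hφ n).smc hψ.smc]

/-- Extended by zero, a function in `H₀¹` with bounded gradient has a bounded weak gradient on the
whole plane. Its mollifications are uniformly Lipschitz, so the extension is Lipschitz at its points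
of continuity and its value next to the boundary is controlled by the zero outside. -/
theorem eq_zero_of_mem_frontier {Ω : Set Plane} (hΩ : IsOpen Ω) (hconv : Convex ℝ Ω)
    (hne : Ω.Nonempty) {u : L2 Ω} (hu : u ∈ H10 Ω) {U : Plane → ℝ}
    (hU : ContinuousOn U (closure Ω)) (huU : u =ᵐ[volume.restrict Ω] U) {B : ℝ} (hB0 : 0 ≤ B)
    (hB : ∀ j, ∀ᵐ x ∂(volume.restrict Ω), |wd1 Ω u j x| ≤ B) {x₀ : Plane} (hx₀ : x₀ ∈ frontier Ω) :
    U x₀ = 0 := by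
  set f : Plane → ℝ := Ω.indicator U with hf
  have hm := fun v : L2 Ω => memLp_indicator_L2 hΩ.measurableSet v
  have hfu : Ω.indicator u =ᵐ[volume] f := by
    filter_upwards [(ae_restrict_iff' hΩ.measurableSet).1 huU] with x hx
    by_cases h : x ∈ Ω
    · rw [hf, indicator_of_mem h, indicator_of_mem h, hx h]
    · rw [hf, indicator_of_notMem h, indicator_of_notMem h]
  have hloc : LocallyIntegrable f volume := ((memLp_congr_ae hfu).1 (hm u)).locallyIntegrable (by norm_num)
  have hcoe := fun v : L2 Ω => indicator_univ_toL2 (hm v)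
  choose k hk using fun n : ℕ => exists_isKernel 0 (Nat.one_div_pos_of_nat (α := ℝ) (n := n))
  have hR := tendsto_one_div_add_atTop_nhds_zero_nat (𝕜 := ℝ)
  have hdd : ∀ n j x, |dd j (moll (k n) 1 f) x| ≤ B := fun n j x => by
    rw [← IsKernel.moll_congr_ae ((hcoe u).trans hfu), (hk n).dd_moll MeasurableSet.univ
      (HasWD.extend_zero hΩ hu j) (fun _ _ => mem_univ _) (hloc.congr ((hcoe u).trans hfu).symm), one_mul,
      IsKernel.moll_congr_ae (hcoe _)]
    refine (hk n).abs_moll_le ?_ x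
    filter_upwards [(ae_restrict_iff' hΩ.measurableSet).1 (hB j)] with t ht
    by_cases h : t ∈ Ω
    · rw [indicator_of_mem h]; exact ht h
    · rw [indicator_of_notMem h, abs_zero]; exact hB0
  have hlip : ∀ n x y, |moll (k n) 1 f y - moll (k n) 1 f x| ≤ 2 * B * ‖y - x‖ := fun n x y =>
    convex_univ.norm_image_sub_le_of_norm_fderiv_le
      (fun z _ => ((hk n).contDiff_moll hloc).differentiable (by simp) z)
      (fun z _ => ContinuousLinearMap.opNorm_le_bound _ (by positivity) fun v => by
        rw [fderiv_eq_sum_dd]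
        exact abs_sum_mul_le fun j => hdd n j z) (mem_univ x) (mem_univ y)
  -- Inside `Ω` and outside its closure the extension is continuous, so mollifications converge
  -- there pointwise.
  have h1 : ∀ z ∈ Ω, ∀ y ∈ (closure Ω)ᶜ, |U z| ≤ 2 * B * ‖z - y‖ := fun z hz y hy => by
    have hzc : ContinuousAt f z := by
      refine ((hU.mono subset_closure).continuousAt (hΩ.mem_nhds hz)).congr ?_
      filter_upwards [hΩ.mem_nhds hz] with w hw
      rw [hf, indicator_of_mem hw]
    have hyc : ContinuousAt f y := by
      refine (continuousAt_const (y := (0 : ℝ))).congr ?_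
      filter_upwards [isClosed_closure.isOpen_compl.mem_nhds hy] with w hw
      rw [hf, indicator_of_notMem fun h => hw (subset_closure h)]
    have h2 := ((tendsto_moll_of_continuousAt hk hR hloc hzc).sub
      (tendsto_moll_of_continuousAt hk hR hloc hyc)).abs
    have h3 := le_of_tendsto' h2 fun n => hlip n y z
    rwa [hf, indicator_of_mem hz, indicator_of_notMem fun h => hy (subset_closure h), sub_zero] at h3
  -- For a convex open set every boundary point is a limit of exterior points; a slit would violate
  -- this.
  have hx₀c : x₀ ∈ closure ((closure Ω)ᶜ) := by
    rw [closure_compl, hconv.interior_closure_eq_interior_of_nonempty_interior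
      (by rwa [hΩ.interior_eq])]
    exact hx₀.2
  have h2 : ∀ z ∈ Ω, |U z| ≤ 2 * B * ‖z - x₀‖ := fun z hz => by
    have hcl : IsClosed {y | |U z| ≤ 2 * B * ‖z - y‖} := isClosed_le (by fun_prop) (by fun_prop)
    exact closure_minimal (fun y hy => h1 z hz y hy) hcl hx₀c
  have hx₀Ω := frontier_subset_closure hx₀
  have : (𝓝[Ω] x₀).NeBot := mem_closure_iff_nhdsWithin_neBot.1 hx₀Ω
  have h3 : Tendsto (fun z => |U z|) (𝓝[Ω] x₀) (𝓝 |U x₀|) :=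
    (((hU x₀ hx₀Ω).mono subset_closure).abs)
  have h4 : Tendsto (fun z => 2 * B * ‖z - x₀‖) (𝓝[Ω] x₀) (𝓝 0) := by
    have : Continuous fun z => 2 * B * ‖z - x₀‖ := by fun_prop
    have h5 := (this.tendsto x₀).mono_left (nhdsWithin_le_nhds (s := Ω))
    simpa using h5
  have h5 := le_of_tendsto_of_tendsto h3 h4 (by
    filter_upwards [self_mem_nhdsWithin] with z hz using h2 z hz)
  exact abs_nonpos_iff.1 h5

end

section

open Filter Metric Topology

/-! ### Continuous representatives -/

/-- Sobolev's inequality for the differences turns convergence in `H²` into a uniform Cauchy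
property on the closure; an almost everywhere convergent subsequence identifies the limit with `u`.
-/
theorem exists_uniform_limit {D : Set Plane} (hD : IsOpen D) (hconv : Convex ℝ D)
    (hb : Bornology.IsBounded D) (hne : D.Nonempty) {g : ℕ → Plane → ℝ} (hg : ∀ n, Smc (g n))
    {u : L2 D} {u' : Fin 2 → L2 D} {u'' : Fin 2 → Fin 2 → L2 D}
    (h0 : Tendsto (fun n => toL2 D (g n)) atTop (𝓝 u))
    (h1 : ∀ j, Tendsto (fun n => toL2 D (dd j (g n))) atTop (𝓝 (u' j)))
    (h2 : ∀ j k, Tendsto (fun n => toL2 D (dd k (dd j (g n)))) atTop (𝓝 (u'' j k))) :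
    ∃ U : Plane → ℝ, ContinuousOn U (closure D) ∧ TendstoUniformlyOn g U atTop (closure D) ∧
      u =ᵐ[volume.restrict D] U := by
  obtain ⟨C, hC, hsob⟩ := exists_sobolev hD hconv hb hne
  have sq : ∀ {φ : ℕ → Plane → ℝ}, (∀ n, Smc (φ n)) → ∀ {w : L2 D},
      Tendsto (fun n => toL2 D (φ n)) atTop (𝓝 w) → Tendsto (fun p : ℕ × ℕ =>
        ∫ y in D, (φ p.1 y - φ p.2 y) ^ 2) (atTop ×ˢ atTop) (𝓝 0) := fun {φ} hφ {w} hw => by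
    have h := ((hw.comp tendsto_fst).sub (hw.comp tendsto_snd)).norm.pow 2
    rw [sub_self, norm_zero, zero_pow two_ne_zero] at h
    refine h.congr fun p => ?_
    simp only [Function.comp_apply]
    rw [← (hφ p.1).toL2_sub (hφ p.2), norm_toL2_sq (((hφ p.1).sub (hφ p.2)).memLp D)]
  have hcau : UniformCauchySeqOn g atTop (closure D) := by
    intro s hs
    obtain ⟨ε, hε, hεs⟩ := Metric.mem_uniformity_dist.1 hs
    have hlim := (((sq hg h0).add (tendsto_finsetSum Finset.univ fun j _ =>
      sq (fun n => (hg n).dd j) (h1 j))).add (tendsto_finsetSum Finset.univ fun j _ =>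
        tendsto_finsetSum Finset.univ fun k _ => sq (fun n => ((hg n).dd j).dd k) (h2 j k))).const_mul C
    simp only [Finset.sum_const_zero, add_zero, mul_zero] at hlim
    filter_upwards [hlim.eventually (gt_mem_nhds (show 0 < ε ^ 2 by positivity))] with p hp z hz
    refine hεs ?_
    have h3 := hsob _ ((hg p.1).sub (hg p.2)) z hz
    simp only [(hg p.1).dd_sub (hg p.2), ((hg p.1).dd _).dd_sub ((hg p.2).dd _)] at h3
    rw [Real.dist_eq]
    exact lt_of_pow_lt_pow_left₀ 2 hε.le (by rw [sq_abs]; exact h3.trans_lt hp)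
  have hex : ∀ z, ∃ y, z ∈ closure D → Tendsto (fun n => g n z) atTop (𝓝 y) := fun z => by
    by_cases hz : z ∈ closure D
    · obtain ⟨y, hy⟩ := cauchySeq_tendsto_of_complete (hcau.cauchySeq hz)
      exact ⟨y, fun _ => hy⟩
    · exact ⟨0, fun h => absurd h hz⟩
  choose U hU using hex
  have hunif := hcau.tendstoUniformlyOn_of_tendsto hU
  refine ⟨U, hunif.continuousOn (.of_forall fun n => (hg n).continuous.continuousOn), hunif, ?_⟩
  obtain ⟨ns, hns, hae⟩ := (tendstoInMeasure_of_tendsto_Lp h0).exists_seq_tendsto_ae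
  have hall : ∀ᵐ x ∂(volume.restrict D), ∀ n, toL2 D (g n) x = g n x :=
    ae_all_iff.2 fun n => coeFn_toL2 ((hg n).memLp D)
  filter_upwards [hae, hall, ae_restrict_mem hD.measurableSet] with x hx1 hx2 hx3
  simp only [hx2] at hx1
  exact tendsto_nhds_unique hx1 ((hU x (subset_closure hx3)).comp hns.tendsto_atTop)

/-- Smooth approximations of functions in `H³` that converge in `C¹`. -/
theorem exists_C1_approx {D : Set Plane} (hD : IsOpen D) (hconv : Convex ℝ D)
    (hb : Bornology.IsBounded D) (hne : D.Nonempty) {u : L2 D} (hu : u ∈ Hk D 3) :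
    ∃ (f : ℕ → Plane → ℝ) (U : Plane → ℝ) (V : Fin 2 → Plane → ℝ), (∀ n, Smc (f n)) ∧
      Tendsto (fun n => toL2 D (f n)) atTop (𝓝 u) ∧
      (∀ j k, Tendsto (fun n => toL2 D (dd k (dd j (f n)))) atTop (𝓝 (wd2 D u j k))) ∧
      (∀ j k l, Tendsto (fun n => toL2 D (dd l (dd k (dd j (f n))))) atTop
        (𝓝 (weakDeriv D 3 u ![j, k, l]))) ∧
      ContinuousOn U (closure D) ∧ TendstoUniformlyOn f U atTop (closure D) ∧
      u =ᵐ[volume.restrict D] U ∧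
      (∀ j, ContinuousOn (V j) (closure D)) ∧
      (∀ j, TendstoUniformlyOn (fun n => dd j (f n)) (V j) atTop (closure D)) ∧
      ∀ j, wd1 D u j =ᵐ[volume.restrict D] V j := by
  obtain ⟨M, hs, m0, m1, m2, m3, -⟩ := exists_smoothing hD hconv hb hne
  have hu2 : u ∈ Hk D 2 := Hk_mono (by norm_num) hu
  have w1 := hasWD_wd1 (Hk_mono (by norm_num) hu : u ∈ Hk D 1)
  have w2 := hasWD_wd2 hu2
  have w3 := hasWD_wd3 hu
  have t1 := fun j => m1 j u _ (w1 j)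
  have t2 := fun j k => m2 j k u _ _ (w1 j) (w2 j k)
  have t3 := fun j k l => m3 j k l u _ _ _ (w1 j) (w2 j k) (w3 j k l)
  obtain ⟨U, hU1, hU2, hU3⟩ := exists_uniform_limit hD hconv hb hne (fun n => hs n u) (m0 u) t1 t2
  choose V hV1 hV2 hV3 using fun j => exists_uniform_limit hD hconv hb hne (fun n => (hs n u).dd j) (t1 j)
    (t2 j) (t3 j)
  exact ⟨fun n => M n u, U, V, fun n => hs n u, m0 u, t2, t3, hU1, hU2, hU3, hV1, hV2, hV3⟩

/-- Uniform convergence of the derivatives allows differentiating the limit along the open segment,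
where it is constant; continuity extends this to the endpoints, which are the vertices needed later.
-/
theorem gradient_eq_zero_of_segment {D : Set Plane} {f : ℕ → Plane → ℝ} (hf : ∀ n, Smc (f n))
    {U : Plane → ℝ} {V : Fin 2 → Plane → ℝ} (hU : TendstoUniformlyOn f U atTop D)
    (hV : ∀ j, ContinuousOn (V j) D)
    (hV' : ∀ j, TendstoUniformlyOn (fun n => dd j (f n)) (V j) atTop D) {x w : Plane}
    (hmem : ∀ t ∈ Icc (0 : ℝ) 1, x + t • w ∈ D) (h0 : ∀ t ∈ Icc (0 : ℝ) 1, U (x + t • w) = 0)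
    {t : ℝ} (ht : t ∈ Icc (0 : ℝ) 1) : ∑ j, w j * V j (x + t • w) = 0 := by
  have hIoo : ∀ t ∈ Ioo (0 : ℝ) 1, ∑ j, w j * V j (x + t • w) = 0 := fun t ht => by
    have hu : TendstoUniformlyOn (fun n (s : ℝ) => ∑ j, w j * dd j (f n) (x + s • w))
        (fun s => ∑ j, w j * V j (x + s • w)) atTop (Ioo 0 1) := by
      have h1 : ∀ j, TendstoUniformlyOn (fun n (s : ℝ) => w j * dd j (f n) (x + s • w))
          (fun s => w j * V j (x + s • w)) atTop (Ioo 0 1) := fun j => by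
        have h2 := ((hV' j).comp fun s : ℝ => x + s • w).mono
          (fun s hs => hmem s (Ioo_subset_Icc_self hs))
        exact (uniformContinuous_const_smul (w j)).comp_tendstoUniformlyOn h2
      simp only [Fin.sum_univ_two]
      exact (h1 0).add (h1 1)
    have h3 := hasDerivAt_of_tendstoUniformlyOn (f := fun n (s : ℝ) => f n (x + s • w))
      (g := fun s => U (x + s • w)) isOpen_Ioo hu
      (.of_forall fun n s _ => (hf n).hasDerivAt_line x w s)
      (fun s hs => hU.tendsto_at (hmem s (Ioo_subset_Icc_self hs))) ht
    have h4 : HasDerivAt (fun s => U (x + s • w)) 0 t := by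
      refine (hasDerivAt_const t (0 : ℝ)).congr_of_eventuallyEq ?_
      filter_upwards [Ioo_mem_nhds ht.1 ht.2] with s hs using h0 s (Ioo_subset_Icc_self hs)
    exact h3.unique h4
  have hc : ContinuousOn (fun t : ℝ => ∑ j, w j * V j (x + t • w)) (Icc 0 1) := by
    refine continuousOn_finsetSum _ fun j _ => continuousOn_const.mul ?_
    exact (hV j).comp (by fun_prop) hmem
  have h5 : EqOn (fun t : ℝ => ∑ j, w j * V j (x + t • w)) (fun _ => 0) (closure (Ioo 0 1)) :=
    EqOn.of_subset_closure (fun t ht => hIoo t ht) (by rwa [closure_Ioo zero_ne_one])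
      continuousOn_const subset_closure subset_rfl
  rw [closure_Ioo zero_ne_one] at h5
  exact h5 ht

end

section

open Filter Metric Topology

/-! ### The interpolant belongs to the discrete space -/

/-- A boundary point in the interior of a segment in a convex set has the segment on the boundary. -/
theorem lineMap_mem_frontier {Ω : Set Plane} (hΩ : IsOpen Ω) (hconv : Convex ℝ Ω) {p q : Plane}
    (hp : p ∈ closure Ω) (hq : q ∈ closure Ω) {t : ℝ} (ht : t ∈ Ioo (0 : ℝ) 1)
    (hx : AffineMap.lineMap p q t ∈ frontier Ω) {τ : ℝ} (hτ : τ ∈ Icc (0 : ℝ) 1) :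
    AffineMap.lineMap p q τ ∈ frontier Ω := by
  have hx' : AffineMap.lineMap p q t ∉ Ω := by rw [hΩ.frontier_eq] at hx; exact hx.2
  obtain ⟨l, hl⟩ := geometric_hahn_banach_open_point hconv hΩ hx'
  have hlc : ∀ y ∈ closure Ω, l y ≤ l (AffineMap.lineMap p q t) := fun y hy =>
    closure_minimal (fun z hz => (hl z hz).le) (isClosed_le l.continuous continuous_const) hy
  have e : ∀ τ : ℝ, l (AffineMap.lineMap p q τ) = l p + τ * (l q - l p) := fun τ => by
    rw [AffineMap.lineMap_apply_module', map_add, map_smul, map_sub, smul_eq_mul]; ring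
  have h1 := hlc p hp
  have h2 := hlc q hq
  rw [e] at h1 h2
  have h3 : l q - l p = 0 := by
    refine le_antisymm ?_ ?_
    · by_contra! h
      nlinarith [mul_lt_mul_of_pos_right ht.2 h]
    · by_contra! h
      nlinarith [mul_neg_of_pos_of_neg ht.1 h]
  rw [hΩ.frontier_eq]
  refine ⟨hconv.closure.lineMap_mem hp hq hτ, fun h => ?_⟩
  have := hl _ h
  rw [e, e, h3] at this
  simp at this

theorem exists_lineMap_of_coord_eq_zero (b : AffineBasis (Fin 3) ℝ Plane) {x : Plane}
    (hx : ∀ i, 0 ≤ b.coord i x) {k : Fin 3} (hk : b.coord k x = 0) :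
    b.coord (k + 2) x ∈ Icc (0 : ℝ) 1 ∧
      x = AffineMap.lineMap (b (k + 1)) (b (k + 2)) (b.coord (k + 2) x) := by
  refine ⟨coord_mem_Icc hx _, ?_⟩
  have h1 := b.linear_combination_coord_eq_self x
  have h2 := coord_other hk
  rw [AffineMap.lineMap_apply_module, ← h2]
  conv_lhs => rw [← h1, Fin.sum_univ_three]
  fin_cases k
  all_goals simp at hk ⊢
  all_goals simp [hk, add_comm]

/-- A segment from a point of `Ω` to a point outside is connected, hence meets the frontier, where
`f` vanishes. -/
theorem LipschitzWith.indicator_of_frontier {Ω : Set Plane} {f : Plane → ℝ} {K : NNReal}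
    (hf : LipschitzWith K f) (h0 : ∀ x ∈ frontier Ω, f x = 0) : LipschitzWith K (Ω.indicator f) := by
  have key : ∀ x ∈ Ω, ∀ y ∉ Ω, |f x| ≤ K * dist x y := fun x hx y hy => by
    obtain ⟨z, hz, hzf⟩ : ∃ z ∈ segment ℝ x y, z ∈ frontier Ω := by
      by_contra! h
      have hsub : segment ℝ x y ⊆ interior Ω ∪ (closure Ω)ᶜ := fun z hz => by
        by_contra hz'
        rw [mem_union, not_or, mem_compl_iff, not_not] at hz'
        exact h z hz ⟨hz'.2, hz'.1⟩
      obtain ⟨z, -, h1, h2⟩ := (convex_segment (𝕜 := ℝ) x y).isPreconnected _ _ isOpen_interior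
        isClosed_closure.isOpen_compl hsub
        ⟨x, left_mem_segment ℝ x y, (hsub (left_mem_segment ℝ x y)).resolve_right fun h => h (subset_closure hx)⟩
        ⟨y, right_mem_segment ℝ x y, (hsub (right_mem_segment ℝ x y)).resolve_left fun h =>
          hy (interior_subset h)⟩
      exact h2 (subset_closure (interior_subset h1))
    have h1 := hf.dist_le_mul x z
    rw [h0 z hzf, Real.dist_eq, sub_zero] at h1
    refine h1.trans (mul_le_mul_of_nonneg_left ?_ K.2)
    have := dist_add_dist_of_mem_segment hz
    linarith [dist_nonneg (x := z) (y := y)]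
  refine LipschitzWith.of_dist_le_mul fun x y => ?_
  by_cases hx : x ∈ Ω <;> by_cases hy : y ∈ Ω
  · rw [indicator_of_mem hx, indicator_of_mem hy]; exact hf.dist_le_mul x y
  · rw [indicator_of_mem hx, indicator_of_notMem hy, Real.dist_eq, sub_zero]; exact key x hx y hy
  · rw [indicator_of_notMem hx, indicator_of_mem hy, dist_comm, Real.dist_eq, sub_zero, dist_comm]
    exact key y hy x hx
  · rw [indicator_of_notMem hx, indicator_of_notMem hy, dist_self]; positivity

namespace Triangulation

variable {Ω : Set Plane} {𝒯 : Triangulation Ω}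

theorem hull_subset (s : 𝒯.tris) : convexHull ℝ (s.1 : Set Plane) ⊆ closure Ω := by
  rw [← 𝒯.cover]
  exact subset_biUnion_of_mem (u := fun s : Finset Plane => convexHull ℝ (s : Set Plane)) s.2

namespace IsInterpolant

variable {U : Plane → ℝ} {G : Plane → Plane} {B : 𝒯.tris → AffineBasis (Fin 3) ℝ Plane} {I : Plane → ℝ}
  {I' : Fin 2 → Plane → ℝ} {K : NNReal} (hI : 𝒯.IsInterpolant U G B I I' K)
include hI

theorem vertex_mem (s : 𝒯.tris) (i : Fin 3) : B s i ∈ convexHull ℝ (s.1 : Set Plane) :=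
  subset_convexHull ℝ _ ((mem_vertices_iff (hI.range_eq s)).2 ⟨i, rfl⟩)

theorem hasWD (hΩ : IsOpen Ω) (hb : Bornology.IsBounded Ω) (j : Fin 2) :
    HasWD Ω j (toL2 Ω I) (toL2 Ω (I' j)) := by
  have h := HasWD.of_lipschitz hI.lipschitz j (memLp_of_continuous hb hI.lipschitz.continuous)
    (memLp_ld hb hI.lipschitz j)
  rwa [toL2_congr (f := ld j I) (g := I' j) hΩ.measurableSet fun x hx => by
    have hx' := interior_maximal subset_closure hΩ hx
    rw [ld, (hI.differentiableAt x hx').lineDeriv_eq_fderiv]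
    exact hI.dd_eq x hx' j] at h

theorem hasWD' (hb : Bornology.IsBounded Ω) (j k : Fin 2) :
    HasWD Ω k (toL2 Ω (I' j)) (toL2 Ω (ld k (I' j))) :=
  HasWD.of_lipschitz (hI.lipschitz' j) k (memLp_of_continuous hb (hI.lipschitz' j).continuous)
    (memLp_ld hb (hI.lipschitz' j) k)

theorem mem_Hk_two (hΩ : IsOpen Ω) (hb : Bornology.IsBounded Ω) : toL2 Ω I ∈ Hk Ω 2 :=
  _root_.mem_Hk_two (hI.hasWD hΩ hb) (hI.hasWD' hb)

/-- A boundary point lies on an edge of some triangle. If it is interior to the edge, the whole edge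
lies in the frontier by convexity, so the values and the tangential derivatives at both ends vanish,
and with them the Hermite cubic. -/
theorem eq_zero_of_mem_frontier (hΩ : IsOpen Ω) (hconv : Convex ℝ Ω)
    {f : ℕ → Plane → ℝ} (hf : ∀ n, Smc (f n))
    {V : Fin 2 → Plane → ℝ} (hU : TendstoUniformlyOn f U atTop (closure Ω))
    (hV : ∀ j, ContinuousOn (V j) (closure Ω))
    (hV' : ∀ j, TendstoUniformlyOn (fun n => dd j (f n)) (V j) atTop (closure Ω))
    (hG : ∀ x j, G x j = V j x) (h0 : ∀ x ∈ frontier Ω, U x = 0) {x : Plane} (hx : x ∈ frontier Ω) :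
    I x = 0 := by
  have hxc := frontier_subset_closure hx
  rw [← 𝒯.cover] at hxc
  obtain ⟨s, hs, hxs⟩ := mem_iUnion₂.1 hxc
  lift s to 𝒯.tris using hs
  rw [hI.eq_hct s x hxs]
  have hnn := (mem_hull_iff (hI.range_eq s)).1 hxs
  have hmem := fun i => hull_subset s (hI.vertex_mem s i)
  obtain ⟨k, hk⟩ : ∃ k, (B s).coord k x = 0 := by
    by_contra! h
    have h1 : x ∈ cell s := (mem_cell_iff (hI.range_eq s)).2 fun i => lt_of_le_of_ne (hnn i) (h i).symm
    rw [hΩ.frontier_eq] at hx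
    exact hx.2 (𝒯.cell_subset s s.2 h1)
  obtain ⟨ht, hxt⟩ := exists_lineMap_of_coord_eq_zero (B s) hnn hk
  generalize (B s).coord (k + 2) x = t at ht hxt
  -- At a vertex the edge need not lie in the frontier, but there the value of the interpolant is
  -- prescribed.
  rcases eq_or_lt_of_le ht.1 with rfl | ht0
  · rw [AffineMap.lineMap_apply_zero] at hxt
    rw [hxt, hct_vertex, Function.comp_apply, ← hxt, h0 x hx]
  rcases eq_or_lt_of_le ht.2 with rfl | ht1
  · rw [AffineMap.lineMap_apply_one] at hxt
    rw [hxt, hct_vertex, Function.comp_apply, ← hxt, h0 x hx]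
  have hfr : ∀ τ ∈ Icc (0 : ℝ) 1, AffineMap.lineMap (B s (k + 1)) (B s (k + 2)) τ ∈ frontier Ω :=
    fun τ hτ => lineMap_mem_frontier hΩ hconv (hmem _) (hmem _) ⟨ht0, ht1⟩ (hxt ▸ hx) hτ
  have e : ∀ τ : ℝ, B s (k + 1) + τ • (B s (k + 2) - B s (k + 1)) =
      AffineMap.lineMap (B s (k + 1)) (B s (k + 2)) τ := fun τ => by
    rw [AffineMap.lineMap_apply_module', add_comm]
  have hg : ∀ τ ∈ Icc (0 : ℝ) 1, ⟪G (AffineMap.lineMap (B s (k + 1)) (B s (k + 2)) τ),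
      B s (k + 2) - B s (k + 1)⟫_ℝ = 0 := fun τ hτ => by
    have := gradient_eq_zero_of_segment hf hU hV hV' (x := B s (k + 1)) (w := B s (k + 2) - B s (k + 1))
      (fun τ hτ => by rw [e]; exact frontier_subset_closure (hfr τ hτ))
      (fun τ hτ => by rw [e]; exact h0 _ (hfr τ hτ)) hτ
    rw [e] at this
    rw [← this]
    simp [PiLp.inner_apply, hG]
  have h0mem : (0 : ℝ) ∈ Icc (0 : ℝ) 1 := by simp
  have h1mem : (1 : ℝ) ∈ Icc (0 : ℝ) 1 := by simp
  have g0 := hg 0 h0mem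
  have g1 := hg 1 h1mem
  have u0 := h0 _ (hfr 0 h0mem)
  have u1 := h0 _ (hfr 1 h1mem)
  rw [AffineMap.lineMap_apply_zero] at g0 u0
  rw [AffineMap.lineMap_apply_one] at g1 u1
  rw [hxt, hct_lineMap _ _ (succ_ne_self_fin_three k).2.2 ht]
  simp only [Function.comp_apply, g0, g1, u0, u1]
  ring

theorem mem_spaceX (hΩ : IsOpen Ω) (hconv : Convex ℝ Ω) (hb : Bornology.IsBounded Ω)
    (hne : Ω.Nonempty) (h0 : ∀ x ∈ frontier Ω, I x = 0) : toL2 Ω I ∈ spaceX Ω := by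
  refine ⟨hI.mem_Hk_two hΩ hb, ?_⟩
  rw [toL2_congr (g := Ω.indicator I) hΩ.measurableSet fun x hx => (indicator_of_mem hx _).symm]
  exact mem_H10_of_lipschitz hΩ hconv hb hne (hI.lipschitz.indicator_of_frontier h0)
    fun x hx => indicator_of_notMem hx _

theorem hasPolyEdgeTrace (s : 𝒯.tris) {a c : Plane} (ha : a ∈ s.1) (hc : c ∈ s.1) (hac : a ≠ c) :
    HasPolyEdgeTrace (cell s) a c (toL2 (cell s) I) 3 ∧ ∀ n : Plane, ⟪n, c - a⟫_ℝ = 0 →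
      HasPolyEdgeTrace (cell s) a c (toL2 (cell s) fun x => ∑ j, n j * I' j x) 1 := by
  obtain ⟨i, rfl⟩ := (mem_vertices_iff (hI.range_eq s)).1 ha
  obtain ⟨j, rfl⟩ := (mem_vertices_iff (hI.range_eq s)).1 hc
  have hij : i ≠ j := fun h => hac (by rw [h])
  have hne := cell_nonempty (hI.range_eq s)
  have hmem : ∀ i, B s i ∈ closure (cell s) := fun i => by
    rw [closure_cell hne]; exact hI.vertex_mem s i
  have hline : ∀ t ∈ Icc (0 : ℝ) 1, AffineMap.lineMap (B s i) (B s j) t ∈ convexHull ℝ (s.1 : Set Plane) :=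
    fun t ht => (convex_convexHull ℝ _).lineMap_mem (hI.vertex_mem s i) (hI.vertex_mem s j) ht
  have trace := fun {f : Plane → ℝ} {L : NNReal} (hf : LipschitzWith L f) {g : ℝ → ℝ} =>
    hasEdgeTrace_of_lipschitz (g := g) (isOpen_cell s) (convex_cell s) (isBounded_cell s) hne hf (hmem i)
      (hmem j)
  refine ⟨⟨.C (U (B s i)) * (.C 3 * (1 - .X) ^ 2 - .C 2 * (1 - .X) ^ 3) +
    .C (U (B s j)) * (.C 3 * .X ^ 2 - .C 2 * .X ^ 3) +
    .C ⟪G (B s i), B s j - B s i⟫_ℝ * ((1 - .X) ^ 2 * .X) -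
    .C ⟪G (B s j), B s j - B s i⟫_ℝ * (.X ^ 2 * (1 - .X)), by compute_degree, ?_⟩, fun n hn =>
    ⟨(1 - .X) * .C ⟪G (B s i), n⟫_ℝ + .X * .C ⟪G (B s j), n⟫_ℝ, by compute_degree, ?_⟩⟩
  · refine trace hI.lipschitz fun t ht => ?_
    rw [hI.eq_hct s _ (hline t ht), hct_lineMap _ _ hij ht]
    simp
  · have hL : LipschitzWith (∑ j, ‖n j‖₊ * K) fun x => ∑ j, n j * I' j x := by
      simp only [Fin.sum_univ_two]
      exact ((lipschitzWith_smul (n 0)).comp (hI.lipschitz' 0)).add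
        ((lipschitzWith_smul (n 1)).comp (hI.lipschitz' 1))
    refine trace hL fun t ht => ?_
    rw [hI.eq_hctD s _ (hline t ht), hctD_lineMap_normal _ _ hij ht hn]
    simp
    exact mul_comm _ _

/-- The glued interpolant has the polynomial edge traces of `U_T` but does not solve the equation;
`exists_mem_localSpace` replaces it on each triangle by a solution with the same functional. -/
theorem trace2T_mem (hΩ : IsOpen Ω) (hconv : Convex ℝ Ω) (hb : Bornology.IsBounded Ω)
    (hne : Ω.Nonempty) (h0 : ∀ x ∈ frontier Ω, I x = 0) :
    𝒯.trace2T (toL2 Ω I) ∈ 𝒯.discreteTraceSpace := by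
  refine ⟨⟨_, hI.mem_spaceX hΩ hconv hb hne h0, rfl⟩, fun s => ?_⟩
  have hbs := hI.range_eq s
  have hsub := 𝒯.cell_subset s s.2
  have hr : ∀ {f : Plane → ℝ}, Continuous f → restrictL2 hsub (toL2 Ω f) = toL2 (cell s) f := fun hf =>
    restrictL2_toL2 hsub (memLp_of_continuous hb hf)
  have hwd : ∀ j, HasWD (cell s) j (toL2 (cell s) I) (toL2 (cell s) (I' j)) := fun j => by
    have := (hI.hasWD hΩ hb j).restrict hΩ.measurableSet hsub
    rwa [hr hI.lipschitz.continuous, hr (hI.lipschitz' j).continuous] at this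
  obtain ⟨w, hw, hwt⟩ := exists_mem_localSpace (cell_nonempty hbs)
    (fun a ha c hc t => lineMap_notMem_cell hbs ha hc t)
    (Hk_restrict hΩ.measurableSet hsub (hI.mem_Hk_two hΩ hb)) (fun a ha c hc hac => by
      rw [hr hI.lipschitz.continuous]
      refine ⟨(hI.hasPolyEdgeTrace s ha hc hac).1, fun n hn => ?_⟩
      have h1 := (hI.hasPolyEdgeTrace s ha hc hac).2 n hn
      have hm : ∀ j, MemLp (I' j) 2 (volume.restrict (cell s)) := fun j =>
        memLp_of_continuous (isBounded_cell s) (hI.lipschitz' j).continuous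
      have e : dirDeriv (cell s) n (toL2 (cell s) I) = toL2 (cell s) fun x => ∑ j, n j * I' j x := by
        rw [dirDeriv_eq]
        simp only [wd1_eq (isOpen_cell s) hwd, Fin.sum_univ_two]
        rw [toL2_add ((hm 0).const_mul _) ((hm 1).const_mul _), toL2_const_mul (hm 0), toL2_const_mul (hm 1)]
      rw [e]
      exact h1)
  exact ⟨w, hw, fun Q => by rw [hwt]; convert 𝒯.trace2T_single _ s Q⟩

end IsInterpolant

end Triangulation

end

section

open Filter Metric Topology

/-! ### Error estimates -/

theorem add_sq_le_two (x y : ℝ) : (x + y) ^ 2 ≤ 2 * x ^ 2 + 2 * y ^ 2 := by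
  nlinarith [sq_nonneg (x - y)]

theorem abs_lineDeriv_sub_le {f : Plane → ℝ} {x v : Plane} {H L : ℝ}
    (hf : LineDifferentiableAt ℝ f x v) (hL : 0 ≤ L)
    (h : ∀ᶠ t : ℝ in 𝓝 0, |f (x + t • v) - f x - t * H| ≤ L * |t|) : |lineDeriv ℝ f x v - H| ≤ L := by
  have h1 : HasDerivAt (fun t : ℝ => f (x + t • v) - t * H) (lineDeriv ℝ f x v - H) 0 := by
    have h2 : HasDerivAt (fun t : ℝ => f (x + t • v)) (lineDeriv ℝ f x v) 0 := hf.hasLineDerivAt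
    have h3 := ((hasDerivAt_id (0 : ℝ)).mul_const H)
    rw [one_mul] at h3
    exact h2.sub h3
  refine h1.le_of_lip' hL ?_
  filter_upwards [h] with t ht
  simp only [zero_smul, add_zero, zero_mul, sub_zero, Real.norm_eq_abs]
  convert ht using 2
  ring

namespace Triangulation

variable {Ω : Set Plane} {𝒯 : Triangulation Ω}

/-- The second derivatives of both functions are compared with the mean Hessian of `f`: those of `f`
by Poincaré, those of the interpolant pointwise by `interpolation_error`. The number `E` may depend
on the triangle, because its term disappears when `δ → 0`. -/
theorem IsInterpolant.cell_error {U : Plane → ℝ} {G : Plane → Plane}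
    {B : 𝒯.tris → AffineBasis (Fin 3) ℝ Plane} {I : Plane → ℝ} {I' : Fin 2 → Plane → ℝ} {K : NNReal}
    (hI : 𝒯.IsInterpolant U G B I I' K) (s : 𝒯.tris) {κ r : ℝ} {x₀ : Plane} (hr : 0 < r)
    (hball : ball x₀ r ⊆ cell s) (hκ : diam (cell s) ≤ κ * r) :
    ∃ E, 0 ≤ E ∧ ∀ f, Smc f → ∀ δ, (∀ z ∈ closure Ω, |U z - f z| ≤ δ) →
      (∀ z ∈ closure Ω, ∀ j, |G z j - dd j f z| ≤ δ) →
      (∫ x in cell s, (f x - I x) ^ 2 ≤ 8 * (2 + 360 * κ) ^ 2 * diam (cell s) ^ 6 *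
        (∑ j, ∑ k, ∑ l, ∫ x in cell s, dd l (dd k (dd j f)) x ^ 2) + E * δ ^ 2) ∧
      ∀ j k, ∫ x in cell s, (dd k (dd j f) x - ld k (I' j) x) ^ 2 ≤
        (16 + 64 * 900 ^ 2 * κ ^ 6) * diam (cell s) ^ 2 *
          (∑ j, ∑ k, ∑ l, ∫ x in cell s, dd l (dd k (dd j f)) x ^ 2) + E * δ ^ 2 := by
  have hbs := hI.range_eq s
  have hne := cell_nonempty hbs
  have hD := isOpen_cell s.1
  have hbd := isBounded_cell s.1
  have hcl := closure_cell hne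
  have hfin := isFiniteMeasure_restrict_of_isBounded hbd
  have hV := volume_real_pos hD hbd hne
  set h := diam (cell s) with hh
  set V := volume.real (cell s) with hVd
  have hh0 : 0 ≤ h := diam_nonneg
  have hd : ∀ x ∈ closure (cell s), ∀ y ∈ closure (cell s), ‖x - y‖ ≤ h := fun x hx y hy => by
    rw [hh, ← diam_closure, ← dist_eq_norm]
    exact dist_le_diam_of_mem hbd.closure hx hy
  set P := h / r with hP
  have hP0 : 0 ≤ P := div_nonneg hh0 hr.le
  have hPκ : P ≤ κ := (div_le_iff₀ hr).2 hκ
  have hPh : P * r = h := div_mul_cancel₀ _ hr.ne'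
  refine ⟨2 * V * (180 * P * (1 + 2 * h)) ^ 2 + 4 * V * (900 * P * (1 + 2 * h) / r ^ 2) ^ 2, by positivity,
    fun f hf δ hU hG => ?_⟩
  set S := ∑ j, ∑ k, ∑ l, ∫ x in cell s, dd l (dd k (dd j f)) x ^ 2 with hS
  have hS0 : 0 ≤ S := by positivity
  set A := 2 * h ^ 2 * (√V)⁻¹ * √S with hA
  set A' := 2 * A * h + (1 + 2 * h) * δ with hA'
  set H : Fin 2 → Fin 2 → ℝ := fun j k => V⁻¹ * ∫ y in cell s, dd k (dd j f) y with hH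
  -- The volume cancels between the pointwise bound and the integration over the triangle.
  have hVA : V * A ^ 2 = 4 * h ^ 4 * S := by
    rw [hA, mul_pow, mul_pow, inv_pow, Real.sq_sqrt hV.le, Real.sq_sqrt hS0]
    field_simp
    ring
  have hvert := fun i => hull_subset s (hI.vertex_mem s i)
  have hδ : 0 ≤ δ := (abs_nonneg _).trans (hU _ (hvert 0))
  have hA0 : 0 ≤ A := by positivity
  have hA'0 : 0 ≤ A' := by positivity
  obtain ⟨e1, e2⟩ := interpolation_error hbs (A' := A') (δ := δ) (U := U ∘ B s) (G := G ∘ B s) (H := H) hr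
    hball hd hf hA (fun i => hU _ (hvert i)) (fun i j => hG _ (hvert i) j) hA' (fun j k => rfl)
  constructor
  · have hb : ∀ᵐ x ∂(volume.restrict (cell s)), (f x - I x) ^ 2 ≤ (2 * A * h + 180 * P * A') ^ 2 := by
      filter_upwards [ae_restrict_mem hD.measurableSet] with x hx
      have hx' := subset_closure hx
      rw [hI.eq_hct s x (hcl ▸ hx')]
      exact sq_le_sq' (by linarith [(abs_le.1 (e1 x hx')).1]) ((abs_le.1 (e1 x hx')).2)
    have h1 := integral_mono_of_nonneg (.of_forall fun x => sq_nonneg _) (integrable_const _) hb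
    rw [setIntegral_const, smul_eq_mul, ← hVd] at h1
    refine h1.trans ?_
    have h2 := add_sq_le_two ((2 + 360 * P) * A * h) (180 * P * (1 + 2 * h) * δ)
    have h3 : 2 * A * h + 180 * P * A' = (2 + 360 * P) * A * h + 180 * P * (1 + 2 * h) * δ := by
      rw [hA']; ring
    have h4 : (2 + 360 * P) ^ 2 ≤ (2 + 360 * κ) ^ 2 := by gcongr
    have h5 := mul_le_mul_of_nonneg_right h4 (show 0 ≤ 8 * h ^ 6 * S by positivity)
    have h6 := mul_le_mul_of_nonneg_left h2 hV.le
    have h7 : 0 ≤ 4 * V * (900 * P * (1 + 2 * h) / r ^ 2) ^ 2 * δ ^ 2 := by positivity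
    rw [h3]
    have h8 : V * (2 * ((2 + 360 * P) * A * h) ^ 2 + 2 * (180 * P * (1 + 2 * h) * δ) ^ 2) =
        (2 + 360 * P) ^ 2 * (8 * h ^ 6 * S) + 2 * V * (180 * P * (1 + 2 * h)) ^ 2 * δ ^ 2 := by
      linear_combination (2 * (2 + 360 * P) ^ 2 * h ^ 2) * hVA
    linarith
  · intro j k
    set L := 900 * P * A' / r ^ 2 with hL
    have hL0 : 0 ≤ L := by positivity
    have hI'D : ∀ y ∈ closure (cell s), I' j y = hctD (B s) (U ∘ B s) (edgeDeriv (B s) (G ∘ B s)) y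
        (EuclideanSpace.single j (1 : ℝ)) := fun y hy => by
      rw [← hI.eq_hctD s y (hcl ▸ hy), Fin.sum_univ_two]
      fin_cases j <;> simp
    -- The bound on increments of the gradient, with increments in the direction `k`, bounds the
    -- difference quotients of `I' j` around `H j k`, hence also the line derivative where it
    -- exists, which is almost everywhere.
    have hb : ∀ᵐ x ∂(volume.restrict (cell s)), |ld k (I' j) x - H j k| ≤ L := by
      filter_upwards [ae_restrict_mem hD.measurableSet, ae_restrict_of_ae
        ((hI.lipschitz' j).ae_lineDifferentiableAt (μ := volume) (EuclideanSpace.single k (1 : ℝ)))]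
        with x hx hlin
      refine abs_lineDeriv_sub_le hlin hL0 ?_
      have hc : ContinuousAt (fun t : ℝ => x + t • EuclideanSpace.single k (1 : ℝ)) 0 := by fun_prop
      have hmem : (fun t : ℝ => x + t • EuclideanSpace.single k (1 : ℝ)) ⁻¹' cell s ∈ 𝓝 (0 : ℝ) :=
        hc.preimage_mem_nhds (by simpa using hD.mem_nhds hx)
      filter_upwards [hmem] with t ht
      have hx' := subset_closure hx
      have ht' : x + t • EuclideanSpace.single k (1 : ℝ) ∈ closure (cell s) := subset_closure ht
      rw [hI'D _ ht', hI'D _ hx']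
      have h1 := e2 _ ht' _ hx' (EuclideanSpace.single j (1 : ℝ))
      have h2 : ∑ j', ∑ k', (EuclideanSpace.single j (1 : ℝ) : Plane) j' * H j' k' *
          (x + t • EuclideanSpace.single k (1 : ℝ) - x) k' = t * H j k := by
        rw [add_sub_cancel_left]
        simp only [Fin.sum_univ_two]
        fin_cases j <;> fin_cases k <;> simp [mul_comm]
      rw [h2, add_sub_cancel_left, norm_smul, PiLp.norm_single, PiLp.norm_single, norm_one, mul_one,
        Real.norm_eq_abs] at h1
      refine h1.trans (le_of_eq ?_)
      rw [hL]
      field_simp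
      rw [← hPh]
      ring
    have hp := ((hf.dd j).dd k).continuous
    have hint : Integrable (fun x => 2 * (dd k (dd j f) x - H j k) ^ 2 + 2 * L ^ 2)
        (volume.restrict (cell s)) :=
      integrableOn_of_continuous hbd (by fun_prop)
    have h1 := integral_mono_of_nonneg (μ := volume.restrict (cell s))
      (f := fun x => (dd k (dd j f) x - ld k (I' j) x) ^ 2) (.of_forall fun x => sq_nonneg _) hint (by
        filter_upwards [hb] with x hx
        have h2 := add_sq_le_two (dd k (dd j f) x - H j k) (H j k - ld k (I' j) x)
        rw [sub_add_sub_cancel] at h2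
        have h3 : (H j k - ld k (I' j) x) ^ 2 ≤ L ^ 2 := by
          rw [← sq_abs, abs_sub_comm]
          exact pow_le_pow_left₀ (abs_nonneg _) hx 2
        linarith)
    refine h1.trans ?_
    rw [integral_add (integrableOn_of_continuous hbd (by fun_prop)) (integrable_const _),
      integral_const_mul, setIntegral_const, smul_eq_mul, ← hVd]
    have h2 := poincare hD (convex_cell s.1) hbd ((hf.dd j).dd k) hne
      (fun x hx y hy => hd y (subset_closure hy) x (subset_closure hx))
    have h3 : ∑ l, ∫ x in cell s, dd l (dd k (dd j f)) x ^ 2 ≤ S :=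
      (Finset.single_le_sum (f := fun k => ∑ l, ∫ x in cell s, dd l (dd k (dd j f)) x ^ 2)
        (fun k _ => by positivity) (Finset.mem_univ k)).trans
      (Finset.single_le_sum (f := fun j => ∑ k, ∑ l, ∫ x in cell s, dd l (dd k (dd j f)) x ^ 2)
        (fun j _ => by positivity) (Finset.mem_univ j))
    have h4 := mul_le_mul_of_nonneg_left h3 (show 0 ≤ 8 * h ^ 2 by positivity)
    have h5 := mul_le_mul_of_nonneg_left (add_sq_le_two (1800 * P * A * h / r ^ 2)
      (900 * P * (1 + 2 * h) / r ^ 2 * δ)) (show 0 ≤ 2 * V by positivity)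
    have h6 : L = 1800 * P * A * h / r ^ 2 + 900 * P * (1 + 2 * h) / r ^ 2 * δ := by
      rw [hL, hA']; ring
    -- With `h = P r` all powers combine to `P⁶ h²`: shape regularity turns the inverse powers of
    -- `r` into powers of `κ`.
    have h7 : V * (1800 * P * A * h / r ^ 2) ^ 2 = 16 * 900 ^ 2 * P ^ 6 * h ^ 2 * S := by
      have e : V * (1800 * P * A * h / r ^ 2) ^ 2 = 1800 ^ 2 * P ^ 2 * h ^ 2 * (V * A ^ 2) / r ^ 4 := by
        field_simp
      rw [e, hVA, ← hPh]
      field_simp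
      ring
    have h8 : P ^ 6 ≤ κ ^ 6 := pow_le_pow_left₀ hP0 hPκ 6
    have h9 := mul_le_mul_of_nonneg_left h8 (show 0 ≤ 64 * 900 ^ 2 * h ^ 2 * S by positivity)
    have h10 : 0 ≤ 2 * V * (180 * P * (1 + 2 * h)) ^ 2 * δ ^ 2 := by positivity
    have h11 : 2 * V * L ^ 2 ≤ 64 * 900 ^ 2 * h ^ 2 * S * P ^ 6 +
        4 * V * (900 * P * (1 + 2 * h) / r ^ 2) ^ 2 * δ ^ 2 := by
      rw [h6]
      refine h5.trans (le_of_eq ?_)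
      linear_combination 4 * h7
    have h12 : ∫ x in cell s, (dd k (dd j f) x - H j k) ^ 2 ≤ 8 * h ^ 2 * S := h2.trans h4
    linarith

end Triangulation

end

section

open Filter Metric Topology

namespace Triangulation

variable {Ω : Set Plane} (𝒯 : Triangulation Ω)

/-! ### Sums over the triangles -/

/-- By conformity a common point lies in the hull of the common vertices. One vertex of `s` is
missing there, and its barycentric coordinate is nonpositive on that hull but positive in the open
cell. -/
theorem disjoint_cell {s t : 𝒯.tris} (h : s ≠ t) : Disjoint (cell s) (cell t) := by
  rw [Set.disjoint_left]
  intro x hs ht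
  obtain ⟨b, hb⟩ := exists_affineBasis (𝒯.card_eq s s.2) (𝒯.indep s s.2)
  have hst : ¬ (s : Finset Plane) ⊆ t := fun hsub => h (Subtype.ext (Finset.eq_of_subset_of_card_le hsub
    (by rw [𝒯.card_eq s s.2, 𝒯.card_eq t t.2])))
  obtain ⟨v, hvs, hvt⟩ := Finset.not_subset.1 hst
  obtain ⟨i, rfl⟩ := (mem_vertices_iff hb).1 hvs
  have hx : x ∈ convexHull ℝ ((s : Set Plane) ∩ (t : Set Plane)) := by
    rw [← 𝒯.conforming s s.2 t t.2]; exact ⟨interior_subset hs, interior_subset ht⟩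
  have hsub : convexHull ℝ (((s : Finset Plane) : Set Plane) ∩ ((t : Finset Plane) : Set Plane)) ⊆
      b.coord i ⁻¹' Iic 0 := by
    refine convexHull_min (fun y hy => ?_) ((convex_Iic (0 : ℝ)).affine_preimage (b.coord i))
    obtain ⟨j, rfl⟩ := (mem_vertices_iff hb).1 hy.1
    have hij : i ≠ j := fun e => hvt (e ▸ hy.2)
    exact (b.coord_apply_ne hij).le
  exact absurd ((mem_cell_iff hb).1 hs i) (not_lt.2 (hsub hx))

/-- Points of `Ω` in no open cell lie on frontiers of finitely many convex sets, which are null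
sets. -/
theorem iUnion_cell_ae_eq : (⋃ s : 𝒯.tris, cell (s : Finset Plane)) =ᵐ[volume] Ω := by
  refine ae_eq_set.2 ⟨?_, ?_⟩
  · rw [sdiff_eq_empty.2 (iUnion_subset fun s : 𝒯.tris => 𝒯.cell_subset s s.2), measure_empty]
  · refine measure_mono_null (t := ⋃ s : 𝒯.tris, frontier (cell (s : Finset Plane))) (fun x hx => ?_)
      (measure_iUnion_null fun s => (convex_cell s.1).addHaar_frontier volume)
    have hx' : x ∈ ⋃ s ∈ 𝒯.tris, convexHull ℝ (s : Set Plane) := by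
      rw [𝒯.cover]; exact subset_closure hx.1
    obtain ⟨s, hs, hxs⟩ := mem_iUnion₂.1 hx'
    obtain ⟨b, hb⟩ := exists_affineBasis (𝒯.card_eq s hs) (𝒯.indep s hs)
    refine mem_iUnion.2 ⟨⟨s, hs⟩, ?_⟩
    rw [frontier, closure_cell (cell_nonempty hb), (isOpen_cell s).interior_eq]
    exact ⟨hxs, fun h => hx.2 (mem_iUnion.2 ⟨⟨s, hs⟩, h⟩)⟩

theorem sum_setIntegral_cell {F : Plane → ℝ} (hF : IntegrableOn F Ω) :
    ∑ s : 𝒯.tris, ∫ x in cell s, F x = ∫ x in Ω, F x := by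
  have h := integral_iUnion_fintype (μ := volume) (f := F) (s := fun s : 𝒯.tris => cell (s : Finset Plane))
    (fun s => (isOpen_cell (s : Finset Plane)).measurableSet) (fun s t h => 𝒯.disjoint_cell h)
    (fun s => hF.mono_set (𝒯.cell_subset s s.2))
  rw [← h]
  exact setIntegral_congr_set 𝒯.iUnion_cell_ae_eq

theorem diam_cell_le_meshSize (s : 𝒯.tris) : diam (cell s) ≤ 𝒯.meshSize :=
  le_ciSup (f := fun s : 𝒯.tris => diam (cell s)) (Set.finite_range _).bddAbove s

theorem meshSize_nonneg : 0 ≤ 𝒯.meshSize := Real.iSup_nonneg fun _ => diam_nonneg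

theorem meshSize_le_diam (hb : Bornology.IsBounded Ω) : 𝒯.meshSize ≤ diam Ω :=
  Real.iSup_le (fun s => diam_mono (𝒯.cell_subset s s.2) hb) diam_nonneg

variable {𝒯}

/-- First `n → ∞`, then `δ → 0`. There are finitely many triangles, so the local constants `E` need
no uniformity. -/
theorem sq_norm_sub_toL2_le {φ : ℕ → Plane → ℝ} (hφ : ∀ n, Smc (φ n)) {F : Plane → ℝ}
    (hF : MemLp F 2 (volume.restrict Ω)) {v : L2 Ω}
    (hv : Tendsto (fun n => toL2 Ω (φ n)) atTop (𝓝 v)) {a R : ℝ} {S : ℕ → 𝒯.tris → ℝ}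
    (hS : Tendsto (fun n => ∑ s, S n s) atTop (𝓝 R))
    (h : ∀ s : 𝒯.tris, ∃ E, 0 ≤ E ∧ ∀ δ > 0, ∀ᶠ n in atTop,
      ∫ x in cell s, (φ n x - F x) ^ 2 ≤ a * S n s + E * δ ^ 2) :
    ‖v - toL2 Ω F‖ ^ 2 ≤ a * R := by
  choose E hE0 hE using h
  have key : ∀ δ > 0, ‖v - toL2 Ω F‖ ^ 2 ≤ a * R + (∑ s, E s) * δ ^ 2 := fun δ hδ => by
    refine le_of_tendsto_of_tendsto ((hv.sub_const _).norm.pow 2)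
      ((hS.const_mul a).add_const ((∑ s, E s) * δ ^ 2)) ?_
    filter_upwards [eventually_all.2 fun s => hE s δ hδ] with n hn
    have hm : MemLp (fun x => φ n x - F x) 2 (volume.restrict Ω) := ((hφ n).memLp Ω).sub hF
    rw [← toL2_sub ((hφ n).memLp Ω) hF, norm_toL2_sq hm,
      ← 𝒯.sum_setIntegral_cell (F := fun x => (φ n x - F x) ^ 2) hm.integrable_sq]
    refine (Finset.sum_le_sum fun s _ => hn s).trans (le_of_eq ?_)
    rw [Finset.sum_add_distrib, Finset.mul_sum, Finset.sum_mul]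
  have hlim : Tendsto (fun δ : ℝ => a * R + (∑ s, E s) * δ ^ 2) (𝓝[>] 0) (𝓝 (a * R)) := by
    have : ContinuousAt (fun δ : ℝ => a * R + (∑ s, E s) * δ ^ 2) 0 := by fun_prop
    have h := this.tendsto
    simp only [ne_eq, OfNat.ofNat_ne_zero, not_false_eq_true, zero_pow, mul_zero, add_zero] at h
    exact h.mono_left nhdsWithin_le_nhds
  exact ge_of_tendsto hlim (eventually_mem_nhdsWithin.mono fun δ hδ => key δ hδ)

theorem tendsto_sum_cell {φ : ℕ → Plane → ℝ} (hφ : ∀ n, Smc (φ n)) {v : L2 Ω}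
    (hv : Tendsto (fun n => toL2 Ω (φ n)) atTop (𝓝 v)) :
    Tendsto (fun n => ∑ s : 𝒯.tris, ∫ x in cell s, φ n x ^ 2) atTop (𝓝 (‖v‖ ^ 2)) := by
  refine (tendsto_setIntegral_sq hφ hv).congr fun n => ?_
  rw [𝒯.sum_setIntegral_cell (F := fun x => φ n x ^ 2) ((hφ n).memLp Ω).integrable_sq]

/-- The global interpolation error. -/
theorem IsInterpolant.error {U : Plane → ℝ} {V : Fin 2 → Plane → ℝ} {G : Plane → Plane}
    {B : 𝒯.tris → AffineBasis (Fin 3) ℝ Plane} {I : Plane → ℝ} {I' : Fin 2 → Plane → ℝ} {K : NNReal}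
    (hI : 𝒯.IsInterpolant U G B I I' K) (hG : ∀ x j, G x j = V j x)
    (hb : Bornology.IsBounded Ω) {κ : ℝ} (hκ : 𝒯.ShapeRegular κ) {u : L2 Ω}
    {f : ℕ → Plane → ℝ} (hf : ∀ n, Smc (f n)) (hfu : Tendsto (fun n => toL2 Ω (f n)) atTop (𝓝 u))
    (hf2 : ∀ j k, Tendsto (fun n => toL2 Ω (dd k (dd j (f n)))) atTop (𝓝 (wd2 Ω u j k)))
    (hf3 : ∀ j k l, Tendsto (fun n => toL2 Ω (dd l (dd k (dd j (f n))))) atTop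
      (𝓝 (weakDeriv Ω 3 u ![j, k, l])))
    (hU : TendstoUniformlyOn f U atTop (closure Ω))
    (hV : ∀ j, TendstoUniformlyOn (fun n => dd j (f n)) (V j) atTop (closure Ω)) :
    ‖u - toL2 Ω I‖ ^ 2 ≤ 8 * (2 + 360 * κ) ^ 2 * 𝒯.meshSize ^ 6 *
        (∑ j, ∑ k, ∑ l, ‖weakDeriv Ω 3 u ![j, k, l]‖ ^ 2) ∧
      ∀ j k, ‖wd2 Ω u j k - toL2 Ω (ld k (I' j))‖ ^ 2 ≤
        (16 + 64 * 900 ^ 2 * κ ^ 6) * 𝒯.meshSize ^ 2 *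
          (∑ j, ∑ k, ∑ l, ‖weakDeriv Ω 3 u ![j, k, l]‖ ^ 2) := by
  set S : ℕ → 𝒯.tris → ℝ := fun n s => ∑ j, ∑ k, ∑ l, ∫ x in cell s, dd l (dd k (dd j (f n))) x ^ 2
    with hSd
  have hS0 : ∀ n s, 0 ≤ S n s := fun n s => by positivity
  have hS : Tendsto (fun n => ∑ s, S n s) atTop
      (𝓝 (∑ j, ∑ k, ∑ l, ‖weakDeriv Ω 3 u ![j, k, l]‖ ^ 2)) := by
    have h := tendsto_finsetSum Finset.univ fun j _ => tendsto_finsetSum Finset.univ fun k _ =>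
      tendsto_finsetSum Finset.univ fun l _ =>
        tendsto_sum_cell (𝒯 := 𝒯) (fun n => (((hf n).dd j).dd k).dd l) (hf3 j k l)
    refine h.congr fun n => ?_
    simp only [hSd, Fin.sum_univ_two, Finset.sum_add_distrib]
  have hev : ∀ δ > 0, ∀ᶠ n in atTop, (∀ z ∈ closure Ω, |U z - f n z| ≤ δ) ∧
      ∀ z ∈ closure Ω, ∀ j, |G z j - dd j (f n) z| ≤ δ := fun δ hδ => by
    filter_upwards [Metric.tendstoUniformlyOn_iff.1 hU δ hδ,
      eventually_all.2 fun j => Metric.tendstoUniformlyOn_iff.1 (hV j) δ hδ] with n h1 h2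
    refine ⟨fun z hz => (h1 z hz).le, fun z hz j => ?_⟩
    rw [hG]
    exact (h2 j z hz).le
  have hmesh := 𝒯.meshSize_nonneg
  have key : ∀ s : 𝒯.tris, ∃ E, 0 ≤ E ∧ ∀ δ > 0, ∀ᶠ n in atTop,
      (∫ x in cell s, (f n x - I x) ^ 2 ≤ 8 * (2 + 360 * κ) ^ 2 * 𝒯.meshSize ^ 6 * S n s + E * δ ^ 2) ∧
      ∀ j k, ∫ x in cell s, (dd k (dd j (f n)) x - ld k (I' j) x) ^ 2 ≤
        (16 + 64 * 900 ^ 2 * κ ^ 6) * 𝒯.meshSize ^ 2 * S n s + E * δ ^ 2 := fun s => by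
    obtain ⟨x₀, r, hr, hball, hd⟩ := hκ s s.2
    obtain ⟨E, hE0, hE⟩ := hI.cell_error s hr hball hd
    have hdm := 𝒯.diam_cell_le_meshSize s
    have hκ6 : 0 ≤ κ ^ 6 := Even.pow_nonneg (by decide) κ
    have hd0 : 0 ≤ diam (cell (s : Finset Plane)) := diam_nonneg
    refine ⟨E, hE0, fun δ hδ => ?_⟩
    filter_upwards [hev δ hδ] with n hn
    obtain ⟨e1, e2⟩ := hE (f n) (hf n) δ hn.1 hn.2
    constructor
    · refine e1.trans (add_le_add_left (mul_le_mul_of_nonneg_right ?_ (hS0 n s)) _)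
      gcongr
    · intro j k
      refine (e2 j k).trans (add_le_add_left (mul_le_mul_of_nonneg_right ?_ (hS0 n s)) _)
      gcongr
  constructor
  · exact sq_norm_sub_toL2_le hf (memLp_of_continuous hb hI.lipschitz.continuous) hfu hS fun s => by
      obtain ⟨E, hE0, hE⟩ := key s
      exact ⟨E, hE0, fun δ hδ => (hE δ hδ).mono fun n hn => hn.1⟩
  · intro j k
    exact sq_norm_sub_toL2_le (fun n => ((hf n).dd j).dd k) (memLp_ld hb (hI.lipschitz' j) k)
      (hf2 j k) hS fun s => by
        obtain ⟨E, hE0, hE⟩ := key s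
        exact ⟨E, hE0, fun δ hδ => (hE δ hδ).mono fun n hn => hn.2 j k⟩

/-! ### Approximation by piecewise constant functions -/

open Classical in
/-- The function with the value `c s` on the triangle with vertices `s`. -/
noncomputable def stepFun (c : 𝒯.tris → ℝ) (x : Plane) : ℝ :=
  ∑ s : 𝒯.tris, (cell s).indicator (fun _ => c s) x

theorem stepFun_eq (c : 𝒯.tris → ℝ) (s : 𝒯.tris) {x : Plane} (hx : x ∈ cell s) :
    stepFun c x = c s := by
  rw [stepFun, Finset.sum_eq_single s, indicator_of_mem hx]
  · intro t _ hts
    exact indicator_of_notMem (fun hxt => Set.disjoint_left.1 (𝒯.disjoint_cell hts) hxt hx) _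
  · exact fun h => absurd (Finset.mem_univ s) h

theorem memLp_stepFun (hb : Bornology.IsBounded Ω) (c : 𝒯.tris → ℝ) :
    MemLp (stepFun c) 2 (volume.restrict Ω) := by
  have := isFiniteMeasure_restrict_of_isBounded hb
  exact memLp_finsetSum _ fun s _ => (memLp_const (c s)).indicator (isOpen_cell s.1).measurableSet

theorem toL2_stepFun_mem (hb : Bornology.IsBounded Ω) (c : 𝒯.tris → ℝ) :
    toL2 Ω (stepFun c) ∈ 𝒯.piecewiseConst := by
  refine 𝒯.mem_piecewiseConst.2 fun s hs => ⟨c ⟨s, hs⟩, ?_⟩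
  filter_upwards [ae_mono (Measure.restrict_mono (𝒯.cell_subset s hs) le_rfl)
    (coeFn_toL2 (memLp_stepFun hb c)), ae_restrict_mem (isOpen_cell s).measurableSet] with x h1 h2
  rw [h1, stepFun_eq c ⟨s, hs⟩ h2]

/-- The competitors are the cellwise means of the smoothings of `v`, with Poincaré on every cell;
the limit keeps the constant. -/
theorem dist_piecewiseConst_le (hΩ : IsOpen Ω) (hconv : Convex ℝ Ω) (hb : Bornology.IsBounded Ω)
    (hne : Ω.Nonempty) {v p : L2 Ω} {g : Fin 2 → L2 Ω} (hg : ∀ j, HasWD Ω j v (g j))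
    (hp : ∀ z ∈ 𝒯.piecewiseConst, ‖v - p‖ ≤ ‖v - z‖) :
    ‖v - p‖ ^ 2 ≤ 8 * 𝒯.meshSize ^ 2 * ∑ j, ‖g j‖ ^ 2 := by
  obtain ⟨M, hs, m0, m1, -⟩ := exists_smoothing hΩ hconv hb hne
  set h := 𝒯.meshSize with hh
  set c : ℕ → 𝒯.tris → ℝ := fun n s => (volume.real (cell s))⁻¹ * ∫ y in cell s, M n v y with hc
  have hstep : ∀ n, ‖toL2 Ω (M n v) - toL2 Ω (stepFun (c n))‖ ^ 2 ≤
      8 * h ^ 2 * ∑ j, ∫ x in Ω, dd j (M n v) x ^ 2 := fun n => by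
    have hm : MemLp (fun x => M n v x - stepFun (c n) x) 2 (volume.restrict Ω) :=
      ((hs n v).memLp Ω).sub (memLp_stepFun hb (c n))
    rw [← toL2_sub ((hs n v).memLp Ω) (memLp_stepFun hb (c n)), norm_toL2_sq hm,
      ← 𝒯.sum_setIntegral_cell (F := fun x => (M n v x - stepFun (c n) x) ^ 2) hm.integrable_sq,
      Finset.sum_congr rfl fun j _ => (𝒯.sum_setIntegral_cell (F := fun x => dd j (M n v) x ^ 2)
        (((hs n v).dd j).memLp Ω).integrable_sq).symm, Finset.sum_comm, Finset.mul_sum]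
    refine Finset.sum_le_sum fun s _ => ?_
    obtain ⟨b, hbs⟩ := exists_affineBasis (𝒯.card_eq s s.2) (𝒯.indep s s.2)
    have hD := isOpen_cell s.1
    rw [setIntegral_congr_fun (g := fun x => (M n v x - c n s) ^ 2) hD.measurableSet
      fun x hx => by simp only [stepFun_eq (c n) s hx]]
    refine poincare hD (convex_cell s.1) (isBounded_cell s.1) (hs n v) (cell_nonempty hbs)
      fun x hx y hy => ?_
    rw [← dist_eq_norm]
    exact (dist_le_diam_of_mem (isBounded_cell s.1) hy hx).trans (𝒯.diam_cell_le_meshSize s)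
  have h1 : ∀ n, ‖v - p‖ ≤ ‖v - toL2 Ω (M n v)‖ + √(8 * h ^ 2 * ∑ j, ∫ x in Ω, dd j (M n v) x ^ 2) :=
    fun n => (hp _ (toL2_stepFun_mem hb (c n))).trans
      ((norm_sub_le_norm_sub_add_norm_sub v (toL2 Ω (M n v)) _).trans
        (add_le_add_right (Real.le_sqrt_of_sq_le (hstep n)) _))
  have h2 : Tendsto (fun n => ‖v - toL2 Ω (M n v)‖ + √(8 * h ^ 2 * ∑ j, ∫ x in Ω, dd j (M n v) x ^ 2))
      atTop (𝓝 (‖v - v‖ + √(8 * h ^ 2 * ∑ j, ‖g j‖ ^ 2))) :=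
    ((m0 v).const_sub v).norm.add (((tendsto_finsetSum Finset.univ fun j _ =>
      tendsto_setIntegral_sq (fun n => (hs n v).dd j) (m1 j v _ (hg j))).const_mul _).sqrt)
  have h3 := ge_of_tendsto' h2 h1
  rw [sub_self, norm_zero, zero_add] at h3
  exact (Real.le_sqrt (norm_nonneg _) (by positivity)).1 h3

end Triangulation

end

/-! ### The interpolation error in `H²(Ω)`. -/

section

open Filter Metric Topology

namespace Triangulation

variable {Ω : Set Plane} {𝒯 : Triangulation Ω}

theorem exists_interpolation_le (hΩ : IsOpen Ω) (hconv : Convex ℝ Ω) (hb : Bornology.IsBounded Ω)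
    (hne : Ω.Nonempty) {κ : ℝ} (hκ : 𝒯.ShapeRegular κ) {u : L2 Ω} (hu : u ∈ Hk Ω 3)
    (hu0 : u ∈ H10 Ω) : ∃ v ∈ Hk Ω 2, 𝒯.trace2T v ∈ 𝒯.discreteTraceSpace ∧
      HkNorm Ω 2 (u - v) ^ 2 ≤ (8 * (2 + 360 * κ) ^ 2 * diam Ω ^ 4 +
        4 * (16 + 64 * 900 ^ 2 * κ ^ 6)) * 𝒯.meshSize ^ 2 *
          (∑ j, ∑ k, ∑ l, ‖weakDeriv Ω 3 u ![j, k, l]‖ ^ 2) := by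
  obtain ⟨f, U, V, hf, hfu, hf2, hf3, hUc, hU, huU, hVc, hV, huV⟩ := exists_C1_approx hΩ hconv hb hne hu
  have hu2 : u ∈ Hk Ω 2 := Hk_mono (by norm_num) hu
  have hu1 : u ∈ Hk Ω 1 := Hk_mono (by norm_num) hu
  set G : Plane → Plane := fun x => !₂[V 0 x, V 1 x] with hGd
  have hG : ∀ x j, G x j = V j x := fun x j => by fin_cases j <;> rfl
  obtain ⟨B, I, I', K, hI⟩ := 𝒯.exists_interpolant hconv hb U G
  have hB : ∃ C, 0 ≤ C ∧ ∀ j, ∀ x ∈ closure Ω, |V j x| ≤ C := by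
    obtain ⟨C₀, h0⟩ := hb.isCompact_closure.exists_bound_of_continuousOn (hVc 0)
    obtain ⟨C₁, h1⟩ := hb.isCompact_closure.exists_bound_of_continuousOn (hVc 1)
    refine ⟨max 0 (max C₀ C₁), le_max_left _ _, Fin.forall_fin_two.2 ⟨fun x hx => ?_, fun x hx => ?_⟩⟩
    · exact (h0 x hx).trans ((le_max_left _ _).trans (le_max_right _ _))
    · exact (h1 x hx).trans ((le_max_right _ _).trans (le_max_right _ _))
  obtain ⟨C, hC0, hC⟩ := hB
  -- The gradient is bounded because its representatives are continuous on the compact closure.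
  have hbdry : ∀ x ∈ frontier Ω, U x = 0 := fun x hx =>
    eq_zero_of_mem_frontier hΩ hconv hne hu0 hUc huU hC0 (fun j => by
      filter_upwards [huV j, ae_restrict_mem hΩ.measurableSet] with y hy hy'
      rw [hy]
      exact hC j y (subset_closure hy')) hx
  have hI0 : ∀ x ∈ frontier Ω, I x = 0 := fun x hx =>
    hI.eq_zero_of_mem_frontier hΩ hconv hf hU hVc hV hG hbdry hx
  have hI2 := hI.mem_Hk_two hΩ hb
  refine ⟨toL2 Ω I, hI2, hI.trace2T_mem hΩ hconv hb hne hI0, ?_⟩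
  obtain ⟨e1, e2⟩ := hI.error hG hb hκ hf hfu hf2 hf3 hU hV
  rw [HkNorm_two_sq hΩ (fun j => (hasWD_wd1 hu1 j).sub (hI.hasWD hΩ hb j))
    (fun j k => (hasWD_wd2 hu2 j k).sub (hI.hasWD' hb j k))]
  set R := ∑ j, ∑ k, ∑ l, ‖weakDeriv Ω 3 u ![j, k, l]‖ ^ 2
  rw [Fin.sum_univ_two, Fin.sum_univ_two, Fin.sum_univ_two]
  have hR : 0 ≤ R := by positivity
  -- The function error has order `h³`; four of the six powers in its square are traded for the
  -- diameter of `Ω` to match the order of the second derivatives.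
  have h4 : 𝒯.meshSize ^ 4 ≤ diam Ω ^ 4 :=
    pow_le_pow_left₀ 𝒯.meshSize_nonneg (𝒯.meshSize_le_diam hb) 4
  have h5 := mul_le_mul_of_nonneg_left h4
    (show 0 ≤ 8 * (2 + 360 * κ) ^ 2 * 𝒯.meshSize ^ 2 * R by positivity)
  linarith [e2 0 0, e2 0 1, e2 1 0, e2 1 1]

end Triangulation


end

/-! ### The approximation estimate. -/

theorem mainTheorem11 (Ω : Set Plane) (hΩ : IsConvexPolygonalDomain Ω) (κ : ℝ) :
    ∃ C > 0, ∀ 𝒯 : Triangulation Ω, 𝒯.ShapeRegular κ →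
      ∀ u ∈ Hk Ω 3 ∩ spaceX Ω,
        𝒯.lift u ∈ 𝒯.spaceU ∧
        ∃ e : ℝ, IsLeast {r | ∃ w ∈ 𝒯.spaceUh, r = 𝒯.normU (𝒯.lift u - w)} e ∧
          e ≤ C * 𝒯.meshSize * HkNorm Ω 3 u := by
  obtain ⟨hO, hne, hconv, W, hW⟩ := hΩ
  have hb : Bornology.IsBounded Ω := by
    refine Bornology.IsBounded.subset ?_ subset_closure
    rw [hW]
    exact isBounded_convexHull.2 W.finite_toSet.isBounded
  obtain ⟨K, hK, hK3⟩ := exists_interp_Hk_three hO hconv hb hne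
  have hκ6 : 0 ≤ κ ^ 6 := Even.pow_nonneg (by decide) κ
  set a := 8 * (2 + 360 * κ) ^ 2 * Metric.diam Ω ^ 4 + 4 * (16 + 64 * 900 ^ 2 * κ ^ 6) with ha
  have ha0 : 0 ≤ a := by positivity
  -- The three summands are the squared constants for `u`, for `D² u` and for the trace.
  refine ⟨√(8 * K + 8 + a), Real.sqrt_pos.2 (by positivity), fun 𝒯 hκ u hu => ?_⟩
  obtain ⟨hu3, huX⟩ := hu
  have hu2 := huX.1
  have hu1 : u ∈ Hk Ω 1 := Hk_mono (by norm_num) hu2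
  have hsymm := (isWeakDeriv_weakDeriv (hu2 2 le_rfl)).symm_two hO
  refine ⟨⟨hsymm, u, huX, rfl⟩, ?_⟩
  obtain ⟨e, he⟩ := 𝒯.exists_isLeast_error hO hconv hb hne hu2
  refine ⟨e, he, ?_⟩
  obtain ⟨v, hv, hvt, hvle⟩ := Triangulation.exists_interpolation_le hO hconv hb hne hκ hu3 huX.2
  choose P hPm hP using fun z : L2 Ω => Triangulation.exists_best_of_isClosed _ 𝒯.isClosed_piecewiseConst z
  -- The competitor: best piecewise constants entry by entry, where equal entries have equal
  -- approximations so that symmetry is kept, and the trace of the interpolant.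
  refine (he.2 ⟨(P u, tensor2 fun j k => P (wd2 Ω u j k), 𝒯.trace2T v), ⟨𝒯.mem_piecewiseConst.1 (hPm _),
    fun j k => ?_, fun i => 𝒯.mem_piecewiseConst.1 (hPm _), hvt⟩, rfl⟩).trans ?_
  · simp [wd2, hsymm j k]
  set R := ∑ j, ∑ k, ∑ l, ‖weakDeriv Ω 3 u ![j, k, l]‖ ^ 2 with hR
  set h := 𝒯.meshSize
  have hh : 0 ≤ h := 𝒯.meshSize_nonneg
  have h1 : ‖u - P u‖ ^ 2 ≤ 8 * h ^ 2 * (K * (‖u‖ ^ 2 + R)) :=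
    (Triangulation.dist_piecewiseConst_le hO hconv hb hne (hasWD_wd1 hu1) (hP u)).trans
      (mul_le_mul_of_nonneg_left (hK3 u _ _ _ (hasWD_wd1 hu1) (hasWD_wd2 hu2) (hasWD_wd3 hu3))
        (by positivity))
  have h2 : ‖weakDeriv Ω 2 u - tensor2 fun j k => P (wd2 Ω u j k)‖ ^ 2 ≤ 8 * h ^ 2 * R := by
    rw [norm_tensor2_sq, hR, Finset.mul_sum]
    refine Finset.sum_le_sum fun j _ => ?_
    rw [Finset.mul_sum]
    exact Finset.sum_le_sum fun k _ =>
      Triangulation.dist_piecewiseConst_le hO hconv hb hne (hasWD_wd3 hu3 j k) (hP _)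
  have h3 : 𝒯.traceNorm (𝒯.trace2T u - 𝒯.trace2T v) ^ 2 ≤ a * h ^ 2 * R := by
    rw [← 𝒯.trace2T_sub hO hu2 hv]
    exact (pow_le_pow_left₀ (𝒯.traceNorm_nonneg _) (𝒯.traceNorm_le (Hk_sub hu2 hv)) 2).trans hvle
  have hN : HkNorm Ω 3 u ^ 2 = ‖u‖ ^ 2 + R := HkNorm_three_sq Ω u
  refine Real.sqrt_le_iff.2 ⟨mul_nonneg (by positivity) (HkNorm_nonneg _ _ _), ?_⟩
  rw [mul_pow, mul_pow, Real.sq_sqrt (by positivity), hN]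
  have h4 : 0 ≤ (8 + a) * h ^ 2 * ‖u‖ ^ 2 := by positivity
  change ‖u - P u‖ ^ 2 + ‖weakDeriv Ω 2 u - tensor2 fun j k => P (wd2 Ω u j k)‖ ^ 2 +
    𝒯.traceNorm (𝒯.trace2T u - 𝒯.trace2T v) ^ 2 ≤ _
  linarith
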